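/- **Setting.** Let $(M,\Omega)$ be a smooth symplectic manifold of dimension $4$, let $H,J:M\to\mathbb R$ be smooth functions with $\{H,J\}=0$ and Hamiltonian vector fields $X_H,X_J$ (where $\Omega(\cdot,X_f)=df$), and suppose that every fibre of $F=(H,J):M\to\mathbb R^2$ is compact and connected. Let $\Gamma:\mathbb R/\mathbb Z\to\mathbb R^2$ be a closed $C^1$ path in the set of regular values of $F$ (values $v\in F(M)$ such that $dF$ is onto at all points of $F^{-1}(v)$). Suppose that on an open neighbourhood $U$ of $F^{-1}(\Gamma)$ the flow of $X_J$ is a smooth action of the circle $\mathbb S^1=\mathbb R/2\pi\mathbb Z$ leaving $F$ invariant, free on $F^{-1}(\Gamma)$. Let $\vartheta$ be a rotation $1$-form: a smooth closed $1$-form with $\vartheta(X_J)=1$ on an open $\mathbb S^1$-invariant set $M'\subseteq U$. Its set of poles is $\Pi=U\setminus M'$. Suppose that, outside the fixed points of the action, $\Pi$ is an embedded smooth surface and $F|_\Pi$ has rank $1$ ($\vartheta$ is *transversal to $F$*). Suppose that $\Gamma$ meets $F(\Pi)$ at finitely many values, and transversally: if $x\in\Pi$ and $F(x)=\Gamma(s)$,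 then $\Gamma'(s)$ and $dF_x(T_x\Pi)$ span $\mathbb R^2$. For $x\in F^{-1}(\Gamma(s))$, let $T>0$ be the first positive time at which the $X_H$-orbit of $x$ meets the circle orbit $\mathbb S^1x$ again, and let $x'$ be the point where it does so. The rotation number $\Theta(s)\in[0,2\pi)$ is the time that the flow of $X_J$ takes from $x$ to $x'$. Let $\gamma_J$ be the cycle given by an $X_J$-orbit, and $\gamma_2$ the cycle generated by $\frac1{2\pi}(-\Theta X_J+TX_H)$. The monodromy number along $\Gamma$ is the integer $k$ such that transporting $\gamma_2$ once along $\Gamma$ through the fibres of the torus bundle turns it into $\gamma_2+k\gamma_J$. **Theorem.** 1. The poles over $\Gamma$ form a disjoint union of finitely many $X_J$-orbits: there are finitely many pairs $(s_i,p_i)$ with $s_i\in[0,1)$, $p_i\in\Pi\cap F^{-1}(\Gamma(s_i))$ such that, for every $s\in[0,1)$, $\Pi\cap F^{-1}(\Gamma(s))$ is the disjoint union of the orbits $\mathbb S^1p_i$ with $s_i=s$. 2. The rotation number is well defined: every $x\in F^{-1}(\Gamma(s))$ has a first return as above, and $\Theta(s)$ does not depend on the choice of $x$. The monodromy number $k$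 exists, and if $\Theta$ has only finitely many discontinuities along $\Gamma$, then its variation $\mathrm{var}_\Gamma\Theta$, defined as minus the sum of its jumps, equals $-2\pi k$. 3. One has $$k=\frac1{2\pi}\sum_i\int_{\delta_i}\vartheta$$ for any choice of loops $\delta_i$ surrounding the polar orbits $\mathbb S^1p_i$ positively, and such loops exist. Here $\delta_i$ surrounds $\mathbb S^1p_i$ positively if it bounds a $C^1$ disc in the bundle $\{(s,x): F(x)=\Gamma(s)\}$ whose only pole is its centre, a point of $\{s_i\}\times\mathbb S^1p_i$ at which the disc is transversal to that orbit, and $\delta_i$ is the boundary of the disc, oriented so that at the centre the coordinates $(s,t)$ ($s$ the parameter of $\Gamma$, $t$ the time along $X_H$) are positive. -/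

import Mathlib

open scoped Manifold ContDiff Topology

namespace RotationForms

noncomputable section

/-- The model space of the phase space: two degrees of freedom, that is, dimension four. -/
abbrev E4 : Type := EuclideanSpace ℝ (Fin 4)

section Forms

variable {M : Type*} [TopologicalSpace M] [ChartedSpace E4 M]

/-- A (not necessarily continuous) differential `k`-form on the 4-manifold `M`. -/
abbrev DForm (k : ℕ) (M : Type*) [TopologicalSpace M] [ChartedSpace E4 M] : Type _ :=
  (x : M) → TangentSpace (𝓡 4) x [⋀^Fin k]→L[ℝ] ℝ

/-- The expression of a form in the chart around `x₀`: its pull-back by the inverse chart. -/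
def DForm.inChart {k : ℕ} (α : DForm k M) (x₀ : M) (y : E4) : E4 [⋀^Fin k]→L[ℝ] ℝ :=
  (α ((extChartAt (𝓡 4) x₀).symm y)).compContinuousLinearMap
    (mfderiv 𝓘(ℝ, E4) (𝓡 4) (extChartAt (𝓡 4) x₀).symm y)

/-- The part of the chart domain around `x₀` (in coordinates) that lies over `W`. -/
def chartPart (x₀ : M) (W : Set M) : Set E4 :=
  (extChartAt (𝓡 4) x₀).target ∩ (extChartAt (𝓡 4) x₀).symm ⁻¹' W

/-- The form `α` is smooth on the open set `W`. -/
def DForm.SmoothOn {k : ℕ} (α : DForm k M) (W : Set M) : Prop :=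
  ∀ x₀ : M, ContDiffOn ℝ ∞ (α.inChart x₀) (chartPart x₀ W)

/-- `dα = 0` on the open set `W`. -/
def DForm.ClosedOn {k : ℕ} (α : DForm k M) (W : Set M) : Prop :=
  ∀ x₀ : M, ∀ y ∈ chartPart x₀ W, extDeriv (α.inChart x₀) y = 0

/-- A symplectic form: a smooth closed nondegenerate 2-form. -/
structure IsSymplectic (Ω : DForm 2 M) : Prop where
  smooth : Ω.SmoothOn Set.univ
  closed : Ω.ClosedOn Set.univ
  nondegenerate : ∀ (x : M) (v : TangentSpace (𝓡 4) x),
    (∀ w : TangentSpace (𝓡 4) x, Ω x ![v, w] = 0) → v = 0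

/-- `X` is the Hamiltonian vector field of `f`: `Ω(·, X) = df`. -/
def IsHamiltonianField (Ω : DForm 2 M) (f : M → ℝ) (X : (x : M) → TangentSpace (𝓡 4) x) : Prop :=
  ∀ (x : M) (v : TangentSpace (𝓡 4) x), Ω x ![v, X x] = mfderiv (𝓡 4) 𝓘(ℝ, ℝ) f x v

/-- The integral of a 1-form along the curve `c : [a, b] → M`. -/
def lineIntegral (α : DForm 1 M) (c : ℝ → M) (a b : ℝ) : ℝ :=
  ∫ τ in a..b, α (c τ) (fun _ => mfderiv 𝓘(ℝ, ℝ) (𝓡 4) c τ (1 : ℝ))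

end Forms

section System

variable {M : Type*} [TopologicalSpace M] [ChartedSpace E4 M]

/-- The energy-momentum map `F = (H, J)`. -/
def energyMomentum (H J : M → ℝ) (x : M) : ℝ × ℝ := (H x, J x)

/-- The differential of a map `M → ℝ²` at `x`. -/
def diff (F : M → ℝ × ℝ) (x : M) : TangentSpace (𝓡 4) x →L[ℝ] ℝ × ℝ :=
  mfderiv (𝓡 4) 𝓘(ℝ, ℝ × ℝ) F x

/-- `v` is a value of `F` all of whose preimages are regular points. -/
def IsRegularValue (F : M → ℝ × ℝ) (v : ℝ × ℝ) : Prop :=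
  v ∈ Set.range F ∧ ∀ x, F x = v → Function.Surjective (diff F x)

/-- `ρ` is a smooth action of the circle `ℝ / 2πℤ` on the open set `U`, whose infinitesimal
generator is the vector field `X`. Values of `ρ` outside `U` are irrelevant. -/
structure IsCircleAction (X : (x : M) → TangentSpace (𝓡 4) x) (U : Set M)
    (ρ : ℝ → M → M) : Prop where
  isOpen : IsOpen U
  mapsTo : ∀ t, ∀ p ∈ U, ρ t p ∈ U
  zero : ∀ p ∈ U, ρ 0 p = p
  add : ∀ t t', ∀ p ∈ U, ρ (t + t') p = ρ t (ρ t' p)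
  period : ∀ p ∈ U, ρ (2 * Real.pi) p = p
  smooth : ContMDiffOn (𝓘(ℝ, ℝ).prod (𝓡 4)) (𝓡 4) ∞ (fun q : ℝ × M => ρ q.1 q.2)
    (Set.univ ×ˢ U)
  generator : ∀ p ∈ U, IsMIntegralCurve (I := 𝓡 4) (fun t => ρ t p) X

/-- The orbit `𝕊¹ p`. -/
def circleOrbit (ρ : ℝ → M → M) (p : M) : Set M := Set.range fun t => ρ t p

/-- `p` is a fixed point of the circle action. -/
def IsFixedPoint (ρ : ℝ → M → M) (p : M) : Prop := ∀ t, ρ t p = p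

/-- `ϑ` is a rotation 1-form defined on the open invariant subset `M'` of the domain `U` of the
circle action: it is smooth and closed, and `ϑ(X_J) = 1`. -/
structure IsRotationForm (XJ : (x : M) → TangentSpace (𝓡 4) x) (U : Set M) (ρ : ℝ → M → M)
    (M' : Set M) (ϑ : DForm 1 M) : Prop where
  isOpen : IsOpen M'
  subset : M' ⊆ U
  invariant : ∀ t, ∀ p ∈ M', ρ t p ∈ M'
  smooth : ϑ.SmoothOn M'
  closed : ϑ.ClosedOn M'
  normalized : ∀ p ∈ M', ϑ p ![XJ p] = 1

/-- The polar set of a rotation 1-form defined on `M' ⊆ U`. -/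
def polarSet (U M' : Set M) : Set M := U \ M'

/-- Near `p`, the set `P` is the zero set of the submersion `g` to `ℝ²`. Then `P` is near `p` an
embedded surface, and its tangent space at `p` is `ker dg_p`, for whichever such `g`. -/
def IsLocalEquation (P : Set M) (p : M) (g : M → ℝ × ℝ) : Prop :=
  ∃ V : Set M, IsOpen V ∧ p ∈ V ∧ ContMDiffOn (𝓡 4) 𝓘(ℝ, ℝ × ℝ) ∞ g V ∧
    ∀ x ∈ V, Function.Surjective (diff g x) ∧ (x ∈ P ↔ g x = 0)

/-- Outside the fixed points of the circle action, `P` is an embedded smooth surface. -/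
def IsSurfaceOffFixed (ρ : ℝ → M → M) (P : Set M) : Prop :=
  ∀ p ∈ P, ¬ IsFixedPoint ρ p → ∃ g, IsLocalEquation P p g

/-- `dF_p (T_p P)`, for a surface `P` with local equation `g` at `p`. -/
def tangentImage (F g : M → ℝ × ℝ) (p : M) : Submodule ℝ (ℝ × ℝ) :=
  (LinearMap.ker (diff g p).toLinearMap).map (diff F p).toLinearMap

/-- Transversality of the rotation 1-form with polar set `P` to `F`: the restriction of `F` to `P`
has rank 1 outside the fixed points of the circle action. -/
def IsTransversalTo (ρ : ℝ → M → M) (P : Set M) (F : M → ℝ × ℝ) : Prop :=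
  ∀ p ∈ P, ¬ IsFixedPoint ρ p → ∀ g, IsLocalEquation P p g →
    Module.finrank ℝ (tangentImage F g p) = 1

/-- The path `Γ` is transversal to `F(P)`: whenever `Γ` meets `F(P)`, its velocity and the
image of the tangent space of `P` (at any point of `P` in the fibre) span `ℝ²`. -/
def PathTransversal (Γ : ℝ → ℝ × ℝ) (F : M → ℝ × ℝ) (P : Set M) : Prop :=
  ∀ (s : ℝ), ∀ p ∈ P, F p = Γ s → ∀ g, IsLocalEquation P p g →
    tangentImage F g p ⊔ Submodule.span ℝ {deriv Γ s} = ⊤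

/-- `γ` is the `X_H`-orbit from `p`; it meets the circle orbit `𝕊¹ p` again for the first time at
time `T`, at the point `p' = ρ θ p`, where `θ ∈ [0, 2π)`. -/
structure IsFirstReturn (XH : (x : M) → TangentSpace (𝓡 4) x) (ρ : ℝ → M → M)
    (p : M) (γ : ℝ → M) (T θ : ℝ) : Prop where
  curve : IsMIntegralCurve (I := 𝓡 4) γ XH
  start : γ 0 = p
  pos : 0 < T
  first : ∀ t ∈ Set.Ioo 0 T, γ t ∉ circleOrbit ρ p
  return_eq : γ T = ρ θ p
  mem : θ ∈ Set.Ico 0 (2 * Real.pi)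

/-- `θ` is the rotation number at `p`: the time in `[0, 2π)` that `X_J` takes to flow from `p` to
the point where the `X_H`-orbit of `p` first returns to `𝕊¹ p`. -/
def IsRotationNumber (XH : (x : M) → TangentSpace (𝓡 4) x) (ρ : ℝ → M → M)
    (p : M) (θ : ℝ) : Prop :=
  ∃ (γ : ℝ → M) (T : ℝ), IsFirstReturn XH ρ p γ T θ

/-- `k` is the monodromy number of the torus bundle over the closed path `Γ` (of period 1).
The family `c s` (`s ∈ [0, 1]`) of closed curves, each in the fibre over `Γ s`, transports the
cycle `γ₂ = c 0` generated by `(-θ X_J + T X_H) / 2π`, which together with the `X_J`-orbit `γ_J` is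
a basis of the first homology of the fibre over `Γ 0`, once around `Γ`. The resulting cycle `c 1` is
`γ₂ + k γ_J`: it is homotopic, through closed curves in the fibre, to the curve `τ ↦ ρ (kτ) (c 0 τ)`
(on a torus, homology classes of closed curves are free homotopy classes). -/
def IsMonodromyNumber (F : M → ℝ × ℝ) (XH : (x : M) → TangentSpace (𝓡 4) x) (ρ : ℝ → M → M)
    (Γ : ℝ → ℝ × ℝ) (k : ℤ) : Prop :=
  ∃ c : ℝ → ℝ → M,
    ContinuousOn (fun q : ℝ × ℝ => c q.1 q.2) (Set.Icc 0 1 ×ˢ Set.univ) ∧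
    (∀ s ∈ Set.Icc (0 : ℝ) 1, ∀ τ, F (c s τ) = Γ s ∧ c s (τ + 2 * Real.pi) = c s τ) ∧
    (∃ (p : M) (γ : ℝ → M) (T θ : ℝ), IsFirstReturn XH ρ p γ T θ ∧
      ∀ τ, c 0 τ = ρ (-(θ * τ / (2 * Real.pi))) (γ (T * τ / (2 * Real.pi)))) ∧
    ∃ h : ℝ → ℝ → M,
      ContinuousOn (fun q : ℝ × ℝ => h q.1 q.2) (Set.Icc 0 1 ×ˢ Set.univ) ∧
      (∀ r ∈ Set.Icc (0 : ℝ) 1, ∀ τ, F (h r τ) = Γ 0 ∧ h r (τ + 2 * Real.pi) = h r τ) ∧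
      (∀ τ, h 0 τ = c 1 τ) ∧ ∀ τ, h 1 τ = ρ (k * τ) (c 0 τ)

/-- The points of `[0, 1)` where the function `g` (of period 1) is discontinuous. -/
def discontinuities (g : ℝ → ℝ) : Set ℝ := {s | s ∈ Set.Ico (0 : ℝ) 1 ∧ ¬ ContinuousAt g s}

/-- The function `g` on the circle (of period 1) has finitely many discontinuities, with jumps
`d s`, and its variation, minus the sum of the jumps, is `V`. -/
def HasVariation (g : ℝ → ℝ) (V : ℝ) : Prop :=
  ∃ (S : Finset ℝ) (d : ℝ → ℝ), (S : Set ℝ) = discontinuities g ∧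
    (∀ s ∈ S, Filter.Tendsto (fun ε => g (s + ε) - g (s - ε)) (𝓝[>] 0) (𝓝 (d s))) ∧
    V = -∑ s ∈ S, d s

/-- A disc `D` in the torus bundle `F⁻¹(Γ)`, whose boundary is a loop surrounding with positive
orientation the polar orbit `𝕊¹ p`, which lies over the parameter `s₀` of `Γ`. The point `D z` lies
in the fibre over `Γ (S z)`; the disc meets the set of poles `P` only at its centre. There it crosses
`𝕊¹ p` transversally inside the bundle, and positively with respect to the coordinates `(s, t)`,
where `s` is the parameter of `Γ` and `t` is the time along `X_H`: modulo `X_J`, its tangent vectors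
are combinations of a lift `w` of the velocity of `Γ` and of `X_H`, with coefficients `dS` and
`A`, and `(dS, A)` is a positive frame. -/
structure IsPolarDisc (F : M → ℝ × ℝ) (XH XJ : (x : M) → TangentSpace (𝓡 4) x) (ρ : ℝ → M → M)
    (Γ : ℝ → ℝ × ℝ) (P : Set M) (s₀ : ℝ) (p : M) (D : ℂ → M) (S : ℂ → ℝ) : Prop where
  smooth : ∀ z ∈ Metric.closedBall (0 : ℂ) 1, ContMDiffAt 𝓘(ℝ, ℂ) (𝓡 4) 1 D z
  smooth_param : ∀ z ∈ Metric.closedBall (0 : ℂ) 1, ContDiffAt ℝ 1 S z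
  fibre_eq : ∀ z ∈ Metric.closedBall (0 : ℂ) 1, F (D z) = Γ (S z)
  centre_param : S 0 = s₀
  centre : D 0 ∈ circleOrbit ρ p
  not_pole : ∀ z ∈ Metric.closedBall (0 : ℂ) 1, z ≠ 0 → D z ∉ P
  oriented : ∃ (w : TangentSpace (𝓡 4) (D 0)) (A B : ℂ →L[ℝ] ℝ),
    diff F (D 0) w = deriv Γ s₀ ∧
    (∀ ζ : ℂ, mfderiv 𝓘(ℝ, ℂ) (𝓡 4) D 0 ζ =
      fderiv ℝ S 0 ζ • w + A ζ • XH (D 0) + B ζ • XJ (D 0)) ∧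
    0 < fderiv ℝ S 0 1 * A Complex.I - fderiv ℝ S 0 Complex.I * A 1

/-- The boundary loop of a disc, parametrized by `[0, 2π]`. -/
def boundaryLoop (D : ℂ → M) (τ : ℝ) : M := D (Complex.exp (τ * Complex.I))

end System

end

end RotationForms

open RotationForms

/-! The bundle `X = F⁻¹(Γ)` is compact (`IsTorusFibration.isCompact_preimage`), so `X_H` is complete
on it. A Hamiltonian circle action preserves `Ω` (`IsCircleAction.pairing_mfderiv`), hence also
`X_H`; the two flows commute and `ℝ²` acts on `X`, transitively on each fibre. From there on only
the topology of this action matters. `TorusSystem` records it, with tubes around circle orbits in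
place of charts.

The first return time `T` is continuous. The return angle is the same for all points of a fibre, is
determined modulo `2π`, and has a continuous lift with `Θt (s + 1) = Θt s - 2πk`
(`TorusSystem.exists_lift`). This `k` is the monodromy number: the closed curve that flows for the
time `T` while rotating back by `Θt` is transported around `Γ` to the same curve with `Θt` replaced
by `Θt - 2πk`, which makes `k` more turns of the circle (`TorusSystem.exists_transport`). The
rotation number `Θ` is `Θt` reduced to `[0, 2π)`. The difference `Θ - Θt` takes values in `2πℤ`,
jumps where `Θ` does and grows by `2πk` over a period, which gives the variation
(`hasVariation_of_lift`).

For the integral formula, integrate `ϑ` over the return cycle. On a fibre without poles this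
integral `κ` is the increment of a primitive over one return, minus `Θt` (`TorusSystem.IsDefect`).
It is locally constant in `s`, and `κ (s + 1) = κ s + 2πk` because only the lift has changed. Across
a polar parameter `κ` jumps by the sum of the residues of the poles over it
(`TorusSystem.PolarData.defect_jump`). To see this, compare primitives on the two sides along an
`X_H`-orbit. Their offset is constant in time off the poles and goes up by the residue at each pole
(`TorusSystem.offset_jump`), while over one return it changes by the jump of `κ` (`IsOffset.shift`).
Adding the jumps over a period gives `2πk = ∑ Rᵢ` (`TorusSystem.PolarData.sum_residues`).

The residue is the loop integral around a pole in a slice. It equals the integral over the boundary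
of any positive disc, since a map whose derivative preserves orientation sends small circles to
curves winding once around the pole (`exists_log_lift`, `TorusSystem.disc_residue`). Transversality
serves to isolate the poles in slices (`IsTorusFibration.eventually_slice_pole`); finiteness of the
polar orbits then follows by compactness.

Closed forms enter through their local primitives, and `PrimOn` continues these along maps that are
merely continuous. Line integrals appear only at the end, in `lineIntegral_eq_sub`. -/

namespace RotationForms

open Set Filter

/-! ### Locally constant functions and their jumps. -/

section LocallyConstant

/-- For the discrete topology on `α`, local constancy is continuity. With `α = Prop` this is the
open-closed argument by which existence statements are continued along intervals and fibres. -/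
lemma eq_of_eventually_eq {Y α : Type*} [TopologicalSpace Y] {A : Set Y} (hA : IsPreconnected A)
    {f : Y → α} (h : ∀ x ∈ A, ∀ᶠ y in 𝓝[A] x, f y = f x) {x y : Y} (hx : x ∈ A) (hy : y ∈ A) :
    f x = f y := by
  let : TopologicalSpace α := ⊥
  have : DiscreteTopology α := ⟨rfl⟩
  refine hA.constant (f := f) (fun z hz => ?_) hx hy
  rw [ContinuousWithinAt, nhds_discrete, tendsto_pure]
  exact h z hz

lemma eventually_nhds_of_sides {p : ℝ → Prop} {x : ℝ} (h1 : ∀ᶠ y in 𝓝[<] x, p y)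
    (h2 : ∀ᶠ y in 𝓝[>] x, p y) (h : p x) : ∀ᶠ y in 𝓝 x, p y := by
  rw [eventually_nhdsWithin_iff] at h1 h2
  filter_upwards [h1, h2] with y h1 h2
  rcases lt_trichotomy y x with h' | h' | h'
  · exact h1 h'
  · exact h' ▸ h
  · exact h2 h'

/-- A function that is locally constant off a finite set grows by the sum of its jumps. -/
lemma sub_eq_sum_jumps {q : ℝ → ℝ} {a b : ℝ} (hab : a ≤ b) (S : Finset ℝ) (d : ℝ → ℝ)
    (hS : ∀ x ∈ S, a < x ∧ x < b)
    (h0 : ∀ x ∈ Icc a b, x ∉ S → ∀ᶠ y in 𝓝 x, q y = q x)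
    (h1 : ∀ x ∈ S, ∃ c, (∀ᶠ y in 𝓝[<] x, q y = c) ∧ ∀ᶠ y in 𝓝[>] x, q y = c + d x) :
    q b - q a = ∑ x ∈ S, d x := by
  classical
  choose! c hc1 hc2 using h1
  -- Subtracting the jumps already passed, and taking the left value `c` at the points of `S`,
  -- leaves a locally constant function.
  set h : ℝ → ℝ := fun y => (if y ∈ S then c y else q y) - ∑ z ∈ S with z < y, d z with hh
  have hfin : ∀ x, ∀ᶠ y in 𝓝[≠] x, y ∉ S := by
    intro x
    have : (({x}ᶜ ∩ (S : Set ℝ)))ᶜ ∈ 𝓝 x :=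
      ((S.finite_toSet.inter_of_right _).isClosed.isOpen_compl).mem_nhds (by simp)
    rw [eventually_nhdsWithin_iff]
    filter_upwards [this] with y hy hyx hyS
    exact hy ⟨hyx, hyS⟩
  have hleft : ∀ x, ∀ᶠ y in 𝓝[<] x, S.filter (· < y) = S.filter (· < x) := by
    intro x
    have : ∀ᶠ y in 𝓝 x, ∀ z ∈ S, z < x → z < y := by
      rw [Filter.eventually_all_finset]
      intro z _
      by_cases hz : z < x
      · filter_upwards [lt_mem_nhds hz] with y hy _ using hy
      · exact Eventually.of_forall fun y h => absurd h hz
    filter_upwards [nhdsWithin_le_nhds this, self_mem_nhdsWithin] with y hy hyx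
    ext z
    simp only [Finset.mem_filter, and_congr_right_iff]
    exact fun hz => ⟨fun h => h.trans hyx, hy z hz⟩
  have hright : ∀ x, ∀ᶠ y in 𝓝[>] x, S.filter (· < y) = S.filter (· ≤ x) := by
    intro x
    have : ∀ᶠ y in 𝓝 x, ∀ z ∈ S, x < z → y < z := by
      rw [Filter.eventually_all_finset]
      intro z _
      by_cases hz : x < z
      · filter_upwards [gt_mem_nhds hz] with y hy _ using hy
      · exact Eventually.of_forall fun y h => absurd h hz
    filter_upwards [nhdsWithin_le_nhds this, self_mem_nhdsWithin] with y hy hyx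
    ext z
    simp only [Finset.mem_filter, and_congr_right_iff]
    refine fun hz => ⟨fun h => ?_, fun h => lt_of_le_of_lt h hyx⟩
    by_contra h'
    exact absurd (hy z hz (not_le.1 h')) (not_lt.2 h.le)
  have key : ∀ x ∈ Icc a b, ∀ᶠ y in 𝓝[Icc a b] x, h y = h x := by
    intro x hx
    refine nhdsWithin_le_nhds ?_
    have hL : 𝓝[<] x ≤ 𝓝[≠] x := nhdsWithin_mono _ fun y hy => ne_of_lt hy
    have hR : 𝓝[>] x ≤ 𝓝[≠] x := nhdsWithin_mono _ fun y hy => ne_of_gt hy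
    by_cases hxS : x ∈ S
    · refine eventually_nhds_of_sides ?_ ?_ rfl
      · filter_upwards [hleft x, hL (hfin x), hc1 x hxS] with y h1 h2 h3
        simp only [hh, h1, if_neg h2, if_pos hxS, h3]
      · filter_upwards [hright x, hR (hfin x), hc2 x hxS] with y h1 h2 h3
        have : S.filter (· ≤ x) = insert x (S.filter (· < x)) := by
          ext z
          simp only [Finset.mem_filter, Finset.mem_insert, le_iff_lt_or_eq]
          constructor
          · rintro ⟨h, h' | h'⟩
            · exact Or.inr ⟨h, h'⟩
            · exact Or.inl h'
          · rintro (rfl | h)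
            · exact ⟨hxS, Or.inr rfl⟩
            · exact ⟨h.1, Or.inl h.2⟩
        simp only [hh, h1, if_neg h2, if_pos hxS, h3, this]
        rw [Finset.sum_insert (by simp)]
        ring
    · have hq := h0 x hx hxS
      refine eventually_nhds_of_sides ?_ ?_ rfl
      · filter_upwards [hleft x, hL (hfin x), nhdsWithin_le_nhds hq] with y h1 h2 h3
        simp only [hh, h1, if_neg h2, if_neg hxS, h3]
      · filter_upwards [hright x, hR (hfin x), nhdsWithin_le_nhds hq] with y h1 h2 h3
        have : S.filter (· ≤ x) = S.filter (· < x) := by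
          ext z
          simp only [Finset.mem_filter, le_iff_lt_or_eq, and_congr_right_iff, or_iff_left_iff_imp]
          rintro hz rfl
          exact absurd hz hxS
        simp only [hh, h1, if_neg h2, if_neg hxS, h3, this]
  have heq := eq_of_eventually_eq isPreconnected_Icc key (left_mem_Icc.2 hab) (right_mem_Icc.2 hab)
  have haS : a ∉ S := fun h => lt_irrefl _ (hS a h).1
  have hbS : b ∉ S := fun h => lt_irrefl _ (hS b h).2
  have e1 : S.filter (· < a) = ∅ := by
    rw [Finset.filter_eq_empty_iff]
    exact fun z hz => not_lt.2 (hS z hz).1.le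
  have e2 : S.filter (· < b) = S := Finset.filter_true_of_mem fun z hz => (hS z hz).2
  simp only [hh, if_neg haS, if_neg hbS, e1, e2, Finset.sum_empty] at heq
  linarith

end LocallyConstant

/-! ### Primitives of a closed form along continuous maps. -/

section Primitives

variable {X Y Z : Type*} [TopologicalSpace X] [TopologicalSpace Y] [TopologicalSpace Z]

/-- A system of local primitives on `G`: `L φ x` means that `φ` is a primitive near `x`. -/
structure LocalPrimitives (L : (X → ℝ) → X → Prop) (G : Set X) : Prop where
  exists_prim : ∀ x ∈ G, ∃ φ, L φ x
  sub_const : ∀ {φ ψ : X → ℝ} {x : X}, L φ x → L ψ x → ∀ᶠ y in 𝓝 x, φ y - ψ y = φ x - ψ x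
  eventually : ∀ {φ : X → ℝ} {x : X}, L φ x → ∀ᶠ y in 𝓝 x, L φ y
  continuousAt : ∀ {φ : X → ℝ} {x : X}, L φ x → ContinuousAt φ x

/-- `f` is a primitive along the map `g` on `A`: locally it is a primitive composed with `g`, up to
a constant. -/
def PrimOn (L : (X → ℝ) → X → Prop) (g : Y → X) (f : Y → ℝ) (A : Set Y) : Prop :=
  ∀ y ∈ A, ∃ φ, L φ (g y) ∧ ∀ᶠ z in 𝓝[A] y, f z - φ (g z) = f y - φ (g y)

variable {L : (X → ℝ) → X → Prop} {G : Set X} {g : Y → X} {f f' : Y → ℝ} {A B : Set Y}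

lemma PrimOn.mono (h : PrimOn L g f A) (hB : B ⊆ A) : PrimOn L g f B := fun y hy => by
  obtain ⟨φ, h1, h2⟩ := h y (hB hy)
  exact ⟨φ, h1, nhdsWithin_mono _ hB h2⟩

lemma PrimOn.congr {g' : Y → X} (h : PrimOn L g f A) (hg : EqOn g' g A) (hf : EqOn f' f A) :
    PrimOn L g' f' A := fun y hy => by
  obtain ⟨φ, h1, h2⟩ := h y hy
  refine ⟨φ, by rwa [hg hy], ?_⟩
  filter_upwards [h2, self_mem_nhdsWithin] with z hz hzA
  rw [hg hy, hf hy, hg hzA, hf hzA, hz]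

lemma PrimOn.add_const (h : PrimOn L g f A) (c : ℝ) : PrimOn L g (fun y => f y + c) A :=
  fun y hy => by
  obtain ⟨φ, h1, h2⟩ := h y hy
  refine ⟨φ, h1, ?_⟩
  filter_upwards [h2] with z hz
  linarith

lemma PrimOn.comp (h : PrimOn L g f A) {k : Z → Y} {C : Set Z} (hk : ContinuousOn k C)
    (hm : MapsTo k C A) : PrimOn L (fun z => g (k z)) (fun z => f (k z)) C := fun y hy => by
  obtain ⟨φ, h1, h2⟩ := h (k y) (hm hy)
  exact ⟨φ, h1, ((hk y hy).tendsto_nhdsWithin hm).eventually h2⟩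

lemma PrimOn.eventually_sub (hL : LocalPrimitives L G) (h : PrimOn L g f A)
    (hg : ContinuousOn g A) {y : Y} (hy : y ∈ A) {ψ : X → ℝ} (hψ : L ψ (g y)) :
    ∀ᶠ z in 𝓝[A] y, f z - ψ (g z) = f y - ψ (g y) := by
  obtain ⟨φ, h1, h2⟩ := h y hy
  filter_upwards [h2, (hg y hy).eventually (hL.sub_const h1 hψ)] with z h3 h4
  linarith

lemma PrimOn.continuousOn (hL : LocalPrimitives L G) (h : PrimOn L g f A)
    (hg : ContinuousOn g A) : ContinuousOn f A := by
  intro y hy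
  obtain ⟨φ, h1, h2⟩ := h y hy
  have : ContinuousWithinAt (fun z => φ (g z) + (f y - φ (g y))) A y :=
    ((hL.continuousAt h1).comp_continuousWithinAt (hg y hy)).add continuousWithinAt_const
  refine this.congr_of_eventuallyEq ?_ (by ring)
  filter_upwards [h2] with z hz
  linarith

lemma PrimOn.eventually_sub_eq (hL : LocalPrimitives L G) (h : PrimOn L g f A)
    (h' : PrimOn L g f' A) (hg : ContinuousOn g A) {y : Y} (hy : y ∈ A) :
    ∀ᶠ z in 𝓝[A] y, f z - f' z = f y - f' y := by
  obtain ⟨φ, h1, h2⟩ := h y hy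
  filter_upwards [h2, h'.eventually_sub hL hg hy h1] with z h3 h4
  linarith

/-- Uniqueness of primitives up to a constant. The comparisons of integrals below are instances of
it. -/
lemma PrimOn.sub_eq_sub (hL : LocalPrimitives L G) (h : PrimOn L g f A)
    (h' : PrimOn L g f' A) (hg : ContinuousOn g A) (hA : IsPreconnected A) {y z : Y} (hy : y ∈ A)
    (hz : z ∈ A) : f y - f' y = f z - f' z :=
  eq_of_eventually_eq (f := fun x => f x - f' x) hA
    (fun _ hx => h.eventually_sub_eq hL h' hg hx) hy hz

/-- On a product with an interval, it is enough to have a primitive along one slice and along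
all lines. -/
lemma PrimOn.prod (hL : LocalPrimitives L G) {g : Y × ℝ → X} {f : Y × ℝ → ℝ} {J : Set ℝ}
    (hJ : J.OrdConnected) (hg : ContinuousOn g (A ×ˢ J)) {t₀ : ℝ} (ht₀ : t₀ ∈ J)
    (h0 : PrimOn L (fun y => g (y, t₀)) (fun y => f (y, t₀)) A)
    (h1 : ∀ y ∈ A, PrimOn L (fun t => g (y, t)) (fun t => f (y, t)) J) :
    PrimOn L g f (A ×ˢ J) := by
  have hgA : ∀ t ∈ J, ContinuousOn (fun y => g (y, t)) A := fun t ht =>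
    hg.comp (by fun_prop) fun y hy => ⟨hy, ht⟩
  have hgJ : ∀ y ∈ A, ContinuousOn (fun t => g (y, t)) J := fun y hy =>
    hg.comp (by fun_prop) fun t ht => ⟨hy, ht⟩
  rintro ⟨y₀, t⟩ ⟨hy₀, ht⟩
  simp only at hy₀ ht
  obtain ⟨φ₀, hφ₀, -⟩ := h1 y₀ hy₀ t ht
  refine ⟨φ₀, hφ₀, ?_⟩
  -- `Q t` says that `f` is a primitive near `(y₀, t)` on the product. It holds at `t₀` and is
  -- locally constant in `t`, so it spreads over the connected set `J`.
  let Q : ℝ → Prop := fun t => ∀ ψ, L ψ (g (y₀, t)) →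
    ∀ᶠ z in 𝓝[A ×ˢ J] (y₀, t), f z - ψ (g z) = f (y₀, t) - ψ (g (y₀, t))
  have hQ0 : ∀ t ∈ J, ∀ᶠ t' in 𝓝[J] t, Q t' = Q t := by
    intro t ht
    obtain ⟨φ, hφ, -⟩ := h1 y₀ hy₀ t ht
    have hev : ∀ᶠ z in 𝓝[A ×ˢ J] (y₀, t), L φ (g z) :=
      (hg (y₀, t) ⟨hy₀, ht⟩).eventually (hL.eventually hφ)
    rw [nhdsWithin_prod_eq] at hev
    obtain ⟨p1, hp1, p2, hp2, hp⟩ := eventually_prod_iff.1 hev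
    rw [eventually_nhdsWithin_iff] at hp2
    obtain ⟨l, u, ⟨hl, hu⟩, hlu⟩ := mem_nhds_iff_exists_Ioo_subset.1 hp2
    have hconn : IsPreconnected (Ioo l u ∩ J) :=
      (Set.OrdConnected.inter ordConnected_Ioo hJ).isPreconnected
    -- In the box where the single function `φ` is a primitive, `f - φ ∘ g` does not depend on the
    -- second coordinate. So `Q t'`, for every `t'` in the box, amounts to one statement about the
    -- slice at `t`.
    have hbox : ∀ y ∈ A, p1 y → ∀ t1 ∈ Ioo l u ∩ J, ∀ t2 ∈ Ioo l u ∩ J,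
        f (y, t1) - φ (g (y, t1)) = f (y, t2) - φ (g (y, t2)) := by
      intro y hy hpy t1 ht1 t2 ht2
      refine eq_of_eventually_eq (f := fun s => f (y, s) - φ (g (y, s))) hconn
        (fun s hs => ?_) ht1 ht2
      exact nhdsWithin_mono _ inter_subset_right
        ((h1 y hy).eventually_sub hL (hgJ y hy) hs.2 (hp hpy (hlu hs.1 hs.2)))
    have hy₀p : p1 y₀ := hp1.self_of_nhdsWithin hy₀
    have hK : ∀ t' ∈ Ioo l u ∩ J, (Q t' ↔
        ∀ᶠ y in 𝓝[A] y₀, f (y, t) - φ (g (y, t)) = f (y₀, t) - φ (g (y₀, t))) := by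
      intro t' ht'
      have htt : t ∈ Ioo l u ∩ J := ⟨⟨hl, hu⟩, ht⟩
      constructor
      · intro h
        have h2 := h φ (hp hy₀p (hlu ht'.1 ht'.2))
        have h3 : Tendsto (fun y => (y, t')) (𝓝[A] y₀) (𝓝[A ×ˢ J] (y₀, t')) :=
          ContinuousWithinAt.tendsto_nhdsWithin (by fun_prop) fun y hy => ⟨hy, ht'.2⟩
        filter_upwards [h3.eventually h2, hp1, self_mem_nhdsWithin] with y h4 h5 h6
        rw [hbox y h6 h5 t htt t' ht', h4, hbox y₀ hy₀ hy₀p t htt t' ht']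
      · intro h ψ hψ
        have e1 : ∀ᶠ z in 𝓝[A ×ˢ J] (y₀, t'), ψ (g z) - φ (g z) =
            ψ (g (y₀, t')) - φ (g (y₀, t')) :=
          (hg (y₀, t') ⟨hy₀, ht'.2⟩).eventually
            (hL.sub_const hψ (hp hy₀p (hlu ht'.1 ht'.2)))
        have e2 : ∀ᶠ z in 𝓝[A ×ˢ J] (y₀, t'), f z - φ (g z) =
            f (y₀, t') - φ (g (y₀, t')) := by
          rw [nhdsWithin_prod_eq]
          have e3 : ∀ᶠ s in 𝓝[J] t', s ∈ Ioo l u ∩ J :=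
            inter_mem (nhdsWithin_le_nhds (Ioo_mem_nhds ht'.1.1 ht'.1.2)) self_mem_nhdsWithin
          filter_upwards [(h.and (hp1.and self_mem_nhdsWithin)).prod_mk e3] with z hz
          obtain ⟨⟨h4, h5, h6⟩, h7⟩ := hz
          rw [hbox z.1 h6 h5 z.2 h7 t htt, h4, hbox y₀ hy₀ hy₀p t htt t' ht']
        filter_upwards [e1, e2] with z h4 h5
        linarith
    filter_upwards [nhdsWithin_le_nhds (Ioo_mem_nhds hl hu), self_mem_nhdsWithin] with t' h2 h3
    exact propext ((hK t' ⟨h2, h3⟩).trans (hK t ⟨⟨hl, hu⟩, ht⟩).symm)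
  have hQt₀ : Q t₀ := by
    obtain ⟨φ, hφ, -⟩ := h1 y₀ hy₀ t₀ ht₀
    intro ψ hψ
    -- a neighbourhood of `(y₀, t₀)` in the product
    have hev : ∀ᶠ z in 𝓝[A ×ˢ J] (y₀, t₀), L ψ (g z) :=
      (hg (y₀, t₀) ⟨hy₀, ht₀⟩).eventually (hL.eventually hψ)
    rw [nhdsWithin_prod_eq] at hev ⊢
    obtain ⟨p1, hp1, p2, hp2, hp⟩ := eventually_prod_iff.1 hev
    rw [eventually_nhdsWithin_iff] at hp2
    obtain ⟨l, u, ⟨hl, hu⟩, hlu⟩ := mem_nhds_iff_exists_Ioo_subset.1 hp2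
    have hconn : IsPreconnected (Ioo l u ∩ J) :=
      (Set.OrdConnected.inter ordConnected_Ioo hJ).isPreconnected
    have e3 : ∀ᶠ s in 𝓝[J] t₀, s ∈ Ioo l u ∩ J :=
      inter_mem (nhdsWithin_le_nhds (Ioo_mem_nhds hl hu)) self_mem_nhdsWithin
    have e4 := h0.eventually_sub hL (hgA t₀ ht₀) hy₀ hψ
    filter_upwards [(e4.and (hp1.and self_mem_nhdsWithin)).prod_mk e3] with z hz
    obtain ⟨⟨h4, h5, h6⟩, h7⟩ := hz
    rw [← h4]
    refine eq_of_eventually_eq (f := fun s => f (z.1, s) - ψ (g (z.1, s))) hconn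
      (fun s hs => ?_) h7 ⟨⟨hl, hu⟩, ht₀⟩
    exact nhdsWithin_mono _ inter_subset_right
      ((h1 z.1 h6).eventually_sub hL (hgJ z.1 h6) hs.2 (hp h5 (hlu hs.1 hs.2)))
  have : Q t := by
    rw [← eq_of_eventually_eq (f := Q) hJ.isPreconnected hQ0 ht₀ ht]
    exact hQt₀
  exact this φ₀ hφ₀

/-- The second primitive is shifted so as to agree with the first at `b`. -/
lemma PrimOn.glue (hL : LocalPrimitives L G) {g : ℝ → X} {f₁ f₂ : ℝ → ℝ} {a b c : ℝ}
    (hab : a ≤ b) (hbc : b ≤ c) (hg : ContinuousOn g (Icc a c)) (h1 : PrimOn L g f₁ (Icc a b))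
    (h2 : PrimOn L g f₂ (Icc b c)) : ∃ f, PrimOn L g f (Icc a c) := by
  refine ⟨fun t => if t ≤ b then f₁ t else f₂ t - f₂ b + f₁ b, fun y hy => ?_⟩
  rcases lt_trichotomy y b with hyb | rfl | hyb
  · obtain ⟨φ, e1, e2⟩ := h1 y ⟨hy.1, hyb.le⟩
    refine ⟨φ, e1, ?_⟩
    rw [eventually_nhdsWithin_iff] at e2 ⊢
    filter_upwards [e2, gt_mem_nhds hyb] with z h3 h4 h5
    simp only [if_pos h4.le, if_pos hyb.le]
    exact h3 ⟨h5.1, h4.le⟩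
  · obtain ⟨φ, e1, e2⟩ := h1 y ⟨hy.1, le_rfl⟩
    have e3 := h2.eventually_sub hL (hg.mono (Icc_subset_Icc_left hab)) ⟨le_rfl, hy.2⟩ e1
    refine ⟨φ, e1, ?_⟩
    rw [eventually_nhdsWithin_iff] at e2 e3 ⊢
    filter_upwards [e2, e3] with z h3 h4 h5
    simp only [le_refl, if_true]
    split_ifs with h6
    · exact h3 ⟨h5.1, h6⟩
    · have := h4 ⟨(not_le.1 h6).le, h5.2⟩
      linarith
  · obtain ⟨φ, e1, e2⟩ := h2 y ⟨hyb.le, hy.2⟩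
    refine ⟨φ, e1, ?_⟩
    rw [eventually_nhdsWithin_iff] at e2 ⊢
    filter_upwards [e2, lt_mem_nhds hyb] with z h3 h4 h5
    simp only [if_neg (not_le.2 h4), if_neg (not_le.2 hyb)]
    have := h3 ⟨h4.le, h5.2⟩
    linarith

lemma LocalPrimitives.primOn_comp (_ : LocalPrimitives L G) {φ : X → ℝ}
    (h : ∀ y ∈ A, L φ (g y)) : PrimOn L g (fun y => φ (g y)) A :=
  fun y hy => ⟨φ, h y hy, Eventually.of_forall fun z => by simp⟩

lemma LocalPrimitives.exists_primOn_Icc (hL : LocalPrimitives L G) {g : ℝ → X} {a b : ℝ}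
    (hab : a ≤ b) (hg : ContinuousOn g (Icc a b)) (hG : MapsTo g (Icc a b) G) :
    ∃ f, PrimOn L g f (Icc a b) := by
  -- `E` is locally constant, because near each point a single local primitive can be glued on.
  let E : ℝ → Prop := fun t => ∃ f, PrimOn L g f (Icc a t)
  have hE : ∀ t ∈ Icc a b, ∀ᶠ t' in 𝓝[Icc a b] t, E t' = E t := by
    intro t ht
    obtain ⟨φ, hφ⟩ := hL.exists_prim (g t) (hG ht)
    have hev := (hg t ht).eventually (hL.eventually hφ)
    rw [eventually_nhdsWithin_iff] at hev
    obtain ⟨l, u, ⟨hl, hu⟩, hlu⟩ := mem_nhds_iff_exists_Ioo_subset.1 hev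
    have key : ∀ t1 ∈ Ioo l u ∩ Icc a b, ∀ t2 ∈ Ioo l u ∩ Icc a b, E t1 → E t2 := by
      rintro t1 ht1 t2 ht2 ⟨f, hf⟩
      rcases le_total t2 t1 with h | h
      · exact ⟨f, hf.mono (Icc_subset_Icc_right h)⟩
      · refine PrimOn.glue hL ht1.2.1 h (hg.mono (Icc_subset_Icc_right ht2.2.2)) hf
          (hL.primOn_comp (φ := φ) fun y hy => hlu ⟨?_, ?_⟩ ⟨?_, ?_⟩)
        · exact ht1.1.1.trans_le hy.1
        · exact hy.2.trans_lt ht2.1.2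
        · exact ht1.2.1.trans hy.1
        · exact hy.2.trans ht2.2.2
    filter_upwards [nhdsWithin_le_nhds (Ioo_mem_nhds hl hu), self_mem_nhdsWithin] with t' h2 h3
    exact propext ⟨key _ ⟨h2, h3⟩ _ ⟨⟨hl, hu⟩, ht⟩, key _ ⟨⟨hl, hu⟩, ht⟩ _ ⟨h2, h3⟩⟩
  have ha : E a := by
    obtain ⟨φ, hφ⟩ := hL.exists_prim (g a) (hG ⟨le_rfl, hab⟩)
    refine ⟨fun t => φ (g t), hL.primOn_comp fun y hy => ?_⟩
    rwa [le_antisymm hy.2 hy.1]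
  have : E b := by
    rw [← eq_of_eventually_eq (f := E) isPreconnected_Icc hE (left_mem_Icc.2 hab)
      (right_mem_Icc.2 hab)]
    exact ha
  exact this

lemma exists_Icc_mem_nhds {J : Set ℝ} (hJ : J.OrdConnected) (hJo : IsOpen J) {t y : ℝ}
    (ht : t ∈ J) (hy : y ∈ J) : ∃ a b, a ≤ b ∧ Icc a b ⊆ J ∧ Icc a b ∈ 𝓝 y ∧ t ∈ Icc a b := by
  obtain ⟨l, u, ⟨hl, hu⟩, hlu⟩ := mem_nhds_iff_exists_Ioo_subset.1 (hJo.mem_nhds hy)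
  obtain ⟨l', hl', hl''⟩ := exists_between hl
  obtain ⟨u', hu', hu''⟩ := exists_between hu
  have h1 : l' ∈ J := hlu ⟨hl', hl''.trans hu⟩
  have h2 : u' ∈ J := hlu ⟨hl.trans hu', hu''⟩
  refine ⟨min l' t, max u' t, (min_le_right _ _).trans (le_max_right _ _), hJ.out ?_ ?_,
    Icc_mem_nhds (min_lt_of_left_lt hl'') (lt_max_of_lt_left hu'),
    min_le_right _ _, le_max_right _ _⟩
  · rcases min_choice l' t with h | h <;> rw [h] <;> assumption
  · rcases max_choice u' t with h | h <;> rw [h] <;> assumption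

lemma LocalPrimitives.exists_primOn_interval (hL : LocalPrimitives L G) {g : ℝ → X} {J : Set ℝ}
    (hJ : J.OrdConnected) (hJo : IsOpen J) (hg : ContinuousOn g J) (hG : MapsTo g J G) :
    ∃ f, PrimOn L g f J := by
  rcases J.eq_empty_or_nonempty with rfl | ⟨t₀, ht₀⟩
  · exact ⟨fun _ => 0, fun y hy => hy.elim⟩
  have hex : ∀ a b, a ≤ b → Icc a b ⊆ J → ∃ f, PrimOn L g f (Icc a b) := fun a b hab hs =>
    hL.exists_primOn_Icc hab (hg.mono hs) (hG.mono_left hs)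
  choose! Φ hΦ using hex
  let F : ℝ → ℝ → ℝ := fun t s => Φ (min t₀ t) (max t₀ t) s
  have hF : ∀ t ∈ J, PrimOn L g (F t) (Icc (min t₀ t) (max t₀ t)) := by
    intro t ht
    refine hΦ _ _ min_le_max (hJ.out ?_ ?_)
    · rcases min_choice t₀ t with h | h <;> rw [h] <;> assumption
    · rcases max_choice t₀ t with h | h <;> rw [h] <;> assumption
  -- The primitives chosen on different compact intervals need not agree, but their increments from
  -- `t₀` do.
  refine ⟨fun t => F t t - F t t₀, fun y hy => ?_⟩
  obtain ⟨a, b, hab, hs, hn, ht⟩ := exists_Icc_mem_nhds hJ hJo ht₀ hy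
  have hP := hΦ a b hab hs
  have heq : ∀ t ∈ Icc a b, F t t - F t t₀ = Φ a b t - Φ a b t₀ := by
    intro t htt
    have hsub : Icc (min t₀ t) (max t₀ t) ⊆ Icc a b :=
      Icc_subset_Icc (le_min ht.1 htt.1) (max_le ht.2 htt.2)
    have := (hF t (hs htt)).sub_eq_sub hL (hP.mono hsub) (hg.mono (hsub.trans hs))
      isPreconnected_Icc (y := t) (z := t₀) ⟨min_le_right _ _, le_max_right _ _⟩
      ⟨min_le_left _ _, le_max_left _ _⟩
    linarith
  have hyab : y ∈ Icc a b := mem_of_mem_nhds hn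
  obtain ⟨φ, h1, h2⟩ := hP y hyab
  refine ⟨φ, h1, ?_⟩
  rw [eventually_nhdsWithin_iff] at h2
  refine nhdsWithin_le_nhds ?_
  filter_upwards [h2, hn] with z h3 h4
  rw [heq z h4, heq y hyab]
  have := h3 h4
  linarith

/-- The primitives on the lines are chosen independently and only normalized at `t₀`; `PrimOn.prod`
shows that they fit together. -/
lemma LocalPrimitives.exists_primOn_prod (hL : LocalPrimitives L G) {g : Y × ℝ → X} {J : Set ℝ}
    (hJ : J.OrdConnected) (hJo : IsOpen J) (hg : ContinuousOn g (A ×ˢ J))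
    (hG : MapsTo g (A ×ˢ J) G) {t₀ : ℝ} (ht₀ : t₀ ∈ J)
    (h0 : ∃ f, PrimOn L (fun y => g (y, t₀)) f A) : ∃ f, PrimOn L g f (A ×ˢ J) := by
  obtain ⟨f₀, hf₀⟩ := h0
  have hex : ∀ y ∈ A, ∃ f, PrimOn L (fun t => g (y, t)) f J := fun y hy =>
    hL.exists_primOn_interval hJ hJo (hg.comp (by fun_prop) fun t ht => ⟨hy, ht⟩)
      fun t ht => hG ⟨hy, ht⟩
  choose! Φ hΦ using hex
  refine ⟨fun z => f₀ z.1 + (Φ z.1 z.2 - Φ z.1 t₀), PrimOn.prod hL hJ hg ht₀ ?_ ?_⟩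
  · simpa using hf₀
  · intro y hy
    refine ((hΦ y hy).add_const (f₀ y - Φ y t₀)).congr (fun _ _ => rfl) fun t _ => ?_
    simp only
    ring

/-- Primitives exist along maps from open rectangles. -/
lemma LocalPrimitives.exists_primOn_rect (hL : LocalPrimitives L G) {g : ℝ × ℝ → X} {I J : Set ℝ}
    (hI : I.OrdConnected) (hIo : IsOpen I) (hJ : J.OrdConnected) (hJo : IsOpen J)
    (hg : ContinuousOn g (I ×ˢ J)) (hG : MapsTo g (I ×ˢ J) G) : ∃ f, PrimOn L g f (I ×ˢ J) := by
  rcases J.eq_empty_or_nonempty with rfl | ⟨t₀, ht₀⟩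
  · exact ⟨fun _ => 0, fun y hy => hy.2.elim⟩
  · exact hL.exists_primOn_prod hJ hJo hg hG ht₀ (hL.exists_primOn_interval hI hIo
      (hg.comp (by fun_prop) fun t ht => ⟨ht, ht₀⟩) fun t ht => hG ⟨ht, ht₀⟩)

end Primitives


/-! ### Growth over a period and the variation of the angle. -/

section Periodic

/-- The growth over a period of a function that is locally constant off a discrete set. -/
lemma eq_sum_jumps_of_period {q : ℝ → ℝ} {κ : ℝ} (B : Set ℝ)
    (hper : ∀ s, s ∉ B → q (s + 1) = q s + κ) (hB : ∀ s ∈ B, s + 1 ∈ B) (S : Finset ℝ) (hS : ∀ s, s ∈ S ↔ s ∈ Ico (0 : ℝ) 1 ∧ s ∈ B)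
    (d : ℝ → ℝ) (h0 : ∀ s, s ∉ B → ∀ᶠ y in 𝓝 s, q y = q s)
    (h1 : ∀ x ∈ S, ∃ c, (∀ᶠ y in 𝓝[<] x, q y = c) ∧ ∀ᶠ y in 𝓝[>] x, q y = c + d x) :
    κ = ∑ s ∈ S, d s := by
  have hev : ∀ᶠ a in 𝓝[<] (0 : ℝ), ∀ s ∈ S, s - 1 < a := by
    rw [Filter.eventually_all_finset]
    intro s hs
    refine nhdsWithin_le_nhds (lt_mem_nhds ?_)
    linarith [((hS s).1 hs).1.2]
  have hev2 : ∀ᶠ a in 𝓝[<] (0 : ℝ), -1 < a :=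
    nhdsWithin_le_nhds (lt_mem_nhds (by norm_num))
  -- The period starts slightly to the left of `0`, beyond all points `s - 1` with `s` in `S`. Then
  -- the end points are not in `B`, and `S` is exactly the part of `B` between `a` and `a + 1`.
  obtain ⟨a, ha, ha1, ha0⟩ := (hev.and (hev2.and self_mem_nhdsWithin)).exists
  have haB : a ∉ B := fun h => by
    have h3 := (hS (a + 1)).2 ⟨⟨by linarith, by linarith⟩, hB a h⟩
    linarith [ha _ h3]
  rw [← sub_eq_sum_jumps (q := q) (a := a) (b := a + 1) (by linarith) S d, hper a haB]
  · ring
  · intro x hx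
    exact ⟨lt_of_lt_of_le ha0 ((hS x).1 hx).1.1, by linarith [ha x hx]⟩
  · intro x hx hxS
    refine h0 x fun hxB => ?_
    rcases lt_or_ge x 0 with h | h
    · have h3 := (hS (x + 1)).2 ⟨⟨by linarith [hx.1], by linarith⟩, hB x hxB⟩
      linarith [ha _ h3, hx.1]
    · exact hxS ((hS x).2 ⟨⟨h, by linarith [hx.2]⟩, hxB⟩)
  · exact h1

/-- A continuous function with values in a coset of `2πℤ` is locally constant. This is how
continuous branches of an angle are compared. -/
lemma eventually_eq_of_int_mul {Y : Type*} [TopologicalSpace Y] {A : Set Y} {h : Y → ℝ} {y : Y}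
    (hc : ContinuousWithinAt h A y)
    (hn : ∀ᶠ z in 𝓝[A] y, ∃ n : ℤ, h z - h y = n * (2 * Real.pi)) :
    ∀ᶠ z in 𝓝[A] y, h z = h y := by
  have := Metric.tendsto_nhds.1 hc (2 * Real.pi) Real.two_pi_pos
  filter_upwards [this, hn] with z h1 ⟨n, h2⟩
  rw [Real.dist_eq, h2, abs_mul, abs_of_pos Real.two_pi_pos] at h1
  have h3 : |(n : ℝ)| < 1 := by
    by_contra h
    nlinarith [Real.two_pi_pos, not_lt.1 h]
  have h4 : n = 0 := by
    rw [← Int.cast_abs] at h3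
    have : |n| < 1 := by exact_mod_cast h3
    exact Int.abs_lt_one_iff.1 this
  rw [h4] at h2
  simp at h2
  linarith

/-- The variation of a periodic function that differs by multiples of `2π` from a continuous one. -/
lemma hasVariation_of_lift {Θ Θt : ℝ → ℝ} {k : ℤ} (hc : Continuous Θt)
    (hk : ∀ s, Θt (s + 1) = Θt s - 2 * Real.pi * k) (hper : ∀ s, Θ (s + 1) = Θ s)
    (hn : ∀ s, ∃ n : ℤ, Θ s - Θt s = n * (2 * Real.pi)) (hfin : (discontinuities Θ).Finite) :
    HasVariation Θ (-2 * k * Real.pi) := by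
  set S : Finset ℝ := hfin.toFinset with hSdef
  have hS : ∀ s, s ∈ S ↔ s ∈ Ico (0 : ℝ) 1 ∧ s ∈ {s | ¬ ContinuousAt Θ s} := fun s => by
    rw [hSdef, Finite.mem_toFinset]; rfl
  -- `q` takes values in `2πℤ`, is locally constant where `Θ` is continuous, has the same jumps as
  -- `Θ` and grows by `2πk` over a period.
  set q : ℝ → ℝ := fun s => Θ s - Θt s with hq
  have hqint : ∀ s s', ∃ n : ℤ, q s - q s' = n * (2 * Real.pi) := by
    intro s s'
    obtain ⟨n, hn1⟩ := hn s
    obtain ⟨m, hm⟩ := hn s'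
    refine ⟨n - m, ?_⟩
    simp only [hq, hn1, hm]
    push_cast
    ring
  have hper' : Function.Periodic Θ 1 := hper
  have hcont1 : ∀ s, ContinuousAt Θ (s + 1) ↔ ContinuousAt Θ s := by
    intro s
    constructor
    · intro h
      have : Θ = fun x => Θ (x + 1) := by ext x; exact (hper x).symm
      rw [this]
      exact ContinuousAt.comp (f := fun x => x + 1) h (by fun_prop)
    · intro h
      have : Θ = fun x => Θ (x - 1) := by ext x; exact (hper'.sub_eq x).symm
      rw [this]
      refine ContinuousAt.comp (f := fun x => x - 1) ?_ (by fun_prop)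
      simpa using h
  have hloc : ∀ s, ContinuousAt Θ s → ∀ᶠ y in 𝓝 s, q y = q s := by
    intro s hs
    have h1 : ContinuousWithinAt q univ s := (hs.sub hc.continuousAt).continuousWithinAt
    have := eventually_eq_of_int_mul h1 (Eventually.of_forall fun z => hqint z s)
    rwa [nhdsWithin_univ] at this
  -- near every point, the function is continuous on both sides
  have hiso : ∀ s, ∃ δ > 0, ∀ y, y ≠ s → |y - s| < δ → ContinuousAt Θ y := by
    intro s
    have : ∀ᶠ y in 𝓝[≠] s, ContinuousAt Θ y := by
      have h2 : ∀ᶠ y in 𝓝 s, ∀ z ∈ S, ∀ m ∈ Finset.Icc (⌊s⌋ - 1) (⌊s⌋ + 1), z + (m : ℤ) ≠ s →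
          y ≠ z + m := by
        rw [Filter.eventually_all_finset]
        intro z _
        rw [Filter.eventually_all_finset]
        intro m _
        by_cases h : z + m = s
        · exact Eventually.of_forall fun y h' => absurd h h'
        · filter_upwards [isOpen_ne.mem_nhds (Ne.symm h)] with y hy _ using hy
      rw [eventually_nhdsWithin_iff]
      filter_upwards [h2, Metric.ball_mem_nhds s one_pos] with y h3 h4 hys
      by_contra h5
      rw [Real.ball_eq_Ioo] at h4
      -- Discontinuity at `y` is discontinuity at its fractional part. Hence near `s` only the
      -- translates of the finite set `S` by `⌊s⌋ - 1`, `⌊s⌋` and `⌊s⌋ + 1` matter.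
      have h6 : Int.fract y ∈ S := by
        rw [hS]
        refine ⟨⟨Int.fract_nonneg y, Int.fract_lt_one y⟩, fun h7 => h5 ?_⟩
        have h8 : ∀ n : ℤ, ContinuousAt Θ (Int.fract y + n) := by
          intro n
          induction n using Int.induction_on with
          | zero => simpa using h7
          | succ i ih =>
            have := (hcont1 _).2 ih
            push_cast at this ⊢
            rwa [add_assoc] at this
          | pred i ih =>
            rw [← hcont1]
            push_cast at ih ⊢
            convert ih using 1
            ring
        simpa using h8 ⌊y⌋
      have h9 := h3 _ h6 ⌊y⌋ ?_ ?_
      · exact h9 (by simp)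
      · rw [Finset.mem_Icc]
        constructor
        · rw [← Int.floor_sub_one]; exact Int.floor_mono h4.1.le
        · rw [← Int.floor_add_one]; exact Int.floor_mono h4.2.le
      · simpa using hys
    rw [eventually_nhdsWithin_iff, Metric.eventually_nhds_iff] at this
    obtain ⟨δ, h1, h2⟩ := this
    exact ⟨δ, h1, fun y hy hyd => h2 (by rwa [Real.dist_eq]) hy⟩
  have hconst : ∀ a b : ℝ, (∀ y ∈ Ioo a b, ContinuousAt Θ y) → ∀ x ∈ Ioo a b, ∀ y ∈ Ioo a b,
      q x = q y := fun a b h x hx y hy =>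
    eq_of_eventually_eq isPreconnected_Ioo (fun z hz => nhdsWithin_le_nhds (hloc z (h z hz))) hx hy
  have hjump : ∀ s, ∃ c d, (∀ᶠ y in 𝓝[<] s, q y = c) ∧ ∀ᶠ y in 𝓝[>] s, q y = c + d := by
    intro s
    obtain ⟨δ, hδ, hδc⟩ := hiso s
    refine ⟨q (s - δ / 2), q (s + δ / 2) - q (s - δ / 2), ?_, ?_⟩
    · filter_upwards [Ioo_mem_nhdsLT (show s - δ < s by linarith)] with y hy
      refine hconst (s - δ) s (fun z hz => hδc z hz.2.ne ?_) y hy _ ⟨by linarith, by linarith⟩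
      rw [abs_lt]; constructor <;> linarith [hz.1, hz.2]
    · filter_upwards [Ioo_mem_nhdsGT (show s < s + δ by linarith)] with y hy
      rw [add_sub_cancel]
      refine hconst s (s + δ) (fun z hz => hδc z hz.1.ne' ?_) y hy _ ⟨by linarith, by linarith⟩
      rw [abs_lt]; constructor <;> linarith [hz.1, hz.2]
  choose c d hc1 hc2 using hjump
  have hsum := eq_sum_jumps_of_period (q := q) (κ := 2 * Real.pi * k)
    {s | ¬ ContinuousAt Θ s} (fun s _ => by simp only [hq, hk, hper]; ring)
    (fun s hs h => hs ((hcont1 s).1 h)) S hS d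
    (fun s hs => hloc s (not_not.1 hs)) fun x _ => ⟨c x, hc1 x, hc2 x⟩
  refine ⟨S, d, by rw [hSdef]; simp, fun s _ => ?_, by rw [← hsum]; ring⟩
  have t1 : Tendsto (fun ε => s + ε) (𝓝[>] 0) (𝓝[>] s) := by
    refine tendsto_nhdsWithin_iff.2 ⟨?_, ?_⟩
    · have : Tendsto (fun ε => s + ε) (𝓝 0) (𝓝 (s + 0)) := tendsto_const_nhds.add tendsto_id
      simpa using this.mono_left nhdsWithin_le_nhds
    · filter_upwards [self_mem_nhdsWithin] with ε hε
      simpa using hε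
  have t2 : Tendsto (fun ε => s - ε) (𝓝[>] 0) (𝓝[<] s) := by
    refine tendsto_nhdsWithin_iff.2 ⟨?_, ?_⟩
    · have : Tendsto (fun ε => s - ε) (𝓝 0) (𝓝 (s - 0)) := tendsto_const_nhds.sub tendsto_id
      simpa using this.mono_left nhdsWithin_le_nhds
    · filter_upwards [self_mem_nhdsWithin] with ε hε
      simpa using hε
  have t3 : Tendsto (fun ε => d s + (Θt (s + ε) - Θt (s - ε))) (𝓝[>] 0) (𝓝 (d s)) := by
    have : Tendsto (fun ε => d s + (Θt (s + ε) - Θt (s - ε))) (𝓝 0)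
        (𝓝 (d s + (Θt (s + 0) - Θt (s - 0)))) := Continuous.tendsto (by fun_prop) 0
    simpa using this.mono_left nhdsWithin_le_nhds
  refine t3.congr' ?_
  filter_upwards [t1.eventually (hc2 s), t2.eventually (hc1 s)] with ε h1 h2
  simp only [hq] at h1 h2
  linarith

end Periodic


/-! ### Actions of the plane on a bundle over a closed path. -/

section Torus

/-- Coordinates around the circle orbit of `p` in the space of an action of `ℝ²`: `w` is constant on
circle orbits and increases along the first factor, `u` is the position on the circle orbit with
respect to the slice `n`, which is parametrized by the parameter `s` of the path and by `w`. -/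
structure IsTube {X : Type*} [TopologicalSpace X] (F : X → ℝ × ℝ) (act : ℝ → ℝ → X → X)
    (Γ : ℝ → ℝ × ℝ) (s₀ : ℝ) (p : X) (V : Set X) (w u : X → ℝ) (n : ℝ → ℝ → X) (ε : ℝ) :
    Prop where
  isOpen : IsOpen V
  mem : p ∈ V
  w_zero : w p = 0
  w_cont : ContinuousOn w V
  u_cont : ContinuousOn u V
  same_fibre : ∀ x ∈ V, ∀ y ∈ V, F x = F y → w x = w y → y = act 0 (u y - u x) x
  same_orbit : ∀ x ∈ V, ∀ c, act 0 c x ∈ V → w (act 0 c x) = w x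
  mono : ∃ δ > 0, ∀ᶠ x in 𝓝 p, (∀ t ∈ Ioo (-δ) δ, act t 0 x ∈ V) ∧
    StrictMonoOn (fun t => w (act t 0 x)) (Ioo (-δ) δ)
  pos : 0 < ε
  w_lt : ∀ x ∈ V, |w x| < ε
  n_cont : ContinuousOn (fun q : ℝ × ℝ => n q.1 q.2) (Ioo (s₀ - ε) (s₀ + ε) ×ˢ Ioo (-ε) ε)
  n_centre : n s₀ 0 = p
  F_n : ∀ s ∈ Ioo (s₀ - ε) (s₀ + ε), ∀ r ∈ Ioo (-ε) ε, F (n s r) = Γ s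
  n_mem : ∀ s ∈ Ioo (s₀ - ε) (s₀ + ε), ∀ r ∈ Ioo (-ε) ε, n s r ∈ V
  w_n : ∀ s ∈ Ioo (s₀ - ε) (s₀ + ε), ∀ r ∈ Ioo (-ε) ε, w (n s r) = r
  u_n : ∀ s ∈ Ioo (s₀ - ε) (s₀ + ε), ∀ r ∈ Ioo (-ε) ε, u (n s r) = 0

/-- A space fibred by `F` over a closed path `Γ`, with an action of `ℝ²` preserving the fibres, in
which the second factor acts freely as a circle action. -/
structure TorusSystem (X : Type*) [TopologicalSpace X] where
  F : X → ℝ × ℝ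
  act : ℝ → ℝ → X → X
  Γ : ℝ → ℝ × ℝ
  continuous_F : Continuous F
  continuous_act : Continuous fun q : ℝ × ℝ × X => act q.1 q.2.1 q.2.2
  act_zero : ∀ x, act 0 0 x = x
  act_act : ∀ t u t' u' x, act t u (act t' u' x) = act (t + t') (u + u') x
  F_act : ∀ t u x, F (act t u x) = F x
  act_two_pi : ∀ x, act 0 (2 * Real.pi) x = x
  free : ∀ u x, act 0 u x = x → ∃ n : ℤ, u = n * (2 * Real.pi)
  fibre : ∀ v, IsPreconnected {x | F x = v}
  continuous_Γ : Continuous Γ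
  Γ_add_one : ∀ s, Γ (s + 1) = Γ s
  exists_fibre : ∀ s, ∃ x, F x = Γ s
  exists_param : ∀ x, ∃ s, F x = Γ s
  tube : ∀ s₀ p, F p = Γ s₀ → ∃ V w u n ε, IsTube F act Γ s₀ p V w u n ε

namespace TorusSystem

variable {X : Type*} [TopologicalSpace X] (S : TorusSystem X)

lemma act_int (x : X) (t u : ℝ) (n : ℤ) : S.act t (u + n * (2 * Real.pi)) x = S.act t u x := by
  have h1 : ∀ n : ℤ, S.act 0 (n * (2 * Real.pi)) x = x := by
    intro n
    induction n using Int.induction_on with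
    | zero => simpa using S.act_zero x
    | succ i ih =>
      have := S.act_act 0 (2 * Real.pi) 0 ((i : ℤ) * (2 * Real.pi)) x
      rw [ih, S.act_two_pi] at this
      nth_rw 2 [this]
      congr 1
      · simp
      · push_cast; ring
    | pred i ih =>
      have := S.act_act 0 (2 * Real.pi) 0 ((-(i : ℤ) - 1 : ℤ) * (2 * Real.pi)) x
      have h2 : S.act 0 (2 * Real.pi) (S.act 0 ((-(i : ℤ) - 1 : ℤ) * (2 * Real.pi)) x) = x := by
        rw [this]
        convert ih using 2
        · simp
        · push_cast; ring
      rwa [S.act_two_pi] at h2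
  have := S.act_act t u 0 (n * (2 * Real.pi)) x
  rw [h1] at this
  rw [this, add_zero]

lemma act_comm (t u t' u' : ℝ) (x : X) :
    S.act t u (S.act t' u' x) = S.act t' u' (S.act t u x) := by
  rw [S.act_act, S.act_act, add_comm t, add_comm u]

lemma act_cont {Y : Type*} [TopologicalSpace Y] {t u : Y → ℝ} {x : Y → X} (ht : Continuous t)
    (hu : Continuous u) (hx : Continuous x) : Continuous fun y => S.act (t y) (u y) (x y) :=
  S.continuous_act.comp (ht.prodMk (hu.prodMk hx))

lemma act_contAt {Y : Type*} [TopologicalSpace Y] {t u : Y → ℝ} {x : Y → X} {y : Y}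
    (ht : ContinuousAt t y) (hu : ContinuousAt u y) (hx : ContinuousAt x y) :
    ContinuousAt (fun y => S.act (t y) (u y) (x y)) y :=
  S.continuous_act.continuousAt.comp (f := fun y => (t y, u y, x y)) (ht.prodMk (hu.prodMk hx))

lemma act_contOn {Y : Type*} [TopologicalSpace Y] {t u : Y → ℝ} {x : Y → X} {A : Set Y}
    (ht : ContinuousOn t A) (hu : ContinuousOn u A) (hx : ContinuousOn x A) :
    ContinuousOn (fun y => S.act (t y) (u y) (x y)) A :=
  S.continuous_act.comp_continuousOn (f := fun y => (t y, u y, x y)) (ht.prodMk (hu.prodMk hx))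

/-- Nearby points of a fibre are related by a small time and a rotation. -/
lemma eventually_crossing (q : X) {η : ℝ} (hη : 0 < η) :
    ∀ᶠ z in 𝓝 (q, q), S.F z.1 = S.F z.2 → ∃ t c, |t| < η ∧ z.1 = S.act t c z.2 := by
  obtain ⟨s₀, hs₀⟩ := S.exists_param q
  obtain ⟨V, w, u, n, ε, hT⟩ := S.tube s₀ q hs₀
  obtain ⟨δ, hδ, hmono⟩ := hT.mono
  set r := min δ η / 2 with hr
  have hr0 : 0 < r := by have := lt_min hδ hη; positivity
  have hrδ : r < δ := by have := min_le_left δ η; have := lt_min hδ hη; linarith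
  have hrη : r < η := by have := min_le_right δ η; have := lt_min hδ hη; linarith
  have hq := hmono.self_of_nhds
  have hwq : ∀ t ∈ Ioo (-δ) δ, ContinuousAt w (S.act t 0 q) := fun t ht =>
    hT.w_cont.continuousAt (hT.isOpen.mem_nhds (hq.1 t ht))
  have hc : ∀ t, ContinuousAt (fun z : X × X => S.act t 0 z.2) (q, q) := fun t =>
    (S.act_cont continuous_const continuous_const continuous_snd).continuousAt
  have hw1 : ContinuousAt (fun z : X × X => w z.1) (q, q) :=
    ContinuousAt.comp (f := fun z : X × X => z.1)
      (hT.w_cont.continuousAt (hT.isOpen.mem_nhds hT.mem)) continuous_fst.continuousAt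
  have m0 : (0 : ℝ) ∈ Ioo (-δ) δ := ⟨by linarith, hδ⟩
  have m1 : r ∈ Ioo (-δ) δ := ⟨by linarith, hrδ⟩
  have m2 : -r ∈ Ioo (-δ) δ := ⟨by linarith, by linarith⟩
  have l1 : w q < w (S.act r 0 q) := by
    have := hq.2 m0 m1 hr0
    simpa only [S.act_zero] using this
  have l2 : w (S.act (-r) 0 q) < w q := by
    have := hq.2 m2 m0 (by linarith)
    simpa only [S.act_zero] using this
  have e1 : ∀ᶠ z in 𝓝 (q, q), w z.1 < w (S.act r 0 z.2) :=
    hw1.eventually_lt (ContinuousAt.comp (f := fun z : X × X => S.act r 0 z.2)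
      (hwq r m1) (hc r)) l1
  have e2 : ∀ᶠ z in 𝓝 (q, q), w (S.act (-r) 0 z.2) < w z.1 :=
    ContinuousAt.eventually_lt (ContinuousAt.comp (f := fun z : X × X => S.act (-r) 0 z.2)
      (hwq (-r) m2) (hc (-r))) hw1 l2
  have e3 : ∀ᶠ z in 𝓝 (q, q), z.1 ∈ V :=
    continuous_fst.continuousAt.eventually (hT.isOpen.mem_nhds hT.mem)
  have e4 : ∀ᶠ z : X × X in 𝓝 (q, q), ∀ t ∈ Ioo (-δ) δ, S.act t 0 z.2 ∈ V :=
    (continuous_snd.continuousAt (x := (q, q))).eventually (hmono.mono fun _ h => h.1)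
  filter_upwards [e1, e2, e3, e4] with z h1 h2 h3 h4 hF
  have hcont : ContinuousOn (fun t => w (S.act t 0 z.2)) (Icc (-r) r) := by
    refine hT.w_cont.comp (S.act_cont continuous_id continuous_const continuous_const).continuousOn
      fun t ht => h4 t ⟨by linarith [ht.1], by linarith [ht.2]⟩
  -- Along the first factor `w` moves from below `w z.1` to above it, so some small time brings
  -- `z.2` to the level of `z.1`. Points of one fibre on the same level differ by a rotation.
  obtain ⟨t, ht, hwt⟩ := intermediate_value_Icc (by linarith) hcont ⟨h2.le, h1.le⟩
  have htδ : t ∈ Ioo (-δ) δ := ⟨by linarith [ht.1], by linarith [ht.2]⟩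
  refine ⟨t, u z.1 - u (S.act t 0 z.2), abs_lt.2 ⟨by linarith [ht.1], by linarith [ht.2]⟩, ?_⟩
  have := hT.same_fibre _ (h4 t htδ) _ h3 (by rw [S.F_act, hF]) hwt
  rw [S.act_act, zero_add, add_zero] at this
  exact this

/-- The action is transitive on the fibres. -/
lemma exists_act_eq {x y : X} (h : S.F x = S.F y) : ∃ t u, y = S.act t u x := by
  -- By `eventually_crossing`, lying on the orbit of `x` is a locally constant property on the
  -- connected fibre.
  have key := eq_of_eventually_eq (S.fibre (S.F x)) (f := fun y => ∃ t u, y = S.act t u x)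
    (x := x) (y := y) ?_ rfl h.symm
  · rw [← key]
    exact ⟨0, 0, (S.act_zero x).symm⟩
  · intro p hp
    have h1 := S.eventually_crossing p one_pos
    have h2 : ContinuousAt (fun y : X => (y, p)) p := by fun_prop
    rw [eventually_nhdsWithin_iff]
    filter_upwards [h2.eventually h1] with z hz hzF
    obtain ⟨t, c, -, hzp⟩ := hz ((show S.F z = S.F x from hzF).trans (show S.F p = _ from hp).symm)
    replace hzp : z = S.act t c p := hzp
    refine propext ⟨?_, ?_⟩
    · rintro ⟨a, b, hab⟩
      refine ⟨-t + a, -c + b, ?_⟩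
      rw [← S.act_act, ← hab, hzp, S.act_act]
      simp [S.act_zero]
    · rintro ⟨a, b, hab⟩
      exact ⟨t + a, c + b, by rw [← S.act_act, ← hab, hzp]⟩

/-- The times at which `x` returns to its circle orbit. -/
def returns (x : X) : AddSubgroup ℝ where
  carrier := {t | ∃ u, S.act t u x = x}
  zero_mem' := ⟨0, S.act_zero x⟩
  add_mem' := by
    rintro t t' ⟨u, hu⟩ ⟨u', hu'⟩
    exact ⟨u + u', by rw [← S.act_act, hu', hu]⟩
  neg_mem' := by
    rintro t ⟨u, hu⟩
    refine ⟨-u, ?_⟩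
    nth_rw 1 [← hu]
    rw [S.act_act]
    simp [S.act_zero]

lemma mem_returns {x : X} {t : ℝ} : t ∈ S.returns x ↔ ∃ u, S.act t u x = x := Iff.rfl

lemma act_eq_of_fibre {x y : X} (h : S.F x = S.F y) {t u : ℝ} (hx : S.act t u x = x) :
    S.act t u y = y := by
  obtain ⟨a, b, rfl⟩ := S.exists_act_eq h
  rw [S.act_comm, hx]

lemma returns_congr {x y : X} (h : S.F x = S.F y) : S.returns x = S.returns y := by
  ext t
  exact ⟨fun ⟨u, hu⟩ => ⟨u, S.act_eq_of_fibre h hu⟩, fun ⟨u, hu⟩ => ⟨u, S.act_eq_of_fibre h.symm hu⟩⟩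

/-- The coordinate `w` increases strictly along the flow but is constant on a circle orbit inside
the tube, so a small positive time is never a return, uniformly near `p`. -/
lemma eventually_not_return (p : X) :
    ∃ δ > 0, ∀ᶠ x in 𝓝 p, ∀ t ∈ Ioo 0 δ, t ∉ S.returns x := by
  obtain ⟨s₀, hs₀⟩ := S.exists_param p
  obtain ⟨V, w, u, n, ε, hT⟩ := S.tube s₀ p hs₀
  obtain ⟨δ, hδ, hmono⟩ := hT.mono
  refine ⟨δ, hδ, ?_⟩
  filter_upwards [hmono] with x hx t ht ⟨c, hc⟩
  have m0 : (0 : ℝ) ∈ Ioo (-δ) δ := ⟨by linarith, hδ⟩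
  have mt : t ∈ Ioo (-δ) δ := ⟨by linarith [ht.1], ht.2⟩
  have h1 := hx.2 m0 mt ht.1
  have h2 : S.act 0 c (S.act t 0 x) = x := by
    rw [S.act_act]
    simpa using hc
  have h3 := hT.same_orbit _ (hx.1 t mt) c (by rw [h2]; simpa [S.act_zero] using hx.1 0 m0)
  rw [h2] at h3
  simp only [S.act_zero] at h1
  exact absurd h3 h1.ne

variable [CompactSpace X]

/-- Recurrence in a compact space: for two indices `n < m` the points `act n 0 x` and `act m 0 x`
are close to the same accumulation point `q`, and each is joined to `q` by a time less than `1/2`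
and a rotation. The bound `1/2` keeps `m - n + (t1 - t2)` positive. -/
lemma exists_return (x : X) : ∃ t ∈ S.returns x, 0 < t := by
  obtain ⟨q, hq⟩ := exists_clusterPt_of_compactSpace
    (Filter.map (fun n : ℕ => S.act n 0 x) atTop)
  have hF : S.F q = S.F x := by
    have hcl : IsClosed {y | S.F y = S.F x} := isClosed_eq S.continuous_F continuous_const
    refine hcl.closure_subset ?_
    rw [mem_closure_iff_clusterPt]
    refine hq.mono ?_
    rw [le_principal_iff]
    exact mem_map.2 (Eventually.of_forall fun n => S.F_act _ _ _)
  have h1 := S.eventually_crossing q (half_pos one_pos)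
  have h2 : ContinuousAt (fun y : X => (y, q)) q := by fun_prop
  have h3 := (mapClusterPt_iff_frequently.1 hq) _ (h2.eventually h1)
  obtain ⟨n, -, hn⟩ := frequently_atTop.1 h3 0
  obtain ⟨m, hnm, hm⟩ := frequently_atTop.1 h3 (n + 1)
  obtain ⟨t1, c1, ht1, e1⟩ := hn (by simp [S.F_act, hF])
  obtain ⟨t2, c2, ht2, e2⟩ := hm (by simp [S.F_act, hF])
  simp only at e1 e2
  refine ⟨m - n + (t1 - t2), ?_, ?_⟩
  · rw [← S.returns_congr hF]
    refine ⟨c1 - c2, ?_⟩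
    have e3 : S.act (m - n) 0 (S.act n 0 x) = S.act m 0 x := by
      rw [S.act_act]; simp
    rw [e1, e2] at e3
    have e4 := congrArg (S.act (-t2) (-c2)) e3
    rw [S.act_act, S.act_act, S.act_act, neg_add_cancel, neg_add_cancel, S.act_zero] at e4
    convert e4 using 2 <;> ring
  · have : (n : ℝ) + 1 ≤ m := by exact_mod_cast hnm
    rw [abs_lt] at ht1 ht2
    linarith [ht1.1, ht2.2]

end TorusSystem

end Torus


/-! ### The first return time and its angle. -/

namespace TorusSystem

variable {X : Type*} [TopologicalSpace X] (S : TorusSystem X) [CompactSpace X]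

/-- The return times form a nontrivial subgroup of `ℝ` in which `0` is isolated, and such a subgroup
is infinite cyclic. -/
lemma exists_period (x : X) : ∃ T > 0, ∀ t, t ∈ S.returns x ↔ ∃ m : ℤ, t = m * T := by
  obtain ⟨δ, hδ, h⟩ := S.eventually_not_return x
  obtain ⟨b, hb⟩ := AddSubgroup.cyclic_of_isolated_zero hδ (H := S.returns x) (by
    rw [Set.disjoint_left]
    exact fun t ht ht' => h.self_of_nhds t ht' ht)
  have hmem : ∀ t, t ∈ S.returns x ↔ ∃ m : ℤ, t = m * b := by
    intro t
    rw [hb, AddSubgroup.mem_closure_singleton]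
    simp only [zsmul_eq_mul, eq_comm]
  obtain ⟨t, ht, ht0⟩ := S.exists_return x
  have hb0 : b ≠ 0 := by
    rintro rfl
    obtain ⟨m, hm⟩ := (hmem t).1 ht
    simp at hm
    linarith
  rcases lt_or_gt_of_ne hb0 with h0 | h0
  · refine ⟨-b, by linarith, fun t => ?_⟩
    rw [hmem]
    exact ⟨fun ⟨m, hm⟩ => ⟨-m, by push_cast; linarith⟩, fun ⟨m, hm⟩ => ⟨-m, by push_cast; linarith⟩⟩
  · exact ⟨b, h0, hmem⟩

/-- The first time of return to the circle orbit. -/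
noncomputable def T (x : X) : ℝ := (S.exists_period x).choose

lemma T_pos (x : X) : 0 < S.T x := (S.exists_period x).choose_spec.1

lemma mem_returns_iff (x : X) (t : ℝ) : t ∈ S.returns x ↔ ∃ m : ℤ, t = m * S.T x :=
  (S.exists_period x).choose_spec.2 t

lemma T_mem (x : X) : S.T x ∈ S.returns x := (S.mem_returns_iff x _).2 ⟨1, by simp⟩

lemma T_le {x : X} {t : ℝ} (h : t ∈ S.returns x) (ht : 0 < t) : S.T x ≤ t := by
  obtain ⟨m, rfl⟩ := (S.mem_returns_iff x t).1 h
  have hm : 0 < m := by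
    have := (pos_iff_pos_of_mul_pos ht).2 (S.T_pos x)
    exact_mod_cast this
  have : (1 : ℝ) ≤ m := by exact_mod_cast hm
  nlinarith [S.T_pos x]

lemma T_congr {x y : X} (h : S.F x = S.F y) : S.T x = S.T y := by
  apply le_antisymm
  · exact S.T_le (by rw [S.returns_congr h]; exact S.T_mem y) (S.T_pos y)
  · exact S.T_le (by rw [← S.returns_congr h]; exact S.T_mem x) (S.T_pos x)

lemma T_act (t u : ℝ) (x : X) : S.T (S.act t u x) = S.T x := S.T_congr (S.F_act t u x)

/-- The sign convention: flowing for the return time and rotating back by `θ` closes the orbit. -/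
lemma exists_angle (x : X) : ∃ θ ∈ Ico 0 (2 * Real.pi), S.act (S.T x) (-θ) x = x := by
  obtain ⟨u, hu⟩ := S.T_mem x
  refine ⟨toIcoMod Real.two_pi_pos 0 (-u), by simpa using toIcoMod_mem_Ico Real.two_pi_pos 0 (-u),
    ?_⟩
  have : -toIcoMod Real.two_pi_pos 0 (-u) =
      u + (toIcoDiv Real.two_pi_pos 0 (-u) : ℤ) * (2 * Real.pi) := by
    rw [toIcoMod]
    simp only [zsmul_eq_mul]
    ring
  rw [this, S.act_int, hu]

/-- Upper semicontinuity of `T`: the map that returns `p` to itself moves nearby points only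
slightly, and `eventually_crossing` turns it into a return of them by a small change of time. -/
lemma eventually_return_near (p : X) {η : ℝ} (hη : 0 < η) :
    ∀ᶠ x in 𝓝 p, ∃ t ∈ S.returns x, |t - S.T p| < η := by
  obtain ⟨θ, -, hθ⟩ := S.exists_angle p
  have h1 := S.eventually_crossing p hη
  have h2 : ContinuousAt (fun x => (x, S.act (S.T p) (-θ) x)) p :=
    continuousAt_id.prodMk (S.act_cont continuous_const continuous_const continuous_id).continuousAt
  have h3 : (p, S.act (S.T p) (-θ) p) = (p, p) := by rw [hθ]
  rw [ContinuousAt, h3] at h2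
  filter_upwards [h2.eventually h1] with x hx
  obtain ⟨t, c, ht, e⟩ := hx (S.F_act _ _ _).symm
  refine ⟨t + S.T p, ⟨c + -θ, ?_⟩, by simpa using ht⟩
  rw [← S.act_act]
  exact e.symm

/-- Lower semicontinuity of `T`. Very short returns are excluded near `p` by
`eventually_not_return`; the others would take place in a compact set of times and rotations, none
of which fixes `p`, so none fixes a nearby point. -/
lemma eventually_lt_T [T2Space X] (p : X) {r : ℝ} (hr : r < S.T p) : ∀ᶠ x in 𝓝 p, r < S.T x := by
  obtain ⟨δ, hδ, h⟩ := S.eventually_not_return p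
  have hK : ∀ᶠ x in 𝓝 p, ∀ q ∈ Icc (δ / 2) r ×ˢ Icc 0 (2 * Real.pi), S.act q.1 q.2 x ≠ x := by
    refine (isCompact_Icc.prod isCompact_Icc).eventually_forall_of_forall_eventually
      fun q hq => ?_
    have hne : S.act q.1 q.2 p ≠ p := fun hq' => by
      have := S.T_le ⟨q.2, hq'⟩ (by linarith [hq.1.1])
      linarith [hq.1.2]
    have hopen : IsOpen {z : X × ℝ × ℝ | S.act z.2.1 z.2.2 z.1 ≠ z.1} := by
      refine isOpen_ne_fun (S.act_cont ?_ ?_ ?_) continuous_fst <;> fun_prop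
    exact hopen.mem_nhds (x := (p, q)) hne
  filter_upwards [h, hK] with x h1 h2
  by_contra h3
  obtain ⟨u, hu⟩ := S.T_mem x
  rcases lt_or_ge (S.T x) δ with h4 | h4
  · exact h1 _ ⟨S.T_pos x, h4⟩ (S.T_mem x)
  · refine h2 (S.T x, toIcoMod Real.two_pi_pos 0 u) ⟨⟨by simp only; linarith, not_lt.1 h3⟩, ?_⟩ ?_
    · have := toIcoMod_mem_Ico Real.two_pi_pos 0 u
      exact ⟨this.1, by simpa using this.2.le⟩
    · have : toIcoMod Real.two_pi_pos 0 u =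
          u + (-toIcoDiv Real.two_pi_pos 0 u : ℤ) * (2 * Real.pi) := by
        rw [toIcoMod]
        simp only [zsmul_eq_mul]
        push_cast
        ring
      simp only
      rw [this, S.act_int, hu]

lemma continuous_T [T2Space X] : Continuous S.T := by
  rw [continuous_iff_continuousAt]
  intro p
  rw [ContinuousAt, tendsto_order]
  refine ⟨fun r hr => S.eventually_lt_T p hr, fun r hr => ?_⟩
  have hη : 0 < min (r - S.T p) (S.T p) := lt_min (by linarith) (S.T_pos p)
  filter_upwards [S.eventually_return_near p hη] with x ⟨t, ht, htη⟩
  rw [abs_lt] at htη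
  have h1 := min_le_left (r - S.T p) (S.T p)
  have h2 := min_le_right (r - S.T p) (S.T p)
  have := S.T_le ht (by linarith)
  linarith

lemma angle_sub {x : X} {a b : ℝ} (ha : S.act (S.T x) (-a) x = x)
    (hb : S.act (S.T x) (-b) x = x) : ∃ n : ℤ, a - b = n * (2 * Real.pi) := by
  refine S.free _ x ?_
  nth_rw 1 [← ha]
  rw [S.act_act]
  convert hb using 2 <;> ring

lemma angle_add {x : X} {a : ℝ} (ha : S.act (S.T x) (-a) x = x) (n : ℤ) :
    S.act (S.T x) (-(a + n * (2 * Real.pi))) x = x := by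
  have : -(a + n * (2 * Real.pi)) = -a + (-n : ℤ) * (2 * Real.pi) := by push_cast; ring
  rw [this, S.act_int, ha]

lemma angle_of_fibre {x y : X} (h : S.F x = S.F y) {a : ℝ} (ha : S.act (S.T x) (-a) x = x) :
    S.act (S.T y) (-a) y = y := by
  rw [← S.T_congr h]
  exact S.act_eq_of_fibre h ha

/-- With the angle `θ` of `p`, a nearby point `x` returns only up to a small rotation, which the
tube coordinate `u` measures continuously. Adding it to `θ` gives the branch. -/
lemma exists_branch [T2Space X] (p : X) :
    ∃ β : X → ℝ, ∀ᶠ x in 𝓝 p, ContinuousAt β x ∧ S.act (S.T x) (-β x) x = x := by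
  obtain ⟨s₀, hs₀⟩ := S.exists_param p
  obtain ⟨V, w, u, n, ε, hT⟩ := S.tube s₀ p hs₀
  obtain ⟨θ, -, hθ⟩ := S.exists_angle p
  let y : X → X := fun x => S.act (S.T x) (-θ) x
  have hy : Continuous y := S.act_cont S.continuous_T continuous_const continuous_id
  have hyp : y p = p := hθ
  have hVy : ∀ᶠ x in 𝓝 p, y x ∈ V :=
    hy.continuousAt.eventually (by rw [hyp]; exact hT.isOpen.mem_nhds hT.mem)
  refine ⟨fun x => θ + (u (y x) - u x), ?_⟩
  filter_upwards [hVy, hT.isOpen.mem_nhds hT.mem] with x h1 h2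
  refine ⟨continuousAt_const.add (ContinuousAt.sub (ContinuousAt.comp (f := y)
    (hT.u_cont.continuousAt (hT.isOpen.mem_nhds h1)) hy.continuousAt)
    (hT.u_cont.continuousAt (hT.isOpen.mem_nhds h2))), ?_⟩
  obtain ⟨a, -, ha⟩ := S.exists_angle x
  have e1 : y x = S.act 0 (a - θ) x := by
    nth_rw 2 [← ha]
    rw [S.act_act]
    simp only [y]
    congr 1 <;> ring
  have e2 : w (y x) = w x := by
    rw [e1] at h1 ⊢
    exact hT.same_orbit x h2 _ h1
  have e3 := hT.same_fibre x h2 (y x) h1 (S.F_act _ _ _).symm e2.symm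
  have e4 : S.act 0 (-(u (y x) - u x)) (y x) = x := by
    nth_rw 2 [e3]
    rw [S.act_act, add_zero, neg_add_cancel, S.act_zero]
  have e5 : S.act 0 (-(u (y x) - u x)) (y x) = S.act (S.T x) (-(θ + (u (y x) - u x))) x := by
    change S.act 0 (-(u (y x) - u x)) (S.act (S.T x) (-θ) x) = _
    rw [S.act_act]
    congr 1 <;> ring
  exact e5.symm.trans e4

omit [CompactSpace X] in
lemma exists_local_section {s₀ : ℝ} {p : X} (h : S.F p = S.Γ s₀) :
    ∃ σ : ℝ → X, σ s₀ = p ∧ ∃ ε > 0, ContinuousOn σ (Ioo (s₀ - ε) (s₀ + ε)) ∧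
      ∀ s ∈ Ioo (s₀ - ε) (s₀ + ε), S.F (σ s) = S.Γ s := by
  obtain ⟨V, w, u, n, ε, hT⟩ := S.tube s₀ p h
  refine ⟨fun s => n s 0, hT.n_centre, ε, hT.pos, ?_, fun s hs =>
    hT.F_n s hs 0 ⟨by linarith [hT.pos], hT.pos⟩⟩
  exact hT.n_cont.comp (f := fun s => (s, (0 : ℝ))) (by fun_prop)
    fun s hs => ⟨hs, by linarith [hT.pos], hT.pos⟩

end TorusSystem


/-! ### The lift of the angle and the transport of the return cycle. -/

namespace TorusSystem

variable {X : Type*} [TopologicalSpace X] (S : TorusSystem X) [CompactSpace X]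

/-- `a` is an angle by which the points over the parameter `s` rotate at their first return. -/
def IsAngle (s a : ℝ) : Prop := ∀ x, S.F x = S.Γ s → S.act (S.T x) (-a) x = x

lemma isAngle_of {s a : ℝ} {x : X} (hx : S.F x = S.Γ s) (h : S.act (S.T x) (-a) x = x) :
    S.IsAngle s a := fun _ hy => S.angle_of_fibre (hx.trans hy.symm) h

variable {S} in
lemma IsAngle.sub {s a b : ℝ} (ha : S.IsAngle s a) (hb : S.IsAngle s b) :
    ∃ n : ℤ, a - b = n * (2 * Real.pi) := by
  obtain ⟨x, hx⟩ := S.exists_fibre s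
  exact S.angle_sub (ha x hx) (hb x hx)

variable {S} in
lemma IsAngle.add {s a : ℝ} (ha : S.IsAngle s a) (n : ℤ) : S.IsAngle s (a + n * (2 * Real.pi)) :=
  fun x hx => S.angle_add (ha x hx) n

variable {S} in
lemma IsAngle.add_one {s a : ℝ} (ha : S.IsAngle (s + 1) a) : S.IsAngle s a :=
  fun x hx => ha x (hx.trans (S.Γ_add_one s).symm)

/-- Continuous branches of the angle differ locally by constants, just as primitives of a form do,
so the continuation lemmas for primitives yield a global lift. -/
lemma localPrimitives_angle : LocalPrimitives
    (fun (β : ℝ → ℝ) s => ∀ᶠ s' in 𝓝 s, ContinuousAt β s' ∧ S.IsAngle s' (β s')) {s | ∃ β : ℝ → ℝ,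
      ∀ᶠ s' in 𝓝 s, ContinuousAt β s' ∧ S.IsAngle s' (β s')} where
  exists_prim s hs := hs
  sub_const {φ ψ x} h1 h2 := by
    have hc : ContinuousWithinAt (fun y => φ y - ψ y) univ x :=
      (h1.self_of_nhds.1.sub h2.self_of_nhds.1).continuousWithinAt
    have := eventually_eq_of_int_mul hc (by
      rw [nhdsWithin_univ]
      filter_upwards [h1, h2] with z e1 e2
      obtain ⟨n, hn⟩ := e1.2.sub e2.2
      obtain ⟨m, hm⟩ := h1.self_of_nhds.2.sub h2.self_of_nhds.2
      exact ⟨n - m, by rw [hn, hm]; push_cast; ring⟩)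
    rwa [nhdsWithin_univ] at this
  eventually h := h.eventually_nhds
  continuousAt h := h.self_of_nhds.1

/-- The rotation angle has a continuous lift, which changes by a multiple of `2π` over a period. -/
lemma exists_lift [T2Space X] : ∃ (Θt : ℝ → ℝ) (k : ℤ), Continuous Θt ∧ (∀ s, S.IsAngle s (Θt s)) ∧
    Θt 0 ∈ Ico 0 (2 * Real.pi) ∧ ∀ s, Θt (s + 1) = Θt s - 2 * Real.pi * k := by
  have hL := S.localPrimitives_angle
  have hex : ∀ s, ∃ β : ℝ → ℝ, ∀ᶠ s' in 𝓝 s, ContinuousAt β s' ∧ S.IsAngle s' (β s') := by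
    intro s
    obtain ⟨p, hp⟩ := S.exists_fibre s
    obtain ⟨σ, hσ, ε, hε, hσc, hFσ⟩ := S.exists_local_section hp
    obtain ⟨β, hβ⟩ := S.exists_branch p
    have hI : Ioo (s - ε) (s + ε) ∈ 𝓝 s := Ioo_mem_nhds (by linarith) (by linarith)
    have hσs : Tendsto σ (𝓝 s) (𝓝 p) := by
      have := hσc.continuousAt hI
      rwa [ContinuousAt, hσ] at this
    refine ⟨fun s => β (σ s), ?_⟩
    filter_upwards [hσs.eventually hβ, hI] with s' h1 h2
    exact ⟨ContinuousAt.comp (f := σ) h1.1 (hσc.continuousAt (isOpen_Ioo.mem_nhds h2)),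
      S.isAngle_of (hFσ s' h2) h1.2⟩
  obtain ⟨f, hf⟩ := hL.exists_primOn_interval (g := id) (J := univ) ordConnected_univ isOpen_univ
    continuousOn_id fun s _ => hex s
  have hfc : Continuous f := by
    rw [← continuousOn_univ]
    exact hf.continuousOn hL continuousOn_id
  obtain ⟨x₀, hx₀⟩ := S.exists_fibre 0
  obtain ⟨θ, hθ, hθ'⟩ := S.exists_angle x₀
  -- `f` is a branch of the angle only up to a constant. The constant is fixed at the parameter `0`,
  -- where the value must lie in `[0, 2π)`; correctness elsewhere follows since it is locally
  -- constant.
  set Θt : ℝ → ℝ := fun s => f s - f 0 + θ with hΘt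
  have hc : Continuous Θt := by fun_prop
  have hcorrect : ∀ s, S.IsAngle s (Θt s) := by
    intro s
    have := eq_of_eventually_eq (A := univ) isPreconnected_univ
      (f := fun s => S.IsAngle s (Θt s)) (x := 0) (y := s) ?_ trivial trivial
    · rw [← this]
      have h0 : Θt 0 = θ := by simp [hΘt]
      rw [h0]
      exact S.isAngle_of hx₀ hθ'
    · intro y _
      obtain ⟨β, hβ, h2⟩ := hf y trivial
      rw [nhdsWithin_univ] at h2 ⊢
      have hβy := hβ.self_of_nhds
      simp only [id] at hβ h2 hβy
      filter_upwards [hβ, h2] with z h3 h4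
      have h5 : Θt z - β z = Θt y - β y := by simp only [hΘt]; linarith
      refine propext ⟨fun h => ?_, fun h => ?_⟩
      · obtain ⟨n, hn⟩ := h.sub h3.2
        have := hβy.2.add n
        rwa [← hn, h5, add_sub_cancel] at this
      · obtain ⟨n, hn⟩ := h.sub hβy.2
        have := h3.2.add n
        rwa [← hn, ← h5, add_sub_cancel] at this
  -- `Θt (s + 1)` and `Θt s` are both lifts over `s`, so they differ by a constant multiple of `2π`,
  -- and `k` is minus this multiple.
  obtain ⟨m, hm⟩ := (hcorrect (0 + 1)).add_one.sub (hcorrect 0)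
  refine ⟨Θt, -m, hc, hcorrect, by simpa [hΘt] using hθ, fun s => ?_⟩
  have h1 : PrimOn (fun (β : ℝ → ℝ) s => ∀ᶠ s' in 𝓝 s, ContinuousAt β s' ∧ S.IsAngle s' (β s'))
      id Θt univ := hL.primOn_comp (g := id) (φ := Θt) fun y _ =>
    Eventually.of_forall fun s => ⟨hc.continuousAt, hcorrect s⟩
  have h2 : PrimOn (fun (β : ℝ → ℝ) s => ∀ᶠ s' in 𝓝 s, ContinuousAt β s' ∧ S.IsAngle s' (β s'))
      id (fun s => Θt (s + 1)) univ := hL.primOn_comp (g := id) (φ := fun s => Θt (s + 1)) fun y _ =>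
    Eventually.of_forall fun s => ⟨(hc.comp (continuous_add_const 1)).continuousAt,
      (hcorrect (s + 1)).add_one⟩
  have := h2.sub_eq_sub hL h1 continuousOn_id isPreconnected_univ (mem_univ s) (mem_univ 0)
  push_cast
  linarith

/-- Local sections are joined by elements of `ℝ²`, which act transitively on the fibre at the
junction. The values over `0` and `1`, which lie in the same fibre, need not agree. -/
lemma exists_section : ∃ σ : ℝ → X, ContinuousOn σ (Icc 0 1) ∧ ∀ s ∈ Icc 0 1, S.F (σ s) = S.Γ s := by
  let E : ℝ → Prop := fun t =>
    ∃ σ : ℝ → X, ContinuousOn σ (Icc 0 t) ∧ ∀ s ∈ Icc 0 t, S.F (σ s) = S.Γ s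
  have hE : ∀ t ∈ Icc (0 : ℝ) 1, ∀ᶠ t' in 𝓝[Icc 0 1] t, E t' = E t := by
    intro t ht
    obtain ⟨p, hp⟩ := S.exists_fibre t
    obtain ⟨τ, -, ε, hε, hτc, hFτ⟩ := S.exists_local_section hp
    have key : ∀ t1 ∈ Ioo (t - ε) (t + ε) ∩ Icc 0 1, ∀ t2 ∈ Ioo (t - ε) (t + ε) ∩ Icc 0 1,
        E t1 → E t2 := by
      rintro t1 ht1 t2 ht2 ⟨σ, hσ, hF⟩
      rcases le_total t2 t1 with h | h
      · exact ⟨σ, hσ.mono (Icc_subset_Icc_right h), fun s hs => hF s ⟨hs.1, hs.2.trans h⟩⟩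
      · obtain ⟨a, b, hab⟩ := S.exists_act_eq (x := τ t1) (y := σ t1)
          (by rw [hFτ t1 ht1.1, hF t1 ⟨ht1.2.1, le_rfl⟩])
        have hsub : Icc t1 t2 ⊆ Ioo (t - ε) (t + ε) := fun s hs =>
          ⟨ht1.1.1.trans_le hs.1, hs.2.trans_lt ht2.1.2⟩
        refine ⟨fun s => if s ≤ t1 then σ s else S.act a b (τ s), ?_, ?_⟩
        · rw [← Icc_union_Icc_eq_Icc ht1.2.1 h]
          refine ContinuousOn.union_of_isClosed ?_ ?_ isClosed_Icc isClosed_Icc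
          · exact hσ.congr fun s hs => if_pos hs.2
          · refine (S.act_contOn (t := fun _ => a) (u := fun _ => b) continuousOn_const
              continuousOn_const (hτc.mono hsub)).congr
              fun s hs => ?_
            simp only
            split_ifs with h'
            · rw [le_antisymm h' hs.1, hab]
            · rfl
        · intro s hs
          simp only
          split_ifs with h'
          · exact hF s ⟨hs.1, h'⟩
          · rw [S.F_act]
            exact hFτ s (hsub ⟨(not_le.1 h').le, hs.2⟩)
    filter_upwards [nhdsWithin_le_nhds (Ioo_mem_nhds (show t - ε < t by linarith)
      (show t < t + ε by linarith)), self_mem_nhdsWithin] with t' h2 h3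
    have htt : t ∈ Ioo (t - ε) (t + ε) ∩ Icc 0 1 := ⟨⟨by linarith, by linarith⟩, ht⟩
    exact propext ⟨key _ ⟨h2, h3⟩ _ htt, key _ htt _ ⟨h2, h3⟩⟩
  have h0 : E 0 := by
    obtain ⟨p, hp⟩ := S.exists_fibre 0
    refine ⟨fun _ => p, continuousOn_const, fun s hs => ?_⟩
    rw [hp, le_antisymm hs.2 hs.1]
  have : E 1 := by
    rw [← eq_of_eventually_eq (f := E) isPreconnected_Icc hE (left_mem_Icc.2 zero_le_one)
      (right_mem_Icc.2 zero_le_one)]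
    exact h0
  exact this

/-- Transport of the cycle generated by the first return once around the path. -/
lemma exists_transport [T2Space X] {Θt : ℝ → ℝ} {k : ℤ} (hc : Continuous Θt)
    (hΘ : ∀ s, S.IsAngle s (Θt s)) (hk : ∀ s, Θt (s + 1) = Θt s - 2 * Real.pi * k) :
    ∃ c : ℝ → ℝ → X,
      ContinuousOn (fun q : ℝ × ℝ => c q.1 q.2) (Set.Icc 0 1 ×ˢ Set.univ) ∧
      (∀ s ∈ Set.Icc (0 : ℝ) 1, ∀ τ, S.F (c s τ) = S.Γ s ∧ c s (τ + 2 * Real.pi) = c s τ) ∧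
      (∃ p, S.F p = S.Γ 0 ∧ ∀ τ, c 0 τ =
        S.act (S.T p * τ / (2 * Real.pi)) (-(Θt 0 * τ / (2 * Real.pi))) p) ∧
      ∃ h : ℝ → ℝ → X,
        ContinuousOn (fun q : ℝ × ℝ => h q.1 q.2) (Set.Icc 0 1 ×ˢ Set.univ) ∧
        (∀ r ∈ Set.Icc (0 : ℝ) 1, ∀ τ, S.F (h r τ) = S.Γ 0 ∧ h r (τ + 2 * Real.pi) = h r τ) ∧
        (∀ τ, h 0 τ = c 1 τ) ∧ ∀ τ, h 1 τ = S.act 0 (k * τ) (c 0 τ) := by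
  obtain ⟨σ, hσ, hFσ⟩ := S.exists_section
  have hpi := Real.two_pi_pos.ne'
  have m0 : (0 : ℝ) ∈ Icc (0 : ℝ) 1 := left_mem_Icc.2 zero_le_one
  have m1 : (1 : ℝ) ∈ Icc (0 : ℝ) 1 := right_mem_Icc.2 zero_le_one
  let c : ℝ → ℝ → X := fun s τ =>
    S.act (S.T (σ s) * τ / (2 * Real.pi)) (-(Θt s * τ / (2 * Real.pi))) (σ s)
  have hper : ∀ s ∈ Icc (0 : ℝ) 1, ∀ τ, c s (τ + 2 * Real.pi) = c s τ := by
    intro s hs τ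
    have h1 := hΘ s (σ s) (hFσ s hs)
    have h2 := S.act_act (S.T (σ s) * τ / (2 * Real.pi)) (-(Θt s * τ / (2 * Real.pi)))
      (S.T (σ s)) (-Θt s) (σ s)
    rw [h1] at h2
    simp only [c]
    rw [h2]
    congr 1 <;> (field_simp; try ring)
  have hΓ1 : S.Γ 1 = S.Γ 0 := by simpa using S.Γ_add_one 0
  have hF01 : S.F (σ 1) = S.F (σ 0) := by rw [hFσ 1 m1, hFσ 0 m0, hΓ1]
  -- The section closes up only after applying some `(a, b)`. Moving the transported curve by `(r a,
  -- r b)` is a homotopy in the fibre. At its end the base points agree, and only the change of `Θt`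
  -- by `2πk` remains, that is, `k` more turns.
  obtain ⟨a, b, hab⟩ := S.exists_act_eq hF01
  have hT01 := S.T_congr hF01
  have hΘ1 : Θt 1 = Θt 0 - 2 * Real.pi * k := by simpa using hk 0
  refine ⟨c, ?_, fun s hs τ => ⟨?_, hper s hs τ⟩, ⟨σ 0, hFσ 0 m0, fun τ => rfl⟩,
    fun r τ => S.act (r * a) (r * b) (c 1 τ), ?_, fun r _ τ => ⟨?_, ?_⟩, fun τ => ?_, fun τ => ?_⟩
  · have hσ' : ContinuousOn (fun q : ℝ × ℝ => σ q.1) (Icc 0 1 ×ˢ univ) :=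
      hσ.comp continuousOn_fst fun q hq => hq.1
    refine S.act_contOn ?_ ?_ hσ'
    · exact ((S.continuous_T.comp_continuousOn hσ').mul continuousOn_snd).div_const _
    · exact (Continuous.continuousOn (by fun_prop))
  · simp only [c]
    rw [S.F_act, hFσ s hs]
  · refine Continuous.continuousOn (S.act_cont (by fun_prop) (by fun_prop) ?_)
    exact S.act_cont (by fun_prop) (by fun_prop) (by fun_prop)
  · simp only [c]
    rw [S.F_act, S.F_act, hFσ 1 m1, hΓ1]
  · simp only
    rw [hper 1 m1]
  · simp [S.act_zero]
  · simp only [c]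
    rw [hab, S.act_act, S.act_act, S.act_act, hΘ1, S.T_act]
    congr 1
    · ring
    · field_simp
      ring

end TorusSystem


/-! ### The integral of a rotation form over the return cycle. -/

namespace TorusSystem

variable {X : Type*} [TopologicalSpace X]

/-- `L` is the system of local primitives of a closed form with set of poles `P` that takes the
value `1` on the generator of the circle action. -/
structure IsRotationPrimitive (S : TorusSystem X) (L : (X → ℝ) → X → Prop) (P : Set X) :
    Prop where
  local_prim : LocalPrimitives L Pᶜ
  isClosed : IsClosed P
  invariant : ∀ u, ∀ x ∈ P, S.act 0 u x ∈ P
  rotate : ∀ {φ : X → ℝ} {x : X}, L φ x → ∀ᶠ u in 𝓝 0, φ (S.act 0 u x) = φ x + u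

variable {S : TorusSystem X} {L : (X → ℝ) → X → Prop} {P : Set X}

namespace IsRotationPrimitive

lemma act_mem_iff (hP : S.IsRotationPrimitive L P) (u : ℝ) (x : X) : S.act 0 u x ∈ P ↔ x ∈ P := by
  refine ⟨fun h => ?_, hP.invariant u x⟩
  have := hP.invariant (-u) _ h
  rw [S.act_act] at this
  simpa [S.act_zero] using this

/-- A primitive along a map extends to a primitive along all its rotations. -/
lemma primOn_rotate (hP : S.IsRotationPrimitive L P) {Y : Type*} [TopologicalSpace Y] {g : Y → X}
    {f : Y → ℝ} {A : Set Y} (h : PrimOn L g f A) (hg : ContinuousOn g A) (hgP : ∀ y ∈ A, g y ∉ P) :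
    PrimOn L (fun z : Y × ℝ => S.act 0 z.2 (g z.1)) (fun z => f z.1 + z.2) (A ×ˢ univ) := by
  -- Along a circle orbit the rotation angle is itself a primitive, because the form takes the value
  -- `1` on the generator.
  refine PrimOn.prod hP.local_prim ordConnected_univ ?_ (t₀ := 0) trivial ?_ ?_
  · exact S.act_contOn continuousOn_const continuousOn_snd
      (hg.comp continuousOn_fst fun z hz => hz.1)
  · simpa [S.act_zero] using h
  · intro y hy u _
    obtain ⟨φ, hφ⟩ := hP.local_prim.exists_prim (S.act 0 u (g y))
      (by rw [mem_compl_iff, hP.act_mem_iff]; exact hgP y hy)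
    refine ⟨φ, hφ, ?_⟩
    rw [nhdsWithin_univ]
    have ht : Tendsto (fun v => v - u) (𝓝 u) (𝓝 0) := by
      have : ContinuousAt (fun v => v - u) u := by fun_prop
      rwa [ContinuousAt, sub_self] at this
    filter_upwards [ht.eventually (hP.rotate hφ)] with v hv
    rw [S.act_act, add_zero, sub_add_cancel] at hv
    rw [hv]
    ring

/-- A primitive along `g` yields one along `act 0 (r y) (g (k y))`. -/
lemma primOn_rotate_comp (hP : S.IsRotationPrimitive L P) {Y Z : Type*} [TopologicalSpace Y]
    [TopologicalSpace Z] {g : Y → X}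
    {f : Y → ℝ} {A : Set Y} (h : PrimOn L g f A) (hg : ContinuousOn g A) (hgP : ∀ y ∈ A, g y ∉ P)
    {k : Z → Y} {r : Z → ℝ} {B : Set Z} (hk : ContinuousOn k B) (hr : ContinuousOn r B)
    (hm : MapsTo k B A) :
    PrimOn L (fun z => S.act 0 (r z) (g (k z))) (fun z => f (k z) + r z) B :=
  (hP.primOn_rotate h hg hgP).comp (k := fun z => (k z, r z)) (hk.prodMk hr)
    fun _ hz => ⟨hm hz, trivial⟩

end IsRotationPrimitive

variable (S P) in
/-- The parameters of the fibres that contain poles. -/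
def polarParams : Set ℝ := {s | ∃ x ∈ P, S.F x = S.Γ s}

lemma polarParams_add_one {s : ℝ} (h : s ∈ S.polarParams P) : s + 1 ∈ S.polarParams P := by
  obtain ⟨x, hx, h⟩ := h
  exact ⟨x, hx, by rw [h, S.Γ_add_one]⟩

lemma not_mem_of_not_polar {s : ℝ} (h : s ∉ S.polarParams P) {x : X} (hx : S.F x = S.Γ s) :
    x ∉ P := fun hxP => h ⟨x, hxP, hx⟩

variable [CompactSpace X]

lemma isClosed_polarParams (hP : IsClosed P) : IsClosed (S.polarParams P) := by
  have : S.polarParams P = S.Γ ⁻¹' (S.F '' P) := by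
    ext s
    exact ⟨fun ⟨x, h1, h2⟩ => ⟨x, h1, h2⟩, fun ⟨x, h1, h2⟩ => ⟨x, h1, h2⟩⟩
  rw [this]
  exact (hP.isCompact.image S.continuous_F).isClosed.preimage S.continuous_Γ

variable (S L) in
/-- `κ` is the integral of the closed form over the cycle generated by the first return at the
parameter `s`. -/
def IsDefect (Θt : ℝ → ℝ) (s κ : ℝ) : Prop :=
  ∀ (x : X) (f : ℝ → ℝ), S.F x = S.Γ s → PrimOn L (fun t => S.act t 0 x) f univ →
    ∀ t, f (t + S.T x) = f t + Θt s + κ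

variable {Θt : ℝ → ℝ}

/-- The absence of poles on the fibre matters: it provides a primitive along an orbit, without which
the condition could be void. -/
lemma IsDefect.unique (hP : S.IsRotationPrimitive L P) {s κ κ' : ℝ} (hs : s ∉ S.polarParams P)
    (h : S.IsDefect L Θt s κ) (h' : S.IsDefect L Θt s κ') : κ = κ' := by
  obtain ⟨x, hx⟩ := S.exists_fibre s
  obtain ⟨f, hf⟩ := hP.local_prim.exists_primOn_interval (g := fun t => S.act t 0 x) (J := univ)
    ordConnected_univ isOpen_univ
    (S.act_cont continuous_id continuous_const continuous_const).continuousOn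
    fun t _ => not_mem_of_not_polar hs ((S.F_act _ _ _).trans hx)
  have h1 := h x f hx hf 0
  have h2 := h' x f hx hf 0
  linarith

/-- The fibres over `s` and `s + 1` coincide; only the lift of the angle differs. -/
lemma IsDefect.add_one {k : ℤ} (hk : ∀ s, Θt (s + 1) = Θt s - 2 * Real.pi * k) {s κ : ℝ}
    (h : S.IsDefect L Θt s κ) : S.IsDefect L Θt (s + 1) (κ + 2 * Real.pi * k) := by
  intro x f hx hf t
  rw [h x f (hx.trans (S.Γ_add_one s)) hf t, hk]
  ring

/-- The defect is constant over a family of fibres without poles. -/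
lemma exists_defect [T2Space X] (hP : S.IsRotationPrimitive L P) (hΘc : Continuous Θt)
    (hΘ : ∀ s, S.IsAngle s (Θt s)) {I : Set ℝ} (hI : IsPreconnected I)
    {σ : ℝ → X} (hσ : ContinuousOn σ I) (hF : ∀ s ∈ I, S.F (σ s) = S.Γ s)
    (hIP : ∀ s ∈ I, s ∉ S.polarParams P) {f : ℝ × ℝ → ℝ}
    (hf : PrimOn L (fun z : ℝ × ℝ => S.act z.2 0 (σ z.1)) f (I ×ˢ univ)) :
    ∃ κ, ∀ s ∈ I, S.IsDefect L Θt s κ ∧ ∀ t, f (s, t + S.T (σ s)) = f (s, t) + Θt s + κ := by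
  rcases I.eq_empty_or_nonempty with rfl | ⟨s₁, hs₁⟩
  · exact ⟨0, fun s hs => hs.elim⟩
  have hσ' : ContinuousOn (fun z : ℝ × ℝ => σ z.1) (I ×ˢ univ) :=
    hσ.comp continuousOn_fst fun z hz => hz.1
  have hg : ContinuousOn (fun z : ℝ × ℝ => S.act z.2 0 (σ z.1)) (I ×ˢ univ) :=
    S.act_contOn continuousOn_snd continuousOn_const hσ'
  have hgP : ∀ z ∈ I ×ˢ (univ : Set ℝ), S.act z.2 0 (σ z.1) ∉ P := fun z hz =>
    not_mem_of_not_polar (hIP z.1 hz.1) ((S.F_act _ _ _).trans (hF z.1 hz.1))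
  -- Flowing for the return time and rotating back by `Θt` is the identity. Transforming `f`
  -- accordingly gives a second primitive along the same map, and its constant difference from `f`
  -- is the defect.
  have h1 := hP.primOn_rotate_comp hf hg hgP (B := I ×ˢ univ)
    (k := fun z : ℝ × ℝ => (z.1, z.2 + S.T (σ z.1))) (r := fun z => -Θt z.1)
    (continuousOn_fst.prodMk (continuousOn_snd.add (S.continuous_T.comp_continuousOn hσ')))
    (by fun_prop) fun z hz => ⟨hz.1, trivial⟩
  have h2 : PrimOn L (fun z : ℝ × ℝ => S.act z.2 0 (σ z.1))
      (fun z => f (z.1, z.2 + S.T (σ z.1)) + -Θt z.1) (I ×ˢ univ) := by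
    refine h1.congr (fun z hz => ?_) fun _ _ => rfl
    have := hΘ z.1 (σ z.1) (hF z.1 hz.1)
    simp only
    rw [S.act_act]
    nth_rw 1 [← this]
    rw [S.act_act]
    congr 1 <;> ring
  have hconst := fun s (hs : s ∈ I) t => h2.sub_eq_sub hP.local_prim hf hg
    (hI.prod isPreconnected_univ) (y := (s, t)) (z := (s₁, 0)) ⟨hs, trivial⟩ ⟨hs₁, trivial⟩
  refine ⟨f (s₁, 0 + S.T (σ s₁)) + -Θt s₁ - f (s₁, 0), fun s hs => ⟨?_, fun t => ?_⟩⟩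
  -- Every other point of the fibre is `act a b (σ s)`; its orbit is that of `σ s` shifted in time
  -- and rotated, which leaves the increment over a return unchanged.
  · intro x f' hx hf' t
    obtain ⟨a, b, rfl⟩ := S.exists_act_eq ((hF s hs).trans hx.symm)
    have hfs : PrimOn L (fun t => S.act t 0 (σ s)) (fun t => f (s, t)) univ :=
      hf.comp (k := fun t : ℝ => (s, t)) (by fun_prop) fun t _ => ⟨hs, trivial⟩
    have h3 := hP.primOn_rotate_comp hfs (B := univ) (k := fun t => t + a) (r := fun _ => b)
      (S.act_cont continuous_id continuous_const continuous_const).continuousOn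
      (fun t _ => hgP (s, t) ⟨hs, trivial⟩) (by fun_prop) (by fun_prop) fun t _ => trivial
    have h4 : PrimOn L (fun t => S.act t 0 (S.act a b (σ s))) (fun t => f (s, t + a) + b) univ := by
      refine h3.congr (fun t _ => ?_) fun _ _ => rfl
      simp only
      rw [S.act_act, S.act_act]
      congr 1 <;> ring
    have h5 := hf'.sub_eq_sub hP.local_prim h4
      (S.act_cont continuous_id continuous_const continuous_const).continuousOn
      isPreconnected_univ (mem_univ t) (mem_univ (t + S.T (S.act a b (σ s))))
    rw [S.T_act] at h5 ⊢
    have h6 := hconst s hs (t + a)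
    have h7 : t + a + S.T (σ s) = t + S.T (σ s) + a := by ring
    simp only at h6
    rw [h7] at h6
    linarith
  · have h6 := hconst s hs t
    simp only at h6
    linarith

end TorusSystem


/-! ### Logarithmic coordinates and winding around a point. -/

section Logarithm

variable {X : Type*} [TopologicalSpace X] {L : (X → ℝ) → X → Prop} {G : Set X}

/-- On a punctured disc there are primitives as functions of the logarithm. -/
lemma LocalPrimitives.exists_log_primitive (hL : LocalPrimitives L G) {m : ℂ → X} {ε : ℝ}
    (hε : 0 < ε) (hm : ContinuousOn m (Metric.ball 0 ε \ {0}))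
    (hG : ∀ z ∈ Metric.ball (0 : ℂ) ε \ {0}, m z ∈ G) :
    ∃ (f : ℝ × ℝ → ℝ) (R : ℝ),
      PrimOn L (fun a : ℝ × ℝ => m (Complex.exp (a.1 + a.2 * Complex.I))) f
        (Iio (Real.log ε) ×ˢ univ) ∧
      ∀ a ∈ Iio (Real.log ε), ∀ b, f (a, b + 2 * Real.pi) = f (a, b) + R := by
  have hmaps : MapsTo (fun a : ℝ × ℝ => Complex.exp (a.1 + a.2 * Complex.I))
      (Iio (Real.log ε) ×ˢ univ) (Metric.ball 0 ε \ {0}) := by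
    intro a ha
    refine ⟨?_, Complex.exp_ne_zero _⟩
    rw [mem_ball_zero_iff, Complex.norm_exp]
    simp only [Complex.add_re, Complex.ofReal_re, Complex.mul_re, Complex.I_re, mul_zero,
      Complex.ofReal_im, Complex.I_im, mul_one, sub_self, add_zero]
    rw [← Real.exp_log hε]
    exact Real.exp_lt_exp.2 ha.1
  have hg : ContinuousOn (fun a : ℝ × ℝ => m (Complex.exp (a.1 + a.2 * Complex.I)))
      (Iio (Real.log ε) ×ˢ univ) :=
    hm.comp (Continuous.continuousOn (by fun_prop)) hmaps
  obtain ⟨f, hf⟩ := hL.exists_primOn_rect ordConnected_Iio isOpen_Iio ordConnected_univ isOpen_univ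
    hg fun a ha => hG _ (hmaps ha)
  -- The exponential has period `2πi`, so the translate of `f` is a primitive along the same map.
  -- Its difference from `f` is the loop integral, which is therefore the same for all radii.
  have h2 : PrimOn L (fun a : ℝ × ℝ => m (Complex.exp (a.1 + a.2 * Complex.I)))
      (fun a => f (a.1, a.2 + 2 * Real.pi)) (Iio (Real.log ε) ×ˢ univ) := by
    refine (hf.comp (k := fun a : ℝ × ℝ => (a.1, a.2 + 2 * Real.pi)) (by fun_prop)
      fun a ha => ⟨ha.1, trivial⟩).congr (fun a _ => ?_) fun _ _ => rfl
    simp only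
    congr 1
    rw [← Complex.exp_periodic (a.1 + a.2 * Complex.I)]
    congr 1
    push_cast
    ring
  set a₀ := Real.log ε - 1
  refine ⟨f, f (a₀, 0 + 2 * Real.pi) - f (a₀, 0), hf, fun a ha b => ?_⟩
  have := h2.sub_eq_sub hL hf hg (isPreconnected_Iio.prod isPreconnected_univ) (y := (a, b))
    (z := (a₀, 0)) ⟨ha, trivial⟩ ⟨by simp [a₀], trivial⟩
  simp only at this
  linarith

/-- Small circles around a point where the derivative preserves the orientation are mapped to
closed curves that wind once around the image. -/
lemma exists_log_lift {q : ℂ → ℂ} {A : ℂ →L[ℝ] ℂ} (hq : HasFDerivAt q A 0) (hq0 : q 0 = 0)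
    (hA : 0 < (A 1).re * (A Complex.I).im - (A Complex.I).re * (A 1).im) :
    ∀ᶠ z in 𝓝[≠] (0 : ℂ), q z ≠ 0 ∧ ∀ a : ℝ, ‖z‖ = Real.exp a →
      (∀ z', ‖z'‖ = ‖z‖ → ContinuousAt q z') → ∃ ℓ : ℝ → ℂ,
        (∀ b : ℝ, Complex.exp (ℓ b) = q (Complex.exp (a + b * Complex.I))) ∧
        (∀ b, ℓ (b + 2 * Real.pi) = ℓ b + 2 * Real.pi * Complex.I) ∧ Continuous ℓ := by
  -- A real-linear map of `ℂ` has the form `α z + β z̄`, with determinant `‖α‖² - ‖β‖²`. Preserving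
  -- orientation thus means `‖β‖ < ‖α‖`, and then `q` stays close enough to `α z` on small circles
  -- to have the same winding number.
  set α : ℂ := (A 1 - Complex.I * A Complex.I) / 2 with hα
  set β : ℂ := (A 1 + Complex.I * A Complex.I) / 2 with hβ
  have hAz : ∀ z, A z = α * z + β * (starRingEnd ℂ) z := by
    intro z
    have h1 : A z = z.re * A 1 + z.im * A Complex.I := by
      have : z = z.re • (1 : ℂ) + z.im • Complex.I := by
        simp [Complex.re_add_im]
      conv_lhs => rw [this, map_add, map_smul, map_smul]
      simp
    have h2 : (starRingEnd ℂ) z = z.re - z.im * Complex.I := by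
      apply Complex.ext <;> simp
    rw [h1, h2]
    conv_rhs => rw [← Complex.re_add_im z]
    simp only [Complex.add_re, Complex.ofReal_re, Complex.mul_re, Complex.I_re, mul_zero,
      Complex.ofReal_im, Complex.I_im, mul_one, sub_self, add_zero, Complex.add_im, Complex.mul_im,
      zero_add, hα, hβ]
    linear_combination ((z.im : ℂ) * A Complex.I) * Complex.I_sq
  have hnorm : ‖β‖ < ‖α‖ := by
    rw [← sq_lt_sq₀ (norm_nonneg _) (norm_nonneg _), Complex.sq_norm, Complex.sq_norm,
      Complex.normSq_apply, Complex.normSq_apply]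
    simp only [hα, hβ, Complex.div_ofNat_re, Complex.div_ofNat_im, Complex.add_re, Complex.sub_re,
      Complex.add_im, Complex.sub_im, Complex.mul_re, Complex.mul_im, Complex.I_re, Complex.I_im]
    nlinarith
  have hα0 : α ≠ 0 := by
    intro h
    rw [h, norm_zero] at hnorm
    linarith [norm_nonneg β]
  have hlittle := hq.isLittleO
  have hη : 0 < (‖α‖ - ‖β‖) / 2 := by linarith
  have hball := hlittle.def hη
  rw [Metric.eventually_nhds_iff] at hball
  obtain ⟨r, hr, hball⟩ := hball
  have hest : ∀ z : ℂ, z ≠ 0 → ‖z‖ < r → ‖q z - α * z‖ < ‖α * z‖ := by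
    intro z hz hzr
    have h1 := hball (y := z) (by simpa using hzr)
    rw [hq0, sub_zero, sub_zero, hAz] at h1
    have h2 : q z - α * z = (q z - (α * z + β * (starRingEnd ℂ) z)) + β * (starRingEnd ℂ) z := by
      ring
    have h3 : 0 < ‖z‖ := norm_pos_iff.2 hz
    calc ‖q z - α * z‖ ≤ (‖α‖ - ‖β‖) / 2 * ‖z‖ + ‖β‖ * ‖z‖ := by
          rw [h2]
          refine (norm_add_le _ _).trans (add_le_add h1 ?_)
          rw [norm_mul, RCLike.norm_conj]
      _ < ‖α * z‖ := by rw [norm_mul]; nlinarith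
  rw [eventually_nhdsWithin_iff]
  filter_upwards [Metric.ball_mem_nhds (0 : ℂ) hr] with z hz hz0
  rw [mem_ball_zero_iff] at hz
  have hne : ∀ z : ℂ, z ≠ 0 → ‖z‖ < r → q z ≠ 0 := by
    intro z hz hzr h
    have := hest z hz hzr
    rw [h, zero_sub, norm_neg] at this
    exact lt_irrefl _ this
  refine ⟨hne z hz0 hz, fun a ha hcont => ?_⟩
  let e : ℝ → ℂ := fun b => Complex.exp (a + b * Complex.I)
  have he : ∀ b, ‖e b‖ = ‖z‖ := by
    intro b
    rw [ha, Complex.norm_exp]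
    simp
  have hec : Continuous e := by simp only [e]; fun_prop
  have he0 : ∀ b, e b ≠ 0 := fun b => Complex.exp_ne_zero _
  have hslit : ∀ b, q (e b) / (α * e b) ∈ Complex.slitPlane := by
    intro b
    have h1 := hest (e b) (he0 b) (by rw [he]; exact hz)
    have hαe : α * e b ≠ 0 := mul_ne_zero hα0 (he0 b)
    have h2 : q (e b) / (α * e b) = 1 + (q (e b) - α * e b) / (α * e b) := by
      rw [sub_div, div_self hαe]
      ring
    rw [h2]
    refine Complex.mem_slitPlane_of_norm_lt_one ?_
    rw [norm_div, div_lt_one (norm_pos_iff.2 hαe)]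
    exact h1
  -- The quotient of `q` by `α e` has distance less than `1` from `1`, where the principal logarithm
  -- is continuous, so it adds no winding. The growth by `2πi` comes from the middle term.
  refine ⟨fun b => Complex.log α + (a + b * Complex.I) + Complex.log (q (e b) / (α * e b)), ?_, ?_,
    ?_⟩
  · intro b
    have h0 : q (e b) ≠ 0 := hne _ (he0 b) (by rw [he]; exact hz)
    rw [Complex.exp_add, Complex.exp_add, Complex.exp_log hα0,
      Complex.exp_log (div_ne_zero h0 (mul_ne_zero hα0 (he0 b)))]
    have : Complex.exp (a + b * Complex.I) = e b := rfl
    rw [this]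
    field_simp [he0 b]
  · intro b
    have : e (b + 2 * Real.pi) = e b := by
      simp only [e]
      rw [← Complex.exp_periodic (a + b * Complex.I)]
      congr 1
      push_cast
      ring
    simp only [this]
    push_cast
    ring
  · refine Continuous.add (by fun_prop) ?_
    rw [continuous_iff_continuousAt]
    intro b
    refine ContinuousAt.clog ?_ (hslit b)
    refine ContinuousAt.div (ContinuousAt.comp (f := e) (hcont _ (he b)) hec.continuousAt) ?_
      (mul_ne_zero hα0 (he0 b))
    exact (continuous_const.mul hec).continuousAt

end Logarithm

/-! ### The polar circle orbits. -/

namespace TorusSystem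

variable {X : Type*} [TopologicalSpace X]

lemma _root_.RotationForms.IsTube.eq_slice {F : X → ℝ × ℝ} {act : ℝ → ℝ → X → X}
    {Γ : ℝ → ℝ × ℝ} {s₀ : ℝ} {p : X} {V : Set X} {w u : X → ℝ} {n : ℝ → ℝ → X} {ε : ℝ}
    (h : IsTube F act Γ s₀ p V w u n ε) {x : X} (hx : x ∈ V) {s : ℝ}
    (hs : s ∈ Ioo (s₀ - ε) (s₀ + ε)) (hF : F x = Γ s) : x = act 0 (u x) (n s (w x)) := by
  have hw : w x ∈ Ioo (-ε) ε := abs_lt.1 (h.w_lt x hx)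
  have := h.same_fibre _ (h.n_mem s hs _ hw) x hx (by rw [h.F_n s hs _ hw, hF]) (h.w_n s hs _ hw)
  rwa [h.u_n s hs _ hw, sub_zero] at this

/-- Around every pole there is a tube that contains no other pole. -/
def HasPoleTubes (S : TorusSystem X) (P : Set X) : Prop :=
  ∀ s₀ p, p ∈ P → S.F p = S.Γ s₀ → ∃ V w u n ε, IsTube S.F S.act S.Γ s₀ p V w u n ε ∧
    ∀ s ∈ Ioo (s₀ - ε) (s₀ + ε), ∀ r ∈ Ioo (-ε) ε, n s r ∈ P → s = s₀ ∧ r = 0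

variable {S : TorusSystem X} {L : (X → ℝ) → X → Prop} {P : Set X}

/-- Since the set of poles is invariant, the slice point of a pole in the tube is again a pole,
hence the centre of the slice. -/
lemma eventually_pole (hP : S.IsRotationPrimitive L P) (hpole : S.HasPoleTubes P) {s₀ : ℝ} {p : X}
    (hp : p ∈ P) (hF : S.F p = S.Γ s₀) : ∀ᶠ z : ℝ × X in 𝓝 (s₀, p), z.2 ∈ P → S.F z.2 = S.Γ z.1 →
      z.1 = s₀ ∧ ∃ c, z.2 = S.act 0 c p := by
  obtain ⟨V, w, u, n, ε, hT, hiso⟩ := hpole s₀ p hp hF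
  have h1 : ∀ᶠ z : ℝ × X in 𝓝 (s₀, p), z.1 ∈ Ioo (s₀ - ε) (s₀ + ε) :=
    (continuous_fst.continuousAt (x := (s₀, p))).eventually
      (Ioo_mem_nhds (by linarith [hT.pos]) (by linarith [hT.pos]))
  have h2 : ∀ᶠ z : ℝ × X in 𝓝 (s₀, p), z.2 ∈ V :=
    (continuous_snd.continuousAt (x := (s₀, p))).eventually (hT.isOpen.mem_nhds hT.mem)
  filter_upwards [h1, h2] with z hz1 hz2 hzP hzF
  have h3 := hT.eq_slice hz2 hz1 hzF
  have h4 : n z.1 (w z.2) ∈ P := by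
    rw [h3, hP.act_mem_iff] at hzP
    exact hzP
  obtain ⟨h5, h6⟩ := hiso _ hz1 _ (abs_lt.1 (hT.w_lt _ hz2)) h4
  refine ⟨h5, u z.2, ?_⟩
  rw [h5, h6, hT.n_centre] at h3
  exact h3

/-- The poles form finitely many circle orbits. -/
lemma exists_poles [CompactSpace X] (hP : S.IsRotationPrimitive L P)
    (hpole : S.HasPoleTubes P) :
    ∃ (N : ℕ) (s : Fin N → ℝ) (p : Fin N → X),
      (∀ i, s i ∈ Ico (0 : ℝ) 1 ∧ p i ∈ P ∧ S.F (p i) = S.Γ (s i)) ∧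
      (∀ i j, s i = s j → (∃ c, p j = S.act 0 c (p i)) → i = j) ∧
      ∀ t ∈ Ico (0 : ℝ) 1, ∀ x ∈ P, S.F x = S.Γ t → ∃ i, s i = t ∧ ∃ c, x = S.act 0 c (p i) := by
  -- Over the closed interval of parameters the poles form a compact set. It is covered by finitely
  -- many neighbourhoods, each of which contains poles of one orbit over one parameter only.
  let K : Set (ℝ × X) := {z | z.1 ∈ Icc 0 1 ∧ z.2 ∈ P ∧ S.F z.2 = S.Γ z.1}
  have hK : IsCompact K := by
    refine (isCompact_Icc (a := (0 : ℝ)) (b := 1)).prod (isCompact_univ (X := X))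
      |>.of_isClosed_subset ?_ fun z hz => ⟨hz.1, trivial⟩
    refine (isClosed_Icc.preimage continuous_fst).inter ((hP.isClosed.preimage continuous_snd).inter
      (isClosed_eq (S.continuous_F.comp continuous_snd) (S.continuous_Γ.comp continuous_fst)))
  obtain ⟨t, htK, ht⟩ := hK.elim_nhds_subcover (fun z => {z' | z'.2 ∈ P → S.F z'.2 = S.Γ z'.1 →
      z'.1 = z.1 ∧ ∃ c, z'.2 = S.act 0 c z.2})
    fun z hz => eventually_pole hP hpole hz.2.1 hz.2.2
  -- Centres over the parameter `1` are discarded, and centres on the same orbit over the same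
  -- parameter are then identified.
  let ι := {z : ℝ × X // z ∈ t ∧ z.1 < 1}
  have : Finite ι := (t.finite_toSet.subset fun z hz => hz.1).to_subtype
  let r : Setoid ι :=
    { r := fun a b => a.1.1 = b.1.1 ∧ ∃ c, b.1.2 = S.act 0 c a.1.2
      iseqv :=
        { refl := fun a => ⟨rfl, 0, (S.act_zero _).symm⟩
          symm := by
            rintro a b ⟨h, c, hc⟩
            refine ⟨h.symm, -c, ?_⟩
            rw [hc, S.act_act]
            simp [S.act_zero]
          trans := by
            rintro a b c ⟨h, x, hx⟩ ⟨h', y, hy⟩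
            refine ⟨h.trans h', y + x, ?_⟩
            rw [hy, hx, S.act_act, add_zero] } }
  obtain ⟨N, ⟨e⟩⟩ := Finite.exists_equiv_fin (Quotient r)
  refine ⟨N, fun i => (e.symm i).out.1.1, fun i => (e.symm i).out.1.2, fun i => ?_, ?_, ?_⟩
  · have h1 := (e.symm i).out.2
    have h2 := htK _ h1.1
    exact ⟨⟨h2.1.1, h1.2⟩, h2.2⟩
  · intro i j h1 h2
    have : (e.symm i).out ≈ (e.symm j).out := ⟨h1, h2⟩
    rw [Quotient.out_equiv_out] at this
    exact e.symm.injective this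
  · intro s hs x hx hF
    have := ht (show (s, x) ∈ K from ⟨⟨hs.1, hs.2.le⟩, hx, hF⟩)
    simp only [mem_iUnion] at this
    obtain ⟨z, hz, hz'⟩ := this
    obtain ⟨h1, c, h2⟩ := hz' hx hF
    simp only at h1 h2
    let a : ι := ⟨z, hz, by rw [← h1]; exact hs.2⟩
    have hout : (Quotient.mk r a).out.1.1 = a.1.1 ∧
        ∃ c, a.1.2 = S.act 0 c (Quotient.mk r a).out.1.2 := @Quotient.mk_out _ r a
    obtain ⟨h3, c', h4⟩ := hout
    refine ⟨e (Quotient.mk r a), ?_, c + c', ?_⟩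
    · beta_reduce
      rw [Equiv.symm_apply_apply]
      rw [h1]
      exact h3
    · beta_reduce
      rw [Equiv.symm_apply_apply, h2]
      have : z.2 = S.act 0 c' (Quotient.mk r a).out.1.2 := h4
      rw [this, S.act_act, add_zero]

end TorusSystem


/-! ### Comparing primitives on the two sides of a polar fibre. -/

/-- The functions `f₁` on the right and `f₂` on the left of the line over `s₀` fit together near
`(s₀, t)` up to the additive constant `c`. -/
def IsOffset (f₁ f₂ : ℝ × ℝ → ℝ) (s₀ t c : ℝ) : Prop :=
  ∃ f : ℝ × ℝ → ℝ, ∀ᶠ z in 𝓝 (s₀, t), ContinuousAt f z ∧ (s₀ < z.1 → f₁ z = f z + c) ∧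
    (z.1 < s₀ → f₂ z = f z)

/-- The difference of the two continuous gluing functions is `c' - c` on the right of `s₀` and `0`
on the left; continuity at `s₀` equates these constants. -/
lemma IsOffset.unique {f₁ f₂ : ℝ × ℝ → ℝ} {s₀ t c c' : ℝ} (h : IsOffset f₁ f₂ s₀ t c)
    (h' : IsOffset f₁ f₂ s₀ t c') : c = c' := by
  obtain ⟨f, hf⟩ := h
  obtain ⟨f', hf'⟩ := h'
  have hc : ContinuousAt (fun s => f (s, t) - f' (s, t)) s₀ :=
    (ContinuousAt.comp (f := fun s => (s, t)) hf.self_of_nhds.1 (by fun_prop)).sub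
      (ContinuousAt.comp (f := fun s => (s, t)) hf'.self_of_nhds.1 (by fun_prop))
  have ht : Tendsto (fun s : ℝ => (s, t)) (𝓝 s₀) (𝓝 (s₀, t)) :=
    Continuous.tendsto (by fun_prop) s₀
  have h1 : (fun s => f (s, t) - f' (s, t)) =ᶠ[𝓝[>] s₀] fun _ => c' - c := by
    filter_upwards [nhdsWithin_le_nhds (ht.eventually hf), nhdsWithin_le_nhds (ht.eventually hf'),
      self_mem_nhdsWithin] with s e1 e2 e3
    have := e1.2.1 e3
    have := e2.2.1 e3
    linarith
  have h2 : (fun s => f (s, t) - f' (s, t)) =ᶠ[𝓝[<] s₀] fun _ => 0 := by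
    filter_upwards [nhdsWithin_le_nhds (ht.eventually hf), nhdsWithin_le_nhds (ht.eventually hf'),
      self_mem_nhdsWithin] with s e1 e2 e3
    have := e1.2.2 e3
    have := e2.2.2 e3
    linarith
  have e1 := tendsto_nhds_unique ((hc.tendsto.mono_left nhdsWithin_le_nhds).congr' h1)
    tendsto_const_nhds
  have e2 := tendsto_nhds_unique ((hc.tendsto.mono_left nhdsWithin_le_nhds).congr' h2)
    tendsto_const_nhds
  linarith

lemma IsOffset.eventually {f₁ f₂ : ℝ × ℝ → ℝ} {s₀ t c : ℝ} (h : IsOffset f₁ f₂ s₀ t c) :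
    ∀ᶠ t' in 𝓝 t, IsOffset f₁ f₂ s₀ t' c := by
  obtain ⟨f, hf⟩ := h
  have ht : Tendsto (fun t' : ℝ => (s₀, t')) (𝓝 t) (𝓝 (s₀, t)) :=
    Continuous.tendsto (by fun_prop) t
  filter_upwards [ht.eventually hf.eventually_nhds] with t' h
  exact ⟨f, h⟩

namespace TorusSystem

variable {X : Type*} [TopologicalSpace X] {S : TorusSystem X} {L : (X → ℝ) → X → Prop} {P : Set X}

/-- The loop integral around a pole in a punctured slice is an additive constant of a primitive in
logarithmic coordinates. -/
def IsResidue (L : (X → ℝ) → X → Prop) (s₀ : ℝ) (n : ℝ → ℝ → X) (ε : ℝ) (f : ℝ × ℝ → ℝ) (R : ℝ) :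
    Prop :=
  PrimOn L (fun a : ℝ × ℝ => n (s₀ + (Complex.exp (a.1 + a.2 * Complex.I)).re)
      (Complex.exp (a.1 + a.2 * Complex.I)).im) f (Iio (Real.log ε) ×ˢ univ) ∧
    ∀ a ∈ Iio (Real.log ε), ∀ b, f (a, b + 2 * Real.pi) = f (a, b) + R

lemma mem_box_of_norm_lt {s₀ ε : ℝ} {z : ℂ} (hz : ‖z‖ < ε) :
    s₀ + z.re ∈ Ioo (s₀ - ε) (s₀ + ε) ∧ z.im ∈ Ioo (-ε) ε := by
  have h1 := abs_lt.1 ((Complex.abs_re_le_norm z).trans_lt hz)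
  have h2 := abs_lt.1 ((Complex.abs_im_le_norm z).trans_lt hz)
  exact ⟨⟨by linarith [h1.1], by linarith [h1.2]⟩, h2⟩

variable {s₀ : ℝ} {p : X} {V : Set X} {w u : X → ℝ} {n : ℝ → ℝ → X} {ε : ℝ}

lemma slice_continuousOn (hT : IsTube S.F S.act S.Γ s₀ p V w u n ε) :
    ContinuousOn (fun z : ℂ => n (s₀ + z.re) z.im) (Metric.ball 0 ε) := by
  refine hT.n_cont.comp (f := fun z : ℂ => (s₀ + z.re, z.im)) ?_ fun z hz => ?_
  · exact ((continuous_const.add Complex.continuous_re).prodMk Complex.continuous_im).continuousOn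
  · rw [mem_ball_zero_iff] at hz
    exact mem_box_of_norm_lt hz

lemma slice_not_mem (hiso : ∀ s ∈ Ioo (s₀ - ε) (s₀ + ε), ∀ r ∈ Ioo (-ε) ε, n s r ∈ P →
    s = s₀ ∧ r = 0) : ∀ z ∈ Metric.ball (0 : ℂ) ε \ {0}, n (s₀ + z.re) z.im ∈ Pᶜ := by
  intro z hz h
  have hz1 := hz.1
  rw [mem_ball_zero_iff] at hz1
  obtain ⟨h1, h2⟩ := mem_box_of_norm_lt (s₀ := s₀) hz1
  obtain ⟨h3, h4⟩ := hiso _ h1 _ h2 h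
  exact hz.2 (Complex.ext (by simpa using h3) h4)

lemma exists_residue (hP : S.IsRotationPrimitive L P)
    (hT : IsTube S.F S.act S.Γ s₀ p V w u n ε)
    (hiso : ∀ s ∈ Ioo (s₀ - ε) (s₀ + ε), ∀ r ∈ Ioo (-ε) ε, n s r ∈ P → s = s₀ ∧ r = 0) :
    ∃ f R, IsResidue L s₀ n ε f R :=
  hP.local_prim.exists_log_primitive hT.pos ((slice_continuousOn hT).mono sdiff_subset)
    (slice_not_mem hiso)

/-- The values of the offset on both sides of a pole differ by its residue. -/
lemma offset_jump (hP : S.IsRotationPrimitive L P)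
    (hT : IsTube S.F S.act S.Γ s₀ p V w u n ε)
    (hiso : ∀ s ∈ Ioo (s₀ - ε) (s₀ + ε), ∀ r ∈ Ioo (-ε) ε, n s r ∈ P → s = s₀ ∧ r = 0)
    {f : ℝ × ℝ → ℝ} {R : ℝ} (hR : IsResidue L s₀ n ε f R) {σ : ℝ → X} {ε' : ℝ} (hε' : 0 < ε')
    (hσ : ContinuousOn σ (Ioo (s₀ - ε') (s₀ + ε')))
    (hFσ : ∀ s ∈ Ioo (s₀ - ε') (s₀ + ε'), S.F (σ s) = S.Γ s) {f₁ f₂ : ℝ × ℝ → ℝ}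
    (hf₁ : PrimOn L (fun z : ℝ × ℝ => S.act z.2 0 (σ z.1)) f₁ (Ioo s₀ (s₀ + ε') ×ˢ univ))
    (hf₂ : PrimOn L (fun z : ℝ × ℝ => S.act z.2 0 (σ z.1)) f₂ (Ioo (s₀ - ε') s₀ ×ˢ univ))
    {t₁ c : ℝ} (ht₁ : S.act t₁ 0 (σ s₀) = S.act 0 c p) :
    ∃ C, (∀ᶠ t in 𝓝[<] t₁, IsOffset f₁ f₂ s₀ t C) ∧
      ∀ᶠ t in 𝓝[>] t₁, IsOffset f₁ f₂ s₀ t (C + R) := by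
  set m : ℂ → X := fun z => n (s₀ + z.re) z.im with hm
  set g : ℝ × ℝ → X := fun z => S.act z.2 0 (σ z.1) with hgdef
  set x : ℝ × ℝ → X := fun z => S.act 0 (-c) (g z) with hx
  -- The complex coordinate of a point in the slice: the real part is the parameter relative to
  -- `s₀`, the imaginary part the level `w`, which increases with time. The rotation by `-c` in `x`
  -- moves the crossing to `p`.
  set ζ : ℝ × ℝ → ℂ := fun z => ((z.1 - s₀ : ℝ) : ℂ) + (w (x z) : ℝ) * Complex.I with hζ
  have hs₀ : s₀ ∈ Ioo (s₀ - ε') (s₀ + ε') := ⟨by linarith, by linarith⟩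
  have hgc : ContinuousOn g (Ioo (s₀ - ε') (s₀ + ε') ×ˢ univ) :=
    S.act_contOn continuousOn_snd continuousOn_const (hσ.comp continuousOn_fst fun z hz => hz.1)
  have hxc : ContinuousOn x (Ioo (s₀ - ε') (s₀ + ε') ×ˢ univ) :=
    S.act_contOn continuousOn_const continuousOn_const hgc
  have hopen : IsOpen (Ioo (s₀ - ε') (s₀ + ε') ×ˢ (univ : Set ℝ)) := isOpen_Ioo.prod isOpen_univ
  have hxp : ∀ t, x (s₀, t) = S.act (t - t₁) 0 p := by
    intro t
    have h1 : g (s₀, t) = S.act (t - t₁) 0 (S.act t₁ 0 (σ s₀)) := by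
      simp only [hgdef]
      rw [S.act_act]
      simp
    simp only [hx]
    rw [h1, ht₁, S.act_act, S.act_act]
    congr 1 <;> ring
  have hxp₁ : x (s₀, t₁) = p := by rw [hxp, sub_self, S.act_zero]
  have hxat : ContinuousAt x (s₀, t₁) := hxc.continuousAt (hopen.mem_nhds ⟨hs₀, trivial⟩)
  have hVx : ∀ᶠ z in 𝓝 (s₀, t₁), x z ∈ V :=
    hxat.eventually (by rw [hxp₁]; exact hT.isOpen.mem_nhds hT.mem)
  have hwx : ContinuousAt (fun z => w (x z)) (s₀, t₁) :=
    ContinuousAt.comp (f := x)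
      (hT.w_cont.continuousAt (by rw [hxp₁]; exact hT.isOpen.mem_nhds hT.mem)) hxat
  have hζat : ContinuousAt ζ (s₀, t₁) := by
    refine ContinuousAt.add ?_ (ContinuousAt.mul ?_ continuousAt_const)
    · exact Complex.continuous_ofReal.continuousAt.comp (by fun_prop)
    · exact Complex.continuous_ofReal.continuousAt.comp hwx
  have hζ0 : ζ (s₀, t₁) = 0 := by simp [hζ, hxp₁, hT.w_zero]
  have hζball : ∀ᶠ z in 𝓝 (s₀, t₁), ζ z ∈ Metric.ball (0 : ℂ) ε :=
    hζat.eventually (by rw [hζ0]; exact Metric.ball_mem_nhds _ hT.pos)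
  have hbox : ∀ᶠ z : ℝ × ℝ in 𝓝 (s₀, t₁), z.1 ∈ Ioo (s₀ - ε') (s₀ + ε') :=
    (continuous_fst.continuousAt (x := (s₀, t₁))).eventually (isOpen_Ioo.mem_nhds hs₀)
  obtain ⟨δ, hδ, hall⟩ := Metric.eventually_nhds_iff_ball.1 (hVx.and (hζball.and hbox))
  set B : Set (ℝ × ℝ) := Ioo (s₀ - δ) (s₀ + δ) ×ˢ Ioo (t₁ - δ) (t₁ + δ) with hB
  have hBball : ∀ z ∈ B, z ∈ Metric.ball (s₀, t₁) δ := by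
    intro z hz
    rw [← ball_prod_same, Real.ball_eq_Ioo, Real.ball_eq_Ioo]
    exact hz
  have hBo : IsOpen B := isOpen_Ioo.prod isOpen_Ioo
  have hBsub : B ⊆ Ioo (s₀ - ε') (s₀ + ε') ×ˢ univ := fun z hz =>
    ⟨(hall z (hBball z hz)).2.2, trivial⟩
  have hxB : ContinuousOn x B := hxc.mono hBsub
  have hwB : ContinuousOn (fun z => w (x z)) B :=
    hT.w_cont.comp hxB fun z hz => (hall z (hBball z hz)).1
  have huB : ContinuousOn (fun z => u (x z)) B :=
    hT.u_cont.comp hxB fun z hz => (hall z (hBball z hz)).1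
  have hζB : ContinuousOn ζ B := by
    refine ContinuousOn.add ?_ (ContinuousOn.mul ?_ continuousOn_const)
    · exact Complex.continuous_ofReal.comp_continuousOn (by fun_prop)
    · exact Complex.continuous_ofReal.comp_continuousOn hwB
  have hζre : ∀ z, (ζ z).re = z.1 - s₀ := fun z => by simp [hζ]
  have hζim : ∀ z, (ζ z).im = w (x z) := fun z => by simp [hζ]
  -- Near the crossing each point is a rotation of its slice point, so a primitive along the
  -- punctured slice becomes one along `g` once the angle of rotation is added.
  have hgm : ∀ z ∈ B, g z = S.act 0 (c + u (x z)) (m (ζ z)) := by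
    intro z hz
    have hz1 := hall z (hBball z hz)
    have hb := mem_box_of_norm_lt (s₀ := s₀) (mem_ball_zero_iff.1 hz1.2.1)
    have hs : s₀ + (ζ z).re = z.1 := by rw [hζre]; ring
    have h1 : x z = S.act 0 (u (x z)) (m (ζ z)) := by
      simp only [hm, hζim, hs]
      rw [hs] at hb
      refine hT.eq_slice hz1.1 hb.1 ?_
      simp only [hx, hgdef]
      rw [S.F_act, S.F_act, hFσ _ hz1.2.2]
    have h2 : g z = S.act 0 c (x z) := by
      simp only [hx]
      rw [S.act_act]
      simp [S.act_zero]
    rw [h2]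
    nth_rw 1 [h1]
    rw [S.act_act, add_zero]
  have hmc := slice_continuousOn hT
  have hmP := slice_not_mem hiso
  -- the two branches of the primitive on slit discs
  have hbranch : ∀ (a : ℂ → ℝ) (D : Set ℂ), ContinuousOn a D → (0 : ℂ) ∉ D →
      (∀ z ∈ D, (Real.exp (Real.log ‖z‖) : ℂ) * Complex.exp (a z * Complex.I) = z) →
      PrimOn L g (fun z => f (Real.log ‖ζ z‖, a (ζ z)) + (c + u (x z))) (B ∩ ζ ⁻¹' D) := by
    intro a D ha hD0 haz
    have h1 : PrimOn L m (fun z => f (Real.log ‖z‖, a z)) (D ∩ Metric.ball 0 ε) := by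
      refine (hR.1.comp (k := fun z : ℂ => (Real.log ‖z‖, a z)) (C := D ∩ Metric.ball 0 ε) ?_
        ?_).congr (fun z hz => ?_) fun _ _ => rfl
      · refine ContinuousOn.prodMk (ContinuousOn.log continuous_norm.continuousOn ?_)
          (ha.mono inter_subset_left)
        rintro z hz h
        exact hD0 (norm_eq_zero.1 h ▸ hz.1)
      · intro z hz
        refine ⟨?_, trivial⟩
        have hz0 : 0 < ‖z‖ := norm_pos_iff.2 fun h => hD0 (h ▸ hz.1)
        exact Real.log_lt_log hz0 (mem_ball_zero_iff.1 hz.2)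
      · simp only [hm]
        rw [Complex.exp_add, ← Complex.ofReal_exp, haz z hz.1]
    refine (hP.primOn_rotate_comp h1 (hmc.mono inter_subset_right)
      (fun z hz => hmP z ⟨hz.2, fun h => hD0 (h ▸ hz.1)⟩) (k := ζ) (r := fun z => c + u (x z))
      (B := B ∩ ζ ⁻¹' D) (hζB.mono inter_subset_left)
      ((continuousOn_const.add huB).mono inter_subset_left) ?_).congr
      (fun z hz => hgm z hz.1) fun _ _ => rfl
    exact fun z hz => ⟨hz.2, (hall z (hBball z hz.1)).2.1⟩
  -- Two branches of the argument are needed: `a₁` in `(-π, π)` covers the right side `s > s₀`, and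
  -- `a₂` in `(0, 2π)` covers the left side. They agree in the upper half plane and differ by `2π`,
  -- hence `f` by `R`, in the lower one.
  set D₁ : Set ℂ := Complex.slitPlane with hD₁
  set D₂ : Set ℂ := {z | -z ∈ Complex.slitPlane} with hD₂
  set a₁ : ℂ → ℝ := Complex.arg with ha₁
  set a₂ : ℂ → ℝ := fun z => Complex.arg (-z) + Real.pi with ha₂
  set F₁ : ℝ × ℝ → ℝ := fun z => f (Real.log ‖ζ z‖, a₁ (ζ z)) + (c + u (x z)) with hF₁
  set F₂ : ℝ × ℝ → ℝ := fun z => f (Real.log ‖ζ z‖, a₂ (ζ z)) + (c + u (x z)) with hF₂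
  have h1 : PrimOn L g F₁ (B ∩ ζ ⁻¹' D₁) := by
    refine hbranch a₁ D₁ (fun z hz => (Complex.continuousAt_arg hz).continuousWithinAt)
      (by simp [hD₁, Complex.mem_slitPlane_iff]) fun z hz => ?_
    have hz0 : z ≠ 0 := fun h => by rw [h] at hz; simp [hD₁, Complex.mem_slitPlane_iff] at hz
    rw [Real.exp_log (norm_pos_iff.2 hz0)]
    exact Complex.norm_mul_exp_arg_mul_I z
  have h2 : PrimOn L g F₂ (B ∩ ζ ⁻¹' D₂) := by
    refine hbranch a₂ D₂ (fun z hz => ContinuousAt.continuousWithinAt ?_)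
      (by simp [hD₂, Complex.mem_slitPlane_iff]) fun z hz => ?_
    · exact (ContinuousAt.comp (f := fun z : ℂ => -z) (Complex.continuousAt_arg hz)
        (by fun_prop)).add continuousAt_const
    have hz0 : z ≠ 0 := fun h => by rw [h] at hz; simp [hD₂, Complex.mem_slitPlane_iff] at hz
    rw [Real.exp_log (norm_pos_iff.2 hz0)]
    simp only [ha₂]
    have := Complex.norm_mul_exp_arg_mul_I (-z)
    rw [norm_neg] at this
    push_cast
    rw [add_mul, Complex.exp_add, Complex.exp_pi_mul_I]
    linear_combination -this
  have hcomp1 : ∃ C₁, ∀ z ∈ B, s₀ < z.1 → f₁ z = F₁ z + C₁ := by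
    have hsub : Ioo s₀ (s₀ + δ) ×ˢ Ioo (t₁ - δ) (t₁ + δ) ⊆ B ∩ ζ ⁻¹' D₁ := by
      intro z hz
      refine ⟨⟨⟨by linarith [hz.1.1], hz.1.2⟩, hz.2⟩, Or.inl ?_⟩
      rw [hζre]
      linarith [hz.1.1]
    have hsub' : Ioo s₀ (s₀ + δ) ×ˢ Ioo (t₁ - δ) (t₁ + δ) ⊆ Ioo s₀ (s₀ + ε') ×ˢ univ := fun z hz =>
      ⟨⟨hz.1.1, (hBsub (hsub hz).1).1.2⟩, trivial⟩
    refine ⟨f₁ (s₀ + δ / 2, t₁) - F₁ (s₀ + δ / 2, t₁), fun z hz hzs => ?_⟩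
    have := (hf₁.mono hsub').sub_eq_sub hP.local_prim (h1.mono hsub)
      (hgc.mono fun z hz => hBsub (hsub hz).1) (isPreconnected_Ioo.prod isPreconnected_Ioo)
      (y := z) (z := (s₀ + δ / 2, t₁)) ⟨⟨hzs, hz.1.2⟩, hz.2⟩
      ⟨⟨by simp only; linarith, by simp only; linarith⟩, by simp only; linarith, by
        simp only; linarith⟩
    linarith
  have hcomp2 : ∃ C₂, ∀ z ∈ B, z.1 < s₀ → f₂ z = F₂ z + C₂ := by
    have hsub : Ioo (s₀ - δ) s₀ ×ˢ Ioo (t₁ - δ) (t₁ + δ) ⊆ B ∩ ζ ⁻¹' D₂ := by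
      intro z hz
      refine ⟨⟨⟨hz.1.1, by linarith [hz.1.2]⟩, hz.2⟩, Or.inl ?_⟩
      rw [Complex.neg_re, hζre]
      linarith [hz.1.2]
    have hsub' : Ioo (s₀ - δ) s₀ ×ˢ Ioo (t₁ - δ) (t₁ + δ) ⊆ Ioo (s₀ - ε') s₀ ×ˢ univ := fun z hz =>
      ⟨⟨(hBsub (hsub hz).1).1.1, hz.1.2⟩, trivial⟩
    refine ⟨f₂ (s₀ - δ / 2, t₁) - F₂ (s₀ - δ / 2, t₁), fun z hz hzs => ?_⟩
    have := (hf₂.mono hsub').sub_eq_sub hP.local_prim (h2.mono hsub)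
      (hgc.mono fun z hz => hBsub (hsub hz).1) (isPreconnected_Ioo.prod isPreconnected_Ioo)
      (y := z) (z := (s₀ - δ / 2, t₁)) ⟨⟨hz.1.1, hzs⟩, hz.2⟩
      ⟨⟨by simp only; linarith, by simp only; linarith⟩, by simp only; linarith, by
        simp only; linarith⟩
    linarith
  obtain ⟨C₁, hC₁⟩ := hcomp1
  obtain ⟨C₂, hC₂⟩ := hcomp2
  have hup : ∀ z ∈ B, 0 < (ζ z).im → F₂ z = F₁ z := by
    intro z _ hz
    simp only [hF₁, hF₂, ha₁, ha₂]
    rw [Complex.arg_neg_eq_arg_sub_pi_of_im_pos hz, sub_add_cancel]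
  have hdown : ∀ z ∈ B, (ζ z).im < 0 → F₂ z = F₁ z + R := by
    intro z hzB hz
    have hlog : Real.log ‖ζ z‖ ∈ Iio (Real.log ε) := by
      have hz0 : 0 < ‖ζ z‖ := norm_pos_iff.2 fun h => by rw [h] at hz; simp at hz
      exact Real.log_lt_log hz0 (mem_ball_zero_iff.1 (hall z (hBball z hzB)).2.1)
    have := hR.2 _ hlog (Complex.arg (ζ z))
    simp only [hF₁, hF₂, ha₁, ha₂]
    rw [Complex.arg_neg_eq_arg_add_pi_of_im_neg hz, add_assoc, ← two_mul, this]
    ring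
  have hF₁c : ∀ z ∈ B, (ζ z).im ≠ 0 → ContinuousAt F₁ z := by
    intro z hz hzi
    refine (h1.continuousOn hP.local_prim (hgc.mono fun z hz => hBsub hz.1)).continuousAt ?_
    exact (hζB.isOpen_inter_preimage hBo Complex.isOpen_slitPlane).mem_nhds ⟨hz, Or.inr hzi⟩
  have himc : ∀ t ∈ Ioo (t₁ - δ) (t₁ + δ), ContinuousAt (fun z => (ζ z).im) (s₀, t) := by
    intro t ht
    refine ContinuousOn.continuousAt (s := B) ?_ (hBo.mem_nhds ⟨⟨by linarith, by linarith⟩, ht⟩)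
    exact Complex.continuous_im.comp_continuousOn hζB
  have hmemB : ∀ t ∈ Ioo (t₁ - δ) (t₁ + δ), (s₀, t) ∈ B := fun t ht =>
    ⟨⟨by simp only; linarith, by simp only; linarith⟩, ht⟩
  obtain ⟨δ', hδ', hmono⟩ := hT.mono
  have hmono' := hmono.self_of_nhds.2
  -- Before the crossing time `ζ` lies in the lower half plane, where `F₂ = F₁ + R`; after it in the
  -- upper one, where `F₂ = F₁`.
  refine ⟨C₁ - C₂ - R, ?_, ?_⟩
  · filter_upwards [Ioo_mem_nhdsLT (show t₁ - min δ δ' < t₁ by linarith [lt_min hδ hδ'])] with t ht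
    have htδ : t ∈ Ioo (t₁ - δ) (t₁ + δ) :=
      ⟨by linarith [ht.1, min_le_left δ δ'], by linarith [ht.2]⟩
    have hneg : (ζ (s₀, t)).im < 0 := by
      rw [hζim, hxp]
      have := hmono' (a := t - t₁) (b := 0) ⟨by linarith [ht.1, min_le_right δ δ'], by
        linarith [ht.2]⟩ ⟨by linarith, hδ'⟩ (by linarith [ht.2])
      simpa [S.act_zero, hT.w_zero] using this
    refine ⟨fun z => F₁ z + (R + C₂), ?_⟩
    filter_upwards [hBo.mem_nhds (hmemB t htδ), (himc t htδ).eventually (gt_mem_nhds hneg)]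
      with z hz hzi
    refine ⟨(hF₁c z hz hzi.ne).add continuousAt_const, fun h => ?_, fun h => ?_⟩
    · rw [hC₁ z hz h]; ring
    · rw [hC₂ z hz h, hdown z hz hzi]; ring
  · filter_upwards [Ioo_mem_nhdsGT (show t₁ < t₁ + min δ δ' by linarith [lt_min hδ hδ'])] with t ht
    have htδ : t ∈ Ioo (t₁ - δ) (t₁ + δ) :=
      ⟨by linarith [ht.1], by linarith [ht.2, min_le_left δ δ']⟩
    have hpos : 0 < (ζ (s₀, t)).im := by
      rw [hζim, hxp]
      have := hmono' (a := 0) (b := t - t₁) ⟨by linarith, hδ'⟩ ⟨by linarith [ht.1], by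
        linarith [ht.2, min_le_right δ δ']⟩ (by linarith [ht.1])
      simpa [S.act_zero, hT.w_zero] using this
    refine ⟨fun z => F₁ z + C₂, ?_⟩
    filter_upwards [hBo.mem_nhds (hmemB t htδ), (himc t htδ).eventually (lt_mem_nhds hpos)]
      with z hz hzi
    refine ⟨(hF₁c z hz hzi.ne').add continuousAt_const, fun h => ?_, fun h => ?_⟩
    · rw [hC₁ z hz h]; ring
    · rw [hC₂ z hz h, hup z hz hzi]

end TorusSystem


/-! ### Discs crossing a polar orbit. -/

namespace TorusSystem

variable {X : Type*} [TopologicalSpace X] {S : TorusSystem X} {L : (X → ℝ) → X → Prop} {P : Set X}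
  {s₀ : ℝ} {p : X} {V : Set X} {w u : X → ℝ} {n : ℝ → ℝ → X} {ε : ℝ}

/-- The integral over the boundary of a disc that crosses a polar orbit positively at its centre
and has no other pole is the residue. -/
lemma disc_residue (hP : S.IsRotationPrimitive L P)
    (hT : IsTube S.F S.act S.Γ s₀ p V w u n ε)
    (hiso : ∀ s ∈ Ioo (s₀ - ε) (s₀ + ε), ∀ r ∈ Ioo (-ε) ε, n s r ∈ P → s = s₀ ∧ r = 0)
    {f : ℝ × ℝ → ℝ} {R : ℝ} (hR : IsResidue L s₀ n ε f R) {D : ℂ → X} {Sg : ℂ → ℝ} {c : ℝ}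
    (hD : ContinuousOn D (Metric.closedBall 0 1)) (hS : ContinuousOn Sg (Metric.closedBall 0 1))
    (hF : ∀ z ∈ Metric.closedBall (0 : ℂ) 1, S.F (D z) = S.Γ (Sg z)) (hS0 : Sg 0 = s₀)
    (hD0 : D 0 = S.act 0 c p) (hDP : ∀ z ∈ Metric.closedBall (0 : ℂ) 1, z ≠ 0 → D z ∉ P)
    {A : ℂ →L[ℝ] ℂ} (hA : HasFDerivAt (fun z => ((Sg z - s₀ : ℝ) : ℂ) +
      (w (S.act 0 (-c) (D z)) : ℝ) * Complex.I) A 0)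
    (hdet : 0 < (A 1).re * (A Complex.I).im - (A Complex.I).re * (A 1).im) {φ : ℝ → ℝ}
    (hφ : PrimOn L (fun τ : ℝ => D (Complex.exp (τ * Complex.I))) φ univ) :
    φ (2 * Real.pi) - φ 0 = R := by
  -- Only the values of `D` on the closed unit disc are controlled. The radial retraction extends
  -- the disc to a ball of radius `2`, so that the boundary circle, of logarithmic radius `0 < log
  -- 2`, lies inside the domain of the primitive.
  set cl : ℂ → ℂ := fun z => ((max 1 ‖z‖)⁻¹ : ℝ) • z with hcl
  have hclc : Continuous cl := by
    have h1 : Continuous fun z : ℂ => max 1 ‖z‖ := continuous_const.max continuous_norm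
    refine Continuous.smul (h1.inv₀ fun z => ?_) continuous_id
    have := le_max_left 1 ‖z‖
    linarith
  have hclm : ∀ z, cl z ∈ Metric.closedBall (0 : ℂ) 1 := by
    intro z
    have h1 := le_max_left 1 ‖z‖
    rw [mem_closedBall_zero_iff, hcl, norm_smul, norm_inv, Real.norm_of_nonneg (by linarith),
      inv_mul_le_one₀ (by linarith)]
    exact le_max_right _ _
  have hcl1 : ∀ z, ‖z‖ ≤ 1 → cl z = z := by
    intro z hz
    simp [hcl, max_eq_left hz]
  have hcl0 : ∀ z, z ≠ 0 → cl z ≠ 0 := by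
    intro z hz
    have h1 := le_max_left 1 ‖z‖
    exact smul_ne_zero (inv_ne_zero (by linarith)) hz
  obtain ⟨fD, κ, hfD, hκ⟩ := hP.local_prim.exists_log_primitive (m := fun z => D (cl z))
    two_pos (hD.comp hclc.continuousOn fun z _ => hclm z)
    fun z hz => hDP _ (hclm z) (hcl0 z hz.2)
  have hlog2 : (0 : ℝ) < Real.log 2 := Real.log_pos (by norm_num)
  have hexp : ∀ a b : ℝ, ‖Complex.exp (a + b * Complex.I)‖ = Real.exp a := by
    intro a b
    rw [Complex.norm_exp]
    simp
  -- the boundary of the disc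
  have hκφ : φ (2 * Real.pi) - φ 0 = κ := by
    have hc : Continuous fun τ : ℝ => D (Complex.exp (τ * Complex.I)) := by
      refine hD.comp_continuous (by fun_prop) fun τ => ?_
      rw [mem_closedBall_zero_iff, Complex.norm_exp_ofReal_mul_I]
    have h1 : PrimOn L (fun τ : ℝ => D (Complex.exp (τ * Complex.I))) (fun b => fD (0, b)) univ := by
      refine (hfD.comp (k := fun b : ℝ => ((0 : ℝ), b)) (C := univ) (by fun_prop)
        fun b _ => ⟨hlog2, trivial⟩).congr (fun b _ => ?_) fun _ _ => rfl
      simp only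
      rw [hcl1 _ (by rw [hexp, Real.exp_zero])]
      simp
    have h2 := hφ.sub_eq_sub hP.local_prim h1 hc.continuousOn isPreconnected_univ
      (mem_univ (0 + 2 * Real.pi)) (mem_univ 0)
    simp only [hκ 0 hlog2 0] at h2
    rw [zero_add] at h2
    linarith
  rw [hκφ]
  set y : ℂ → X := fun z => S.act 0 (-c) (D z) with hy
  set q : ℂ → ℂ := fun z => ((Sg z - s₀ : ℝ) : ℂ) + (w (y z) : ℝ) * Complex.I with hq
  have hy0 : y 0 = p := by
    simp only [hy]
    rw [hD0, S.act_act]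
    simp [S.act_zero]
  have hball : Metric.closedBall (0 : ℂ) 1 ∈ 𝓝 (0 : ℂ) := Metric.closedBall_mem_nhds _ one_pos
  have hDat : ∀ z ∈ Metric.ball (0 : ℂ) 1, ContinuousAt D z := fun z hz =>
    hD.continuousAt (mem_of_superset (Metric.isOpen_ball.mem_nhds hz) Metric.ball_subset_closedBall)
  have hSat : ∀ z ∈ Metric.ball (0 : ℂ) 1, ContinuousAt Sg z := fun z hz =>
    hS.continuousAt (mem_of_superset (Metric.isOpen_ball.mem_nhds hz) Metric.ball_subset_closedBall)
  have hyat : ∀ z ∈ Metric.ball (0 : ℂ) 1, ContinuousAt y z := fun z hz =>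
    S.act_contAt continuousAt_const continuousAt_const (hDat z hz)
  have h0b : (0 : ℂ) ∈ Metric.ball (0 : ℂ) 1 := Metric.mem_ball_self one_pos
  have hqat : ∀ z ∈ Metric.ball (0 : ℂ) 1, y z ∈ V → ContinuousAt q z := by
    intro z hz hzV
    refine ContinuousAt.add ?_ (ContinuousAt.mul ?_ continuousAt_const)
    · exact Complex.continuous_ofReal.continuousAt.comp ((hSat z hz).sub continuousAt_const)
    · exact Complex.continuous_ofReal.continuousAt.comp (ContinuousAt.comp (f := y)
        (hT.w_cont.continuousAt (hT.isOpen.mem_nhds hzV)) (hyat z hz))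
  have hq0 : q 0 = 0 := by simp [hq, hS0, hy0, hT.w_zero]
  have e1 : ∀ᶠ z in 𝓝 (0 : ℂ), y z ∈ V :=
    (hyat 0 h0b).eventually (by rw [hy0]; exact hT.isOpen.mem_nhds hT.mem)
  have e2 : ∀ᶠ z in 𝓝 (0 : ℂ), q z ∈ Metric.ball (0 : ℂ) ε :=
    (hqat 0 h0b (by rw [hy0]; exact hT.mem)).eventually
      (by rw [hq0]; exact Metric.ball_mem_nhds _ hT.pos)
  -- The projection of a small circle of the disc to the slice winds once around the pole. Its
  -- logarithm `ℓ` pulls the slice primitive `f` back to the circle, where it grows by `R`, while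
  -- the disc primitive `fD` grows by `κ`; both are primitives along the same curve.
  have e3 := eventually_nhdsWithin_iff.1 (exists_log_lift hA hq0 hdet)
  obtain ⟨δ, hδ, hall⟩ := Metric.eventually_nhds_iff_ball.1
    (e1.and (e2.and (e3.and (Metric.isOpen_ball.mem_nhds h0b))))
  set r : ℝ := δ / 2 with hr
  have hr0 : 0 < r := by positivity
  have hnr : ‖(r : ℂ)‖ = r := by rw [Complex.norm_real, Real.norm_of_nonneg hr0.le]
  have hrδ : ∀ z : ℂ, ‖z‖ = r → z ∈ Metric.ball (0 : ℂ) δ := fun z hz => by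
    rw [mem_ball_zero_iff, hz]; linarith
  set a := Real.log r with ha
  have hea : Real.exp a = r := Real.exp_log hr0
  have hr1 : r < 1 := by
    have : ‖(r : ℂ)‖ < 1 := mem_ball_zero_iff.1 (hall r (hrδ _ hnr)).2.2.2
    rwa [hnr] at this
  have ha0 : a < 0 := Real.log_neg hr0 hr1
  obtain ⟨-, hlift⟩ := (hall r (hrδ _ hnr)).2.2.1 (by
    simp only [mem_compl_iff, mem_singleton_iff, Complex.ofReal_eq_zero]; exact hr0.ne')
  obtain ⟨ℓ, hℓ1, hℓ2, hℓc⟩ := hlift a (by rw [hnr, hea]) fun z hz => by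
    have := hall z (hrδ z (by rw [hz, hnr]))
    exact hqat z this.2.2.2 this.1
  set e : ℝ → ℂ := fun b => Complex.exp (a + b * Complex.I) with he
  have hec : Continuous e := by simp only [he]; fun_prop
  have hen : ∀ b, ‖e b‖ = r := fun b => by rw [hexp, hea]
  have heall := fun b => hall (e b) (hrδ _ (hen b))
  have hDe : ∀ b, D (e b) = S.act 0 (c + u (y (e b)))
      (n (s₀ + (Complex.exp (ℓ b)).re) (Complex.exp (ℓ b)).im) := by
    intro b
    obtain ⟨h1, h2, -, h3⟩ := heall b
    have hb := mem_box_of_norm_lt (s₀ := s₀) (mem_ball_zero_iff.1 h2)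
    have hre : s₀ + (q (e b)).re = Sg (e b) := by simp [hq]
    have him : (q (e b)).im = w (y (e b)) := by simp [hq]
    rw [hℓ1, hre, him]
    rw [hre] at hb
    have h4 := hT.eq_slice h1 hb.1 (by
      simp only [hy]
      rw [S.F_act, hF _ (Metric.ball_subset_closedBall h3)])
    have h5 : D (e b) = S.act 0 c (y (e b)) := by
      simp only [hy]
      rw [S.act_act]
      simp [S.act_zero]
    rw [h5]
    nth_rw 1 [h4]
    rw [S.act_act, add_zero]
  have hycont : Continuous fun b => y (e b) := by
    rw [continuous_iff_continuousAt]
    exact fun b => ContinuousAt.comp (f := e) (hyat _ (heall b).2.2.2) hec.continuousAt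
  have hDec : Continuous fun b => D (e b) := by
    rw [continuous_iff_continuousAt]
    exact fun b => ContinuousAt.comp (f := e) (hDat _ (heall b).2.2.2) hec.continuousAt
  have hucont : Continuous fun b => u (y (e b)) := by
    rw [continuous_iff_continuousAt]
    exact fun b => ContinuousAt.comp (f := fun b => y (e b))
      (hT.u_cont.continuousAt (hT.isOpen.mem_nhds (heall b).1)) hycont.continuousAt
  have hmaps : MapsTo (fun a : ℝ × ℝ => Complex.exp (a.1 + a.2 * Complex.I))
      (Iio (Real.log ε) ×ˢ univ) (Metric.ball 0 ε \ {0}) := by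
    intro a ha
    refine ⟨?_, Complex.exp_ne_zero _⟩
    rw [mem_ball_zero_iff, hexp, ← Real.exp_log hT.pos]
    exact Real.exp_lt_exp.2 ha.1
  have hℓre : ∀ b, (ℓ b).re ∈ Iio (Real.log ε) := by
    intro b
    rw [mem_Iio, Real.lt_log_iff_exp_lt hT.pos, ← Complex.norm_exp, hℓ1]
    exact mem_ball_zero_iff.1 (heall b).2.1
  have g1 : PrimOn L (fun b => D (e b))
      (fun b => f ((ℓ b).re, (ℓ b).im) + (c + u (y (e b)))) univ := by
    refine (hP.primOn_rotate_comp hR.1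
      ((slice_continuousOn hT).comp (Continuous.continuousOn (by fun_prop))
        fun a ha => (hmaps ha).1)
      (fun a ha => slice_not_mem hiso _ (hmaps ha)) (B := univ)
      (k := fun b => ((ℓ b).re, (ℓ b).im)) (r := fun b => c + u (y (e b)))
      ((Complex.continuous_re.comp hℓc).prodMk (Complex.continuous_im.comp hℓc)).continuousOn
      (continuous_const.add hucont).continuousOn fun b _ => ⟨hℓre b, trivial⟩).congr
      (fun b _ => ?_) fun _ _ => rfl
    simp only [Complex.re_add_im]
    exact hDe b
  have g2 : PrimOn L (fun b => D (e b)) (fun b => fD (a, b)) univ := by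
    refine (hfD.comp (k := fun b : ℝ => (a, b)) (C := univ) (by fun_prop)
      fun b _ => ⟨by simp only [mem_Iio]; linarith, trivial⟩).congr (fun b _ => ?_) fun _ _ => rfl
    simp only
    rw [hcl1 _ (by rw [hexp, hea]; exact hr1.le)]
  have h2 := g2.sub_eq_sub hP.local_prim g1 hDec.continuousOn isPreconnected_univ
    (mem_univ (0 + 2 * Real.pi)) (mem_univ 0)
  have h3 : e (0 + 2 * Real.pi) = e 0 := by
    simp only [he]
    rw [← Complex.exp_periodic (a + (0 : ℝ) * Complex.I)]
    congr 1
    push_cast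
    ring
  have h4 : ℓ (0 + 2 * Real.pi) = ℓ 0 + ((2 * Real.pi : ℝ) : ℂ) * Complex.I := by
    rw [hℓ2]; push_cast; ring
  have h5 : (ℓ (0 + 2 * Real.pi)).re = (ℓ 0).re := by rw [h4]; simp
  have h6 : (ℓ (0 + 2 * Real.pi)).im = (ℓ 0).im + 2 * Real.pi := by rw [h4]; simp
  have h7 := hκ a (by simp only [mem_Iio]; linarith) 0
  have h8 := hR.2 _ (hℓre 0) (ℓ 0).im
  simp only [h3, h5, h6, h7, h8] at h2
  linarith

end TorusSystem


/-! ### Jumps of the defect and the sum of the residues. -/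

namespace TorusSystem

variable {X : Type*} [TopologicalSpace X] {S : TorusSystem X} {L : (X → ℝ) → X → Prop} {P : Set X}

/-- The primitives on both sides of a fibre fit together off the poles. -/
lemma exists_isOffset (hP : S.IsRotationPrimitive L P) {s₀ ε : ℝ} (hε : 0 < ε) {g : ℝ × ℝ → X}
    (hg : ContinuousOn g (Ioo (s₀ - ε) (s₀ + ε) ×ˢ univ)) {f₁ f₂ : ℝ × ℝ → ℝ}
    (hf₁ : PrimOn L g f₁ (Ioo s₀ (s₀ + ε) ×ˢ univ))
    (hf₂ : PrimOn L g f₂ (Ioo (s₀ - ε) s₀ ×ˢ univ)) {t : ℝ} (ht : g (s₀, t) ∉ P) :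
    ∃ c, IsOffset f₁ f₂ s₀ t c := by
  -- One local primitive at the point of the dividing line is compared with the primitives of both
  -- sides.
  obtain ⟨φ, hφ⟩ := hP.local_prim.exists_prim _ ht
  have hopen : IsOpen (Ioo (s₀ - ε) (s₀ + ε) ×ˢ (univ : Set ℝ)) := isOpen_Ioo.prod isOpen_univ
  have hmem : (s₀, t) ∈ Ioo (s₀ - ε) (s₀ + ε) ×ˢ (univ : Set ℝ) :=
    ⟨⟨by simp only; linarith, by simp only; linarith⟩, trivial⟩
  have e1 : ∀ᶠ z in 𝓝 (s₀, t), L φ (g z) :=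
    (hg.continuousAt (hopen.mem_nhds hmem)).eventually (hP.local_prim.eventually hφ)
  obtain ⟨δ, hδ, hall⟩ := Metric.eventually_nhds_iff_ball.1 (e1.and (hopen.mem_nhds hmem))
  have hball : ∀ z ∈ Ioo (s₀ - δ) (s₀ + δ) ×ˢ Ioo (t - δ) (t + δ), z ∈ Metric.ball (s₀, t) δ := by
    intro z hz
    rw [← ball_prod_same, Real.ball_eq_Ioo, Real.ball_eq_Ioo]
    exact hz
  have hprim : PrimOn L g (fun z => φ (g z)) (Ioo (s₀ - δ) (s₀ + δ) ×ˢ Ioo (t - δ) (t + δ)) :=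
    hP.local_prim.primOn_comp fun z hz => (hall z (hball z hz)).1
  have hr : Ioo s₀ (s₀ + δ) ×ˢ Ioo (t - δ) (t + δ) ⊆
      Ioo (s₀ - δ) (s₀ + δ) ×ˢ Ioo (t - δ) (t + δ) :=
    prod_mono (Ioo_subset_Ioo_left (by linarith)) Subset.rfl
  have hl : Ioo (s₀ - δ) s₀ ×ˢ Ioo (t - δ) (t + δ) ⊆
      Ioo (s₀ - δ) (s₀ + δ) ×ˢ Ioo (t - δ) (t + δ) :=
    prod_mono (Ioo_subset_Ioo_right (by linarith)) Subset.rfl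
  have hc1 : ∀ z ∈ Ioo s₀ (s₀ + δ) ×ˢ Ioo (t - δ) (t + δ),
      f₁ z - φ (g z) = f₁ (s₀ + δ / 2, t) - φ (g (s₀ + δ / 2, t)) := fun z hz =>
    (hf₁.mono fun z hz => ⟨⟨hz.1.1, (hall z (hball z (hr hz))).2.1.2⟩, trivial⟩).sub_eq_sub
      hP.local_prim (hprim.mono hr) (hg.mono fun z hz => (hall z (hball z (hr hz))).2)
      (isPreconnected_Ioo.prod isPreconnected_Ioo) hz
      ⟨⟨by simp only; linarith, by simp only; linarith⟩, by simp only; linarith, by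
        simp only; linarith⟩
  have hc2 : ∀ z ∈ Ioo (s₀ - δ) s₀ ×ˢ Ioo (t - δ) (t + δ),
      f₂ z - φ (g z) = f₂ (s₀ - δ / 2, t) - φ (g (s₀ - δ / 2, t)) := fun z hz =>
    (hf₂.mono fun z hz => ⟨⟨(hall z (hball z (hl hz))).2.1.1, hz.1.2⟩, trivial⟩).sub_eq_sub
      hP.local_prim (hprim.mono hl) (hg.mono fun z hz => (hall z (hball z (hl hz))).2)
      (isPreconnected_Ioo.prod isPreconnected_Ioo) hz
      ⟨⟨by simp only; linarith, by simp only; linarith⟩, by simp only; linarith, by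
        simp only; linarith⟩
  refine ⟨f₁ (s₀ + δ / 2, t) - φ (g (s₀ + δ / 2, t)) -
    (f₂ (s₀ - δ / 2, t) - φ (g (s₀ - δ / 2, t))), fun z => φ (g z) +
    (f₂ (s₀ - δ / 2, t) - φ (g (s₀ - δ / 2, t))), ?_⟩
  filter_upwards [prod_mem_nhds (Ioo_mem_nhds (show s₀ - δ < s₀ by linarith)
    (show s₀ < s₀ + δ by linarith)) (Ioo_mem_nhds (show t - δ < t by linarith)
    (show t < t + δ by linarith))] with z hz
  have hz1 := hall z (hball z hz)
  refine ⟨(ContinuousAt.comp (hP.local_prim.continuousAt hz1.1)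
    (hg.continuousAt (hopen.mem_nhds hz1.2))).add continuousAt_const, fun h => ?_, fun h => ?_⟩
  · linarith [hc1 z ⟨⟨h, hz.1.2⟩, hz.2⟩]
  · linarith [hc2 z ⟨⟨hz.1.1, h⟩, hz.2⟩]

/-- The change of the offset after one return. -/
lemma _root_.RotationForms.IsOffset.shift {f₁ f₂ : ℝ × ℝ → ℝ} {s₀ ε t c κ₁ κ₂ : ℝ} (hε : 0 < ε)
    {T Θ : ℝ → ℝ} (hT : ContinuousOn T (Ioo (s₀ - ε) (s₀ + ε))) (hΘ : Continuous Θ)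
    (h₁ : ∀ s ∈ Ioo s₀ (s₀ + ε), ∀ t, f₁ (s, t + T s) = f₁ (s, t) + Θ s + κ₁)
    (h₂ : ∀ s ∈ Ioo (s₀ - ε) s₀, ∀ t, f₂ (s, t + T s) = f₂ (s, t) + Θ s + κ₂)
    (h : IsOffset f₁ f₂ s₀ (t + T s₀) c) : IsOffset f₁ f₂ s₀ t (c - (κ₁ - κ₂)) := by
  obtain ⟨f, hf⟩ := h
  have hm : ∀ z : ℝ × ℝ, z.1 ∈ Ioo (s₀ - ε) (s₀ + ε) →
      ContinuousAt (fun z : ℝ × ℝ => (z.1, z.2 + T z.1)) z := fun z hz =>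
    continuousAt_fst.prodMk (continuousAt_snd.add
      (ContinuousAt.comp (f := Prod.fst) (hT.continuousAt (isOpen_Ioo.mem_nhds hz)) continuousAt_fst))
  have hs₀ : s₀ ∈ Ioo (s₀ - ε) (s₀ + ε) := ⟨by linarith, by linarith⟩
  -- Pulling the gluing function back by one return requires subtracting `Θ + κ₂` on the left but `Θ
  -- + κ₁` on the right. With the left choice made on both sides, the offset absorbs `κ₁ - κ₂`.
  refine ⟨fun z => f (z.1, z.2 + T z.1) - Θ z.1 - κ₂, ?_⟩
  have e1 : ∀ᶠ z : ℝ × ℝ in 𝓝 (s₀, t), z.1 ∈ Ioo (s₀ - ε) (s₀ + ε) :=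
    (continuous_fst.continuousAt (x := (s₀, t))).eventually (isOpen_Ioo.mem_nhds hs₀)
  filter_upwards [(hm (s₀, t) hs₀).eventually hf, e1] with z hz hz1
  refine ⟨((ContinuousAt.comp (f := fun z : ℝ × ℝ => (z.1, z.2 + T z.1)) hz.1 (hm z hz1)).sub
    (hΘ.comp continuous_fst).continuousAt).sub continuousAt_const, fun h => ?_, fun h => ?_⟩
  · have h3 := h₁ z.1 ⟨h, hz1.2⟩ z.2
    have h4 := hz.2.1 h
    linarith
  · have h3 := h₂ z.1 ⟨hz1.1, h⟩ z.2
    have h4 := hz.2.2 h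
    linarith

/-- Near each point of the bundle, poles over parameters near `s₀` lie over `s₀` itself, by
`eventually_pole` or because the set of poles is closed. Compactness makes the range of parameters
uniform. -/
lemma eventually_not_polar [CompactSpace X] (hP : S.IsRotationPrimitive L P)
    (hpole : S.HasPoleTubes P) (s₀ : ℝ) : ∀ᶠ s in 𝓝[≠] s₀, s ∉ S.polarParams P := by
  rw [eventually_nhdsWithin_iff]
  have : ∀ᶠ s in 𝓝 s₀, ∀ x ∈ (univ : Set X), x ∈ P → S.F x = S.Γ s → s = s₀ := by
    refine isCompact_univ.eventually_forall_of_forall_eventually fun x _ => ?_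
    by_cases hx : x ∈ P ∧ S.F x = S.Γ s₀
    · filter_upwards [eventually_pole hP hpole hx.1 hx.2] with z hz h1 h2
      exact (hz h1 h2).1
    · have hcl : IsClosed {z : ℝ × X | z.2 ∈ P ∧ S.F z.2 = S.Γ z.1} :=
        (hP.isClosed.preimage continuous_snd).inter
          (isClosed_eq (S.continuous_F.comp continuous_snd) (S.continuous_Γ.comp continuous_fst))
      filter_upwards [hcl.isOpen_compl.mem_nhds (show (s₀, x) ∈ _ from hx)] with z hz h1 h2
      exact absurd ⟨h1, h2⟩ hz
  filter_upwards [this] with s hs hne ⟨x, hx, hF⟩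
  exact hne (hs x trivial hx hF)

/-- If the whole flow orbit were polar, points reached after a short time would lie on the circle
orbit of `x`, which `eventually_not_return` forbids. -/
lemma exists_not_pole (hP : S.IsRotationPrimitive L P) (hpole : S.HasPoleTubes P) {s₀ : ℝ} {x : X}
    (hx : S.F x = S.Γ s₀) : ∃ t, S.act t 0 x ∉ P := by
  by_contra! h
  have hxP : x ∈ P := by simpa [S.act_zero] using h 0
  obtain ⟨δ, hδ, hret⟩ := S.eventually_not_return x
  have hc : Continuous fun t : ℝ => (s₀, S.act t 0 x) :=
    continuous_const.prodMk (S.act_cont continuous_id continuous_const continuous_const)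
  have h1 := hc.continuousAt (x := 0)
  rw [ContinuousAt, S.act_zero] at h1
  have h2 : ∀ᶠ t in 𝓝[>] (0 : ℝ), S.act t 0 x ∈ P → S.F (S.act t 0 x) = S.Γ s₀ →
      s₀ = s₀ ∧ ∃ c, S.act t 0 x = S.act 0 c x :=
    nhdsWithin_le_nhds (h1.eventually (eventually_pole hP hpole hxP hx))
  obtain ⟨t, ht, ht'⟩ := (h2.and (Ioo_mem_nhdsGT hδ)).exists
  obtain ⟨-, c, hc⟩ := ht (h t) ((S.F_act _ _ _).trans hx)
  refine hret.self_of_nhds t ht' ⟨-c, ?_⟩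
  have := congrArg (S.act 0 (-c)) hc
  rw [S.act_act, S.act_act] at this
  simpa [S.act_zero] using this

/-- The data of the poles: representatives of the polar orbits and their residues. -/
structure PolarData (S : TorusSystem X) (L : (X → ℝ) → X → Prop) (P : Set X) {N : ℕ}
    (s : Fin N → ℝ) (p : Fin N → X) (R : Fin N → ℝ) : Prop where
  mem : ∀ i, s i ∈ Ico (0 : ℝ) 1 ∧ p i ∈ P ∧ S.F (p i) = S.Γ (s i)
  injective : ∀ i j, s i = s j → (∃ c, p j = S.act 0 c (p i)) → i = j
  exhaust : ∀ t ∈ Ico (0 : ℝ) 1, ∀ x ∈ P, S.F x = S.Γ t → ∃ i, s i = t ∧ ∃ c, x = S.act 0 c (p i)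
  residue : ∀ i, ∃ V w u n ε f, IsTube S.F S.act S.Γ (s i) (p i) V w u n ε ∧
    (∀ s' ∈ Ioo (s i - ε) (s i + ε), ∀ r ∈ Ioo (-ε) ε, n s' r ∈ P → s' = s i ∧ r = 0) ∧
    IsResidue L (s i) n ε f (R i)

variable [CompactSpace X] [T2Space X] {N : ℕ} {s : Fin N → ℝ} {p : Fin N → X} {R : Fin N → ℝ}
  {Θt : ℝ → ℝ}

/-- The jump of the defect is the sum of the residues. -/
lemma PolarData.defect_jump (hN : S.PolarData L P s p R) (hP : S.IsRotationPrimitive L P)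
    (hpole : S.HasPoleTubes P) (hΘc : Continuous Θt) (hΘ : ∀ s, S.IsAngle s (Θt s)) {s₀ : ℝ}
    (hs₀ : s₀ ∈ Ico (0 : ℝ) 1) : ∃ C, (∀ᶠ t in 𝓝[<] s₀, S.IsDefect L Θt t C) ∧
      ∀ᶠ t in 𝓝[>] s₀, S.IsDefect L Θt t (C + ∑ i with s i = s₀, R i) := by
  classical
  obtain ⟨x, hx⟩ := S.exists_fibre s₀
  obtain ⟨σ, hσ0, ε₁, hε₁, hσ₁, hFσ₁⟩ := S.exists_local_section hx
  obtain ⟨ε₂, hε₂, hiso⟩ := Metric.eventually_nhds_iff_ball.1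
    (eventually_nhdsWithin_iff.1 (eventually_not_polar hP hpole s₀))
  set ε := min ε₁ ε₂ with hεdef
  have hε : 0 < ε := lt_min hε₁ hε₂
  have hsub : Ioo (s₀ - ε) (s₀ + ε) ⊆ Ioo (s₀ - ε₁) (s₀ + ε₁) :=
    Ioo_subset_Ioo (by linarith [min_le_left ε₁ ε₂]) (by linarith [min_le_left ε₁ ε₂])
  have hσ := hσ₁.mono hsub
  have hFσ : ∀ t ∈ Ioo (s₀ - ε) (s₀ + ε), S.F (σ t) = S.Γ t := fun t ht => hFσ₁ t (hsub ht)
  have hnp : ∀ t ∈ Ioo (s₀ - ε) (s₀ + ε), t ≠ s₀ → t ∉ S.polarParams P := by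
    intro t ht hne
    refine hiso t ?_ hne
    rw [Real.ball_eq_Ioo]
    exact ⟨by linarith [min_le_right ε₁ ε₂, ht.1], by linarith [min_le_right ε₁ ε₂, ht.2]⟩
  set g : ℝ × ℝ → X := fun z => S.act z.2 0 (σ z.1) with hgdef
  have hg : ContinuousOn g (Ioo (s₀ - ε) (s₀ + ε) ×ˢ univ) :=
    S.act_contOn continuousOn_snd continuousOn_const (hσ.comp continuousOn_fst fun z hz => hz.1)
  have hr : Ioo s₀ (s₀ + ε) ⊆ Ioo (s₀ - ε) (s₀ + ε) := Ioo_subset_Ioo_left (by linarith)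
  have hl : Ioo (s₀ - ε) s₀ ⊆ Ioo (s₀ - ε) (s₀ + ε) := Ioo_subset_Ioo_right (by linarith)
  have hside : ∀ I : Set ℝ, I.OrdConnected → IsOpen I → I ⊆ Ioo (s₀ - ε) (s₀ + ε) → s₀ ∉ I →
      ∃ f κ, PrimOn L g f (I ×ˢ univ) ∧
        ∀ t ∈ I, S.IsDefect L Θt t κ ∧ ∀ t', f (t, t' + S.T (σ t)) = f (t, t') + Θt t + κ := by
    intro I hI hIo hIs hI0
    have hIP : ∀ t ∈ I, t ∉ S.polarParams P := fun t ht =>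
      hnp t (hIs ht) fun h => hI0 (h ▸ ht)
    obtain ⟨f, hf⟩ := hP.local_prim.exists_primOn_rect hI hIo ordConnected_univ isOpen_univ
      (hg.mono (prod_mono hIs Subset.rfl)) fun z hz =>
        not_mem_of_not_polar (hIP z.1 hz.1) ((S.F_act _ _ _).trans (hFσ z.1 (hIs hz.1)))
    obtain ⟨κ, hκ⟩ := exists_defect hP hΘc hΘ hI.isPreconnected (hσ.mono hIs)
      (fun t ht => hFσ t (hIs ht)) hIP hf
    exact ⟨f, κ, hf, hκ⟩
  obtain ⟨f₁, κ₁, hf₁, hκ₁⟩ := hside _ ordConnected_Ioo isOpen_Ioo hr (by simp)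
  obtain ⟨f₂, κ₂, hf₂, hκ₂⟩ := hside _ ordConnected_Ioo isOpen_Ioo hl (by simp)
  suffices hmain : κ₁ - κ₂ = ∑ i with s i = s₀, R i by
    refine ⟨κ₂, ?_, ?_⟩
    · filter_upwards [Ioo_mem_nhdsLT (show s₀ - ε < s₀ by linarith)] with t ht
      exact (hκ₂ t ht).1
    · filter_upwards [Ioo_mem_nhdsGT (show s₀ < s₀ + ε by linarith)] with t ht
      rw [← hmain, add_sub_cancel]
      exact (hκ₁ t ht).1
  -- Time is counted from a point that is no pole. Then neither end of the period is a crossing, and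
  -- each polar orbit over `s₀` is crossed exactly once inside it.
  obtain ⟨t₀, ht₀⟩ := exists_not_pole hP hpole hx
  have hTpos := S.T_pos x
  have hτ : ∀ i, s i = s₀ → ∃ t ∈ Ioo t₀ (t₀ + S.T x), ∃ c, S.act t 0 x = S.act 0 c (p i) := by
    intro i hi
    obtain ⟨-, hpP, hpF⟩ := hN.mem i
    obtain ⟨a, b, hab⟩ := S.exists_act_eq (x := x) (y := p i) (by rw [hx, hpF, hi])
    set t := toIcoMod hTpos t₀ a with ht
    have hret : t - a ∈ S.returns x := by
      rw [S.mem_returns_iff]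
      refine ⟨-toIcoDiv hTpos t₀ a, ?_⟩
      rw [ht, toIcoMod, zsmul_eq_mul]
      push_cast
      ring
    obtain ⟨u, hu⟩ := hret
    have hc : ∃ c, S.act t 0 x = S.act 0 c (p i) := by
      refine ⟨-u - b, ?_⟩
      have h2 : S.act t 0 x = S.act a (-u) (S.act (t - a) u x) := by
        rw [S.act_act]
        congr 1 <;> ring
      rw [h2, hu, hab, S.act_act]
      congr 1 <;> ring
    have hIco := toIcoMod_mem_Ico hTpos t₀ a
    refine ⟨t, ⟨lt_of_le_of_ne hIco.1 fun h => ht₀ ?_, hIco.2⟩, hc⟩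
    obtain ⟨c, hc⟩ := hc
    rw [h, hc]
    exact hP.invariant c _ hpP
  choose! τ hτ1 hτ2 using hτ
  have hτinj : ∀ i j, s i = s₀ → s j = s₀ → τ i = τ j → i = j := by
    intro i j hi hj h
    obtain ⟨c, hc⟩ := hτ2 i hi
    obtain ⟨c', hc'⟩ := hτ2 j hj
    refine hN.injective i j (hi.trans hj.symm) ⟨-c' + c, ?_⟩
    rw [h, hc'] at hc
    have := congrArg (S.act 0 (-c')) hc
    rw [S.act_act, S.act_act] at this
    simpa [S.act_zero] using this
  have hoff : ∀ t, S.act t 0 x ∉ P → ∃ c, IsOffset f₁ f₂ s₀ t c := fun t ht =>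
    exists_isOffset hP hε hg hf₁ hf₂ (by simpa only [hgdef, hσ0] using ht)
  -- The offset as a function of time. The default value `0` can occur only at a crossing, where the
  -- value of `q` plays no role.
  set q : ℝ → ℝ := fun t => if h : ∃ c, IsOffset f₁ f₂ s₀ t c then h.choose else 0 with hq
  have hqspec : ∀ t c, IsOffset f₁ f₂ s₀ t c → q t = c := by
    intro t c h
    have h' : ∃ c, IsOffset f₁ f₂ s₀ t c := ⟨c, h⟩
    simp only [hq, dif_pos h']
    exact h'.choose_spec.unique h
  set A : Finset (Fin N) := {i | s i = s₀} with hA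
  have hAmem : ∀ i, i ∈ A ↔ s i = s₀ := fun i => by simp [hA]
  -- The growth of the offset over one return is the sum of the residues crossed, and by
  -- `IsOffset.shift` it is also `κ₁ - κ₂`.
  have hkey := sub_eq_sum_jumps (q := q) (a := t₀) (b := t₀ + S.T x) (by linarith) (A.image τ)
    (fun t => ∑ i ∈ A with τ i = t, R i) ?_ ?_ ?_
  · rw [Finset.sum_fiberwise_of_maps_to fun i hi => Finset.mem_image_of_mem τ hi] at hkey
    obtain ⟨c, hc⟩ := hoff (t₀ + S.T x) fun h => ht₀ (by
      obtain ⟨u, hu⟩ := S.T_mem x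
      have := hP.invariant u _ h
      rw [S.act_act] at this
      have h2 := S.act_act t₀ 0 (S.T x) u x
      rw [hu] at h2
      rw [h2]
      convert this using 2 <;> ring)
    have h1 := IsOffset.shift hε (T := fun t => S.T (σ t)) (t := t₀) (c := c)
      (S.continuous_T.comp_continuousOn hσ) hΘc
      (fun t ht => (hκ₁ t ht).2) (fun t ht => (hκ₂ t ht).2) (by simpa only [hσ0] using hc)
    rw [hqspec _ _ hc, hqspec _ _ h1] at hkey
    linarith
  · intro t ht
    obtain ⟨i, hi, rfl⟩ := Finset.mem_image.1 ht
    exact hτ1 i ((hAmem i).1 hi)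
  · intro t ht htS
    obtain ⟨c, hc⟩ := hoff t fun h => by
      obtain ⟨i, hi, c, hc⟩ := hN.exhaust s₀ hs₀ _ h ((S.F_act _ _ _).trans hx)
      obtain ⟨c', hc'⟩ := hτ2 i hi
      have hret : t - τ i ∈ S.returns x := by
        refine ⟨c' - c, ?_⟩
        have h5 : S.act t (-c) x = S.act (τ i) (-c') x := by
          have e1 := congrArg (S.act 0 (-c)) hc
          have e2 := congrArg (S.act 0 (-c')) hc'
          rw [S.act_act, S.act_act] at e1 e2
          simp only [zero_add, add_zero, neg_add_cancel] at e1 e2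
          rw [e1, e2]
        have h6 := congrArg (S.act (-τ i) c') h5
        rw [S.act_act, S.act_act] at h6
        rw [neg_add_cancel, add_neg_cancel, S.act_zero] at h6
        convert h6 using 2 <;> ring
      obtain ⟨m, hm⟩ := (S.mem_returns_iff x _).1 hret
      have hτi := hτ1 i hi
      have hm0 : m = 0 := by
        have h1 : (m : ℝ) < 1 := by
          by_contra hcon
          nlinarith [ht.2, hτi.1]
        have h2 : (-1 : ℝ) < m := by
          by_contra hcon
          nlinarith [ht.1, hτi.2]
        have h1' : m < 1 := by exact_mod_cast h1
        have h2' : -1 < m := by exact_mod_cast h2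
        omega
      rw [hm0] at hm
      refine htS (Finset.mem_image.2 ⟨i, (hAmem i).2 hi, ?_⟩)
      simp at hm
      linarith
    filter_upwards [hc.eventually] with t' ht'
    rw [hqspec _ _ ht', hqspec _ _ hc]
  · intro t ht
    obtain ⟨i, hi, rfl⟩ := Finset.mem_image.1 ht
    have hi' := (hAmem i).1 hi
    have hsum : ∑ j ∈ A with τ j = τ i, R j = R i := by
      rw [Finset.sum_eq_single_of_mem i (by simp [hi])]
      intro j hj hne
      rw [Finset.mem_filter] at hj
      exact absurd (hτinj j i ((hAmem j).1 hj.1) hi' hj.2) hne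
    obtain ⟨c, hc⟩ := hτ2 i hi'
    obtain ⟨V, w, u, n, η, f, hT, hniso, hR⟩ := hN.residue i
    rw [hi'] at hT hniso hR
    obtain ⟨C, hC1, hC2⟩ := offset_jump hP hT hniso hR hε hσ hFσ hf₁ hf₂ (t₁ := τ i) (c := c)
      (by rw [hσ0, hc])
    refine ⟨C, ?_, ?_⟩
    · filter_upwards [hC1] with t' ht'
      exact hqspec _ _ ht'
    · filter_upwards [hC2] with t' ht'
      rw [hqspec _ _ ht', hsum]

/-- The sum of the residues is the monodromy of the angle. -/
theorem PolarData.sum_residues (hN : S.PolarData L P s p R) (hP : S.IsRotationPrimitive L P)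
    (hpole : S.HasPoleTubes P) (hΘc : Continuous Θt) (hΘ : ∀ s, S.IsAngle s (Θt s)) {k : ℤ}
    (hk : ∀ s, Θt (s + 1) = Θt s - 2 * Real.pi * k) : 2 * Real.pi * k = ∑ i, R i := by
  classical
  have hloc : ∀ t, t ∉ S.polarParams P → ∃ κ, ∀ᶠ t' in 𝓝 t, S.IsDefect L Θt t' κ := by
    intro t ht
    obtain ⟨x, hx⟩ := S.exists_fibre t
    obtain ⟨σ, hσ0, ε₁, hε₁, hσ, hFσ⟩ := S.exists_local_section hx
    obtain ⟨ε₂, hε₂, hball⟩ := Metric.mem_nhds_iff.1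
      ((isClosed_polarParams (S := S) hP.isClosed).isOpen_compl.mem_nhds ht)
    set ε := min ε₁ ε₂ with hεdef
    have hε : 0 < ε := lt_min hε₁ hε₂
    have hsub : Ioo (t - ε) (t + ε) ⊆ Ioo (t - ε₁) (t + ε₁) :=
      Ioo_subset_Ioo (by linarith [min_le_left ε₁ ε₂]) (by linarith [min_le_left ε₁ ε₂])
    have hIP : ∀ t' ∈ Ioo (t - ε) (t + ε), t' ∉ S.polarParams P := by
      intro t' ht'
      refine hball ?_
      rw [Real.ball_eq_Ioo]
      exact ⟨by linarith [min_le_right ε₁ ε₂, ht'.1], by linarith [min_le_right ε₁ ε₂, ht'.2]⟩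
    obtain ⟨f, hf⟩ := hP.local_prim.exists_primOn_rect (I := Ioo (t - ε) (t + ε))
      (g := fun z : ℝ × ℝ => S.act z.2 0 (σ z.1)) ordConnected_Ioo isOpen_Ioo
      ordConnected_univ isOpen_univ
      (S.act_contOn continuousOn_snd continuousOn_const
        ((hσ.mono hsub).comp continuousOn_fst fun z hz => hz.1)) fun z hz =>
        not_mem_of_not_polar (hIP z.1 hz.1) ((S.F_act _ _ _).trans (hFσ z.1 (hsub hz.1)))
    obtain ⟨κ, hκ⟩ := exists_defect hP hΘc hΘ isPreconnected_Ioo (hσ.mono hsub)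
      (fun t ht => hFσ t (hsub ht)) hIP hf
    refine ⟨κ, ?_⟩
    filter_upwards [Ioo_mem_nhds (show t - ε < t by linarith) (show t < t + ε by linarith)]
      with t' ht'
    exact (hκ t' ht').1
  -- The defect as a function of the parameter: locally constant off the polar parameters, with sums
  -- of residues as jumps, and growing by `2πk` over a period.
  set W : ℝ → ℝ := fun t => if h : ∃ κ, S.IsDefect L Θt t κ then h.choose else 0 with hW
  have hWspec : ∀ t κ, t ∉ S.polarParams P → S.IsDefect L Θt t κ → W t = κ := by
    intro t κ ht h
    have h' : ∃ κ, S.IsDefect L Θt t κ := ⟨κ, h⟩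
    simp only [hW, dif_pos h']
    exact h'.choose_spec.unique hP ht h
  have hev : ∀ t, ∀ᶠ t' in 𝓝[≠] t, t' ∉ S.polarParams P := eventually_not_polar hP hpole
  have hkey := eq_sum_jumps_of_period (q := W) (κ := 2 * Real.pi * k) (S.polarParams P) ?_
    (fun _ => polarParams_add_one) (Finset.univ.image s) ?_ (fun t => ∑ i with s i = t, R i) ?_ ?_
  · rw [hkey]
    exact Finset.sum_fiberwise_of_maps_to (fun i _ => Finset.mem_image_of_mem s (Finset.mem_univ i)) _
  · intro t ht
    obtain ⟨κ, hκ⟩ := hloc t ht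
    rw [hWspec t κ ht hκ.self_of_nhds, hWspec (t + 1) _ ?_ (hκ.self_of_nhds.add_one hk)]
    rintro ⟨x, hx, h⟩
    exact ht ⟨x, hx, h.trans (S.Γ_add_one t)⟩
  · intro t
    simp only [Finset.mem_image, Finset.mem_univ, true_and]
    constructor
    · rintro ⟨i, rfl⟩
      exact ⟨(hN.mem i).1, p i, (hN.mem i).2⟩
    · rintro ⟨ht, x, hx, hF⟩
      obtain ⟨i, hi, -⟩ := hN.exhaust t ht x hx hF
      exact ⟨i, hi⟩
  · intro t ht
    obtain ⟨κ, hκ⟩ := hloc t ht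
    filter_upwards [hκ, (isClosed_polarParams (S := S) hP.isClosed).isOpen_compl.mem_nhds ht]
      with t' h1 h2
    rw [hWspec t' κ h2 h1, hWspec t κ ht hκ.self_of_nhds]
  · intro t ht
    obtain ⟨i, -, rfl⟩ := Finset.mem_image.1 ht
    obtain ⟨C, hC1, hC2⟩ := hN.defect_jump hP hpole hΘc hΘ (hN.mem i).1
    refine ⟨C, ?_, ?_⟩
    · filter_upwards [hC1, nhdsLT_le_nhdsNE _ (hev (s i))] with t' h1 h2
      exact hWspec _ _ h2 h1
    · filter_upwards [hC2, nhdsGT_le_nhdsNE _ (hev (s i))] with t' h1 h2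
      exact hWspec _ _ h2 h1

end TorusSystem


/-! ### Forms, vector fields and derivatives in charts. -/

section Charts

variable {M : Type*} [TopologicalSpace M] [ChartedSpace E4 M] [IsManifold (𝓡 4) ∞ M]

lemma isOpen_chartPart (x₀ : M) {W : Set M} (hW : IsOpen W) : IsOpen (chartPart x₀ W) :=
  (continuousOn_extChartAt_symm x₀).isOpen_inter_preimage (isOpen_extChartAt_target x₀) hW

lemma hasMFDerivAt_chart {x₀ x : M} (hx : x ∈ (extChartAt (𝓡 4) x₀).source) :
    HasMFDerivAt (𝓡 4) 𝓘(ℝ, E4) (extChartAt (𝓡 4) x₀) x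
      (mfderiv (𝓡 4) 𝓘(ℝ, E4) (extChartAt (𝓡 4) x₀) x) :=
  (mdifferentiableAt_extChartAt (by rwa [extChartAt_source] at hx)).hasMFDerivAt

lemma hasMFDerivAt_chart_symm {x₀ : M} {y : E4} (hy : y ∈ (extChartAt (𝓡 4) x₀).target) :
    HasMFDerivAt 𝓘(ℝ, E4) (𝓡 4) (extChartAt (𝓡 4) x₀).symm y
      (mfderiv 𝓘(ℝ, E4) (𝓡 4) (extChartAt (𝓡 4) x₀).symm y) := by
  have := mdifferentiableWithinAt_extChartAt_symm (I := 𝓡 4) hy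
  rw [ModelWithCorners.range_eq_univ, mdifferentiableWithinAt_univ] at this
  exact this.hasMFDerivAt

lemma mfderiv_chart_symm_apply {x₀ : M} {y : E4} (hy : y ∈ (extChartAt (𝓡 4) x₀).target) (v : E4) :
    mfderiv (𝓡 4) 𝓘(ℝ, E4) (extChartAt (𝓡 4) x₀) ((extChartAt (𝓡 4) x₀).symm y)
      (mfderiv 𝓘(ℝ, E4) (𝓡 4) (extChartAt (𝓡 4) x₀).symm y v) = v := by
  have := mfderiv_extChartAt_comp_mfderivWithin_extChartAt_symm (I := 𝓡 4) hy
  rw [ModelWithCorners.range_eq_univ, mfderivWithin_univ] at this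
  exact congrArg (fun f => f v) this

lemma mfderiv_symm_chart_apply {x₀ : M} {y : E4} (hy : y ∈ (extChartAt (𝓡 4) x₀).target)
    (v : TangentSpace (𝓡 4) ((extChartAt (𝓡 4) x₀).symm y)) :
    mfderiv 𝓘(ℝ, E4) (𝓡 4) (extChartAt (𝓡 4) x₀).symm y
      (mfderiv (𝓡 4) 𝓘(ℝ, E4) (extChartAt (𝓡 4) x₀) ((extChartAt (𝓡 4) x₀).symm y) v) = v := by
  have := mfderivWithin_extChartAt_symm_comp_mfderiv_extChartAt (I := 𝓡 4) hy
  rw [ModelWithCorners.range_eq_univ, mfderivWithin_univ] at this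
  exact congrArg (fun f => f v) this

/-- The expression of a vector field in a chart. -/
noncomputable def fieldInChart (X : (x : M) → TangentSpace (𝓡 4) x) (x₀ : M) (y : E4) : E4 :=
  mfderiv (𝓡 4) 𝓘(ℝ, E4) (extChartAt (𝓡 4) x₀) ((extChartAt (𝓡 4) x₀).symm y)
    (X ((extChartAt (𝓡 4) x₀).symm y))

variable {X : (x : M) → TangentSpace (𝓡 4) x}

lemma mfderiv_symm_fieldInChart {x₀ : M} {y : E4} (hy : y ∈ (extChartAt (𝓡 4) x₀).target) :
    mfderiv 𝓘(ℝ, E4) (𝓡 4) (extChartAt (𝓡 4) x₀).symm y (fieldInChart X x₀ y) =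
      X ((extChartAt (𝓡 4) x₀).symm y) :=
  mfderiv_symm_chart_apply hy _

/-- In the trivialization of the tangent bundle at `x₀`, the section is the expression of the field
in the chart. -/
lemma contMDiffAt_section_of_chart {n : WithTop ℕ∞} {x₀ : M}
    (h : ContDiffAt ℝ n (fieldInChart X x₀) (extChartAt (𝓡 4) x₀ x₀)) (hn : n ≤ ∞) :
    ContMDiffAt (𝓡 4) (𝓡 4).tangent n (fun x => (⟨x, X x⟩ : TangentBundle (𝓡 4) M)) x₀ := by
  have : IsManifold (𝓡 4) n M := IsManifold.of_le hn
  refine (Bundle.contMDiffAt_section (E := TangentSpace (𝓡 4)) (s := X) x₀).2 ?_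
  have h1 : ContMDiffAt (𝓡 4) 𝓘(ℝ, E4) n (fun x => fieldInChart X x₀ (extChartAt (𝓡 4) x₀ x)) x₀ :=
    h.contMDiffAt.comp x₀ contMDiffAt_extChartAt
  refine h1.congr_of_eventuallyEq ?_
  filter_upwards [extChartAt_source_mem_nhds (I := 𝓡 4) x₀] with x hx
  have hx' : x ∈ (chartAt E4 x₀).source := by rwa [extChartAt_source] at hx
  have h2 := congrArg (fun f => f (X x))
    (TangentBundle.continuousLinearMapAt_trivializationAt (𝕜 := ℝ) (I := 𝓡 4) hx')
  rw [fieldInChart, (extChartAt (𝓡 4) x₀).left_inv hx]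
  refine Eq.trans ?_ h2
  refine Eq.trans ?_ (congrFun (Bundle.Trivialization.continuousLinearMapAt_apply ℝ
    (trivializationAt E4 (TangentSpace (𝓡 4)) x₀) x) (X x)).symm
  rw [Bundle.Trivialization.linearMapAt_apply, if_pos]
  simpa using hx'

lemma DForm.apply_eq_inChart {k : ℕ} (α : DForm k M) {x₀ x : M}
    (hx : x ∈ (extChartAt (𝓡 4) x₀).source) (v : Fin k → TangentSpace (𝓡 4) x) :
    α x v = α.inChart x₀ (extChartAt (𝓡 4) x₀ x)
      (fun i => mfderiv (𝓡 4) 𝓘(ℝ, E4) (extChartAt (𝓡 4) x₀) x (v i)) := by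
  obtain ⟨y, hy, rfl⟩ : ∃ y ∈ (extChartAt (𝓡 4) x₀).target, (extChartAt (𝓡 4) x₀).symm y = x :=
    ⟨_, (extChartAt (𝓡 4) x₀).map_source hx, (extChartAt (𝓡 4) x₀).left_inv hx⟩
  rw [(extChartAt (𝓡 4) x₀).right_inv hy]
  refine congrArg (α _) (funext fun i => ?_)
  exact (mfderiv_symm_chart_apply hy (v i)).symm

omit [IsManifold (𝓡 4) ∞ M] in
lemma DForm.inChart_apply_two (α : DForm 2 M) (x₀ : M) (y v w : E4) :
    α.inChart x₀ y ![v, w] = α ((extChartAt (𝓡 4) x₀).symm y)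
      ![mfderiv 𝓘(ℝ, E4) (𝓡 4) (extChartAt (𝓡 4) x₀).symm y v,
        mfderiv 𝓘(ℝ, E4) (𝓡 4) (extChartAt (𝓡 4) x₀).symm y w] := by
  refine congrArg (α _) (funext fun i => ?_)
  fin_cases i <;> rfl

omit [IsManifold (𝓡 4) ∞ M] in
lemma DForm.swap (α : DForm 2 M) (x : M) (v w : TangentSpace (𝓡 4) x) :
    α x ![v, w] = -α x ![w, v] := by
  have := (α x).map_swap ![w, v] (show (0 : Fin 2) ≠ 1 by decide)
  refine Eq.trans (congrArg (α _) (funext fun i => ?_)) this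
  fin_cases i <;> rfl

lemma DForm.SmoothOn.contDiffAt {k : ℕ} {α : DForm k M} {W : Set M} (h : α.SmoothOn W)
    (hW : IsOpen W) {x₀ : M} {y : E4} (hy : y ∈ chartPart x₀ W) :
    ContDiffAt ℝ ∞ (α.inChart x₀) y :=
  (h x₀).contDiffAt ((isOpen_chartPart x₀ hW).mem_nhds hy)

/-- The derivative in a chart. -/
lemma fderiv_chart {E : Type*} [NormedAddCommGroup E] [NormedSpace ℝ E] {f : M → E} {x₀ : M} {y : E4}
    (hy : y ∈ (extChartAt (𝓡 4) x₀).target)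
    (hf : MDifferentiableAt (𝓡 4) 𝓘(ℝ, E) f ((extChartAt (𝓡 4) x₀).symm y)) :
    HasFDerivAt (fun y => f ((extChartAt (𝓡 4) x₀).symm y))
      ((mfderiv (𝓡 4) 𝓘(ℝ, E) f ((extChartAt (𝓡 4) x₀).symm y)).comp
        (mfderiv 𝓘(ℝ, E4) (𝓡 4) (extChartAt (𝓡 4) x₀).symm y)) y :=
  (hf.hasMFDerivAt.comp y (hasMFDerivAt_chart_symm hy)).hasFDerivAt

lemma fderiv_chart_apply {E : Type*} [NormedAddCommGroup E] [NormedSpace ℝ E] {f : M → E} {x₀ : M}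
    {y : E4} (hy : y ∈ (extChartAt (𝓡 4) x₀).target)
    (hf : MDifferentiableAt (𝓡 4) 𝓘(ℝ, E) f ((extChartAt (𝓡 4) x₀).symm y)) (v : E4) :
    fderiv ℝ (fun y => f ((extChartAt (𝓡 4) x₀).symm y)) y v =
      mfderiv (𝓡 4) 𝓘(ℝ, E) f ((extChartAt (𝓡 4) x₀).symm y)
        (mfderiv 𝓘(ℝ, E4) (𝓡 4) (extChartAt (𝓡 4) x₀).symm y v) :=
  have h := HasFDerivAt.fderiv (𝕜 := ℝ) (E := E4) (F := E) (fderiv_chart hy hf)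
  congrArg (fun l : E4 →L[ℝ] E => l v) h

end Charts

/-! ### Smoothness of Hamiltonian vector fields. -/

section Hamiltonian

variable {M : Type*} [TopologicalSpace M] [ChartedSpace E4 M] [IsManifold (𝓡 4) ∞ M]
  {Ω : DForm 2 M} {f : M → ℝ} {X : (x : M) → TangentSpace (𝓡 4) x}

lemma contDiffAt_comp_chart_symm {E : Type*} [NormedAddCommGroup E] [NormedSpace ℝ E] {f : M → E}
    {x₀ : M} {y : E4} {n : WithTop ℕ∞} (hn : n ≤ ∞) (hy : y ∈ (extChartAt (𝓡 4) x₀).target)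
    (hf : ContMDiffAt (𝓡 4) 𝓘(ℝ, E) n f ((extChartAt (𝓡 4) x₀).symm y)) :
    ContDiffAt ℝ n (fun y => f ((extChartAt (𝓡 4) x₀).symm y)) y := by
  have : IsManifold (𝓡 4) n M := IsManifold.of_le hn
  have h1 : ContMDiffAt 𝓘(ℝ, E4) (𝓡 4) n (extChartAt (𝓡 4) x₀).symm y :=
    (contMDiffOn_extChartAt_symm x₀).contMDiffAt ((isOpen_extChartAt_target x₀).mem_nhds hy)
  exact (hf.comp y h1).contDiffAt

/-- The equation of a Hamiltonian vector field in a chart. -/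
lemma IsHamiltonianField.inChart (h : IsHamiltonianField Ω f X)
    (hf : ContMDiff (𝓡 4) 𝓘(ℝ, ℝ) ∞ f) {x₀ : M} {y : E4} (hy : y ∈ (extChartAt (𝓡 4) x₀).target)
    (v : E4) : Ω.inChart x₀ y ![v, fieldInChart X x₀ y] =
      fderiv ℝ (fun y => f ((extChartAt (𝓡 4) x₀).symm y)) y v := by
  have h1 := h _ (mfderiv 𝓘(ℝ, E4) (𝓡 4) (extChartAt (𝓡 4) x₀).symm y v)
  refine Eq.trans ?_ (h1.trans
    (fderiv_chart_apply hy ((hf _).mdifferentiableAt (by simp)) v).symm)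
  refine (DForm.inChart_apply_two Ω x₀ y v _).trans ?_
  rw [mfderiv_symm_fieldInChart hy]

lemma IsSymplectic.inChart_nondegenerate (hΩ : IsSymplectic Ω) {x₀ : M} {y : E4}
    (hy : y ∈ (extChartAt (𝓡 4) x₀).target) {a : E4} (h : ∀ v, Ω.inChart x₀ y ![v, a] = 0) :
    a = 0 := by
  have h1 := hΩ.nondegenerate _ (mfderiv 𝓘(ℝ, E4) (𝓡 4) (extChartAt (𝓡 4) x₀).symm y a) ?_
  · rw [← mfderiv_chart_symm_apply hy a, h1]
    exact map_zero _
  intro w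
  have h2 := h (mfderiv (𝓡 4) 𝓘(ℝ, E4) (extChartAt (𝓡 4) x₀) ((extChartAt (𝓡 4) x₀).symm y) w)
  have h3 := (DForm.inChart_apply_two Ω x₀ y _ a).symm.trans h2
  rw [mfderiv_symm_chart_apply hy] at h3
  rw [DForm.swap, h3, neg_zero]

/-- Contraction of a `2`-form with its second argument. -/
noncomputable def contract (β : E4 [⋀^Fin 2]→L[ℝ] ℝ) : E4 →L[ℝ] (E4 →L[ℝ] ℝ) :=
  have h0 : ∀ a v : E4, Function.update ![0, a] 0 v = ![v, a] := fun a v =>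
    funext fun i => by fin_cases i <;> rfl
  have h1 : ∀ a v : E4, Function.update ![v, 0] 1 a = ![v, a] := fun a v =>
    funext fun i => by fin_cases i <;> rfl
  LinearMap.toContinuousLinearMap
    { toFun := fun a => LinearMap.toContinuousLinearMap
        { toFun := fun v => β ![v, a]
          map_add' := fun v w => by
            rw [← h0 a (v + w), ← h0 a v, ← h0 a w, β.map_update_add]
          map_smul' := fun c v => by
            rw [← h0 a (c • v), ← h0 a v, β.map_update_smul, RingHom.id_apply] }
      map_add' := fun a b => by
        ext v
        change β ![v, a + b] = β ![v, a] + β ![v, b]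
        rw [← h1 (a + b), ← h1 a, ← h1 b, β.map_update_add]
      map_smul' := fun c a => by
        ext v
        change β ![v, c • a] = c • β ![v, a]
        rw [← h1 (c • a), ← h1 a, β.map_update_smul] }

@[simp] lemma contract_apply (β : E4 [⋀^Fin 2]→L[ℝ] ℝ) (a v : E4) : contract β a v = β ![v, a] :=
  rfl

lemma contract_swap (β : E4 [⋀^Fin 2]→L[ℝ] ℝ) (a b : E4) : contract β a b = -contract β b a := by
  have := β.map_swap ![a, b] (show (0 : Fin 2) ≠ 1 by decide)
  refine Eq.trans (congrArg β (funext fun i => ?_)) this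
  fin_cases i <;> rfl

lemma IsSymplectic.contDiffAt_inChart (hΩ : IsSymplectic Ω) {x₀ : M} {y : E4}
    (hy : y ∈ (extChartAt (𝓡 4) x₀).target) : ContDiffAt ℝ ∞ (Ω.inChart x₀) y :=
  hΩ.smooth.contDiffAt isOpen_univ ⟨hy, trivial⟩

lemma IsSymplectic.contDiffAt_contract (hΩ : IsSymplectic Ω) {x₀ : M} {y : E4}
    (hy : y ∈ (extChartAt (𝓡 4) x₀).target) :
    ContDiffAt ℝ ∞ (fun y => contract (Ω.inChart x₀ y)) y := by
  obtain ⟨s, hs, hys, h3⟩ : ∃ s, IsOpen s ∧ y ∈ s ∧ ContDiffOn ℝ ∞ (Ω.inChart x₀) s :=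
    ⟨_, isOpen_extChartAt_target x₀, hy, fun z hz =>
      (hΩ.contDiffAt_inChart hz).contDiffWithinAt⟩
  have h4 : ContDiffOn ℝ ∞ (fun y => contract (Ω.inChart x₀ y)) s :=
    contDiffOn_clm_apply.2 fun a => contDiffOn_clm_apply.2 fun v =>
      (ContinuousAlternatingMap.apply ℝ E4 ℝ ![v, a]).contDiff.comp_contDiffOn h3
  exact h4.contDiffAt (hs.mem_nhds hys)

/-- Nondegeneracy and equality of dimensions make the contraction with the form invertible. The
field is the inverse applied to `df`, and inversion of operators is smooth. -/
lemma IsHamiltonianField.contDiffAt_fieldInChart (hΩ : IsSymplectic Ω)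
    (h : IsHamiltonianField Ω f X) (hf : ContMDiff (𝓡 4) 𝓘(ℝ, ℝ) ∞ f) {x₀ : M} {y : E4}
    (hy : y ∈ (extChartAt (𝓡 4) x₀).target) : ContDiffAt ℝ ∞ (fieldInChart X x₀) y := by
  have hinv : ∀ y ∈ (extChartAt (𝓡 4) x₀).target,
      (contract (Ω.inChart x₀ y)).IsInvertible := by
    intro y hy
    have hinj : Function.Injective (contract (Ω.inChart x₀ y)).toLinearMap := by
      rw [← LinearMap.ker_eq_bot, LinearMap.ker_eq_bot']
      intro a ha
      exact hΩ.inChart_nondegenerate hy fun v => congrArg (fun l : E4 →L[ℝ] ℝ => l v) ha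
    have hdim : Module.finrank ℝ E4 = Module.finrank ℝ (E4 →L[ℝ] ℝ) := by
      rw [LinearMap.toContinuousLinearMap.symm.finrank_eq, Subspace.dual_finrank_eq]
    exact ⟨(LinearEquiv.ofInjectiveOfFinrankEq _ hinj hdim).toContinuousLinearEquiv, rfl⟩
  have h1 : fieldInChart X x₀ =ᶠ[𝓝 y] fun y => (contract (Ω.inChart x₀ y)).inverse
      (fderiv ℝ (fun y => f ((extChartAt (𝓡 4) x₀).symm y)) y) := by
    filter_upwards [(isOpen_extChartAt_target x₀).mem_nhds hy] with y hy
    refine ((hinv y hy).inverse_apply_eq.2 ?_).symm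
    ext v
    exact (h.inChart hf hy v).symm
  refine ContDiffAt.congr_of_eventuallyEq ?_ h1
  have h2 := hΩ.contDiffAt_contract hy
  exact ((hinv y hy).contDiffAt_map_inverse.comp y h2).clm_apply
    ((contDiffAt_comp_chart_symm le_rfl hy (hf _)).fderiv_right (m := ∞) (by simp))

end Hamiltonian


/-! ### The Lie derivative of the symplectic form. -/

section Cartan

variable {E : Type*} [NormedAddCommGroup E] [NormedSpace ℝ E]

/-- The derivative at time `0` of the pull-back of a closed `2`-form by the flow of a Hamiltonian
vector field. -/
lemma hasDerivAt_pullback_zero {B : E → E →L[ℝ] E →L[ℝ] ℝ} {B' : E →L[ℝ] E →L[ℝ] E →L[ℝ] ℝ} {y : E}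
    (hB : HasFDerivAt B B' y) (hanti : ∀ y a b, B y a b = -B y b a)
    (hclosed : ∀ a b c, B' c b a - B' a b c + B' b a c = 0) {r : ℝ × E → E} (hr : ContDiffAt ℝ 2 r (0, y))
    (hr0 : ∀ᶠ y' in 𝓝 y, r (0, y') = y') {j : E → ℝ} (hj : ContDiffAt ℝ 2 j y)
    (hZ : ∀ᶠ y' in 𝓝 y, ∀ v, B y' (fderiv ℝ r (0, y') (1, 0)) v = fderiv ℝ j y' v) (a b : E) :
    HasDerivAt (fun h : ℝ => B (r (h, y)) (fderiv ℝ r (h, y) (0, b)) (fderiv ℝ r (h, y) (0, a)))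
      0 0 := by
  have hB'anti : ∀ c a b, B' c a b = -B' c b a := by
    intro c a b
    have h1 := fun a b => (hB.clm_apply (hasFDerivAt_const a y)).clm_apply (hasFDerivAt_const b y)
    have h4 := (h1 a b).congr_of_eventuallyEq (f₁ := fun y => -B y b a)
      (Eventually.of_forall fun y => (hanti y a b).symm)
    have h5 := congrArg (fun l : E →L[ℝ] ℝ => l c) (h4.unique (h1 b a).neg)
    simpa using h5
  set Z : E → E := fun y' => fderiv ℝ r (0, y') (1, 0) with hZdef
  have hdr : HasFDerivAt (fderiv ℝ r) (fderiv ℝ (fderiv ℝ r) (0, y)) (0, y) :=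
    ((hr.fderiv_right (m := 1) (by norm_num)).differentiableAt (by norm_num)).hasFDerivAt
  have hsymm : ∀ v w, fderiv ℝ (fderiv ℝ r) (0, y) v w = fderiv ℝ (fderiv ℝ r) (0, y) w v :=
    fun v w => hr.isSymmSndFDerivAt (by simp) v w
  have hZd : ∀ c, HasFDerivAt (fun y' => fderiv ℝ r (0, y') c)
      (((ContinuousLinearMap.apply ℝ E c).comp (fderiv ℝ (fderiv ℝ r) (0, y))).comp
        (ContinuousLinearMap.inr ℝ ℝ E)) y := fun c =>
    ((ContinuousLinearMap.apply ℝ E c).hasFDerivAt.comp (0, y) hdr).comp y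
      (hasFDerivAt_prodMk_right (0 : ℝ) y)
  set DZ : E → E := fun a => fderiv ℝ (fderiv ℝ r) (0, y) (0, a) (1, 0) with hDZ
  have hrd : HasFDerivAt r (fderiv ℝ r (0, y)) (0, y) :=
    (hr.differentiableAt (by norm_num)).hasFDerivAt
  have hr0' : r (0, y) = y := hr0.self_of_nhds
  have hid : ∀ a, fderiv ℝ r (0, y) (0, a) = a := by
    intro a
    have h1 := hrd.comp y (hasFDerivAt_prodMk_right (0 : ℝ) y)
    have h2 : HasFDerivAt (fun y' => r (0, y')) (ContinuousLinearMap.id ℝ E) y :=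
      (hasFDerivAt_id y).congr_of_eventuallyEq hr0
    exact congrArg (fun l : E →L[ℝ] E => l a) (h1.unique h2)
  -- the derivative of the Hamiltonian equation
  have hham : ∀ a b, B' a (Z y) b + B y (DZ a) b = fderiv ℝ (fderiv ℝ j) y a b := by
    intro a b
    have hdj : HasFDerivAt (fderiv ℝ j) (fderiv ℝ (fderiv ℝ j) y) y :=
      ((hj.fderiv_right (m := 1) (by norm_num)).differentiableAt (by norm_num)).hasFDerivAt
    have h1 := (ContinuousLinearMap.apply ℝ ℝ b).hasFDerivAt.comp y hdj
    have h2 := (ContinuousLinearMap.apply ℝ ℝ b).hasFDerivAt.comp y (hB.clm_apply (hZd (1, 0)))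
    have h3 := (h1.congr_of_eventuallyEq (f₁ := fun y' => B y' (Z y') b) (by
      filter_upwards [hZ] with y' h
      exact h b)).unique h2
    have h4 := congrArg (fun l : E →L[ℝ] ℝ => l a) h3
    simp at h4
    rw [h4]
    simp only [hZdef, hDZ]
    ring
  have hjsymm := hj.isSymmSndFDerivAt (by simp) a b
  -- the derivative in time
  have ht : HasDerivAt (fun h : ℝ => (h, y)) ((1 : ℝ), (0 : E)) 0 :=
    (hasDerivAt_id (0 : ℝ)).prodMk (hasDerivAt_const _ _)
  have e1 : HasDerivAt (fun h : ℝ => r (h, y)) (Z y) 0 := hrd.comp_hasDerivAt (0 : ℝ) ht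
  have e2 : HasDerivAt (fun h : ℝ => B (r (h, y))) (B' (Z y)) 0 := by
    have hB2 : HasFDerivAt B B' (r (0, y)) := by rw [hr0']; exact hB
    exact HasFDerivAt.comp_hasDerivAt (l := B) (l' := B') (f := fun h => r (h, y)) 0 hB2 e1
  -- Symmetry of the second derivative turns the time derivative of the differential of the flow
  -- into the spatial derivative of its generator.
  have e3 : ∀ a, HasDerivAt (fun h : ℝ => fderiv ℝ r (h, y) (0, a)) (DZ a) 0 := by
    intro a
    have h1 : HasDerivAt (fun h : ℝ => fderiv ℝ r (h, y)) (fderiv ℝ (fderiv ℝ r) (0, y) (1, 0)) 0 :=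
      hdr.comp_hasDerivAt (0 : ℝ) ht
    have h2 := h1.clm_apply (hasDerivAt_const (0 : ℝ) ((0 : ℝ), a))
    rw [map_zero, add_zero, hsymm] at h2
    exact h2
  -- By the product rule the derivative is `B' Z b a + B (DZ b) a + B b (DZ a)`, the Lie derivative.
  -- It vanishes by closedness, the differentiated Hamiltonian equation and the symmetry of the
  -- second derivative of `j`; this is Cartan's formula.
  have e4 := (e2.clm_apply (e3 b)).clm_apply (e3 a)
  refine e4.congr_deriv ?_
  simp only [hr0', hid, add_apply]
  have h1 := hclosed a b (Z y)
  have h2 := hham a b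
  have h3 := hham b a
  have h4 := hanti y b (DZ a)
  have h5 := hB'anti a b (Z y)
  have h6 := hB'anti b a (Z y)
  linarith

end Cartan


/-! ### Hamiltonian circle actions preserve the form and the invariant fields. -/

section Invariance

variable {M : Type*} [TopologicalSpace M] [ChartedSpace E4 M] [IsManifold (𝓡 4) ∞ M]
  {Ω : DForm 2 M} {H J : M → ℝ} {XH XJ : (x : M) → TangentSpace (𝓡 4) x} {U : Set M}
  {ρ : ℝ → M → M}

/-- A `2`-form at a point, as a function of two vectors of the model space. -/
noncomputable def DForm.pairing (Ω : DForm 2 M) (x : M) : E4 →L[ℝ] E4 →L[ℝ] ℝ := contract (Ω x)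

omit [IsManifold (𝓡 4) ∞ M] in
lemma DForm.pairing_apply (Ω : DForm 2 M) (x : M) (a v : TangentSpace (𝓡 4) x) :
    Ω.pairing x a v = Ω x ![v, a] := rfl

lemma DForm.pairing_eq_inChart (Ω : DForm 2 M) {x₀ x : M}
    (hx : x ∈ (extChartAt (𝓡 4) x₀).source) (a v : TangentSpace (𝓡 4) x) :
    Ω.pairing x a v = contract (Ω.inChart x₀ (extChartAt (𝓡 4) x₀ x))
      (mfderiv (𝓡 4) 𝓘(ℝ, E4) (extChartAt (𝓡 4) x₀) x a)
      (mfderiv (𝓡 4) 𝓘(ℝ, E4) (extChartAt (𝓡 4) x₀) x v) := by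
  refine (Ω.apply_eq_inChart hx ![v, a]).trans ?_
  refine congrArg (Ω.inChart _ _) (funext fun i => ?_)
  fin_cases i <;> rfl

namespace IsCircleAction

omit [IsManifold (𝓡 4) ∞ M] in
lemma contMDiffAt (hρ : IsCircleAction XJ U ρ) {x : M} (hx : x ∈ U) (t : ℝ) :
    ContMDiffAt (𝓘(ℝ, ℝ).prod (𝓡 4)) (𝓡 4) ∞ (fun q : ℝ × M => ρ q.1 q.2) (t, x) :=
  hρ.smooth.contMDiffAt ((isOpen_univ.prod hρ.isOpen).mem_nhds ⟨trivial, hx⟩)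

omit [IsManifold (𝓡 4) ∞ M] in
lemma contMDiffAt_time (hρ : IsCircleAction XJ U ρ) {x : M} (hx : x ∈ U) (t : ℝ) :
    ContMDiffAt (𝓡 4) (𝓡 4) ∞ (ρ t) x :=
  (hρ.contMDiffAt hx t).comp x (contMDiffAt_const.prodMk contMDiffAt_id)

omit [IsManifold (𝓡 4) ∞ M] in
lemma mdifferentiableAt (hρ : IsCircleAction XJ U ρ) {x : M} (hx : x ∈ U) (t : ℝ) :
    MDifferentiableAt (𝓡 4) (𝓡 4) (ρ t) x :=
  (hρ.contMDiffAt_time hx t).mdifferentiableAt (by simp)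

/-- The action in a chart. -/
noncomputable def _root_.RotationForms.actionInChart (ρ : ℝ → M → M) (x₀ : M) (z : ℝ × E4) : E4 :=
  extChartAt (𝓡 4) x₀ (ρ z.1 ((extChartAt (𝓡 4) x₀).symm z.2))

lemma contDiffAt_actionInChart (hρ : IsCircleAction XJ U ρ) {x₀ : M} {z : ℝ × E4}
    (hz : z.2 ∈ (extChartAt (𝓡 4) x₀).target) (hzU : (extChartAt (𝓡 4) x₀).symm z.2 ∈ U)
    (hs : ρ z.1 ((extChartAt (𝓡 4) x₀).symm z.2) ∈ (extChartAt (𝓡 4) x₀).source) :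
    ContDiffAt ℝ ∞ (actionInChart ρ x₀) z := by
  have h1 : ContMDiffAt 𝓘(ℝ, ℝ × E4) (𝓘(ℝ, ℝ).prod (𝓡 4)) ∞
      (fun z : ℝ × E4 => (z.1, (extChartAt (𝓡 4) x₀).symm z.2)) z := by
    refine ContMDiffAt.prodMk contDiffAt_fst.contMDiffAt ?_
    exact ((contMDiffOn_extChartAt_symm x₀).contMDiffAt
      ((isOpen_extChartAt_target x₀).mem_nhds hz)).comp z contDiffAt_snd.contMDiffAt
  have h2 := (hρ.contMDiffAt hzU z.1).comp z h1
  have h3 : ContMDiffAt (𝓡 4) 𝓘(ℝ, E4) ∞ (extChartAt (𝓡 4) x₀)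
      (ρ z.1 ((extChartAt (𝓡 4) x₀).symm z.2)) :=
    contMDiffAt_extChartAt' (by rwa [extChartAt_source] at hs)
  exact (h3.comp z h2).contDiffAt

lemma fderiv_actionInChart_zero (hρ : IsCircleAction XJ U ρ) {x₀ : M} {y : E4}
    (hy : y ∈ (extChartAt (𝓡 4) x₀).target) (hU : (extChartAt (𝓡 4) x₀).symm y ∈ U) :
    fderiv ℝ (actionInChart ρ x₀) (0, y) (1, 0) = fieldInChart XJ x₀ y := by
  have hz := hρ.zero _ hU
  have hs : ρ 0 ((extChartAt (𝓡 4) x₀).symm y) ∈ (extChartAt (𝓡 4) x₀).source := by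
    rw [hz]; exact (extChartAt (𝓡 4) x₀).map_target hy
  have h1 := ((hρ.contDiffAt_actionInChart (z := (0, y)) hy hU hs).differentiableAt
    (by simp)).hasFDerivAt
  have h2 : HasDerivAt (fun h : ℝ => actionInChart ρ x₀ (h, y))
      (fderiv ℝ (actionInChart ρ x₀) (0, y) (1, 0)) 0 := by
    have ht : HasDerivAt (fun h : ℝ => (h, y)) ((1 : ℝ), (0 : E4)) 0 :=
      (hasDerivAt_id (0 : ℝ)).prodMk (hasDerivAt_const _ _)
    exact HasFDerivAt.comp_hasDerivAt (l := actionInChart ρ x₀) (f := fun h => (h, y)) 0 h1 ht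
  have h3 := (hasMFDerivAt_chart hs).comp (0 : ℝ) (hρ.generator _ hU 0)
  have h4 : HasDerivAt (fun h : ℝ => actionInChart ρ x₀ (h, y)) _ 0 :=
    HasFDerivAt.hasDerivAt (𝕜 := ℝ) (F := E4) h3.hasFDerivAt
  rw [h2.unique h4]
  let g : M → E4 := fun z => mfderiv (𝓡 4) 𝓘(ℝ, E4) (extChartAt (𝓡 4) x₀) z (XJ z)
  have h5 : g (ρ 0 ((extChartAt (𝓡 4) x₀).symm y)) = g ((extChartAt (𝓡 4) x₀).symm y) := by rw [hz]
  refine Eq.trans ?_ h5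
  change mfderiv (𝓡 4) 𝓘(ℝ, E4) (extChartAt (𝓡 4) x₀) _ ((1 : ℝ) • XJ _) = _
  rw [one_smul]

lemma mfderiv_chart_action (hρ : IsCircleAction XJ U ρ) {x₀ : M} {z : ℝ × E4}
    (hz : z.2 ∈ (extChartAt (𝓡 4) x₀).target) (hzU : (extChartAt (𝓡 4) x₀).symm z.2 ∈ U)
    (hs : ρ z.1 ((extChartAt (𝓡 4) x₀).symm z.2) ∈ (extChartAt (𝓡 4) x₀).source) (v : E4) :
    mfderiv (𝓡 4) 𝓘(ℝ, E4) (extChartAt (𝓡 4) x₀) (ρ z.1 ((extChartAt (𝓡 4) x₀).symm z.2))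
      (mfderiv (𝓡 4) (𝓡 4) (ρ z.1) ((extChartAt (𝓡 4) x₀).symm z.2)
        (mfderiv 𝓘(ℝ, E4) (𝓡 4) (extChartAt (𝓡 4) x₀).symm z.2 v)) =
      fderiv ℝ (actionInChart ρ x₀) z (0, v) := by
  have h1 := (hasMFDerivAt_chart hs).comp _ (hρ.mdifferentiableAt hzU z.1).hasMFDerivAt
  have h2 := HasMFDerivAt.hasFDerivAt (h1.comp z.2 (hasMFDerivAt_chart_symm hz))
  have h3 := ((hρ.contDiffAt_actionInChart hz hzU hs).differentiableAt (by simp)).hasFDerivAt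
  have h4 : HasFDerivAt (fun y => actionInChart ρ x₀ (z.1, y))
    ((fderiv ℝ (actionInChart ρ x₀) z).comp (ContinuousLinearMap.inr ℝ ℝ E4)) z.2 :=
    HasFDerivAt.comp z.2 (g := actionInChart ρ x₀) (f := fun y => (z.1, y)) h3
      (hasFDerivAt_prodMk_right z.1 z.2)
  exact congrArg (fun l : E4 →L[ℝ] E4 => l v) (HasFDerivAt.unique (𝕜 := ℝ) (E := E4) (F := E4) h2 h4)

/-- The pull-back of the symplectic form by a Hamiltonian circle action is stationary at `0`. -/
lemma hasDerivAt_pairing_zero (hΩ : IsSymplectic Ω) (hJ : ContMDiff (𝓡 4) 𝓘(ℝ, ℝ) ∞ J)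
    (hXJ : IsHamiltonianField Ω J XJ) (hρ : IsCircleAction XJ U ρ) {x : M} (hx : x ∈ U)
    (v w : TangentSpace (𝓡 4) x) : HasDerivAt (fun h : ℝ => Ω.pairing (ρ h x)
      (mfderiv (𝓡 4) (𝓡 4) (ρ h) x w) (mfderiv (𝓡 4) (𝓡 4) (ρ h) x v)) 0 0 := by
  obtain ⟨x₀, y, hy, rfl⟩ :
      ∃ x₀ : M, ∃ y ∈ (extChartAt (𝓡 4) x₀).target, (extChartAt (𝓡 4) x₀).symm y = x :=
    ⟨x, _, mem_extChartAt_target x, extChartAt_to_inv x⟩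
  obtain ⟨v, rfl⟩ : ∃ v' : E4, mfderiv 𝓘(ℝ, E4) (𝓡 4) (extChartAt (𝓡 4) x₀).symm y v' = v :=
    ⟨_, mfderiv_symm_chart_apply hy v⟩
  obtain ⟨w, rfl⟩ : ∃ v' : E4, mfderiv 𝓘(ℝ, E4) (𝓡 4) (extChartAt (𝓡 4) x₀).symm y v' = w :=
    ⟨_, mfderiv_symm_chart_apply hy w⟩
  set e := extChartAt (𝓡 4) x₀ with he
  have hz := hρ.zero _ hx
  have hs : ρ 0 (e.symm y) ∈ e.source := by rw [hz]; exact e.map_target hy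
  have hr := hρ.contDiffAt_actionInChart (z := (0, y)) hy hx hs
  have hnear : ∀ᶠ y' in 𝓝 y, y' ∈ e.target ∧ e.symm y' ∈ U :=
    (isOpen_chartPart x₀ hρ.isOpen).mem_nhds ⟨hy, hx⟩
  have hΩd : ∀ y' ∈ e.target, DifferentiableAt ℝ (Ω.inChart x₀) y' := fun y' hy' =>
    (hΩ.contDiffAt_inChart hy').differentiableAt (by simp)
  have hcontr : ContDiffAt ℝ ∞ (fun y => contract (Ω.inChart x₀ y)) y :=
    hΩ.contDiffAt_contract hy
  have hBd := (hcontr.differentiableAt (by simp)).hasFDerivAt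
  have hB' : ∀ c a b, fderiv ℝ (fun y => contract (Ω.inChart x₀ y)) y c a b =
      fderiv ℝ (fun y => Ω.inChart x₀ y ![b, a]) y c := by
    intro c a b
    have h1 := (hBd.clm_apply (hasFDerivAt_const a y)).clm_apply (hasFDerivAt_const b y)
    have h2 := h1.fderiv
    simp only [contract_apply] at h2
    rw [h2]
    simp
  have h2 : (2 : WithTop ℕ∞) ≤ ∞ := 
    WithTop.coe_le_coe.2 (le_top : (2 : ℕ∞) ≤ ⊤)
  have key := hasDerivAt_pullback_zero (B := fun y => contract (Ω.inChart x₀ y)) hBd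
    (fun y a b => contract_swap _ a b) (fun a b c => ?_) (hr.of_le h2) ?_
    (contDiffAt_comp_chart_symm h2 hy ((hJ _).of_le h2)) ?_ v w
  · refine key.congr_of_eventuallyEq ?_
    have hc : ContinuousAt (fun h : ℝ => ρ h (e.symm y)) 0 :=
      (hρ.contMDiffAt hx 0).continuousAt.comp (f := fun h : ℝ => (h, e.symm y)) (by fun_prop)
    filter_upwards [hc.eventually ((isOpen_extChartAt_source x₀).mem_nhds hs)] with h hh
    rw [Ω.pairing_eq_inChart hh, hρ.mfderiv_chart_action (z := (h, y)) hy hx hh,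
      hρ.mfderiv_chart_action (z := (h, y)) hy hx hh]
    rfl
  · have h1 := hΩ.closed x₀ y ⟨hy, trivial⟩
    have h2 := congrArg (fun l => l ![c, a, b]) h1
    rw [extDeriv_apply (hΩd y hy)] at h2
    simp [Fin.sum_univ_succ] at h2
    have e1 : Fin.removeNth 1 ![c, a, b] = ![c, b] := funext fun i => by fin_cases i <;> rfl
    have e2 : Fin.removeNth 2 ![c, a, b] = ![c, a] := funext fun i => by fin_cases i <;> rfl
    rw [e1, e2] at h2
    rw [hB', hB', hB']
    linarith
  · filter_upwards [hnear] with y' hy'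
    simp only [actionInChart]
    rw [hρ.zero _ hy'.2, e.right_inv hy'.1]
  · filter_upwards [hnear] with y' hy' v
    rw [hρ.fderiv_actionInChart_zero hy'.1 hy'.2]
    exact hXJ.inChart hJ hy'.1 v

/-- A Hamiltonian circle action preserves the symplectic form. -/
lemma pairing_mfderiv (hΩ : IsSymplectic Ω) (hJ : ContMDiff (𝓡 4) 𝓘(ℝ, ℝ) ∞ J)
    (hXJ : IsHamiltonianField Ω J XJ) (hρ : IsCircleAction XJ U ρ) {x : M} (hx : x ∈ U) (u : ℝ)
    (v w : TangentSpace (𝓡 4) x) : Ω.pairing (ρ u x) (mfderiv (𝓡 4) (𝓡 4) (ρ u) x w)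
      (mfderiv (𝓡 4) (𝓡 4) (ρ u) x v) = Ω.pairing x w v := by
  let D : ℝ → E4 → E4 := fun u a => mfderiv (𝓡 4) (𝓡 4) (ρ u) x a
  have hadd : ∀ h u (a : TangentSpace (𝓡 4) x), D (h + u) a =
      mfderiv (𝓡 4) (𝓡 4) (ρ h) (ρ u x) (mfderiv (𝓡 4) (𝓡 4) (ρ u) x a) := by
    intro h u a
    have h1 : ρ (h + u) =ᶠ[𝓝 x] ρ h ∘ ρ u := by
      filter_upwards [hρ.isOpen.mem_nhds hx] with y hy
      exact hρ.add h u y hy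
    have h2 := (hρ.mdifferentiableAt (hρ.mapsTo u x hx) h).hasMFDerivAt.comp x
      (hρ.mdifferentiableAt hx u).hasMFDerivAt
    have h3 := (h2.congr_of_eventuallyEq h1).mfderiv
    exact congrArg (fun l : E4 →L[ℝ] E4 => l a) h3
  -- The group law reduces the derivative at time `u` to the derivative at time `0` at the point `ρ
  -- u x`.
  have hd : ∀ u, HasDerivAt (fun u => Ω.pairing (ρ u x) (D u w) (D u v)) 0 u := by
    intro u
    have h1 := hρ.hasDerivAt_pairing_zero hΩ hJ hXJ (hρ.mapsTo u x hx)
      (mfderiv (𝓡 4) (𝓡 4) (ρ u) x v) (mfderiv (𝓡 4) (𝓡 4) (ρ u) x w)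
    have h2 : HasDerivAt (fun t : ℝ => t - u) 1 u := (hasDerivAt_id u).sub_const u
    have h3 := HasDerivAt.comp_of_eq (h := fun t : ℝ => t - u) u h1 h2 (sub_self u).symm
    rw [zero_mul] at h3
    refine h3.congr_of_eventuallyEq (Eventually.of_forall fun t => ?_)
    have h4 : ρ (t - u) (ρ u x) = ρ t x := by rw [← hρ.add _ _ x hx, sub_add_cancel]
    have h5 := hadd (t - u) u w
    have h6 := hadd (t - u) u v
    rw [sub_add_cancel] at h5 h6
    simp only [Function.comp_apply, h4]
    rw [h5, h6]
  have hconst := is_const_of_deriv_eq_zero (fun u => (hd u).differentiableAt)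
    (fun u => (hd u).deriv) u 0
  refine hconst.trans ?_
  have h0 : ∀ a : TangentSpace (𝓡 4) x, D 0 a = a := by
    intro a
    have h1 : ρ 0 =ᶠ[𝓝 x] id := by
      filter_upwards [hρ.isOpen.mem_nhds hx] with y hy
      exact hρ.zero y hy
    have h2 := ((hasMFDerivAt_id (I := 𝓡 4) x).congr_of_eventuallyEq h1).mfderiv
    exact congrArg (fun l : E4 →L[ℝ] E4 => l a) h2
  simp only [h0, hρ.zero x hx]

omit [IsManifold (𝓡 4) ∞ M] in
lemma mfderiv_comp_time {E : Type*} [NormedAddCommGroup E] [NormedSpace ℝ E] {f : M → E}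
    (hρ : IsCircleAction XJ U ρ) (hf : ∀ u, ∀ x ∈ U, f (ρ u x) = f x) {x : M} (hx : x ∈ U)
    (hfd : ∀ x, MDifferentiableAt (𝓡 4) 𝓘(ℝ, E) f x) (u : ℝ) (v : TangentSpace (𝓡 4) x) :
    mfderiv (𝓡 4) 𝓘(ℝ, E) f (ρ u x) (mfderiv (𝓡 4) (𝓡 4) (ρ u) x v) =
      mfderiv (𝓡 4) 𝓘(ℝ, E) f x v := by
  have h1 := (hfd (ρ u x)).hasMFDerivAt.comp x (hρ.mdifferentiableAt hx u).hasMFDerivAt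
  have h2 : f ∘ ρ u =ᶠ[𝓝 x] f := by
    filter_upwards [hρ.isOpen.mem_nhds hx] with y hy
    exact hf u y hy
  have h3 := (h1.congr_of_eventuallyEq h2.symm).mfderiv
  exact (congrArg (fun l : E4 →L[ℝ] E => l v) h3).symm

omit [IsManifold (𝓡 4) ∞ M] in
lemma mfderiv_surjective (hρ : IsCircleAction XJ U ρ) {x : M} (hx : x ∈ U) (u : ℝ)
    (w : TangentSpace (𝓡 4) (ρ u x)) : ∃ v, mfderiv (𝓡 4) (𝓡 4) (ρ u) x v = w := by
  have hback : ρ (-u) (ρ u x) = x := by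
    rw [← hρ.add _ _ x hx, neg_add_cancel, hρ.zero x hx]
  have hux := hρ.mapsTo u x hx
  have h1 : ρ u ∘ ρ (-u) =ᶠ[𝓝 (ρ u x)] id := by
    filter_upwards [hρ.isOpen.mem_nhds hux] with y hy
    rw [Function.comp_apply, ← hρ.add _ _ y hy, add_neg_cancel, hρ.zero y hy, id]
  have h2 := (hρ.mdifferentiableAt (hρ.mapsTo (-u) _ hux) u).hasMFDerivAt.comp (ρ u x)
    (hρ.mdifferentiableAt hux (-u)).hasMFDerivAt
  have h3 := hasMFDerivAt_unique h2 ((hasMFDerivAt_id (I := 𝓡 4) (ρ u x)).congr_of_eventuallyEq h1)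
  let g : M → E4 → E4 := fun z a => mfderiv (𝓡 4) (𝓡 4) (ρ u) z a
  have h4 : g (ρ (-u) (ρ u x)) (mfderiv (𝓡 4) (𝓡 4) (ρ (-u)) (ρ u x) w) = w :=
    congrArg (fun l : E4 →L[ℝ] E4 => l w) h3
  rw [hback] at h4
  exact ⟨_, h4⟩

/-- A Hamiltonian circle action preserves the Hamiltonian vector fields of invariant functions. -/
lemma mfderiv_hamiltonianField (hΩ : IsSymplectic Ω) (hJ : ContMDiff (𝓡 4) 𝓘(ℝ, ℝ) ∞ J)
    (hXJ : IsHamiltonianField Ω J XJ) (hρ : IsCircleAction XJ U ρ)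
    (hH : ContMDiff (𝓡 4) 𝓘(ℝ, ℝ) ∞ H) (hXH : IsHamiltonianField Ω H XH)
    (hinv : ∀ u, ∀ x ∈ U, H (ρ u x) = H x) {x : M} (hx : x ∈ U) (u : ℝ) :
    mfderiv (𝓡 4) (𝓡 4) (ρ u) x (XH x) = XH (ρ u x) := by
  -- Every `w` is the image of some `v`, and the action preserves both `Ω` and `dH`. So the two
  -- vectors have the same pairing with all `w`, and nondegeneracy makes them equal.
  have h1 : ∀ w : TangentSpace (𝓡 4) (ρ u x),
      Ω.pairing (ρ u x) (mfderiv (𝓡 4) (𝓡 4) (ρ u) x (XH x)) w =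
        Ω.pairing (ρ u x) (XH (ρ u x)) w := by
    intro w
    obtain ⟨v, rfl⟩ := hρ.mfderiv_surjective hx u w
    rw [hρ.pairing_mfderiv hΩ hJ hXJ hx]
    refine (hXH x v).trans ?_
    refine Eq.trans ?_ (hXH (ρ u x) _).symm
    exact (hρ.mfderiv_comp_time hinv hx (fun x => (hH x).mdifferentiableAt (by simp)) u v).symm
  have h2 := hΩ.nondegenerate (ρ u x)
    (mfderiv (𝓡 4) (𝓡 4) (ρ u) x (XH x) - XH (ρ u x)) fun w => by
      rw [Ω.swap, neg_eq_zero]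
      change Ω.pairing (ρ u x) (mfderiv (𝓡 4) (𝓡 4) (ρ u) x (XH x) - XH (ρ u x)) w = 0
      have h3 := congrArg (fun l : E4 →L[ℝ] ℝ => l w) ((Ω.pairing (ρ u x)).map_sub
        (mfderiv (𝓡 4) (𝓡 4) (ρ u) x (XH x)) (XH (ρ u x)))
      refine h3.trans ?_
      exact sub_eq_zero.2 (h1 w)
  exact sub_eq_zero.1 h2

end IsCircleAction

end Invariance


/-! ### Flows on compact invariant sets. -/

section Flow

variable {M : Type*} [TopologicalSpace M] [ChartedSpace E4 M] [IsManifold (𝓡 4) ∞ M]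
  {X : (x : M) → TangentSpace (𝓡 4) x}

/-- A vector field of class `C¹` has a continuous local flow. -/
lemma exists_local_flow (x₀ : M)
    (hX : ContDiffAt ℝ 1 (fieldInChart X x₀) (extChartAt (𝓡 4) x₀ x₀)) :
    ∃ W : Set M, IsOpen W ∧ x₀ ∈ W ∧ ∃ δ > 0, ∃ ψ : M → ℝ → M,
      (∀ x ∈ W, ψ x 0 = x ∧ IsMIntegralCurveOn (ψ x) X (Ioo (-δ) δ)) ∧
      ContinuousOn (fun q : ℝ × M => ψ q.2 q.1) (Ioo (-δ) δ ×ˢ W) := by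
  set e := extChartAt (𝓡 4) x₀ with he
  obtain ⟨ε, hε, a, r, L, K, hr, hpl⟩ := IsPicardLindelof.of_contDiffAt_one hX
  obtain ⟨α, hα, hαc⟩ :=
    (hpl 0).exists_forall_mem_closedBall_eq_hasDerivWithinAt_continuousOn
  simp only [zero_sub, zero_add] at hα hαc
  have hx₀ : e x₀ ∈ Metric.closedBall (e x₀) (r : ℝ) := Metric.mem_closedBall_self r.2
  have hnh : Metric.closedBall (e x₀) (r : ℝ) ×ˢ Icc (-ε) ε ∈ 𝓝 (e x₀, (0 : ℝ)) :=
    prod_mem_nhds (Metric.closedBall_mem_nhds _ hr) (Icc_mem_nhds (by linarith) hε)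
  have h0 : α (e x₀, 0) = e x₀ := (hα _ hx₀).1
  have hcat : ContinuousAt α (e x₀, 0) := hαc.continuousAt hnh
  have hev : ∀ᶠ z in 𝓝 (e x₀, (0 : ℝ)), α z ∈ e.target :=
    hcat.eventually (by rw [h0]; exact extChartAt_target_mem_nhds x₀)
  obtain ⟨η, hη, hball⟩ := Metric.eventually_nhds_iff_ball.1 (hev.and hnh)
  rw [← ball_prod_same] at hball
  have hball' : ∀ y ∈ Metric.ball (e x₀) η, ∀ t ∈ Ioo (-η) η, α (y, t) ∈ e.target ∧
      y ∈ Metric.closedBall (e x₀) (r : ℝ) ∧ t ∈ Icc (-ε) ε := by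
    intro y hy t ht
    have := hball (y, t) ⟨hy, by rw [Real.ball_eq_Ioo]; simpa using ht⟩
    exact ⟨this.1, this.2⟩
  have hηε : η ≤ ε := by
    by_contra! h
    have := (hball' (e x₀) (Metric.mem_ball_self hη) ((ε + η) / 2)
      ⟨by linarith, by linarith⟩).2.2.2
    linarith
  have hWo : IsOpen (e.source ∩ e ⁻¹' Metric.ball (e x₀) η) :=
    (continuousOn_extChartAt x₀).isOpen_inter_preimage (isOpen_extChartAt_source x₀)
      Metric.isOpen_ball
  refine ⟨e.source ∩ e ⁻¹' Metric.ball (e x₀) η, hWo,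
    ⟨mem_extChartAt_source x₀, Metric.mem_ball_self hη⟩, η, hη,
    fun x t => e.symm (α (e x, t)), ?_, ?_⟩
  · rintro x ⟨hxs, hx⟩
    have hx0 := hball' (e x) hx 0 ⟨by linarith, hη⟩
    refine ⟨?_, fun t ht => ?_⟩
    · change e.symm (α (e x, 0)) = x
      rw [(hα _ hx0.2.1).1, e.left_inv hxs]
    · have h1 := hball' (e x) hx t ht
      have h2 : HasDerivAt (fun t => α (e x, t)) (fieldInChart X x₀ (α (e x, t))) t :=
        ((hα _ h1.2.1).2 t h1.2.2).hasDerivAt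
          (Icc_mem_nhds (by linarith [ht.1]) (by linarith [ht.2]))
      have h3 := (hasMFDerivAt_chart_symm h1.1).comp t (HasFDerivAt.hasMFDerivAt h2.hasFDerivAt)
      refine HasMFDerivAt.hasMFDerivWithinAt (h3.congr_mfderiv ?_)
      ext
      refine Eq.trans ?_ (Eq.trans (mfderiv_symm_fieldInChart (X := X) h1.1) ?_)
      · change mfderiv 𝓘(ℝ, E4) (𝓡 4) e.symm _ ((1 : ℝ) • fieldInChart X x₀ _) = _
        rw [one_smul]
      · exact (one_smul ℝ (X (e.symm (α (e x, t))))).symm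
  · refine (continuousOn_extChartAt_symm x₀).comp (t := e.target)
      (f := fun q : ℝ × M => α (e q.2, q.1)) ?_ fun q hq => (hball' _ hq.2.2 _ hq.1).1
    refine hαc.comp (f := fun q : ℝ × M => (e q.2, q.1)) ?_ fun q hq =>
      (hball' _ hq.2.2 _ hq.1).2
    exact ((continuousOn_extChartAt x₀).comp continuousOn_snd fun q hq => hq.2.1).prodMk
      continuousOn_fst

variable [T2Space M]

/-- A vector field of class `C¹` is complete on compact invariant sets. -/
lemma exists_integralCurve_of_invariant
    (hX : ∀ x₀, ContDiffAt ℝ 1 (fieldInChart X x₀) (extChartAt (𝓡 4) x₀ x₀)) {C : Set M}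
    (hC : IsCompact C) (hinv : ∀ (γ : ℝ → M) (a b : ℝ), IsMIntegralCurveOn γ X (Ioo a b) →
      ∀ t₀ ∈ Ioo a b, γ t₀ ∈ C → ∀ t ∈ Ioo a b, γ t ∈ C) {x : M} (hx : x ∈ C) :
    ∃ γ, γ 0 = x ∧ IsMIntegralCurve γ X := by
  have hv : ContMDiff (𝓡 4) (𝓡 4).tangent 1 (fun x => (⟨x, X x⟩ : TangentBundle (𝓡 4) M)) :=
    fun x₀ => contMDiffAt_section_of_chart (hX x₀) (by exact_mod_cast le_top)
  -- By compactness one time of existence serves all points of `C`.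
  obtain ⟨δ, hδ, hloc⟩ : ∃ δ > 0, ∀ x ∈ C, ∃ γ : ℝ → M, γ 0 = x ∧
      IsMIntegralCurveOn γ X (Ioo (-δ) δ) := by
    refine hC.induction_on (p := fun s => ∃ δ > 0, ∀ x ∈ s, ∃ γ : ℝ → M, γ 0 = x ∧
      IsMIntegralCurveOn γ X (Ioo (-δ) δ)) ⟨1, one_pos, by simp⟩ ?_ ?_ ?_
    · rintro s t hst ⟨δ, hδ, h⟩
      exact ⟨δ, hδ, fun x hx => h x (hst hx)⟩
    · rintro s t ⟨δ, hδ, h⟩ ⟨δ', hδ', h'⟩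
      refine ⟨min δ δ', lt_min hδ hδ', fun x hx => ?_⟩
      rcases hx with hx | hx
      · obtain ⟨γ, h1, h2⟩ := h x hx
        exact ⟨γ, h1, h2.mono (Ioo_subset_Ioo (by simp) (by simp))⟩
      · obtain ⟨γ, h1, h2⟩ := h' x hx
        exact ⟨γ, h1, h2.mono (Ioo_subset_Ioo (by simp) (by simp))⟩
    · intro x _
      obtain ⟨W, hWo, hxW, δ, hδ, ψ, hψ, -⟩ := exists_local_flow x (hX x)
      exact ⟨W, mem_nhdsWithin_of_mem_nhds (hWo.mem_nhds hxW), δ, hδ, fun x hx => ⟨ψ x, hψ x hx⟩⟩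
  -- A curve that stays in `C` can be prolonged by `δ / 2` at both ends: new pieces of half-width
  -- `δ` are attached at distance `δ / 2` from the ends.
  have hlong : ∀ n : ℕ, ∃ γ : ℝ → M, γ 0 = x ∧
      IsMIntegralCurveOn γ X (Ioo (-(δ + n * (δ / 2))) (δ + n * (δ / 2))) := by
    intro n
    induction n with
    | zero => simpa using hloc x hx
    | succ n ih =>
      obtain ⟨γ, h0, hγ⟩ := ih
      set a := δ + n * (δ / 2) with ha
      have ha0 : δ ≤ a := by rw [ha]; linarith [show 0 ≤ n * (δ / 2) by positivity]
      have hsucc : δ + (n + 1 : ℕ) * (δ / 2) = a + δ / 2 := by push_cast; rw [ha]; ring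
      rw [hsucc]
      have hγC := hinv γ _ _ hγ 0 ⟨by linarith, by linarith⟩ (h0 ▸ hx)
      obtain ⟨γ₁, h1, hγ₁⟩ := hloc _ (hγC (a - δ / 2) ⟨by linarith, by linarith⟩)
      obtain ⟨γ₂, h2, hγ₂⟩ := hloc _ (hγC (-(a - δ / 2)) ⟨by linarith, by linarith⟩)
      have e1 : IsMIntegralCurveOn (γ₁ ∘ (· - (a - δ / 2))) X (Ioo (a - δ / 2 - δ) (a + δ / 2)) :=
        ((isMIntegralCurveOn_comp_sub (dt := a - δ / 2)).2 hγ₁).mono fun t ht =>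
          ⟨by linarith [ht.1], by linarith [ht.2]⟩
      have e2 : IsMIntegralCurveOn (γ₂ ∘ (· + (a - δ / 2))) X
          (Ioo (-(a + δ / 2)) (-(a - δ / 2 - δ))) :=
        ((isMIntegralCurveOn_comp_add (dt := a - δ / 2)).2 hγ₂).mono fun t ht =>
          ⟨by linarith [ht.1], by linarith [ht.2]⟩
      have e3 := isMIntegralCurveOn_piecewise hv hγ e1 (t₀ := a - δ / 2)
        ⟨⟨by linarith, by linarith⟩, by linarith, by linarith⟩ (by simp [h1])
      set γ' := piecewise (Ioo (-a) a) γ (γ₁ ∘ (· - (a - δ / 2))) with hγ'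
      have hγ'γ : ∀ t ∈ Ioo (-a) a, γ' t = γ t := fun t ht => piecewise_eq_of_mem _ _ _ ht
      have e4 : IsMIntegralCurveOn γ' X (Ioo (-a) (a + δ / 2)) := e3.mono fun t ht => by
        rcases lt_or_ge t a with h | h
        · exact Or.inl ⟨ht.1, h⟩
        · exact Or.inr ⟨by linarith, ht.2⟩
      have e5 := isMIntegralCurveOn_piecewise hv e4 e2 (t₀ := -(a - δ / 2))
        ⟨⟨by linarith, by linarith⟩, by linarith, by linarith⟩ (by
          rw [hγ'γ _ ⟨by linarith, by linarith⟩]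
          simp [h2])
      refine ⟨_, ?_, e5.mono fun t ht => ?_⟩
      · rw [piecewise_eq_of_mem _ _ _
            (show (0 : ℝ) ∈ Ioo (-a) (a + δ / 2) from ⟨by linarith, by linarith⟩),
          hγ'γ _ ⟨by linarith, by linarith⟩, h0]
      · rcases lt_or_ge (-a) t with h | h
        · exact Or.inl ⟨h, ht.2⟩
        · exact Or.inr ⟨ht.1, by linarith⟩
  refine (exists_isMIntegralCurve_iff_exists_isMIntegralCurveOn_Ioo hv x).2 fun a => ?_
  obtain ⟨n, hn⟩ := exists_nat_gt (a / (δ / 2))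
  obtain ⟨γ, h1, h2⟩ := hlong n
  rw [div_lt_iff₀ (by positivity)] at hn
  exact ⟨γ, h1, h2.mono (Ioo_subset_Ioo (by linarith) (by linarith))⟩

/-- The flow of a vector field of class `C¹` on a compact invariant set. -/
lemma exists_flow
    (hX : ∀ x₀, ContDiffAt ℝ 1 (fieldInChart X x₀) (extChartAt (𝓡 4) x₀ x₀)) {C : Set M}
    (hC : IsCompact C) (hinv : ∀ (γ : ℝ → M) (a b : ℝ), IsMIntegralCurveOn γ X (Ioo a b) →
      ∀ t₀ ∈ Ioo a b, γ t₀ ∈ C → ∀ t ∈ Ioo a b, γ t ∈ C) :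
    ∃ φ : ℝ → M → M, (∀ x ∈ C, φ 0 x = x ∧ IsMIntegralCurve (fun t => φ t x) X ∧
        ∀ t, φ t x ∈ C) ∧
      (∀ x ∈ C, ∀ t t', φ (t + t') x = φ t (φ t' x)) ∧
      ContinuousOn (fun q : ℝ × M => φ q.1 q.2) (univ ×ˢ C) := by
  have hv : ContMDiff (𝓡 4) (𝓡 4).tangent 1 (fun x => (⟨x, X x⟩ : TangentBundle (𝓡 4) M)) :=
    fun x₀ => contMDiffAt_section_of_chart (hX x₀) (by exact_mod_cast le_top)
  have hex : ∀ x ∈ C, ∃ γ, γ 0 = x ∧ IsMIntegralCurve γ X := fun x hx =>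
    exists_integralCurve_of_invariant hX hC hinv hx
  choose! γ h0 hγ using hex
  have hmem : ∀ x ∈ C, ∀ t, γ x t ∈ C := fun x hx t =>
    hinv (γ x) (-(|t| + 1)) (|t| + 1) ((hγ x hx).isMIntegralCurveOn _) 0
      ⟨by linarith [abs_nonneg t], by linarith [abs_nonneg t]⟩ ((h0 x hx).symm ▸ hx) t
      ⟨by linarith [neg_abs_le t], by linarith [le_abs_self t]⟩
  have hadd : ∀ x ∈ C, ∀ t t', γ x (t + t') = γ (γ x t') t := by
    intro x hx t t'
    have h1 := isMIntegralCurve_Ioo_eq_of_contMDiff_boundaryless (t₀ := 0) hv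
      ((hγ x hx).comp_add t') (hγ _ (hmem x hx t')) (by simp [h0 _ (hmem x hx t')])
    exact congrFun h1 t
  set Φ : ℝ × M → M := fun q => γ q.2 q.1 with hΦ
  obtain ⟨δ, hδ, hsmall⟩ : ∃ δ > 0, ∀ x ∈ C, x ∈ C → ∀ t ∈ Ioo (-δ) δ,
      ContinuousWithinAt Φ (univ ×ˢ C) (t, x) := by
    refine hC.induction_on (p := fun s => ∃ δ > 0, ∀ x ∈ s, x ∈ C → ∀ t ∈ Ioo (-δ) δ,
      ContinuousWithinAt Φ (univ ×ˢ C) (t, x)) ⟨1, one_pos, by simp⟩ ?_ ?_ ?_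
    · rintro s t hst ⟨δ, hδ, h⟩
      exact ⟨δ, hδ, fun x hx => h x (hst hx)⟩
    · rintro s t ⟨δ, hδ, h⟩ ⟨δ', hδ', h'⟩
      refine ⟨min δ δ', lt_min hδ hδ', fun x hx hxC t ht => ?_⟩
      rcases hx with hx | hx
      · exact h x hx hxC t (Ioo_subset_Ioo (by simp) (by simp) ht)
      · exact h' x hx hxC t (Ioo_subset_Ioo (by simp) (by simp) ht)
    · intro x _
      obtain ⟨W, hWo, hxW, δ, hδ, ψ, hψ, hψc⟩ := exists_local_flow x (hX x)
      refine ⟨W, mem_nhdsWithin_of_mem_nhds (hWo.mem_nhds hxW), δ, hδ, fun y hy hyC t ht => ?_⟩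
      have hopen : Ioo (-δ) δ ×ˢ W ∈ 𝓝 (t, y) := (isOpen_Ioo.prod hWo).mem_nhds ⟨ht, hy⟩
      refine (hψc.continuousAt hopen).continuousWithinAt.congr_of_eventuallyEq_of_mem ?_
        ⟨trivial, hyC⟩
      filter_upwards [mem_nhdsWithin_of_mem_nhds hopen, self_mem_nhdsWithin] with q hq hqC
      exact isMIntegralCurveOn_Ioo_eqOn_of_contMDiff_boundaryless (t₀ := 0)
        ⟨by linarith, hδ⟩ hv ((hγ q.2 hqC.2).isMIntegralCurveOn _) (hψ q.2 hq.2).2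
        (by rw [h0 _ hqC.2, (hψ q.2 hq.2).1]) hq.1
  refine ⟨fun t x => γ x t, fun x hx => ⟨h0 x hx, hγ x hx, hmem x hx⟩, fun x hx t t' =>
    hadd x hx t t', ?_⟩
  -- Joint continuity, known for times shorter than `δ`, is carried to all times by iterating the
  -- flow `n` times.
  have hiter : ∀ n : ℕ, ∀ x ∈ C, ∀ t ∈ Ioo (-δ) δ,
      ContinuousWithinAt (fun q : ℝ × M => Φ (n * q.1, q.2)) (univ ×ˢ C) (t, x) := by
    intro n
    induction n with
    | zero =>
      intro x hx t _
      refine continuousWithinAt_snd.congr_of_eventuallyEq_of_mem ?_ ⟨trivial, hx⟩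
      filter_upwards [self_mem_nhdsWithin] with q hq
      simp [hΦ, h0 _ hq.2]
    | succ n ih =>
      intro x hx t ht
      have h1 : ContinuousWithinAt (fun q : ℝ × M => (q.1, Φ (n * q.1, q.2))) (univ ×ˢ C) (t, x) :=
        continuousWithinAt_fst.prodMk (ih x hx t ht)
      have h2 := ContinuousWithinAt.comp (g := Φ) (f := fun q : ℝ × M => (q.1, Φ (n * q.1, q.2)))
        (t := univ ×ˢ C) (x := (t, x)) (hsmall _ (hmem x hx (n * t)) (hmem x hx (n * t)) t ht) h1
        fun q hq => ⟨trivial, hmem _ hq.2 _⟩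
      refine h2.congr_of_eventuallyEq_of_mem ?_ ⟨trivial, hx⟩
      filter_upwards [self_mem_nhdsWithin] with q hq
      have h3 := hadd q.2 hq.2 q.1 (n * q.1)
      simp only [hΦ, Function.comp_apply]
      rw [← h3]
      congr 1
      push_cast
      ring
  rintro ⟨t, x⟩ ⟨-, hx⟩
  obtain ⟨n, hn⟩ := exists_nat_gt (|t| / δ)
  have hn0 : (0 : ℝ) < n := lt_of_le_of_lt (by positivity) hn
  rw [div_lt_iff₀ hδ] at hn
  have ht : t / n ∈ Ioo (-δ) δ := by
    refine abs_lt.1 ?_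
    rw [abs_div, abs_of_pos hn0, div_lt_iff₀ hn0]
    linarith
  have h1 : ContinuousWithinAt (fun q : ℝ × M => (q.1 / n, q.2)) (univ ×ˢ C) (t, x) :=
    (continuousWithinAt_fst.div_const _).prodMk continuousWithinAt_snd
  have h2 := ContinuousWithinAt.comp (g := fun q : ℝ × M => Φ (n * q.1, q.2))
    (f := fun q : ℝ × M => (q.1 / n, q.2)) (t := univ ×ˢ C) (x := (t, x))
    (hiter n x hx _ ht) h1 fun q hq => ⟨trivial, hq.2⟩
  refine h2.congr_of_eventuallyEq_of_mem ?_ ⟨trivial, hx⟩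
  filter_upwards with q
  simp only [hΦ, Function.comp_apply]
  rw [mul_div_cancel₀ _ hn0.ne']

end Flow


/-! ### Linear coordinates adapted to a submersion. -/

section LinearAlgebra

/-- A right inverse of `l`, completed by `a` and `b`, is an injective map between spaces of
dimension four; `k` is its inverse. -/
lemma exists_adapted_equiv (l : E4 →L[ℝ] ℝ × ℝ) (hl : Function.Surjective l) {a b : E4}
    (ha : l a = 0) (hb : l b = 0) (hab : ∀ r s : ℝ, r • a + s • b = 0 → r = 0 ∧ s = 0) :
    ∃ k : E4 ≃L[ℝ] (ℝ × ℝ) × (ℝ × ℝ), (∀ v, (k v).1 = l v) ∧ k a = (0, (1, 0)) ∧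
      k b = (0, (0, 1)) := by
  obtain ⟨R, hR⟩ := (l : E4 →ₗ[ℝ] ℝ × ℝ).exists_rightInverse_of_surjective
    (LinearMap.range_eq_top.2 hl)
  have hR' : ∀ v, l (R v) = v := fun v => congrArg (fun f => f v) hR
  let g : (ℝ × ℝ) × (ℝ × ℝ) →ₗ[ℝ] E4 :=
    LinearMap.coprod R (LinearMap.coprod (LinearMap.toSpanSingleton ℝ E4 a)
      (LinearMap.toSpanSingleton ℝ E4 b))
  have hg : ∀ z, g z = R z.1 + (z.2.1 • a + z.2.2 • b) := fun z => rfl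
  have hlg : ∀ z, l (g z) = z.1 := by
    intro z
    rw [hg, map_add, map_add, map_smul, map_smul, ha, hb, hR']
    simp
  have hinj : Function.Injective g := by
    rw [injective_iff_map_eq_zero]
    intro z hz
    have h1 : z.1 = 0 := by rw [← hlg, hz, map_zero]
    rw [hg, h1, map_zero, zero_add] at hz
    obtain ⟨h2, h3⟩ := hab _ _ hz
    exact Prod.ext h1 (Prod.ext h2 h3)
  let k := (LinearMap.linearEquivOfInjective g hinj (by simp)).toContinuousLinearEquiv
  have hk : ∀ z, k z = g z := fun z => rfl
  refine ⟨k.symm, fun v => ?_, ?_, ?_⟩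
  · obtain ⟨z, rfl⟩ := k.surjective v
    rw [k.symm_apply_apply, hk, hlg]
  · rw [k.symm_apply_eq, hk, hg]
    simp
  · rw [k.symm_apply_eq, hk, hg]
    simp

end LinearAlgebra

/-! ### The bundle over the path and its compactness. -/

/-- The hypotheses on the integrable system, the path of regular values and the circle action. -/
structure IsTorusFibration {M : Type*} [TopologicalSpace M] [ChartedSpace E4 M]
    (Ω : DForm 2 M) (H J : M → ℝ) (XH XJ : (x : M) → TangentSpace (𝓡 4) x) (F : M → ℝ × ℝ)
    (Γ : ℝ → ℝ × ℝ) (U : Set M) (ρ : ℝ → M → M) : Prop where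
  symplectic : IsSymplectic Ω
  smooth_H : ContMDiff (𝓡 4) 𝓘(ℝ, ℝ) ∞ H
  smooth_J : ContMDiff (𝓡 4) 𝓘(ℝ, ℝ) ∞ J
  field_H : IsHamiltonianField Ω H XH
  field_J : IsHamiltonianField Ω J XJ
  comm : ∀ x, Ω x ![XH x, XJ x] = 0
  F_eq : F = energyMomentum H J
  fibre : ∀ v, IsCompact (F ⁻¹' {v}) ∧ IsPreconnected (F ⁻¹' {v})
  smooth_path : ContDiff ℝ 1 Γ
  path_add_one : ∀ s, Γ (s + 1) = Γ s
  regular : ∀ s, IsRegularValue F (Γ s)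
  subset : F ⁻¹' Set.range Γ ⊆ U
  action : IsCircleAction XJ U ρ
  invariant : ∀ t, ∀ p ∈ U, F (ρ t p) = F p
  free : ∀ p ∈ F ⁻¹' Set.range Γ, ∀ t, ρ t p = p → ∃ n : ℤ, t = n * (2 * Real.pi)

namespace IsTorusFibration

variable {M : Type*} [TopologicalSpace M] [ChartedSpace E4 M] [IsManifold (𝓡 4) ∞ M]
  {Ω : DForm 2 M} {H J : M → ℝ} {XH XJ : (x : M) → TangentSpace (𝓡 4) x} {F : M → ℝ × ℝ}
  {Γ : ℝ → ℝ × ℝ} {U : Set M} {ρ : ℝ → M → M}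

lemma smooth_F (h : IsTorusFibration Ω H J XH XJ F Γ U ρ) :
    ContMDiff (𝓡 4) 𝓘(ℝ, ℝ × ℝ) ∞ F := by
  rw [h.F_eq]
  exact h.smooth_H.prodMk_space h.smooth_J

lemma mdifferentiable_F (h : IsTorusFibration Ω H J XH XJ F Γ U ρ) (x : M) :
    MDifferentiableAt (𝓡 4) 𝓘(ℝ, ℝ × ℝ) F x := (h.smooth_F x).mdifferentiableAt (by simp)

lemma continuous_F (h : IsTorusFibration Ω H J XH XJ F Γ U ρ) : Continuous F :=
  h.smooth_F.continuous

lemma diff_apply (h : IsTorusFibration Ω H J XH XJ F Γ U ρ) (x : M) (v : TangentSpace (𝓡 4) x) :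
    diff F x v = (Ω x ![v, XH x], Ω x ![v, XJ x]) := by
  have h1 := (h.mdifferentiable_F x).hasMFDerivAt
  have hH : mfderiv (𝓡 4) 𝓘(ℝ, ℝ) H x = (ContinuousLinearMap.fst ℝ ℝ ℝ).comp
      (show E4 →L[ℝ] ℝ × ℝ from diff F x) := by
    have h2 := (ContinuousLinearMap.fst ℝ ℝ ℝ).hasMFDerivAt.comp x h1
    rw [h.F_eq] at h2
    rw [h.F_eq]
    exact h2.mfderiv
  have hJ : mfderiv (𝓡 4) 𝓘(ℝ, ℝ) J x = (ContinuousLinearMap.snd ℝ ℝ ℝ).comp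
      (show E4 →L[ℝ] ℝ × ℝ from diff F x) := by
    have h2 := (ContinuousLinearMap.snd ℝ ℝ ℝ).hasMFDerivAt.comp x h1
    rw [h.F_eq] at h2
    rw [h.F_eq]
    exact h2.mfderiv
  rw [h.field_H, h.field_J, hH, hJ]
  rfl

omit [IsManifold (𝓡 4) ∞ M] in
lemma self_zero (Ω : DForm 2 M) (x : M) (v : TangentSpace (𝓡 4) x) : Ω x ![v, v] = 0 := by
  have := Ω.swap x v v
  linarith

lemma diff_XH (h : IsTorusFibration Ω H J XH XJ F Γ U ρ) (x : M) : diff F x (XH x) = 0 := by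
  rw [h.diff_apply, self_zero, h.comm]
  rfl

lemma diff_XJ (h : IsTorusFibration Ω H J XH XJ F Γ U ρ) (x : M) : diff F x (XJ x) = 0 := by
  rw [h.diff_apply, self_zero, Ω.swap, h.comm, neg_zero]
  rfl

lemma mem_U (h : IsTorusFibration Ω H J XH XJ F Γ U ρ) {x : M} {s : ℝ} (hx : F x = Γ s) :
    x ∈ U := h.subset ⟨s, hx.symm⟩

/-- Over the path the two Hamiltonian fields are independent. -/
lemma independent (h : IsTorusFibration Ω H J XH XJ F Γ U ρ) {x : M}
    (hx : Function.Surjective (diff F x)) {r s : ℝ} (hrs : r • XH x + s • XJ x = 0) :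
    r = 0 ∧ s = 0 := by
  -- With `dF v = (r, s)`, pairing the relation with `v` gives `r² + s² = 0`.
  obtain ⟨v, hv⟩ := hx (r, s)
  rw [h.diff_apply, Prod.mk.injEq] at hv
  have h1 : Ω.pairing x (r • XH x + s • XJ x) v = 0 := by
    rw [hrs]
    exact congrArg (fun l : E4 →L[ℝ] ℝ => l v) (map_zero (Ω.pairing x))
  have h2 : Ω.pairing x (r • XH x + s • XJ x) v =
      r * Ω.pairing x (XH x) v + s * Ω.pairing x (XJ x) v := by
    have e := map_add (Ω.pairing x) (r • (XH x : E4)) (s • (XJ x : E4))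
    refine (congrArg (fun l : E4 →L[ℝ] ℝ => l v) e).trans ?_
    have e1 := map_smul (Ω.pairing x) r (XH x : E4)
    have e2 := map_smul (Ω.pairing x) s (XJ x : E4)
    exact congrArg₂ (· + ·) (congrArg (fun l : E4 →L[ℝ] ℝ => l v) e1)
      (congrArg (fun l : E4 →L[ℝ] ℝ => l v) e2)
  rw [h2, Ω.pairing_apply, Ω.pairing_apply, hv.1, hv.2] at h1
  exact ⟨by nlinarith, by nlinarith⟩

/-- The energy-momentum map is constant along the integral curves of `X_H`. -/
lemma F_const (h : IsTorusFibration Ω H J XH XJ F Γ U ρ) {γ : ℝ → M} {a b : ℝ}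
    (hγ : IsMIntegralCurveOn γ XH (Ioo a b)) {t t' : ℝ} (ht : t ∈ Ioo a b) (ht' : t' ∈ Ioo a b) :
    F (γ t) = F (γ t') := by
  have hd : ∀ t ∈ Ioo a b, HasDerivAt (fun t => F (γ t)) 0 t := by
    intro t ht
    have h1 := (h.mdifferentiable_F (γ t)).hasMFDerivAt.comp t
      ((hγ t ht).hasMFDerivAt (isOpen_Ioo.mem_nhds ht))
    have h2 : HasDerivAt (fun t => F (γ t)) _ t :=
      HasFDerivAt.hasDerivAt (𝕜 := ℝ) (F := ℝ × ℝ) h1.hasFDerivAt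
    convert! h2 using 1
    refine ((h.diff_XH (γ t)).symm.trans ?_)
    change mfderiv (𝓡 4) 𝓘(ℝ, ℝ × ℝ) F (γ t) (XH (γ t)) =
      mfderiv (𝓡 4) 𝓘(ℝ, ℝ × ℝ) F (γ t) ((1 : ℝ) • XH (γ t))
    rw [one_smul]
  refine isOpen_Ioo.is_const_of_deriv_eq_zero isPreconnected_Ioo
    (fun t ht => (hd t ht).differentiableAt.differentiableWithinAt)
    (fun t ht => (hd t ht).deriv) ht ht'

/-- The map `F` in a chart is a submersion at points over the path. -/
lemma exists_chart_equiv (h : IsTorusFibration Ω H J XH XJ F Γ U ρ) {p : M}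
    (hp : Function.Surjective (diff F p)) :
    ∃ k : E4 ≃L[ℝ] (ℝ × ℝ) × (ℝ × ℝ),
      (∀ v, (k v).1 = fderiv ℝ (fun y => F ((extChartAt (𝓡 4) p).symm y)) (extChartAt (𝓡 4) p p) v) ∧
      k (fieldInChart XH p (extChartAt (𝓡 4) p p)) = (0, (1, 0)) ∧
      k (fieldInChart XJ p (extChartAt (𝓡 4) p p)) = (0, (0, 1)) := by
  set e := extChartAt (𝓡 4) p with he
  have hy : e p ∈ e.target := mem_extChartAt_target p
  have hp' : e.symm (e p) = p := extChartAt_to_inv p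
  have hsurj : ∀ z, z = p → Function.Surjective (diff F z) := by rintro z rfl; exact hp
  have hs := hsurj _ hp'
  have hfd : ∀ v, fderiv ℝ (fun y => F (e.symm y)) (e p) v =
      diff F (e.symm (e p)) (mfderiv 𝓘(ℝ, E4) (𝓡 4) e.symm (e p) v) := fun v =>
    fderiv_chart_apply hy (h.mdifferentiable_F _) v
  refine exists_adapted_equiv _ (fun z => ?_) ?_ ?_ fun r s hrs => ?_
  · obtain ⟨v, hv⟩ := hs z
    refine ⟨mfderiv (𝓡 4) 𝓘(ℝ, E4) e (e.symm (e p)) v, ?_⟩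
    refine (hfd _).trans ?_
    rw [mfderiv_symm_chart_apply hy, hv]
  · rw [hfd, mfderiv_symm_fieldInChart hy, h.diff_XH]
  · rw [hfd, mfderiv_symm_fieldInChart hy, h.diff_XJ]
  · refine h.independent hs ?_
    have h1 := congrArg (fun v : E4 => mfderiv 𝓘(ℝ, E4) (𝓡 4) e.symm (e p) v) hrs
    have h2 : mfderiv 𝓘(ℝ, E4) (𝓡 4) e.symm (e p)
        (r • fieldInChart XH p (e p) + s • fieldInChart XJ p (e p)) =
        r • XH (e.symm (e p)) + s • XJ (e.symm (e p)) := by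
      let l : E4 →L[ℝ] E4 := mfderiv 𝓘(ℝ, E4) (𝓡 4) e.symm (e p)
      have h3 : l (r • fieldInChart XH p (e p) + s • fieldInChart XJ p (e p)) =
          r • l (fieldInChart XH p (e p)) + s • l (fieldInChart XJ p (e p)) := by
        rw [map_add, map_smul, map_smul]
      exact h3.trans (congrArg₂ (fun a b : E4 => r • a + s • b) (mfderiv_symm_fieldInChart hy)
        (mfderiv_symm_fieldInChart hy))
    exact h2.symm.trans (h1.trans (map_zero (mfderiv 𝓘(ℝ, E4) (𝓡 4) e.symm (e p))))

/-- A submersion is open; this makes nearby fibres meet any given neighbourhood of `p`. -/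
lemma map_nhds (h : IsTorusFibration Ω H J XH XJ F Γ U ρ) {p : M}
    (hp : Function.Surjective (diff F p)) : Filter.map F (𝓝 p) = 𝓝 (F p) := by
  set e := extChartAt (𝓡 4) p with he
  have hy : e p ∈ e.target := mem_extChartAt_target p
  have hp' : e.symm (e p) = p := extChartAt_to_inv p
  obtain ⟨k, hk, -, -⟩ := h.exists_chart_equiv hp
  have hF : ContDiffAt ℝ 1 (fun y => F (e.symm y)) (e p) :=
    contDiffAt_comp_chart_symm (by exact_mod_cast le_top) hy
      ((h.smooth_F _).of_le (by exact_mod_cast le_top))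
  have h1 := (hF.hasStrictFDerivAt one_ne_zero).map_nhds_eq_of_surj
    (LinearMap.range_eq_top.2 fun z => ⟨k.symm (z, 0), by
      change fderiv ℝ (fun y => F (e.symm y)) (e p) _ = z
      rw [← hk, k.apply_symm_apply]⟩)
  have h2 : Filter.map e.symm (𝓝 (e p)) = 𝓝 p := by
    have := map_extChartAt_symm_nhdsWithin_range (I := 𝓡 4) p
    rwa [ModelWithCorners.range_eq_univ, nhdsWithin_univ] at this
  rw [hp'] at h1
  rw [← h1, ← h2, Filter.map_map]
  rfl

variable [T2Space M]

/-- `F` is proper over the path. A compact neighbourhood `Q` of one fibre contains all nearby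
fibres: they meet the interior of `Q` because `F` is open there, they miss the frontier because its
image is closed, and they are connected. -/
lemma isCompact_preimage (h : IsTorusFibration Ω H J XH XJ F Γ U ρ) :
    IsCompact (F ⁻¹' range Γ) := by
  have : LocallyCompactSpace M := ChartedSpace.locallyCompactSpace E4 M
  have hΓ1 : range Γ = Γ '' Icc 0 1 := by
    refine Subset.antisymm ?_ (image_subset_range _ _)
    rintro _ ⟨s, rfl⟩
    refine ⟨Int.fract s, ⟨Int.fract_nonneg s, (Int.fract_lt_one s).le⟩, ?_⟩
    have hper : Function.Periodic Γ 1 := h.path_add_one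
    have := hper.sub_int_mul_eq ⌊s⌋ (x := s)
    rwa [mul_one] at this
  have hK : IsCompact (range Γ) := by
    rw [hΓ1]
    exact isCompact_Icc.image h.smooth_path.continuous
  have hcl : IsClosed (F ⁻¹' range Γ) := hK.isClosed.preimage h.continuous_F
  have hloc : ∀ v ∈ range Γ, ∃ Q, IsCompact Q ∧ F ⁻¹' {v} ⊆ interior Q ∧
      ∀ᶠ v' in 𝓝 v, F ⁻¹' {v'} ⊆ Q := by
    rintro _ ⟨s, rfl⟩
    obtain ⟨Q, hQ, hKQ⟩ := exists_compact_superset (h.fibre (Γ s)).1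
    refine ⟨Q, hQ, hKQ, ?_⟩
    have hfr : IsCompact (frontier Q) := hQ.of_isClosed_subset isClosed_frontier
      (frontier_subset_closure.trans hQ.isClosed.closure_subset)
    have h1 : ∀ᶠ v' in 𝓝 (Γ s), v' ∉ F '' frontier Q := by
      refine (hfr.image h.continuous_F).isClosed.isOpen_compl.mem_nhds ?_
      rintro ⟨x, hx, hxs⟩
      exact hx.2 (hKQ hxs)
    obtain ⟨p, hp⟩ := (h.regular s).1
    have h2 : F '' interior Q ∈ 𝓝 (Γ s) := by
      rw [← hp, ← h.map_nhds ((h.regular s).2 p hp)]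
      exact image_mem_map (isOpen_interior.mem_nhds (hKQ hp))
    filter_upwards [h1, h2] with v' h3 ⟨q, hq, hqv⟩
    refine Subset.trans ?_ interior_subset
    refine (h.fibre v').2.subset_left_of_subset_union (v := Qᶜ) isOpen_interior
      hQ.isClosed.isOpen_compl (disjoint_compl_right.mono_left interior_subset) (fun x hx => ?_)
      ⟨q, hqv, hq⟩
    by_contra hcon
    rw [mem_union, not_or, mem_compl_iff, not_not] at hcon
    exact h3 ⟨x, ⟨subset_closure hcon.2, hcon.1⟩, hx⟩
  choose! Q hQ _ hQv using hloc
  obtain ⟨t, ht, htc⟩ := hK.elim_nhds_subcover (fun v => {v' | F ⁻¹' {v'} ⊆ Q v}) hQv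
  refine (t.isCompact_biUnion fun v hv => hQ v (ht v hv)).of_isClosed_subset hcl fun x hx => ?_
  obtain ⟨v, hv, hxv⟩ := mem_iUnion₂.1 (htc hx)
  exact mem_iUnion₂.2 ⟨v, hv, hxv rfl⟩

end IsTorusFibration


/-! ### Slices of the circle action. -/

lemma exists_local_inverse {E G : Type*} [NormedAddCommGroup E] [NormedSpace ℝ E] [CompleteSpace E]
    [NormedAddCommGroup G] [NormedSpace ℝ G] {f : E → G} {a : E} (k : E ≃L[ℝ] G)
    (hf : ContDiffAt ℝ 1 f a) (hk : HasFDerivAt f (k : E →L[ℝ] G) a) :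
    ∃ g, ContDiffAt ℝ 1 g (f a) ∧ g (f a) = a ∧ HasFDerivAt g (k.symm : G →L[ℝ] E) (f a) ∧
      (∀ᶠ x in 𝓝 a, g (f x) = x) ∧ ∀ᶠ y in 𝓝 (f a), f (g y) = y := by
  have hs := hf.hasStrictFDerivAt' hk one_ne_zero
  exact ⟨hf.localInverse hk one_ne_zero, hf.to_localInverse hk one_ne_zero,
    hf.localInverse_apply_image hk one_ne_zero, hs.to_localInverse.hasFDerivAt,
    hs.eventually_left_inverse, hs.eventually_right_inverse⟩

/-- A slice `N` of the circle action at `p`, parametrized by the value of `F` and by the time along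
`X_H`, and the coordinates `κ` that it defines together with the time along `X_J`. -/
structure IsSlice {M : Type*} [TopologicalSpace M] [ChartedSpace E4 M]
    (XH XJ : (x : M) → TangentSpace (𝓡 4) x) (F : M → ℝ × ℝ) (ρ : ℝ → M → M) (p : M)
    (N : (ℝ × ℝ) × ℝ → M) (κ : M → (ℝ × ℝ) × (ℝ × ℝ)) : Prop where
  N_centre : N (F p, 0) = p
  N_smooth : ∀ᶠ z in 𝓝 (F p, (0 : ℝ)), ContMDiffAt 𝓘(ℝ, (ℝ × ℝ) × ℝ) (𝓡 4) 1 N z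
  F_N : ∀ᶠ z in 𝓝 (F p, (0 : ℝ)), F (N z) = z.1
  N_time : ∀ r : ℝ, mfderiv 𝓘(ℝ, (ℝ × ℝ) × ℝ) (𝓡 4) N (F p, 0) ((0, r) : (ℝ × ℝ) × ℝ) =
    r • (show TangentSpace (𝓡 4) (N (F p, 0)) from XH (N (F p, 0)))
  κ_centre : κ p = (F p, (0, 0))
  κ_smooth : ∀ᶠ x in 𝓝 p, ContMDiffAt (𝓡 4) 𝓘(ℝ, (ℝ × ℝ) × (ℝ × ℝ)) 1 κ x
  κ_N : ∀ᶠ z in 𝓝 (F p, ((0 : ℝ), (0 : ℝ))), κ (ρ z.2.2 (N (z.1, z.2.1))) = z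
  N_κ : ∀ᶠ x in 𝓝 p, x = ρ (κ x).2.2 (N (F x, (κ x).2.1))
  κ_time : ∀ᶠ x in 𝓝 p,
    0 < (mfderiv (𝓡 4) 𝓘(ℝ, (ℝ × ℝ) × (ℝ × ℝ)) κ x (XH x) : (ℝ × ℝ) × (ℝ × ℝ)).2.1
  κ_XH : mfderiv (𝓡 4) 𝓘(ℝ, (ℝ × ℝ) × (ℝ × ℝ)) κ p (XH p) =
    ((0, (1, 0)) : (ℝ × ℝ) × (ℝ × ℝ))
  κ_XJ : mfderiv (𝓡 4) 𝓘(ℝ, (ℝ × ℝ) × (ℝ × ℝ)) κ p (XJ p) =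
    ((0, (0, 1)) : (ℝ × ℝ) × (ℝ × ℝ))

namespace IsTorusFibration

variable {M : Type*} [TopologicalSpace M] [ChartedSpace E4 M] [IsManifold (𝓡 4) ∞ M]
  {Ω : DForm 2 M} {H J : M → ℝ} {XH XJ : (x : M) → TangentSpace (𝓡 4) x} {F : M → ℝ × ℝ}
  {Γ : ℝ → ℝ × ℝ} {U : Set M} {ρ : ℝ → M → M}

/-- The inverse function theorem is used twice. First `F`, completed by two linear coordinates from
`k`, is inverted by `n`, and `N` is the part of `n` where the last coordinate vanishes. Then the
rotations of `N` form a local diffeomorphism `g`, whose derivative at the centre is `k⁻¹` because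
`k` sends `X_J` to the last basis vector; `κ` is its inverse. -/
lemma exists_slice (h : IsTorusFibration Ω H J XH XJ F Γ U ρ) {p : M} {s₀ : ℝ} (hp : F p = Γ s₀) :
    ∃ N κ, IsSlice XH XJ F ρ p N κ := by
  set e := extChartAt (𝓡 4) p with he
  have hy : e p ∈ e.target := mem_extChartAt_target p
  have hp' : e.symm (e p) = p := extChartAt_to_inv p
  have hpU : p ∈ U := h.mem_U hp
  have h1 : (1 : WithTop ℕ∞) ≤ ∞ := by exact_mod_cast le_top
  obtain ⟨k, hkF, hkH, hkJ⟩ := h.exists_chart_equiv ((h.regular s₀).2 p hp)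
  set y₀ := e p with hy₀
  -- straightening of `F`
  set f : E4 → (ℝ × ℝ) × (ℝ × ℝ) := fun y => (F (e.symm y), (k (y - y₀)).2) with hf
  have hFc : ContDiffAt ℝ 1 (fun y => F (e.symm y)) y₀ :=
    contDiffAt_comp_chart_symm h1 hy ((h.smooth_F _).of_le h1)
  have hfc : ContDiffAt ℝ 1 f y₀ :=
    hFc.prodMk (contDiff_snd.contDiffAt.comp y₀ (k.contDiff.contDiffAt.comp y₀
      (contDiffAt_id.sub contDiffAt_const)))
  have hfd : HasFDerivAt f (k : E4 →L[ℝ] (ℝ × ℝ) × (ℝ × ℝ)) y₀ := by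
    have e1 : HasFDerivAt (fun y => k (y - y₀)) (k : E4 →L[ℝ] (ℝ × ℝ) × (ℝ × ℝ)) y₀ :=
      HasFDerivAt.comp (g := k) (f := fun y => y - y₀) y₀ k.hasFDerivAt
        ((hasFDerivAt_id y₀).sub_const y₀)
    have e2 := (hFc.differentiableAt one_ne_zero).hasFDerivAt.prodMk e1.snd
    convert! e2 using 1
    exact ContinuousLinearMap.ext fun v => Prod.ext (hkF v) rfl
  have hfy : f y₀ = (F p, (0, 0)) := by
    simp only [hf, sub_self, map_zero, hp']
    rfl
  obtain ⟨n, hnc, hn0, hnd, -, hn⟩ := exists_local_inverse k hfc hfd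
  rw [hfy] at hnc hn0 hnd hn
  set ι : (ℝ × ℝ) × ℝ → (ℝ × ℝ) × (ℝ × ℝ) := fun z => (z.1, (z.2, 0)) with hι
  have hιc : ContDiff ℝ 1 ι := by fun_prop
  have hι0 : ι (F p, 0) = (F p, (0, 0)) := rfl
  have hιt : Tendsto ι (𝓝 (F p, 0)) (𝓝 (F p, (0, 0))) := hιc.continuous.continuousAt
  set N : (ℝ × ℝ) × ℝ → M := fun z => e.symm (n (ι z)) with hN
  have hN0 : N (F p, 0) = p := by simp only [hN, hι0, hn0, hp']
  have hnt : Tendsto n (𝓝 (F p, (0, 0))) (𝓝 y₀) := by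
    have := hnc.continuousAt
    rwa [ContinuousAt, hn0] at this
  have hnev : ∀ᶠ z in 𝓝 (F p, ((0 : ℝ), (0 : ℝ))), ContDiffAt ℝ 1 n z :=
    hnc.eventually (by simp)
  have htar : ∀ᶠ z in 𝓝 (F p, ((0 : ℝ), (0 : ℝ))), n z ∈ e.target :=
    hnt.eventually (extChartAt_target_mem_nhds p)
  have hN_smooth : ∀ᶠ z in 𝓝 (F p, (0 : ℝ)), ContMDiffAt 𝓘(ℝ, (ℝ × ℝ) × ℝ) (𝓡 4) 1 N z := by
    filter_upwards [hιt.eventually hnev, hιt.eventually htar] with z e1 e2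
    have : IsManifold (𝓡 4) 1 M := IsManifold.of_le h1
    have e3 : ContMDiffAt 𝓘(ℝ, E4) (𝓡 4) 1 e.symm (n (ι z)) :=
      (contMDiffOn_extChartAt_symm p).contMDiffAt ((isOpen_extChartAt_target p).mem_nhds e2)
    exact e3.comp z (e1.comp z hιc.contDiffAt).contMDiffAt
  have hF_N : ∀ᶠ z in 𝓝 (F p, (0 : ℝ)), F (N z) = z.1 := by
    filter_upwards [hιt.eventually hn] with z e1
    exact congrArg Prod.fst e1
  -- the action along the slice
  set π : (ℝ × ℝ) × (ℝ × ℝ) → (ℝ × ℝ) × ℝ := fun z => (z.1, z.2.1) with hπ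
  have hπc : ContDiff ℝ 1 π := by fun_prop
  have hπt : Tendsto π (𝓝 (F p, (0, 0))) (𝓝 (F p, 0)) := hπc.continuous.continuousAt
  set q : (ℝ × ℝ) × (ℝ × ℝ) → ℝ × E4 := fun z => (z.2.2, n (ι (π z))) with hq
  set g : (ℝ × ℝ) × (ℝ × ℝ) → E4 := fun z => actionInChart ρ p (q z) with hg
  have hz₀ : ι (π (F p, (0, 0))) = (F p, (0, 0)) := rfl
  have hq0 : q (F p, (0, 0)) = (0, y₀) := by simp only [hq, hz₀, hn0]
  have hUy : e.symm y₀ ∈ U := by rw [hp']; exact hpU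
  have hρ0 : ρ 0 (e.symm y₀) = p := by rw [h.action.zero _ hUy, hp']
  have hac := h.action.contDiffAt_actionInChart (x₀ := p) (z := (0, y₀)) hy hUy
    (by rw [hρ0]; exact mem_extChartAt_source p)
  have hqc : ContDiffAt ℝ 1 q (F p, (0, 0)) :=
    (contDiff_snd.comp contDiff_snd).contDiffAt.prodMk
      (hnc.comp (F p, ((0 : ℝ), (0 : ℝ))) (hιc.comp hπc).contDiffAt)
  have hgc : ContDiffAt ℝ 1 g (F p, (0, 0)) := by
    have := hac.of_le h1
    rw [← hq0] at this
    exact this.comp _ hqc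
  have hg0 : g (F p, (0, 0)) = y₀ := by
    simp only [hg, hq0, actionInChart]
    rw [← he, hρ0]
  have hgd : HasFDerivAt g (k.symm : (ℝ × ℝ) × (ℝ × ℝ) →L[ℝ] E4) (F p, (0, 0)) := by
    have d1 : HasFDerivAt (fun y => actionInChart ρ p (0, y)) (ContinuousLinearMap.id ℝ E4) y₀ := by
      refine (hasFDerivAt_id y₀).congr_of_eventuallyEq ?_
      filter_upwards [(isOpen_chartPart p h.action.isOpen).mem_nhds ⟨hy, hUy⟩] with y hy'
      simp only [actionInChart]
      rw [h.action.zero _ hy'.2]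
      exact e.right_inv hy'.1
    have d2 : HasFDerivAt (fun y => actionInChart ρ p (0, y))
        ((fderiv ℝ (actionInChart ρ p) (0, y₀)).comp (ContinuousLinearMap.inr ℝ ℝ E4)) y₀ :=
      HasFDerivAt.comp y₀ (g := actionInChart ρ p) (f := fun y => ((0 : ℝ), y))
        (hac.differentiableAt (by simp)).hasFDerivAt (hasFDerivAt_prodMk_right 0 y₀)
    have d3 : ∀ v, fderiv ℝ (actionInChart ρ p) (0, y₀) (0, v) = v := fun v =>
      congrArg (fun l : E4 →L[ℝ] E4 => l v) (d2.unique d1)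
    have d4 := h.action.fderiv_actionInChart_zero hy hUy
    have d5 : ∀ a v, fderiv ℝ (actionInChart ρ p) (0, y₀) (a, v) =
        a • fieldInChart XJ p y₀ + v := by
      intro a v
      have : ((a, v) : ℝ × E4) = a • (1, 0) + (0, v) := by simp
      rw [this, map_add, map_smul, d3, d4]
    have dι : HasFDerivAt (fun z => ι (π z)) ((ContinuousLinearMap.fst ℝ (ℝ × ℝ) (ℝ × ℝ)).prod
        (((ContinuousLinearMap.fst ℝ ℝ ℝ).comp (ContinuousLinearMap.snd ℝ (ℝ × ℝ) (ℝ × ℝ))).prod 0))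
        (F p, ((0 : ℝ), (0 : ℝ))) :=
      hasFDerivAt_fst.prodMk ((HasFDerivAt.fst hasFDerivAt_snd).prodMk
        (hasFDerivAt_const _ _))
    have d6 := HasFDerivAt.comp (F p, ((0 : ℝ), (0 : ℝ))) (g := n) (f := fun z => ι (π z)) hnd dι
    have d7 : HasFDerivAt q _ (F p, ((0 : ℝ), (0 : ℝ))) :=
      (hasFDerivAt_snd.comp (F p, ((0 : ℝ), (0 : ℝ))) hasFDerivAt_snd).prodMk d6
    have d8 : HasFDerivAt (actionInChart ρ p) (fderiv ℝ (actionInChart ρ p) (0, y₀))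
      (q (F p, (0, 0))) := by rw [hq0]; exact (hac.differentiableAt (by simp)).hasFDerivAt
    have d9 := d8.comp (F p, ((0 : ℝ), (0 : ℝ))) d7
    convert! d9 using 1
    refine ContinuousLinearMap.ext fun z => ?_
    refine Eq.trans ?_ (d5 z.2.2 (k.symm (z.1, (z.2.1, 0)))).symm
    change k.symm z = _
    rw [k.symm_apply_eq, map_add, map_smul, hkJ, k.apply_symm_apply]
    ext <;> simp
  obtain ⟨c, hcc, hc0, hcd, hcg, hgc'⟩ := exists_local_inverse k.symm hgc hgd
  rw [hg0] at hcc hc0 hcd hgc'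
  rw [ContinuousLinearEquiv.symm_symm] at hcd
  have het : Tendsto e (𝓝 p) (𝓝 y₀) := continuousAt_extChartAt p
  have hsrc : ∀ᶠ x in 𝓝 p, x ∈ e.source := extChartAt_source_mem_nhds p
  have hct : Tendsto (fun x => c (e x)) (𝓝 p) (𝓝 (F p, (0, 0))) := by
    have := hcc.continuousAt
    rw [ContinuousAt, hc0] at this
    exact this.comp het
  have hNt : Tendsto N (𝓝 (F p, 0)) (𝓝 p) := by
    have := hN_smooth.self_of_nhds.continuousAt
    rwa [ContinuousAt, hN0] at this
  have hρt : Tendsto (fun z : (ℝ × ℝ) × (ℝ × ℝ) => ρ z.2.2 (N (π z))) (𝓝 (F p, (0, 0))) (𝓝 p) := by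
    have e1 := (h.action.contMDiffAt hpU 0).continuousAt
    rw [ContinuousAt, h.action.zero p hpU] at e1
    have e2 : Tendsto (fun z : (ℝ × ℝ) × (ℝ × ℝ) => (z.2.2, N (π z))) (𝓝 (F p, (0, 0)))
        (𝓝 (0, p)) :=
      Tendsto.prodMk_nhds ((continuous_snd.comp continuous_snd).tendsto (F p, ((0 : ℝ), (0 : ℝ))))
        (hNt.comp hπt)
    exact e1.comp e2
  have hκd : ∀ᶠ x in 𝓝 p, ContMDiffAt (𝓡 4) 𝓘(ℝ, (ℝ × ℝ) × (ℝ × ℝ)) 1 (fun x => c (e x)) x ∧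
      mfderiv (𝓡 4) 𝓘(ℝ, (ℝ × ℝ) × (ℝ × ℝ)) (fun x => c (e x)) x =
        (fderiv ℝ c (e x)).comp (mfderiv (𝓡 4) 𝓘(ℝ, E4) e x) := by
    filter_upwards [het.eventually (hcc.eventually (by simp)), hsrc] with x e1 e2
    have : IsManifold (𝓡 4) 1 M := IsManifold.of_le h1
    refine ⟨e1.contMDiffAt.comp x (contMDiffAt_extChartAt'
      (by rwa [he, extChartAt_source] at e2)), ?_⟩
    exact (((e1.differentiableAt one_ne_zero).hasFDerivAt).hasMFDerivAt.comp x
      (hasMFDerivAt_chart e2)).mfderiv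
  have hfield : ∀ (X : (x : M) → TangentSpace (𝓡 4) x), ∀ᶠ x in 𝓝 p,
      mfderiv (𝓡 4) 𝓘(ℝ, (ℝ × ℝ) × (ℝ × ℝ)) (fun x => c (e x)) x (X x) =
        fderiv ℝ c (e x) (fieldInChart X p (e x)) := by
    intro X
    filter_upwards [hκd, hsrc] with x e1 e2
    rw [e1.2]
    let G : M → E4 := fun z => mfderiv (𝓡 4) 𝓘(ℝ, E4) e z (X z)
    have e3 : G (e.symm (e x)) = G x := by rw [e.left_inv e2]
    exact congrArg (fderiv ℝ c (e x)) e3.symm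
  have hcd' : fderiv ℝ c y₀ = k := hcd.fderiv
  refine ⟨N, fun x => c (e x), hN0, hN_smooth, hF_N, fun r => ?_, hc0, hκd.mono fun x hx => hx.1,
    hcg, ?_, ?_, ?_, ?_⟩
  · have dι : HasFDerivAt ι ((ContinuousLinearMap.fst ℝ (ℝ × ℝ) ℝ).prod
        ((ContinuousLinearMap.snd ℝ (ℝ × ℝ) ℝ).prod 0)) (F p, (0 : ℝ)) :=
      hasFDerivAt_fst.prodMk (hasFDerivAt_snd.prodMk (hasFDerivAt_const _ _))
    have e1 : HasMFDerivAt 𝓘(ℝ, (ℝ × ℝ) × ℝ) 𝓘(ℝ, E4) (fun z => n (ι z)) (F p, (0 : ℝ))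
        ((k.symm : (ℝ × ℝ) × (ℝ × ℝ) →L[ℝ] E4).comp ((ContinuousLinearMap.fst ℝ (ℝ × ℝ) ℝ).prod
        ((ContinuousLinearMap.snd ℝ (ℝ × ℝ) ℝ).prod 0))) :=
      (HasFDerivAt.comp (F p, (0 : ℝ)) (g := n) (f := ι) hnd dι).hasMFDerivAt
    have e0 : n (ι (F p, 0)) ∈ e.target := by rw [hι0, hn0]; exact hy
    have e2 := ((hasMFDerivAt_chart_symm e0).comp (F p, (0 : ℝ)) e1).mfderiv
    refine (congrArg (fun l : (ℝ × ℝ) × ℝ →L[ℝ] E4 => l (0, r)) e2).trans ?_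
    have e3 : k.symm ((0 : ℝ × ℝ), (r, (0 : ℝ))) = r • fieldInChart XH p (n (ι (F p, 0))) := by
      rw [hι0, hn0, k.symm_apply_eq, map_smul, hkH]
      ext <;> simp
    have e4 := mfderiv_symm_fieldInChart (X := XH) e0
    let l : E4 →L[ℝ] E4 := mfderiv 𝓘(ℝ, E4) (𝓡 4) e.symm (n (ι (F p, 0)))
    have e5 : l (k.symm ((0 : ℝ × ℝ), (r, (0 : ℝ)))) =
        r • l (fieldInChart XH p (n (ι (F p, 0)))) := by rw [e3, map_smul]
    exact e5.trans (congrArg (fun v : E4 => r • v) e4)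
  · have e1 : ∀ᶠ z in 𝓝 (F p, ((0 : ℝ), (0 : ℝ))), ρ z.2.2 (N (π z)) ∈ e.source :=
      hρt.eventually hsrc
    have e2 : ∀ᶠ z in 𝓝 (F p, ((0 : ℝ), (0 : ℝ))), N (π z) ∈ U :=
      (hNt.comp hπt).eventually (h.action.isOpen.mem_nhds hpU)
    filter_upwards [hct.eventually e1, hct.eventually e2, hct.eventually (hπt.eventually hF_N),
      het.eventually hgc', hsrc] with x h2 h3 h4 h5 h6
    have h7 : ρ (c (e x)).2.2 (N (π (c (e x)))) = x := e.injOn h2 h6 h5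
    have h8 : F x = (c (e x)).1 := by
      rw [← h4, ← h.invariant (c (e x)).2.2 _ h3, h7]
    rw [h8]
    exact h7.symm
  · have e1 : ContinuousAt (fun y => (fderiv ℝ c y (fieldInChart XH p y)).2.1) y₀ := by
      have e2 : ContinuousAt (fderiv ℝ c) y₀ :=
        (hcc.fderiv_right (m := 0) (by simp)).continuousAt
      have e3 := (h.field_H.contDiffAt_fieldInChart h.symplectic h.smooth_H hy).continuousAt
      exact (e2.clm_apply e3).snd.fst
    have e2 : ∀ᶠ y in 𝓝 y₀, 0 < (fderiv ℝ c y (fieldInChart XH p y)).2.1 := by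
      refine e1.eventually (lt_mem_nhds ?_)
      change 0 < (fderiv ℝ c y₀ (fieldInChart XH p y₀)).2.1
      rw [hcd']
      change 0 < (k (fieldInChart XH p y₀)).2.1
      rw [hkH]
      exact one_pos
    filter_upwards [het.eventually e2, hfield XH] with x h2 h3
    rw [h3]
    exact h2
  · refine (hfield XH).self_of_nhds.trans ?_
    rw [← hy₀, hcd']
    exact hkH
  · refine (hfield XJ).self_of_nhds.trans ?_
    rw [← hy₀, hcd']
    exact hkJ

end IsTorusFibration


/-! ### The flow over the path, tubes, and the torus system. -/

lemma IsCircleAction.int_period {M : Type*} [TopologicalSpace M] [ChartedSpace E4 M]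
    {X : (x : M) → TangentSpace (𝓡 4) x} {U : Set M} {ρ : ℝ → M → M} (hρ : IsCircleAction X U ρ)
    {x : M} (hx : x ∈ U) (u : ℝ) (n : ℤ) : ρ (u + n * (2 * Real.pi)) x = ρ u x := by
  have h1 : Function.Periodic (fun u => ρ u x) (2 * Real.pi) := fun u => by
    simp only
    rw [hρ.add _ _ x hx, hρ.period x hx]
  exact h1.int_mul n u

/-- The flow of `X_H` over the path. -/
structure IsPathFlow {M : Type*} [TopologicalSpace M] [ChartedSpace E4 M]
    (XH : (x : M) → TangentSpace (𝓡 4) x) (F : M → ℝ × ℝ) (Γ : ℝ → ℝ × ℝ) (ρ : ℝ → M → M)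
    (φ : ℝ → M → M) : Prop where
  zero : ∀ x ∈ F ⁻¹' range Γ, φ 0 x = x
  curve : ∀ x ∈ F ⁻¹' range Γ, IsMIntegralCurve (I := 𝓡 4) (fun t => φ t x) XH
  F_eq : ∀ x ∈ F ⁻¹' range Γ, ∀ t, F (φ t x) = F x
  add : ∀ x ∈ F ⁻¹' range Γ, ∀ t t', φ (t + t') x = φ t (φ t' x)
  continuousOn : ContinuousOn (fun q : ℝ × M => φ q.1 q.2) (univ ×ˢ (F ⁻¹' range Γ))
  comm : ∀ x ∈ F ⁻¹' range Γ, ∀ t u, ρ u (φ t x) = φ t (ρ u x)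

/-- The bundle over the path. -/
abbrev PathSpace {M : Type*} (F : M → ℝ × ℝ) (Γ : ℝ → ℝ × ℝ) : Type _ := {x : M // F x ∈ range Γ}

/-- A slice as a map to the bundle over the path. -/
noncomputable def sliceMap {M : Type*} {F : M → ℝ × ℝ} {Γ : ℝ → ℝ × ℝ} (N : (ℝ × ℝ) × ℝ → M)
    (p : PathSpace F Γ) (s r : ℝ) : PathSpace F Γ :=
  open Classical in if h : F (N (Γ s, r)) ∈ range Γ then ⟨N (Γ s, r), h⟩ else p

namespace IsTorusFibration

variable {M : Type*} [TopologicalSpace M] [ChartedSpace E4 M] [IsManifold (𝓡 4) ∞ M]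
  {Ω : DForm 2 M} {H J : M → ℝ} {XH XJ : (x : M) → TangentSpace (𝓡 4) x} {F : M → ℝ × ℝ}
  {Γ : ℝ → ℝ × ℝ} {U : Set M} {ρ : ℝ → M → M} {φ : ℝ → M → M}

lemma contDiffAt_fieldInChart (h : IsTorusFibration Ω H J XH XJ F Γ U ρ) (x₀ : M) :
    ContDiffAt ℝ 1 (fieldInChart XH x₀) (extChartAt (𝓡 4) x₀ x₀) :=
  (h.field_H.contDiffAt_fieldInChart h.symplectic h.smooth_H (mem_extChartAt_target x₀)).of_le
    (by exact_mod_cast le_top)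

lemma contMDiff_XH (h : IsTorusFibration Ω H J XH XJ F Γ U ρ) :
    ContMDiff (𝓡 4) (𝓡 4).tangent 1 (fun x => (⟨x, XH x⟩ : TangentBundle (𝓡 4) M)) :=
  fun x₀ => contMDiffAt_section_of_chart (h.contDiffAt_fieldInChart x₀) (by exact_mod_cast le_top)

lemma mfderiv_XH (h : IsTorusFibration Ω H J XH XJ F Γ U ρ) {x : M} (hx : x ∈ U) (u : ℝ) :
    mfderiv (𝓡 4) (𝓡 4) (ρ u) x (XH x) = XH (ρ u x) :=
  h.action.mfderiv_hamiltonianField h.symplectic h.smooth_J h.field_J h.smooth_H h.field_H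
    (fun u x hx => by
      have := congrArg Prod.fst (h.invariant u x hx)
      rwa [h.F_eq] at this) hx u

variable [T2Space M]

lemma integralCurve_unique (h : IsTorusFibration Ω H J XH XJ F Γ U ρ) {γ γ' : ℝ → M}
    (hγ : IsMIntegralCurve γ XH) (hγ' : IsMIntegralCurve γ' XH) (h0 : γ 0 = γ' 0) : γ = γ' :=
  isMIntegralCurve_Ioo_eq_of_contMDiff_boundaryless (t₀ := 0) h.contMDiff_XH hγ hγ' h0

/-- The bundle is compact, and invariant because `F` is conserved. The flow commutes with the action
since rotations carry `X_H` to itself, so a rotated integral curve is again an integral curve. -/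
lemma exists_pathFlow (h : IsTorusFibration Ω H J XH XJ F Γ U ρ) :
    ∃ φ, IsPathFlow XH F Γ ρ φ := by
  obtain ⟨φ, h1, h2, h3⟩ := exists_flow h.contDiffAt_fieldInChart h.isCompact_preimage
    fun γ a b hγ t₀ ht₀ hm t ht => by
      rw [mem_preimage, h.F_const hγ ht ht₀]
      exact hm
  have hF : ∀ x ∈ F ⁻¹' range Γ, ∀ t, F (φ t x) = F x := fun x hx t => by
    have := h.F_const (γ := fun t => φ t x) (a := -(|t| + 1)) (b := |t| + 1)
      ((h1 x hx).2.1.isMIntegralCurveOn _) (t := t) (t' := 0)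
      ⟨by linarith [neg_abs_le t], by linarith [le_abs_self t]⟩
      ⟨by linarith [abs_nonneg t], by linarith [abs_nonneg t]⟩
    simp only [(h1 x hx).1] at this
    exact this
  refine ⟨φ, fun x hx => (h1 x hx).1, fun x hx => (h1 x hx).2.1, hF, h2, h3, fun x hx t u => ?_⟩
  have hxU := h.subset hx
  have hux : ρ u x ∈ F ⁻¹' range Γ := by
    rw [mem_preimage, h.invariant u x hxU]
    exact hx
  have hc : IsMIntegralCurve (fun t => ρ u (φ t x)) XH := by
    intro t
    have hU : φ t x ∈ U := h.subset ((h1 x hx).2.2 t)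
    have e1 := (h.action.mdifferentiableAt hU u).hasMFDerivAt.comp t ((h1 x hx).2.1 t)
    let l : E4 →L[ℝ] E4 := mfderiv (𝓡 4) (𝓡 4) (ρ u) (φ t x)
    refine e1.congr_mfderiv (ContinuousLinearMap.ext fun (a : ℝ) => ?_)
    exact (l.map_smul a (XH (φ t x))).trans
      (congrArg (fun v : E4 => a • v) (h.mfderiv_XH hU u))
  have := h.integralCurve_unique hc (h1 _ hux).2.1 (by rw [(h1 x hx).1, (h1 _ hux).1])
  exact congrFun this t

omit [IsManifold (𝓡 4) ∞ M] [T2Space M] in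
lemma act_mem (h : IsTorusFibration Ω H J XH XJ F Γ U ρ) (hφ : IsPathFlow XH F Γ ρ φ) (t u : ℝ)
    (x : PathSpace F Γ) : F (ρ u (φ t x)) = F x := by
  have h1 := hφ.F_eq x x.2 t
  rw [h.invariant u _ (h.subset (by rw [mem_preimage, h1]; exact x.2)), h1]

/-- The action of `ℝ²` on the bundle over the path by the two Hamiltonian flows. -/
def act (h : IsTorusFibration Ω H J XH XJ F Γ U ρ) (hφ : IsPathFlow XH F Γ ρ φ) (t u : ℝ)
    (x : PathSpace F Γ) : PathSpace F Γ :=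
  ⟨ρ u (φ t x), by rw [h.act_mem hφ]; exact x.2⟩

omit [IsManifold (𝓡 4) ∞ M] [T2Space M] in
lemma coe_act (h : IsTorusFibration Ω H J XH XJ F Γ U ρ) (hφ : IsPathFlow XH F Γ ρ φ) (t u : ℝ)
    (x : PathSpace F Γ) : (h.act hφ t u x : M) = ρ u (φ t x) := rfl

omit [IsManifold (𝓡 4) ∞ M] [T2Space M] in
lemma coe_mem_U (h : IsTorusFibration Ω H J XH XJ F Γ U ρ) (x : PathSpace F Γ) : (x : M) ∈ U :=
  h.subset x.2

omit [IsManifold (𝓡 4) ∞ M] [T2Space M] in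
lemma coe_act_zero_right (h : IsTorusFibration Ω H J XH XJ F Γ U ρ) (hφ : IsPathFlow XH F Γ ρ φ)
    (t : ℝ) (x : PathSpace F Γ) : (h.act hφ t 0 x : M) = φ t x := by
  rw [coe_act, h.action.zero]
  refine h.subset ?_
  rw [mem_preimage, hφ.F_eq x x.2]
  exact x.2

omit [IsManifold (𝓡 4) ∞ M] [T2Space M] in
lemma coe_act_zero_left (h : IsTorusFibration Ω H J XH XJ F Γ U ρ) (hφ : IsPathFlow XH F Γ ρ φ)
    (u : ℝ) (x : PathSpace F Γ) : (h.act hφ 0 u x : M) = ρ u x := by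
  rw [coe_act, hφ.zero x x.2]

omit [IsManifold (𝓡 4) ∞ M] [T2Space M] in
lemma continuous_act (h : IsTorusFibration Ω H J XH XJ F Γ U ρ) (hφ : IsPathFlow XH F Γ ρ φ) :
    Continuous fun q : ℝ × ℝ × PathSpace F Γ => h.act hφ q.1 q.2.1 q.2.2 := by
  refine Continuous.subtype_mk ?_ _
  have h1 : Continuous fun q : ℝ × ℝ × PathSpace F Γ => φ q.1 (q.2.2 : M) :=
    hφ.continuousOn.comp_continuous (f := fun q : ℝ × ℝ × PathSpace F Γ => (q.1, (q.2.2 : M)))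
      (by fun_prop) fun q => ⟨trivial, q.2.2.2⟩
  refine h.action.smooth.continuousOn.comp_continuous
    (f := fun q : ℝ × ℝ × PathSpace F Γ => (q.2.1, φ q.1 (q.2.2 : M)))
    (Continuous.prodMk (by fun_prop) h1)
    fun q => ⟨trivial, h.subset ?_⟩
  rw [mem_preimage, hφ.F_eq _ q.2.2.2]
  exact q.2.2.2

omit [IsManifold (𝓡 4) ∞ M] [T2Space M] in
lemma act_act (h : IsTorusFibration Ω H J XH XJ F Γ U ρ) (hφ : IsPathFlow XH F Γ ρ φ)
    (t u t' u' : ℝ) (x : PathSpace F Γ) :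
    h.act hφ t u (h.act hφ t' u' x) = h.act hφ (t + t') (u + u') x := by
  have hm : ∀ t, φ t x ∈ F ⁻¹' range Γ := fun t => by
    rw [mem_preimage, hφ.F_eq x x.2]
    exact x.2
  refine Subtype.ext ?_
  rw [coe_act, coe_act, coe_act, ← hφ.comm _ (hm t'), ← hφ.add x x.2,
    h.action.add _ _ _ (h.subset (hm _))]

/-- On small pairs of neighbourhoods, the points of a circle orbit have the same slice time. -/
lemma eventually_same_time (h : IsTorusFibration Ω H J XH XJ F Γ U ρ) {p : M} {s₀ : ℝ}
    (hp : F p = Γ s₀) {N : (ℝ × ℝ) × ℝ → M} {κ : M → (ℝ × ℝ) × (ℝ × ℝ)}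
    (hN : IsSlice XH XJ F ρ p N κ) : ∀ᶠ q in 𝓝 (p, p), ∀ c ∈ Icc 0 (2 * Real.pi),
      q.2 = ρ c q.1 → (κ q.2).2.1 = (κ q.1).2.1 := by
  have hpU := h.mem_U hp
  refine isCompact_Icc.eventually_forall_of_forall_eventually fun c _ => ?_
  have h1 : Tendsto (fun z : (M × M) × ℝ => z.1.1) (𝓝 ((p, p), c)) (𝓝 p) :=
    (continuous_fst.comp continuous_fst).tendsto ((p, p), c)
  have h2 : Tendsto (fun z : (M × M) × ℝ => z.1.2) (𝓝 ((p, p), c)) (𝓝 p) :=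
    (continuous_snd.comp continuous_fst).tendsto ((p, p), c)
  have h3 : Tendsto (fun z : (M × M) × ℝ => z.2) (𝓝 ((p, p), c)) (𝓝 c) :=
    continuous_snd.tendsto ((p, p), c)
  -- If `c` fixes `p`, it is a multiple of `2π`, and rotations near it change only the last slice
  -- coordinate. Otherwise no rotation near `c` relates two points close to `p`.
  by_cases hc : ρ c p = p
  · obtain ⟨n, hn⟩ := h.free p (by rw [mem_preimage, hp]; exact mem_range_self s₀) c hc
    have hκ : Tendsto κ (𝓝 p) (𝓝 (F p, (0, 0))) := by
      have := hN.κ_smooth.self_of_nhds.continuousAt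
      rwa [ContinuousAt, hN.κ_centre] at this
    have hF : Tendsto F (𝓝 p) (𝓝 (F p)) := h.continuous_F.tendsto p
    have hw : Tendsto (fun x => (κ x).2.1) (𝓝 p) (𝓝 0) :=
      ((continuous_fst.comp continuous_snd).tendsto (F p, ((0 : ℝ), (0 : ℝ)))).comp hκ
    have hu : Tendsto (fun x => (κ x).2.2) (𝓝 p) (𝓝 0) :=
      ((continuous_snd.comp continuous_snd).tendsto (F p, ((0 : ℝ), (0 : ℝ)))).comp hκ
    have hz : Tendsto (fun z : (M × M) × ℝ => (F z.1.1, ((κ z.1.1).2.1,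
        z.2 - c + (κ z.1.1).2.2))) (𝓝 ((p, p), c)) (𝓝 (F p, (0, 0))) := by
      refine (hF.comp h1).prodMk_nhds ((hw.comp h1).prodMk_nhds ?_)
      have := (h3.sub_const c).add (hu.comp h1)
      simpa using this
    have hNt : Tendsto (fun x => N (F x, (κ x).2.1)) (𝓝 p) (𝓝 p) := by
      have e1 := hN.N_smooth.self_of_nhds.continuousAt
      rw [ContinuousAt, hN.N_centre] at e1
      exact e1.comp (hF.prodMk_nhds hw)
    filter_upwards [hz.eventually hN.κ_N, h1.eventually hN.N_κ,
      (hNt.comp h1).eventually (h.action.isOpen.mem_nhds hpU),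
      h1.eventually (h.action.isOpen.mem_nhds hpU)] with z e1 e2 e3 e4 e5
    have e6 : z.1.2 = ρ (z.2 - c + (κ z.1.1).2.2) (N (F z.1.1, (κ z.1.1).2.1)) := by
      rw [h.action.add _ _ (N (F z.1.1, (κ z.1.1).2.1)) e3, ← e2, e5, ← h.action.int_period e4 (z.2 - c) n, ← hn,
        sub_add_cancel]
    rw [e6, e1]
  · have e1 := (h.action.contMDiffAt hpU c).continuousAt
    have e2 : Tendsto (fun z : (M × M) × ℝ => (z.2, z.1.1)) (𝓝 ((p, p), c)) (𝓝 (c, p)) :=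
      h3.prodMk_nhds h1
    have e3 : Tendsto (fun z : (M × M) × ℝ => ρ z.2 z.1.1) (𝓝 ((p, p), c)) (𝓝 (ρ c p)) :=
      Tendsto.comp (g := fun q : ℝ × M => ρ q.1 q.2) e1 e2
    filter_upwards [(h2.prodMk_nhds e3).eventually (isClosed_diagonal.isOpen_compl.mem_nhds
      (show (p, ρ c p) ∈ _ from Ne.symm hc))] with z hz hz'
    exact absurd hz' hz

omit [T2Space M] in
lemma eventually_slice (h : IsTorusFibration Ω H J XH XJ F Γ U ρ) {p : M} {s₀ : ℝ}
    (hp : F p = Γ s₀) {N : (ℝ × ℝ) × ℝ → M} {κ : M → (ℝ × ℝ) × (ℝ × ℝ)}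
    (hN : IsSlice XH XJ F ρ p N κ) : ∀ᶠ z : ℝ × ℝ in 𝓝 (s₀, 0),
      F (N (Γ z.1, z.2)) = Γ z.1 ∧ κ (N (Γ z.1, z.2)) = (Γ z.1, (z.2, 0)) ∧
      ContMDiffAt 𝓘(ℝ, (ℝ × ℝ) × ℝ) (𝓡 4) 1 N (Γ z.1, z.2) := by
  have hpU := h.mem_U hp
  have h1 : Tendsto (fun z : ℝ × ℝ => (Γ z.1, z.2)) (𝓝 (s₀, 0)) (𝓝 (F p, 0)) := by
    rw [hp]
    exact (h.smooth_path.continuous.fst'.prodMk continuous_snd).tendsto (s₀, (0 : ℝ))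
  have h2 : Tendsto (fun z : ℝ × ℝ => (Γ z.1, (z.2, (0 : ℝ)))) (𝓝 (s₀, 0)) (𝓝 (F p, (0, 0))) := by
    rw [hp]
    exact (h.smooth_path.continuous.fst'.prodMk (continuous_snd.prodMk continuous_const)).tendsto
      (s₀, (0 : ℝ))
  have hNt : Tendsto N (𝓝 (F p, 0)) (𝓝 p) := by
    have e1 := hN.N_smooth.self_of_nhds.continuousAt
    rwa [ContinuousAt, hN.N_centre] at e1
  filter_upwards [h1.eventually hN.F_N, h2.eventually hN.κ_N, h1.eventually hN.N_smooth,
    (hNt.comp h1).eventually (h.action.isOpen.mem_nhds hpU)] with z e1 e2 e3 e4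
  exact ⟨e1, (congrArg κ (h.action.zero (N (Γ z.1, z.2)) e4)).symm.trans e2, e3⟩

/-- A slice defines a tube over the path. -/
lemma eventually_isTube (h : IsTorusFibration Ω H J XH XJ F Γ U ρ) (hφ : IsPathFlow XH F Γ ρ φ)
    {p : PathSpace F Γ} {s₀ : ℝ} (hp : F p = Γ s₀) {N : (ℝ × ℝ) × ℝ → M}
    {κ : M → (ℝ × ℝ) × (ℝ × ℝ)} (hN : IsSlice XH XJ F ρ p N κ) : ∀ᶠ ε in 𝓝[>] (0 : ℝ), ∃ V,
      IsTube (fun x : PathSpace F Γ => F x) (h.act hφ) Γ s₀ p V (fun x => (κ x).2.1)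
        (fun x => (κ x).2.2) (sliceMap N p) ε := by
  have hpU := h.mem_U hp
  have hκ : Tendsto κ (𝓝 (p : M)) (𝓝 (F p, (0, 0))) := by
    have := hN.κ_smooth.self_of_nhds.continuousAt
    rwa [ContinuousAt, hN.κ_centre] at this
  have hNt : Tendsto N (𝓝 (F p, 0)) (𝓝 (p : M)) := by
    have e1 := hN.N_smooth.self_of_nhds.continuousAt
    rwa [ContinuousAt, hN.N_centre] at e1
  have hNU : ∀ᶠ x in 𝓝 (p : M), N (F x, (κ x).2.1) ∈ U := by
    have hw : Tendsto (fun x => (κ x).2.1) (𝓝 (p : M)) (𝓝 0) :=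
      ((continuous_fst.comp continuous_snd).tendsto (F p, ((0 : ℝ), (0 : ℝ)))).comp hκ
    exact (hNt.comp ((h.continuous_F.tendsto (p : M)).prodMk_nhds hw)).eventually
      (h.action.isOpen.mem_nhds hpU)
  obtain ⟨O₁, hO₁, hO₁o, hpO₁⟩ := eventually_nhds_iff.1
    (hN.κ_smooth.and (hN.N_κ.and (hNU.and hN.κ_time)))
  obtain ⟨O₂, ⟨hpO₂, hO₂o⟩, hO₂⟩ := (nhds_basis_opens (p : M)).prod_self.mem_iff.1
    (by rw [← nhds_prod_eq]; exact h.eventually_same_time hp hN)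
  -- On `O₁` the slice coordinates are valid. On `O₂` two points of one circle orbit have the same
  -- slice time, even if the orbit leaves the neighbourhood between them.
  set O := O₁ ∩ O₂ with hO
  have hOo : IsOpen O := hO₁o.inter hO₂o
  have hpO : (p : M) ∈ O := ⟨hpO₁, hpO₂⟩
  have hκc : ContinuousOn κ O := fun x hx =>
    (hO₁ x hx.1).1.continuousAt.continuousWithinAt
  have hNO : ∀ᶠ z : ℝ × ℝ in 𝓝 (s₀, 0), N (Γ z.1, z.2) ∈ O := by
    have h1 : Tendsto (fun z : ℝ × ℝ => (Γ z.1, z.2)) (𝓝 (s₀, 0)) (𝓝 (F p, 0)) := by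
      rw [hp]
      exact (h.smooth_path.continuous.fst'.prodMk continuous_snd).tendsto (s₀, (0 : ℝ))
    exact (hNt.comp h1).eventually (hOo.mem_nhds hpO)
  obtain ⟨δ, hδ, hall⟩ := Metric.eventually_nhds_iff_ball.1 (hNO.and (h.eventually_slice hp hN))
  filter_upwards [Ioo_mem_nhdsGT hδ] with ε hε
  have hbox : ∀ s ∈ Ioo (s₀ - ε) (s₀ + ε), ∀ r ∈ Ioo (-ε) ε, (s, r) ∈ Metric.ball (s₀, (0 : ℝ)) δ := by
    intro s hs r hr
    rw [← ball_prod_same, Real.ball_eq_Ioo, Real.ball_eq_Ioo]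
    exact ⟨⟨by linarith [hs.1, hε.2], by linarith [hs.2, hε.2]⟩, by linarith [hr.1, hε.2],
      by linarith [hr.2, hε.2]⟩
  have hn : ∀ s ∈ Ioo (s₀ - ε) (s₀ + ε), ∀ r ∈ Ioo (-ε) ε,
      (sliceMap N p s r : M) = N (Γ s, r) := by
    intro s hs r hr
    have hm : F (N (Γ s, r)) ∈ range Γ := by
      rw [(hall _ (hbox s hs r hr)).2.1]
      exact mem_range_self s
    simp only [sliceMap, dif_pos hm]
  set V : Set (PathSpace F Γ) := {x | (x : M) ∈ O ∧ |(κ x).2.1| < ε} with hV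
  have hVo : IsOpen V := by
    have h1 : IsOpen (O ∩ (fun x => (κ x).2.1) ⁻¹' {r | |r| < ε}) :=
      hκc.snd.fst.isOpen_inter_preimage hOo (isOpen_lt continuous_abs continuous_const)
    exact h1.preimage continuous_subtype_val
  have hpV : p ∈ V := ⟨hpO, by rw [hN.κ_centre]; simpa using hε.1⟩
  have hκV : ContinuousOn (fun x : PathSpace F Γ => κ x) V :=
    hκc.comp continuous_subtype_val.continuousOn fun x hx => hx.1
  refine ⟨V, hVo, hpV, by rw [hN.κ_centre], hκV.snd.fst, hκV.snd.snd,
    ?_, ?_, ?_, hε.1, fun x hx => hx.2, ?_, ?_, ?_, ?_, ?_, ?_⟩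
  · intro x hx y hy hF hw
    refine Subtype.ext ?_
    have hx1 := hO₁ x hx.1.1
    have hy1 := hO₁ y hy.1.1
    beta_reduce at hF hw ⊢
    rw [coe_act_zero_left]
    nth_rw 2 [hx1.2.1]
    rw [← h.action.add _ _ _ hx1.2.2.1, sub_add_cancel, hF, hw]
    exact hy1.2.1
  · intro x hx c hxc
    have h1 := hO₂ (show ((x : M), ((h.act hφ 0 c x : PathSpace F Γ) : M)) ∈ O₂ ×ˢ O₂ from
      ⟨hx.1.2, hxc.1.2⟩) (toIcoMod Real.two_pi_pos 0 c) ?_ ?_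
    · exact h1
    · have := toIcoMod_mem_Ico Real.two_pi_pos 0 c
      exact ⟨this.1, by simpa using this.2.le⟩
    · simp only
      rw [coe_act_zero_left, toIcoMod, zsmul_eq_mul, sub_eq_add_neg, ← neg_mul, ← Int.cast_neg,
        h.action.int_period (h.coe_mem_U x)]
  · have hc : ContinuousAt (fun q : ℝ × PathSpace F Γ => h.act hφ q.1 0 q.2) (0, p) :=
      ((h.continuous_act hφ).comp (f := fun q : ℝ × PathSpace F Γ => (q.1, (0 : ℝ), q.2))
        (by fun_prop)).continuousAt
    have h0 : h.act hφ 0 0 p = p := Subtype.ext (by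
      rw [coe_act_zero_left, h.action.zero _ hpU])
    have hev := hc.eventually (show ∀ᶠ x in 𝓝 (h.act hφ 0 0 p), x ∈ V by
      rw [h0]; exact hVo.mem_nhds hpV)
    rw [nhds_prod_eq, eventually_prod_iff] at hev
    obtain ⟨pa, hpa, pb, hpb, hab⟩ := hev
    obtain ⟨η, hη, hball⟩ := Metric.eventually_nhds_iff_ball.1 hpa
    rw [Real.ball_eq_Ioo] at hball
    simp only [zero_sub, zero_add] at hball
    refine ⟨η, hη, ?_⟩
    filter_upwards [hpb] with x hx
    refine ⟨fun t ht => hab (hball t ht) hx, ?_⟩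
    have hd : ∀ t ∈ Ioo (-η) η, ∃ d > 0, HasDerivAt (fun t => (κ (φ t x)).2.1) d t := by
      intro t ht
      have hm := hO₁ _ (hab (hball t ht) hx).1.1
      rw [coe_act_zero_right] at hm
      have e1 := (hm.1.mdifferentiableAt one_ne_zero).hasMFDerivAt.comp t (hφ.curve x x.2 t)
      have e2 : HasDerivAt (fun t => κ (φ t x)) _ t :=
        HasFDerivAt.hasDerivAt (𝕜 := ℝ) (F := (ℝ × ℝ) × (ℝ × ℝ)) e1.hasFDerivAt
      refine ⟨_, ?_, ((ContinuousLinearMap.fst ℝ ℝ ℝ).comp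
        (ContinuousLinearMap.snd ℝ (ℝ × ℝ) (ℝ × ℝ))).hasFDerivAt.comp_hasDerivAt t e2⟩
      refine lt_of_lt_of_eq hm.2.2.2 (congrArg (fun v : (ℝ × ℝ) × (ℝ × ℝ) => v.2.1) ?_)
      change _ = mfderiv (𝓡 4) 𝓘(ℝ, (ℝ × ℝ) × (ℝ × ℝ)) κ (φ t x) ((1 : ℝ) • XH (φ t x))
      rw [one_smul]
    have hmono : StrictMonoOn (fun t => (κ (φ t x)).2.1) (Ioo (-η) η) := by
      refine strictMonoOn_of_deriv_pos (convex_Ioo _ _) (fun t ht => ?_) fun t ht => ?_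
      · obtain ⟨d, -, hd⟩ := hd t ht
        exact hd.continuousAt.continuousWithinAt
      · rw [interior_Ioo] at ht
        obtain ⟨d, hd0, hd⟩ := hd t ht
        rwa [hd.deriv]
    simpa only [coe_act_zero_right] using hmono
  · refine Topology.IsInducing.subtypeVal.continuousOn_iff.2 ?_
    have h1 : ContinuousOn (fun q : ℝ × ℝ => N (Γ q.1, q.2))
        (Ioo (s₀ - ε) (s₀ + ε) ×ˢ Ioo (-ε) ε) := by
      intro q hq
      refine ContinuousAt.continuousWithinAt ?_
      have h2 := (hall _ (hbox _ hq.1 _ hq.2)).2.2.2.continuousAt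
      exact ContinuousAt.comp (f := fun q : ℝ × ℝ => (Γ q.1, q.2)) h2
        (h.smooth_path.continuous.fst'.prodMk continuous_snd).continuousAt
    exact h1.congr fun q hq => hn _ hq.1 _ hq.2
  · refine Subtype.ext ?_
    rw [hn s₀ ⟨by linarith [hε.1], by linarith [hε.1]⟩ 0 ⟨by linarith [hε.1], hε.1⟩, ← hp,
      hN.N_centre]
  · intro s hs r hr
    rw [hn s hs r hr]
    exact (hall _ (hbox s hs r hr)).2.1
  · intro s hs r hr
    have h1 := hall _ (hbox s hs r hr)
    refine ⟨by rw [hn s hs r hr]; exact h1.1, ?_⟩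
    rw [hn s hs r hr, h1.2.2.1]
    exact abs_lt.2 hr
  · intro s hs r hr
    rw [hn s hs r hr, (hall _ (hbox s hs r hr)).2.2.1]
  · intro s hs r hr
    rw [hn s hs r hr, (hall _ (hbox s hs r hr)).2.2.1]

/-- The bundle over the path with the action of `ℝ²`. -/
noncomputable def torusSystem (h : IsTorusFibration Ω H J XH XJ F Γ U ρ)
    (hφ : IsPathFlow XH F Γ ρ φ) : TorusSystem (PathSpace F Γ) where
  F x := F x
  act := h.act hφ
  Γ := Γ
  continuous_F := h.continuous_F.comp continuous_subtype_val
  continuous_act := h.continuous_act hφ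
  act_zero x := Subtype.ext (by rw [coe_act_zero_left, h.action.zero _ (h.coe_mem_U x)])
  act_act := h.act_act hφ
  F_act t u x := h.act_mem hφ t u x
  act_two_pi x := Subtype.ext (by rw [coe_act_zero_left, h.action.period _ (h.coe_mem_U x)])
  free u x hx := h.free x x.2 u (by
    have := congrArg Subtype.val hx
    rwa [coe_act_zero_left] at this)
  fibre v := by
    refine Topology.IsInducing.subtypeVal.isPreconnected_image.1 ?_
    by_cases hv : v ∈ range Γ
    · convert! (h.fibre v).2 using 1
      ext x
      constructor
      · rintro ⟨y, hy, rfl⟩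
        exact hy
      · intro hx
        have hx' : F x ∈ range Γ := by rw [show F x = v from hx]; exact hv
        exact ⟨(⟨x, hx'⟩ : PathSpace F Γ), hx, rfl⟩
    · have : {x : PathSpace F Γ | F x = v} = ∅ :=
        eq_empty_of_forall_notMem fun x hx => hv (hx ▸ x.2)
      rw [this, image_empty]
      exact isPreconnected_empty
  continuous_Γ := h.smooth_path.continuous
  Γ_add_one := h.path_add_one
  exists_fibre s := by
    obtain ⟨x, hx⟩ := (h.regular s).1
    exact ⟨⟨x, hx ▸ mem_range_self s⟩, hx⟩
  exists_param x := by
    obtain ⟨s, hs⟩ := x.2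
    exact ⟨s, hs.symm⟩
  tube s₀ p hp := by
    obtain ⟨N, κ, hN⟩ := h.exists_slice hp
    obtain ⟨ε, V, hV⟩ := (h.eventually_isTube hφ hp hN).exists
    exact ⟨V, _, _, _, ε, hV⟩

lemma compactSpace (h : IsTorusFibration Ω H J XH XJ F Γ U ρ) : CompactSpace (PathSpace F Γ) :=
  isCompact_iff_compactSpace.1 h.isCompact_preimage

end IsTorusFibration


/-! ### Local primitives of the rotation form. -/

section Primitive

variable {M : Type*} [TopologicalSpace M] [ChartedSpace E4 M]

/-- A `1`-form on the model space as a linear function. -/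
noncomputable def covector (β : E4 [⋀^Fin 1]→L[ℝ] ℝ) : E4 →L[ℝ] ℝ :=
  (ContinuousAlternatingMap.ofSubsingleton ℝ E4 ℝ (0 : Fin 1)).symm β

lemma covector_apply (β : E4 [⋀^Fin 1]→L[ℝ] ℝ) (v : E4) : covector β v = β fun _ => v := by
  rfl

/-- `φ` is a primitive of the form `ϑ`, which is defined on `M'`, near `x`. -/
def IsPrimitiveAt (ϑ : DForm 1 M) (M' : Set M) (φ : M → ℝ) (x : M) : Prop :=
  ∀ᶠ y in 𝓝 x, y ∈ M' ∧ ContMDiffAt (𝓡 4) 𝓘(ℝ, ℝ) 1 φ y ∧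
    ∀ v : TangentSpace (𝓡 4) y, mfderiv (𝓡 4) 𝓘(ℝ, ℝ) φ y v = ϑ y fun _ => v

variable {ϑ : DForm 1 M} {M' : Set M}

lemma IsPrimitiveAt.eventually {φ : M → ℝ} {x : M} (h : IsPrimitiveAt ϑ M' φ x) :
    ∀ᶠ y in 𝓝 x, IsPrimitiveAt ϑ M' φ y := h.eventually_nhds

lemma contDiffOn_covector {α : E4 → E4 [⋀^Fin 1]→L[ℝ] ℝ} {s : Set E4}
    (h : ContDiffOn ℝ ∞ α s) : ContDiffOn ℝ ∞ (fun y => covector (α y)) s :=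
  contDiffOn_clm_apply.2 fun v =>
    ((ContinuousAlternatingMap.apply ℝ E4 ℝ (fun _ : Fin 1 => v)).contDiff.comp_contDiffOn h).congr
      fun y _ => covector_apply (α y) v

variable [IsManifold (𝓡 4) ∞ M]

/-- The Poincaré lemma on a ball in a chart: for a `1`-form, closedness is the symmetry of its
derivative. -/
lemma exists_isPrimitiveAt (hM' : IsOpen M') (hs : ϑ.SmoothOn M') (hc : ϑ.ClosedOn M') {x : M}
    (hx : x ∈ M') : ∃ φ, IsPrimitiveAt ϑ M' φ x := by
  set e := extChartAt (𝓡 4) x with he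
  set y₀ := e x with hy₀
  have hmem : y₀ ∈ chartPart x M' := ⟨mem_extChartAt_target x, by
    rw [mem_preimage, hy₀, he, extChartAt_to_inv]; exact hx⟩
  obtain ⟨r, hr, hB⟩ := Metric.isOpen_iff.1 (isOpen_chartPart x hM') y₀ hmem
  set α : E4 → E4 →L[ℝ] ℝ := fun y => covector (ϑ.inChart x y) with hα
  have hαc : ContDiffOn ℝ ∞ α (Metric.ball y₀ r) :=
    contDiffOn_covector ((hs x).mono hB)
  have hαd : DifferentiableOn ℝ α (Metric.ball y₀ r) := hαc.differentiableOn (by simp)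
  have hsym : ∀ a ∈ Metric.ball y₀ r, ∀ v w, fderiv ℝ α a v w = fderiv ℝ α a w v := by
    intro a ha v w
    have hd : DifferentiableAt ℝ (ϑ.inChart x) a :=
      (hs.contDiffAt hM' (hB ha)).differentiableAt (by simp)
    have h1 := hc x a (hB ha)
    have h2 := congrArg (fun l => l ![v, w]) h1
    rw [extDeriv_apply hd] at h2
    simp [Fin.sum_univ_succ] at h2
    have e0 : (fun y => ϑ.inChart x y ![w]) = fun y => α y w := funext fun y =>
      congrArg (ϑ.inChart x y) (funext fun i => by fin_cases i; rfl)
    have e1 : (fun y => ϑ.inChart x y (Fin.removeNth 1 ![v, w])) = fun y => α y v := funext fun y =>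
      congrArg (ϑ.inChart x y) (funext fun i => by fin_cases i; rfl)
    have hda := hαd.differentiableAt (Metric.isOpen_ball.mem_nhds ha)
    have e2 : ∀ u v, fderiv ℝ (fun y => α y u) a v = fderiv ℝ α a v u := by
      intro u v
      have := (hda.hasFDerivAt.clm_apply (hasFDerivAt_const u a)).fderiv
      rw [this]
      simp
    rw [e0, e1, e2, e2] at h2
    linarith
  obtain ⟨f, hf⟩ := (convex_ball y₀ r).exists_forall_hasFDerivAt_of_fderiv_symmetric
    Metric.isOpen_ball hαd hsym
  refine ⟨fun y => f (e y), ?_⟩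
  have het : Tendsto e (𝓝 x) (𝓝 y₀) := continuousAt_extChartAt x
  filter_upwards [het.eventually (Metric.isOpen_ball.mem_nhds (Metric.mem_ball_self hr)),
    extChartAt_source_mem_nhds (I := 𝓡 4) x] with y hy hys
  have : IsManifold (𝓡 4) 1 M := IsManifold.of_le (n := ∞) (by exact_mod_cast le_top)
  refine ⟨?_, ?_, fun v => ?_⟩
  · have := (hB hy).2
    rwa [mem_preimage, (extChartAt (𝓡 4) x).left_inv hys] at this
  · have h1 : ContDiffAt ℝ 1 f (e y) := contDiffAt_one_iff.2
      ⟨α, Metric.ball y₀ r, Metric.isOpen_ball.mem_nhds hy, hαc.continuousOn, hf⟩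
    exact h1.contMDiffAt.comp y (contMDiffAt_extChartAt' (by rwa [extChartAt_source] at hys))
  · have h1 := ((hf _ hy).hasMFDerivAt.comp y (hasMFDerivAt_chart hys)).mfderiv
    refine (congrArg (fun l : E4 →L[ℝ] ℝ => l v) h1).trans ?_
    exact (ϑ.apply_eq_inChart hys _).symm

lemma IsPrimitiveAt.eventually_sub {φ ψ : M → ℝ} {x : M} (hφ : IsPrimitiveAt ϑ M' φ x)
    (hψ : IsPrimitiveAt ϑ M' ψ x) : ∀ᶠ y in 𝓝 x, φ y - ψ y = φ x - ψ x := by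
  set e := extChartAt (𝓡 4) x with he
  have hy₀ : e x ∈ e.target := mem_extChartAt_target x
  have hinv : e.symm (e x) = x := extChartAt_to_inv x
  have hst : Tendsto e.symm (𝓝 (e x)) (𝓝 x) := by
    have := continuousAt_extChartAt_symm (I := 𝓡 4) x
    rwa [ContinuousAt, ← he, hinv] at this
  obtain ⟨r, hr, hB⟩ := Metric.eventually_nhds_iff_ball.1
    ((hst.eventually (hφ.and hψ)).and ((isOpen_extChartAt_target x).mem_nhds hy₀))
  set g : E4 → ℝ := fun y => φ (e.symm y) - ψ (e.symm y) with hg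
  have hd : ∀ y ∈ Metric.ball (e x) r, HasFDerivAt g (0 : E4 →L[ℝ] ℝ) y := by
    intro y hy
    obtain ⟨⟨h1, h2⟩, h3⟩ := hB y hy
    have d1 := fderiv_chart h3 (h1.2.1.mdifferentiableAt one_ne_zero)
    have d2 := fderiv_chart h3 (h2.2.1.mdifferentiableAt one_ne_zero)
    refine HasFDerivAt.congr_fderiv (HasFDerivAt.sub d1 d2) (ContinuousLinearMap.ext fun v => ?_)
    have e1 := h1.2.2 (mfderiv 𝓘(ℝ, E4) (𝓡 4) e.symm y v)
    have e2 := h2.2.2 (mfderiv 𝓘(ℝ, E4) (𝓡 4) e.symm y v)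
    exact sub_eq_zero.2 (e1.trans e2.symm)
  have hconst : ∀ y ∈ Metric.ball (e x) r, g y = g (e x) := fun y hy =>
    Metric.isOpen_ball.is_const_of_fderiv_eq_zero (convex_ball _ _).isPreconnected
      (fun y hy => (hd y hy).differentiableAt.differentiableWithinAt)
      (fun y hy => (hd y hy).fderiv) hy (Metric.mem_ball_self hr)
  have het : Tendsto e (𝓝 x) (𝓝 (e x)) := continuousAt_extChartAt x
  filter_upwards [het.eventually (Metric.isOpen_ball.mem_nhds (Metric.mem_ball_self hr)),
    extChartAt_source_mem_nhds (I := 𝓡 4) x] with y hy hys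
  have := hconst _ hy
  simp only [hg, hinv] at this
  rwa [e.left_inv hys] at this

omit [IsManifold (𝓡 4) ∞ M] in
lemma IsPrimitiveAt.hasDerivAt_comp {φ : M → ℝ} {c : ℝ → M} {τ : ℝ}
    (h : IsPrimitiveAt ϑ M' φ (c τ)) {c' : ℝ →L[ℝ] TangentSpace (𝓡 4) (c τ)}
    (hc : HasMFDerivAt 𝓘(ℝ, ℝ) (𝓡 4) c τ c') :
    HasDerivAt (fun τ => φ (c τ)) (ϑ (c τ) fun _ => c' 1) τ := by
  obtain ⟨-, h1, h2⟩ := h.self_of_nhds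
  have h3 := (h1.mdifferentiableAt one_ne_zero).hasMFDerivAt.comp τ hc
  have h4 : HasDerivAt (fun τ => φ (c τ)) _ τ :=
    HasFDerivAt.hasDerivAt (𝕜 := ℝ) (F := ℝ) h3.hasFDerivAt
  rw [← h2 (c' 1)]
  exact h4

end Primitive

/-- The local primitives of a form on the total space, as functions on the bundle over the path. -/
def pathPrimitive {M : Type*} [TopologicalSpace M] [ChartedSpace E4 M] {F : M → ℝ × ℝ}
    {Γ : ℝ → ℝ × ℝ} (ϑ : DForm 1 M) (M' : Set M) (φ : PathSpace F Γ → ℝ) (x : PathSpace F Γ) : Prop :=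
  ∃ ψ : M → ℝ, IsPrimitiveAt ϑ M' ψ x ∧ ∀ᶠ y in 𝓝 x, φ y = ψ y

namespace IsTorusFibration

variable {M : Type*} [TopologicalSpace M] [ChartedSpace E4 M] [IsManifold (𝓡 4) ∞ M] [T2Space M]
  {Ω : DForm 2 M} {H J : M → ℝ} {XH XJ : (x : M) → TangentSpace (𝓡 4) x} {F : M → ℝ × ℝ}
  {Γ : ℝ → ℝ × ℝ} {U : Set M} {ρ : ℝ → M → M} {φ : ℝ → M → M} {M' : Set M} {ϑ : DForm 1 M}

omit [IsManifold (𝓡 4) ∞ M] [T2Space M] in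
lemma mem_polarSet_iff (h : IsTorusFibration Ω H J XH XJ F Γ U ρ) (x : PathSpace F Γ) :
    (x : M) ∈ polarSet U M' ↔ (x : M) ∉ M' :=
  ⟨fun hx => hx.2, fun hx => ⟨h.coe_mem_U x, hx⟩⟩

lemma isRotationPrimitive (h : IsTorusFibration Ω H J XH XJ F Γ U ρ) (hφ : IsPathFlow XH F Γ ρ φ)
    (hϑ : IsRotationForm XJ U ρ M' ϑ) :
    (h.torusSystem hφ).IsRotationPrimitive (pathPrimitive ϑ M')
      {x | (x : M) ∈ polarSet U M'} where
  local_prim :=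
    { exists_prim := fun x hx => by
        have hx' : (x : M) ∈ M' := by
          by_contra hcon
          exact hx ((h.mem_polarSet_iff x).2 hcon)
        obtain ⟨ψ, hψ⟩ := exists_isPrimitiveAt hϑ.isOpen hϑ.smooth hϑ.closed hx'
        exact ⟨fun x => ψ x, ψ, hψ, Eventually.of_forall fun _ => rfl⟩
      sub_const := fun {f g x} hf hg => by
        obtain ⟨f', hf', hf⟩ := hf
        obtain ⟨g', hg', hg⟩ := hg
        have h1 := continuous_subtype_val.continuousAt.eventually (hf'.eventually_sub hg')
        filter_upwards [h1, hf, hg] with y e1 e2 e3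
        rw [e2, e3, hf.self_of_nhds, hg.self_of_nhds, e1]
      eventually := fun {f x} hf => by
        obtain ⟨f', hf', hf⟩ := hf
        filter_upwards [continuous_subtype_val.continuousAt.eventually hf'.eventually,
          hf.eventually_nhds] with y e1 e2
        exact ⟨f', e1, e2⟩
      continuousAt := fun {f x} hf => by
        obtain ⟨f', hf', hf⟩ := hf
        exact (hf'.self_of_nhds.2.1.continuousAt.comp
          continuous_subtype_val.continuousAt).congr (hf.mono fun y hy => hy.symm) }
  isClosed := by
    have h1 : {x : PathSpace F Γ | (x : M) ∈ polarSet U M'} = (Subtype.val ⁻¹' M')ᶜ := by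
      ext x
      exact h.mem_polarSet_iff x
    rw [h1]
    exact (hϑ.isOpen.preimage continuous_subtype_val).isClosed_compl
  invariant u x hx := by
    refine (h.mem_polarSet_iff (h.act hφ 0 u x)).2 ?_
    rw [coe_act_zero_left]
    intro hcon
    have := hϑ.invariant (-u) _ hcon
    rw [← h.action.add _ _ _ (h.coe_mem_U x), neg_add_cancel,
      h.action.zero _ (h.coe_mem_U x)] at this
    exact hx.2 this
  rotate := fun {f x} hf => by
    obtain ⟨ψ, hψ, hf⟩ := hf
    have hxU := h.coe_mem_U x
    have hc : Continuous fun u : ℝ => h.act hφ 0 u x :=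
      (h.continuous_act hφ).comp (f := fun u : ℝ => ((0 : ℝ), u, x)) (by fun_prop)
    have h0 : h.act hφ 0 0 x = x := Subtype.ext (by
      rw [coe_act_zero_left, h.action.zero _ hxU])
    have hct : Tendsto (fun u : ℝ => h.act hφ 0 u x) (𝓝 0) (𝓝 x) := by
      have := hc.tendsto 0
      rwa [h0] at this
    have h1 : ∀ᶠ u : ℝ in 𝓝 0, IsPrimitiveAt ϑ M' ψ (ρ u x) := by
      have := hct.eventually (continuous_subtype_val.continuousAt.eventually hψ.eventually)
      simpa only [coe_act_zero_left] using this
    obtain ⟨r, hr, hB⟩ := Metric.eventually_nhds_iff_ball.1 h1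
    -- The normalization `ϑ(X_J) = 1` makes `ψ (ρ u x) - u` constant for small `u`.
    have hd : ∀ u ∈ Metric.ball (0 : ℝ) r, HasDerivAt (fun u => ψ (ρ u x) - u) 0 u := by
      intro u hu
      have e1 := (hB u hu).hasDerivAt_comp (h.action.generator _ hxU u)
      have e2 : ϑ (ρ u x) (fun _ => ((1 : ℝ →L[ℝ] ℝ).smulRight (XJ (ρ u x) : E4)) 1) = 1 := by
        refine Eq.trans (congrArg (ϑ (ρ u x)) (funext fun i => ?_))
          (hϑ.normalized _ (hB u hu).self_of_nhds.1)
        fin_cases i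
        exact one_smul ℝ (XJ (ρ u x))
      have e3 : HasDerivAt (fun u => ψ (ρ u x)) 1 u := e1.congr_deriv e2
      exact (e3.sub (hasDerivAt_id u)).congr_deriv (sub_self 1)
    filter_upwards [Metric.ball_mem_nhds (0 : ℝ) hr, hct.eventually hf] with u hu hfu
    have e1 := Metric.isOpen_ball.is_const_of_deriv_eq_zero (convex_ball (0 : ℝ) r).isPreconnected
      (fun u hu => (hd u hu).differentiableAt.differentiableWithinAt)
      (fun u hu => (hd u hu).deriv) hu (Metric.mem_ball_self hr)
    simp only [h.action.zero _ hxU] at e1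
    change f (h.act hφ 0 u x) = _
    rw [hfu, coe_act_zero_left, hf.self_of_nhds]
    linarith

end IsTorusFibration


/-! ### Transversality and isolated poles. -/

section LinearAlgebra

/-- Transversality makes the equation of the surface injective on the slice. -/
lemma eq_zero_of_transversal {f g : E4 →L[ℝ] ℝ × ℝ} (hg : Function.Surjective g) {a b w : E4}
    (hab : ∀ r s : ℝ, r • a + s • b = 0 → r = 0 ∧ s = 0) (ha : f a = 0) (hb : f b = 0)
    (hgb : g b = 0)
    (h1 : Module.finrank ℝ ((LinearMap.ker g.toLinearMap).map f.toLinearMap) = 1)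
    (h2 : (LinearMap.ker g.toLinearMap).map f.toLinearMap ⊔ Submodule.span ℝ {f w} = ⊤) {r s : ℝ}
    (hrs : g (r • w + s • a) = 0) : r = 0 ∧ s = 0 := by
  -- If `r ≠ 0`, then `f w` already lies in the image of `ker g`, so this image would be the whole
  -- plane although it has dimension one.
  have hr : r = 0 := by
    by_contra hr
    have h3 : f w ∈ (LinearMap.ker g.toLinearMap).map f.toLinearMap := by
      have h4 : f (r • w + s • a) ∈ (LinearMap.ker g.toLinearMap).map f.toLinearMap :=
        Submodule.mem_map_of_mem (f := f.toLinearMap) (LinearMap.mem_ker.2 hrs)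
      rw [map_add, map_smul, map_smul, ha, smul_zero, add_zero] at h4
      exact (Submodule.smul_mem_iff _ hr).1 h4
    rw [sup_eq_left.2 ((Submodule.span_singleton_le_iff_mem _ _).2 h3)] at h2
    rw [h2, finrank_top] at h1
    simp at h1
  refine ⟨hr, ?_⟩
  by_contra hs
  -- If `s ≠ 0`, then `a` and `b` span `ker g`, and `f` kills both, so the image of `ker g` would be
  -- zero.
  have hga : g a = 0 := by
    rw [hr, zero_smul, zero_add, map_smul] at hrs
    exact (smul_eq_zero.1 hrs).resolve_left hs
  have hli : LinearIndependent ℝ ![a, b] := LinearIndependent.pair_iff.2 hab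
  have hle : Submodule.span ℝ (range ![a, b]) ≤ LinearMap.ker g.toLinearMap := by
    rw [Submodule.span_le]
    rintro _ ⟨i, rfl⟩
    fin_cases i
    · exact hga
    · exact hgb
  have hker : Module.finrank ℝ (LinearMap.ker g.toLinearMap) = 2 := by
    have h3 := LinearMap.finrank_range_add_finrank_ker g.toLinearMap
    rw [LinearMap.range_eq_top.2 hg, finrank_top] at h3
    simp at h3
    omega
  have heq : Submodule.span ℝ (range ![a, b]) = LinearMap.ker g.toLinearMap :=
    Submodule.eq_of_le_of_finrank_eq hle (by
      rw [finrank_span_eq_card hli, hker, Fintype.card_fin])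
  have hbot : (LinearMap.ker g.toLinearMap).map f.toLinearMap = ⊥ := by
    rw [← heq, Submodule.map_span, Submodule.span_eq_bot]
    rintro _ ⟨_, ⟨i, rfl⟩, rfl⟩
    fin_cases i
    · exact ha
    · exact hb
  rw [hbot, finrank_bot] at h1
  exact absurd h1 (by norm_num)

end LinearAlgebra

namespace IsTorusFibration

variable {M : Type*} [TopologicalSpace M] [ChartedSpace E4 M] [IsManifold (𝓡 4) ∞ M]
  {Ω : DForm 2 M} {H J : M → ℝ} {XH XJ : (x : M) → TangentSpace (𝓡 4) x} {F : M → ℝ × ℝ}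
  {Γ : ℝ → ℝ × ℝ} {U : Set M} {ρ : ℝ → M → M} {φ : ℝ → M → M} {M' : Set M} {ϑ : DForm 1 M}
  {p : M} {s₀ : ℝ} {N : (ℝ × ℝ) × ℝ → M} {κ : M → (ℝ × ℝ) × (ℝ × ℝ)}

/-- The derivative of a slice is a section of the derivative of `F`. -/
lemma diff_slice (h : IsTorusFibration Ω H J XH XJ F Γ U ρ) (hN : IsSlice XH XJ F ρ p N κ)
    (z : (ℝ × ℝ) × ℝ) :
    diff F (N (F p, 0)) (mfderiv 𝓘(ℝ, (ℝ × ℝ) × ℝ) (𝓡 4) N (F p, 0) z) = z.1 := by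
  have h1 := (h.mdifferentiable_F (N (F p, 0))).hasMFDerivAt.comp (F p, (0 : ℝ))
    (hN.N_smooth.self_of_nhds.mdifferentiableAt one_ne_zero).hasMFDerivAt
  have h2 : HasFDerivAt (fun z : (ℝ × ℝ) × ℝ => z.1) (ContinuousLinearMap.fst ℝ (ℝ × ℝ) ℝ)
    (F p, (0 : ℝ)) := hasFDerivAt_fst
  have h3 := h2.congr_of_eventuallyEq hN.F_N
  exact congrArg (fun l : (ℝ × ℝ) × ℝ →L[ℝ] ℝ × ℝ => l z)
    (HasFDerivAt.unique (𝕜 := ℝ) (E := (ℝ × ℝ) × ℝ) (F := ℝ × ℝ) h1.hasFDerivAt h3)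

/-- The poles in a slice over the path are isolated. -/
lemma eventually_slice_pole (h : IsTorusFibration Ω H J XH XJ F Γ U ρ)
    (hϑ : IsRotationForm XJ U ρ M' ϑ) (hsurf : IsSurfaceOffFixed ρ (polarSet U M'))
    (htrans : IsTransversalTo ρ (polarSet U M') F) (hΓtrans : PathTransversal Γ F (polarSet U M'))
    (hp : F p = Γ s₀) (hpP : p ∈ polarSet U M') (hN : IsSlice XH XJ F ρ p N κ) :
    ∀ᶠ z : ℝ × ℝ in 𝓝 (s₀, 0), N (Γ z.1, z.2) ∈ polarSet U M' → z = (s₀, 0) := by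
  set q := N (F p, 0) with hq
  have hqp : q = p := hN.N_centre
  have hFq : F q = Γ s₀ := by rw [hqp, hp]
  have hqP : q ∈ polarSet U M' := by rw [hqp]; exact hpP
  have hqU : q ∈ U := h.mem_U hFq
  have hfix : ¬ IsFixedPoint ρ q := by
    intro hfix
    obtain ⟨n, hn⟩ := h.free q (by rw [mem_preimage, hFq]; exact mem_range_self s₀) 1 (hfix 1)
    rcases eq_or_ne n 0 with rfl | h0
    · simp at hn
    · have h1 : (1 : ℝ) ≤ |(n : ℝ)| := by exact_mod_cast Int.one_le_abs h0
      have h2 : |(n : ℝ)| * (2 * Real.pi) = 1 := by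
        rw [← abs_of_pos Real.two_pi_pos, ← abs_mul, ← hn, abs_one]
      nlinarith [Real.pi_gt_three]
  obtain ⟨g, hg⟩ := hsurf q hqP hfix
  have hrank := htrans q hqP hfix g hg
  have hspan := hΓtrans s₀ q hqP hFq g hg
  obtain ⟨V, hVo, hqV, hgV, hVP⟩ := hg
  have hgd := ((hgV.contMDiffAt (hVo.mem_nhds hqV)).mdifferentiableAt (by simp)).hasMFDerivAt
  have hNd := (hN.N_smooth.self_of_nhds.mdifferentiableAt one_ne_zero).hasMFDerivAt
  -- the polar set is invariant
  have hgJ : diff g q (XJ q) = 0 := by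
    let G : M → ℝ × ℝ := fun z => diff g z (XJ z)
    have hz := h.action.zero q hqU
    have hVz : ρ 0 q ∈ V := by rw [hz]; exact hqV
    have h1 := ((hgV.contMDiffAt (hVo.mem_nhds hVz)).mdifferentiableAt
      (by simp)).hasMFDerivAt.comp (0 : ℝ) (h.action.generator q hqU 0)
    have h2 : HasDerivAt (fun u => g (ρ u q)) _ 0 :=
      HasFDerivAt.hasDerivAt (𝕜 := ℝ) (F := ℝ × ℝ) h1.hasFDerivAt
    have h3 : HasDerivAt (fun u => g (ρ u q)) (0 : ℝ × ℝ) 0 := by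
      refine (hasDerivAt_const (0 : ℝ) (0 : ℝ × ℝ)).congr_of_eventuallyEq ?_
      have hc : ContinuousAt (fun u => ρ u q) 0 :=
        (h.action.contMDiffAt hqU 0).continuousAt.comp (f := fun u : ℝ => (u, q)) (by fun_prop)
      filter_upwards [hc.eventually (hVo.mem_nhds hVz)] with u hu
      refine ((hVP _ hu).2.1 ⟨h.action.mapsTo u q hqU, fun hcon => hqP.2 ?_⟩)
      have := hϑ.invariant (-u) _ hcon
      rwa [← h.action.add _ _ _ hqU, neg_add_cancel, hz] at this
    have h4 : G (ρ 0 q) = 0 := by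
      refine Eq.trans ?_ (h2.unique h3)
      change _ = mfderiv (𝓡 4) 𝓘(ℝ, ℝ × ℝ) g (ρ 0 q) ((1 : ℝ) • XJ (ρ 0 q))
      rw [one_smul]
      rfl
    rw [hz] at h4
    exact h4
  set l : (ℝ × ℝ) × ℝ →L[ℝ] E4 := mfderiv 𝓘(ℝ, (ℝ × ℝ) × ℝ) (𝓡 4) N (F p, 0) with hl
  set lg : E4 →L[ℝ] ℝ × ℝ := diff g q with hlg
  set lF : E4 →L[ℝ] ℝ × ℝ := diff F q with hlF
  have hlFl : ∀ z, lF (l z) = z.1 := h.diff_slice hN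
  have hlX : ∀ r, l (0, r) = r • (show E4 from XH q) := hN.N_time
  have hγ : HasFDerivAt (fun z : ℝ × ℝ => (Γ z.1, z.2))
      (((ContinuousLinearMap.toSpanSingleton ℝ (deriv Γ s₀)).comp
        (ContinuousLinearMap.fst ℝ ℝ ℝ)).prod (ContinuousLinearMap.snd ℝ ℝ ℝ)) (s₀, (0 : ℝ)) := by
    have h1 : HasFDerivAt Γ (ContinuousLinearMap.toSpanSingleton ℝ (deriv Γ s₀)) s₀ :=
      (h.smooth_path.differentiable one_ne_zero s₀).hasDerivAt.hasFDerivAt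
    exact (HasFDerivAt.comp (g := Γ) (f := Prod.fst) (s₀, (0 : ℝ)) h1 hasFDerivAt_fst).prodMk
      hasFDerivAt_snd
  have hm : HasFDerivAt (fun z => g (N z)) (lg.comp l) (Γ s₀, (0 : ℝ)) := by
    rw [← hp]
    exact (hgd.comp (F p, (0 : ℝ)) hNd).hasFDerivAt
  have hmγ := HasFDerivAt.comp (s₀, (0 : ℝ)) (g := fun z => g (N z))
    (f := fun z : ℝ × ℝ => (Γ z.1, z.2)) hm hγ
  -- Restricted to the slice over the path, the equation of the polar surface has an injective
  -- derivative, so the centre is an isolated zero.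
  have hinj : ∀ z : ℝ × ℝ, lg (l (z.1 • deriv Γ s₀, z.2)) = 0 → z = 0 := by
    intro z hz
    have e1 : l (z.1 • deriv Γ s₀, z.2) = z.1 • l (deriv Γ s₀, 0) + z.2 • (show E4 from XH q) := by
      rw [← hlX, ← map_smul, ← map_add]
      simp
    rw [e1] at hz
    have e2 : lF (l (deriv Γ s₀, 0)) = deriv Γ s₀ := hlFl _
    obtain ⟨e3, e4⟩ := eq_zero_of_transversal (f := lF) (g := lg) (w := l (deriv Γ s₀, 0))
      (hVP q hqV).1 (a := XH q) (b := XJ q)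
      (fun r s hrs => h.independent ((h.regular s₀).2 q hFq) hrs) (h.diff_XH q) (h.diff_XJ q) hgJ
      hrank (by rw [e2]; exact hspan) hz
    exact Prod.ext e3 e4
  have hanti := LinearMap.exists_antilipschitzWith (((lg.comp l).comp
    (((ContinuousLinearMap.toSpanSingleton ℝ (deriv Γ s₀)).comp
        (ContinuousLinearMap.fst ℝ ℝ ℝ)).prod (ContinuousLinearMap.snd ℝ ℝ ℝ))).toLinearMap)
    (LinearMap.ker_eq_bot'.2 fun z hz => hinj z hz)
  obtain ⟨K, -, hK⟩ := hanti
  have hne := hmγ.eventually_ne (c := 0) ⟨K, hK⟩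
  rw [eventually_nhdsWithin_iff] at hne
  have hVt : ∀ᶠ z : ℝ × ℝ in 𝓝 (s₀, 0), N (Γ z.1, z.2) ∈ V := by
    have h1 : ContinuousAt N (Γ s₀, 0) := by
      rw [← hp]
      exact hN.N_smooth.self_of_nhds.continuousAt
    have h2 : ContinuousAt (fun z : ℝ × ℝ => N (Γ z.1, z.2)) (s₀, 0) :=
      ContinuousAt.comp (f := fun z : ℝ × ℝ => (Γ z.1, z.2)) h1 hγ.continuousAt
    refine h2.eventually (hVo.mem_nhds ?_)
    change N (Γ s₀, 0) ∈ V
    rw [← hp]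
    exact hqV
  filter_upwards [hne, hVt] with z h1 h2 h3
  by_contra hcon
  exact h1 hcon ((hVP _ h2).2.1 h3)

/-- There are discs that cross a polar orbit positively. -/
lemma exists_isPolarDisc (h : IsTorusFibration Ω H J XH XJ F Γ U ρ) {P : Set M}
    (hp : F p = Γ s₀) (hN : IsSlice XH XJ F ρ p N κ)
    (hiso : ∀ᶠ z : ℝ × ℝ in 𝓝 (s₀, 0), N (Γ z.1, z.2) ∈ P → z = (s₀, 0)) :
    ∃ D S, IsPolarDisc F XH XJ ρ Γ P s₀ p D S := by
  obtain ⟨δ, hδ, hall⟩ := Metric.eventually_nhds_iff_ball.1 (hiso.and (h.eventually_slice hp hN))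
  set ε := δ / 2 with hε
  have hε0 : 0 < ε := by positivity
  -- The disc is the slice itself, scaled by `ε`: the real part gives the parameter, the imaginary
  -- part the time along `X_H`. Its orientation determinant is `ε²`.
  set S : ℂ → ℝ := fun z => s₀ + ε * z.re with hS
  set c : ℂ → (ℝ × ℝ) × ℝ := fun z => (Γ (S z), ε * z.im) with hc
  have hSc : ContDiff ℝ 1 S := contDiff_const.add (contDiff_const.mul Complex.reCLM.contDiff)
  have hcc : ContDiff ℝ 1 c := (h.smooth_path.comp hSc).prodMk
    (contDiff_const.mul Complex.imCLM.contDiff)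
  have hbox : ∀ z ∈ Metric.closedBall (0 : ℂ) 1, (S z, ε * z.im) ∈ Metric.ball (s₀, (0 : ℝ)) δ := by
    intro z hz
    rw [mem_closedBall_zero_iff] at hz
    have h1 := (Complex.abs_re_le_norm z).trans hz
    have h2 := (Complex.abs_im_le_norm z).trans hz
    rw [← ball_prod_same]
    refine ⟨?_, ?_⟩
    · rw [Metric.mem_ball, Real.dist_eq]
      simp only [hS, add_sub_cancel_left]
      rw [abs_mul, abs_of_pos hε0]
      nlinarith
    · rw [Metric.mem_ball, Real.dist_eq, sub_zero, abs_mul, abs_of_pos hε0]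
      nlinarith
  have hS0 : S 0 = s₀ := by simp [hS]
  have hc0 : c 0 = (F p, 0) := by simp [hc, hS0, hp]
  have hSd : HasFDerivAt S (ε • Complex.reCLM) 0 :=
    ((Complex.reCLM.hasFDerivAt (x := (0 : ℂ))).const_mul ε).const_add s₀
  have hcd : HasFDerivAt c (((ContinuousLinearMap.toSpanSingleton ℝ (deriv Γ s₀)).comp
      (ε • Complex.reCLM)).prod (ε • Complex.imCLM)) 0 := by
    have h1 : HasFDerivAt Γ (ContinuousLinearMap.toSpanSingleton ℝ (deriv Γ s₀)) (S 0) := by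
      rw [hS0]
      exact (h.smooth_path.differentiable one_ne_zero s₀).hasDerivAt.hasFDerivAt
    exact (h1.comp (0 : ℂ) hSd).prodMk ((Complex.imCLM.hasFDerivAt (x := (0 : ℂ))).const_mul ε)
  have hND : HasMFDerivAt 𝓘(ℝ, (ℝ × ℝ) × ℝ) (𝓡 4) N (c 0)
      (mfderiv 𝓘(ℝ, (ℝ × ℝ) × ℝ) (𝓡 4) N (c 0)) := by
    rw [hc0]
    exact (hN.N_smooth.self_of_nhds.mdifferentiableAt one_ne_zero).hasMFDerivAt
  have hDd := (hND.comp (0 : ℂ) hcd.hasMFDerivAt).mfderiv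
  refine ⟨fun z => N (c z), S, ?_, fun z _ => hSc.contDiffAt, ?_, hS0, ?_, ?_, ?_⟩
  · intro z hz
    have h1 := (hall _ (hbox z hz)).2.2.2
    exact ContMDiffAt.comp (g := N) z h1 hcc.contDiffAt.contMDiffAt
  · intro z hz
    exact (hall _ (hbox z hz)).2.1
  · refine ⟨0, ?_⟩
    simp only [hc0]
    rw [hN.N_centre, h.action.zero _ (h.mem_U hp)]
  · intro z hz hz0 hP
    have h1 := (hall _ (hbox z hz)).1 hP
    rw [Prod.mk.injEq] at h1
    refine hz0 (Complex.ext ?_ ?_)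
    · have h2 := h1.1
      simp only [hS] at h2
      simpa [hε0.ne'] using h2
    · simpa [hε0.ne'] using h1.2
  · have key : ∀ a, a = (F p, 0) → ∃ (w : TangentSpace (𝓡 4) (N a)) (A B : ℂ →L[ℝ] ℝ),
        diff F (N a) w = deriv Γ s₀ ∧
        (∀ ζ : ℂ, mfderiv 𝓘(ℝ, (ℝ × ℝ) × ℝ) (𝓡 4) N a
          ((ε * ζ.re) • deriv Γ s₀, ε * ζ.im) =
          fderiv ℝ S 0 ζ • w + A ζ • XH (N a) + B ζ • XJ (N a)) ∧
        0 < fderiv ℝ S 0 1 * A Complex.I - fderiv ℝ S 0 Complex.I * A 1 := by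
      rintro _ rfl
      let l : (ℝ × ℝ) × ℝ →L[ℝ] E4 := mfderiv 𝓘(ℝ, (ℝ × ℝ) × ℝ) (𝓡 4) N (F p, 0)
      refine ⟨l (deriv Γ s₀, 0), ε • Complex.imCLM, 0, h.diff_slice hN _, fun ζ => ?_, ?_⟩
      · have e1 : l ((ε * ζ.re) • deriv Γ s₀, ε * ζ.im) =
            (ε * ζ.re) • l (deriv Γ s₀, 0) + l (0, ε * ζ.im) := by
          rw [← map_smul, ← map_add]
          simp
        refine e1.trans ?_
        rw [hSd.fderiv]
        have e2 : l (0, ε * ζ.im) = (ε * ζ.im) • (show E4 from XH (N (F p, 0))) :=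
          hN.N_time (ε * ζ.im)
        rw [e2]
        exact ((congrArg (fun v : E4 => _ + v) (zero_smul ℝ (XJ (N (F p, 0))))).trans
          (add_zero (M := E4) _)).symm
      · rw [hSd.fderiv]
        simp only [smul_apply, Complex.reCLM_apply, Complex.imCLM_apply,
          Complex.one_re, Complex.I_im, Complex.I_re, Complex.one_im, smul_eq_mul]
        nlinarith
    obtain ⟨w, A, B, h1, h2, h3⟩ := key _ hc0
    exact ⟨w, A, B, h1, fun ζ => (congrArg (fun l : ℂ →L[ℝ] E4 => l ζ) hDd).trans (h2 ζ), h3⟩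

end IsTorusFibration


/-! ### Line integrals over boundary loops. -/

lemma coe_sliceMap {M : Type*} {F : M → ℝ × ℝ} {Γ : ℝ → ℝ × ℝ} {N : (ℝ × ℝ) × ℝ → M}
    {p : PathSpace F Γ} {s r : ℝ} (h : F (N (Γ s, r)) = Γ s) :
    (sliceMap N p s r : M) = N (Γ s, r) := by
  have hm : F (N (Γ s, r)) ∈ range Γ := by
    rw [h]
    exact mem_range_self s
  simp only [sliceMap, dif_pos hm]

/-- A primitive along a curve computes the line integral. -/
lemma lineIntegral_eq_sub {M : Type*} [TopologicalSpace M] [ChartedSpace E4 M]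
    {F : M → ℝ × ℝ} {Γ : ℝ → ℝ × ℝ} {M' : Set M} {ϑ : DForm 1 M} {c : ℝ → PathSpace F Γ}
    (hc : ∀ τ, ContMDiffAt 𝓘(ℝ, ℝ) (𝓡 4) 1 (fun τ => (c τ : M)) τ) {φ : ℝ → ℝ}
    (hφ : PrimOn (pathPrimitive ϑ M') c φ univ) (a b : ℝ) :
    lineIntegral ϑ (fun τ => (c τ : M)) a b = φ b - φ a := by
  have hcc : Continuous c := by
    refine Topology.IsInducing.subtypeVal.continuous_iff.2 ?_
    exact continuous_iff_continuousAt.2 fun τ => (hc τ).continuousAt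
  -- Locally `φ` is a primitive on `M` along the `C¹` curve, up to a constant. So `φ` is `C¹` and
  -- its derivative is the integrand.
  have key : ∀ τ, ∃ ψ C, IsPrimitiveAt ϑ M' ψ (c τ) ∧ φ =ᶠ[𝓝 τ] fun z => ψ (c z) + C := by
    intro τ
    obtain ⟨χ, ⟨ψ, hψ, hχ⟩, h⟩ := hφ τ (mem_univ τ)
    rw [nhdsWithin_univ] at h
    refine ⟨ψ, φ τ - χ (c τ), hψ, ?_⟩
    filter_upwards [h, hcc.continuousAt.eventually hχ] with z h1 h2
    rw [← h1, ← h2]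
    ring
  have hd : ∀ τ, HasDerivAt φ
      (ϑ (c τ) fun _ => mfderiv 𝓘(ℝ, ℝ) (𝓡 4) (fun τ => (c τ : M)) τ (1 : ℝ)) τ := by
    intro τ
    obtain ⟨ψ, C, hψ, h⟩ := key τ
    exact ((hψ.hasDerivAt_comp (c := fun τ => (c τ : M))
      ((hc τ).mdifferentiableAt one_ne_zero).hasMFDerivAt).add_const C).congr_of_eventuallyEq h
  have hs : ContDiff ℝ 1 φ := by
    rw [contDiff_iff_contDiffAt]
    intro τ
    obtain ⟨ψ, C, hψ, h⟩ := key τ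
    have h1 : ContMDiffAt 𝓘(ℝ, ℝ) 𝓘(ℝ, ℝ) 1 (fun z => ψ (c z)) τ :=
      ContMDiffAt.comp (g := ψ) (f := fun τ => (c τ : M)) τ hψ.self_of_nhds.2.1 (hc τ)
    exact (h1.contDiffAt.add contDiffAt_const).congr_of_eventuallyEq h
  refine intervalIntegral.integral_eq_sub_of_hasDerivAt (fun τ _ => hd τ) ?_
  have h1 : deriv φ = fun τ =>
      (ϑ (c τ) fun _ => mfderiv 𝓘(ℝ, ℝ) (𝓡 4) (fun τ => (c τ : M)) τ (1 : ℝ)) :=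
    funext fun τ => (hd τ).deriv
  rw [← h1]
  exact (hs.continuous_deriv le_rfl).intervalIntegrable a b

namespace IsTorusFibration

variable {M : Type*} [TopologicalSpace M] [ChartedSpace E4 M] [IsManifold (𝓡 4) ∞ M] [T2Space M]
  {Ω : DForm 2 M} {H J : M → ℝ} {XH XJ : (x : M) → TangentSpace (𝓡 4) x} {F : M → ℝ × ℝ}
  {Γ : ℝ → ℝ × ℝ} {U : Set M} {ρ : ℝ → M → M} {φ : ℝ → M → M} {M' : Set M} {ϑ : DForm 1 M}

/-- Every pole has a slice that contains no other pole. -/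
lemma exists_pole_slice (h : IsTorusFibration Ω H J XH XJ F Γ U ρ) (hφ : IsPathFlow XH F Γ ρ φ)
    (hϑ : IsRotationForm XJ U ρ M' ϑ) (hsurf : IsSurfaceOffFixed ρ (polarSet U M'))
    (htrans : IsTransversalTo ρ (polarSet U M') F) (hΓtrans : PathTransversal Γ F (polarSet U M'))
    {p : PathSpace F Γ} {s₀ : ℝ} (hp : F p = Γ s₀) (hpP : (p : M) ∈ polarSet U M') :
    ∃ N κ V ε, IsSlice XH XJ F ρ (p : M) N κ ∧
      (∀ᶠ z : ℝ × ℝ in 𝓝 (s₀, 0), N (Γ z.1, z.2) ∈ polarSet U M' → z = (s₀, 0)) ∧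
      IsTube (h.torusSystem hφ).F (h.torusSystem hφ).act (h.torusSystem hφ).Γ s₀ p V
        (fun x => (κ x).2.1) (fun x => (κ x).2.2) (sliceMap N p) ε ∧
      ∀ s ∈ Ioo (s₀ - ε) (s₀ + ε), ∀ r ∈ Ioo (-ε) ε,
        sliceMap N p s r ∈ {x : PathSpace F Γ | (x : M) ∈ polarSet U M'} → s = s₀ ∧ r = 0 := by
  obtain ⟨N, κ, hN⟩ := h.exists_slice hp
  have hiso := h.eventually_slice_pole hϑ hsurf htrans hΓtrans hp hpP hN
  obtain ⟨δ, hδ, hall⟩ := Metric.eventually_nhds_iff_ball.1 (hiso.and (h.eventually_slice hp hN))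
  obtain ⟨ε, ⟨V, hV⟩, hε⟩ := ((h.eventually_isTube hφ hp hN).and (Ioo_mem_nhdsGT hδ)).exists
  refine ⟨N, κ, V, ε, hN, hiso, hV, fun s hs r hr hsr => ?_⟩
  have hbox : (s, r) ∈ Metric.ball (s₀, (0 : ℝ)) δ := by
    rw [← ball_prod_same, Real.ball_eq_Ioo, Real.ball_eq_Ioo]
    exact ⟨⟨by linarith [hs.1, hε.2], by linarith [hs.2, hε.2]⟩, by linarith [hr.1, hε.2],
      by linarith [hr.2, hε.2]⟩
  have h1 := hall _ hbox
  rw [mem_ofPred_eq, coe_sliceMap h1.2.1] at hsr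
  exact Prod.mk.inj (h1.1 hsr)

lemma mfderiv_XJ (h : IsTorusFibration Ω H J XH XJ F Γ U ρ) {x : M} (hx : x ∈ U) (u : ℝ) :
    mfderiv (𝓡 4) (𝓡 4) (ρ u) x (XJ x) = XJ (ρ u x) :=
  h.action.mfderiv_hamiltonianField h.symplectic h.smooth_J h.field_J h.smooth_J h.field_J
    (fun u x hx => by
      have := congrArg Prod.snd (h.invariant u x hx)
      rwa [h.F_eq] at this) hx u

/-- The time along `X_H` on a disc crossing a polar orbit. -/
lemma hasFDerivAt_time_disc (h : IsTorusFibration Ω H J XH XJ F Γ U ρ) {P : Set M} {p : M}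
    {s₀ : ℝ} {N : (ℝ × ℝ) × ℝ → M} {κ : M → (ℝ × ℝ) × (ℝ × ℝ)} (hp : F p = Γ s₀)
    (hN : IsSlice XH XJ F ρ p N κ) {D : ℂ → M} {S : ℂ → ℝ}
    (hD : IsPolarDisc F XH XJ ρ Γ P s₀ p D S) {c : ℝ} (hc : ρ c p = D 0) :
    ∃ m : ℂ →L[ℝ] ℝ, HasFDerivAt (fun z => (κ (ρ (-c) (D z))).2.1) m 0 ∧
      0 < fderiv ℝ S 0 1 * m Complex.I - fderiv ℝ S 0 Complex.I * m 1 := by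
  obtain ⟨w, A, B, -, hd, hdet⟩ := hD.oriented
  have hpU := h.mem_U hp
  have hDU : D 0 ∈ U := by
    rw [← hc]
    exact h.action.mapsTo c p hpU
  have hy : ρ (-c) (D 0) = p := by
    rw [← hc, ← h.action.add _ _ _ hpU, neg_add_cancel, h.action.zero _ hpU]
  have hκ : ∀ y, y = p → MDifferentiableAt (𝓡 4) 𝓘(ℝ, (ℝ × ℝ) × (ℝ × ℝ)) κ y ∧
      mfderiv (𝓡 4) 𝓘(ℝ, (ℝ × ℝ) × (ℝ × ℝ)) κ y (XH y) = ((0, (1, 0)) : (ℝ × ℝ) × (ℝ × ℝ)) ∧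
      mfderiv (𝓡 4) 𝓘(ℝ, (ℝ × ℝ) × (ℝ × ℝ)) κ y (XJ y) = ((0, (0, 1)) : (ℝ × ℝ) × (ℝ × ℝ)) := by
    rintro _ rfl
    exact ⟨hN.κ_smooth.self_of_nhds.mdifferentiableAt one_ne_zero, hN.κ_XH, hN.κ_XJ⟩
  obtain ⟨hκd, hκH, hκJ⟩ := hκ _ hy
  have h1 := (hD.smooth 0 (Metric.mem_closedBall_self zero_le_one)).mdifferentiableAt
    one_ne_zero |>.hasMFDerivAt
  have h2 := (h.action.mdifferentiableAt hDU (-c)).hasMFDerivAt.comp (0 : ℂ) h1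
  have h3 := (hκd.hasMFDerivAt.comp (0 : ℂ) h2).hasFDerivAt
  let lκ : E4 →L[ℝ] (ℝ × ℝ) × (ℝ × ℝ) :=
    mfderiv (𝓡 4) 𝓘(ℝ, (ℝ × ℝ) × (ℝ × ℝ)) κ (ρ (-c) (D 0))
  let lρ : E4 →L[ℝ] E4 := mfderiv (𝓡 4) (𝓡 4) (ρ (-c)) (D 0)
  let lD : ℂ →L[ℝ] E4 := mfderiv 𝓘(ℝ, ℂ) (𝓡 4) D 0
  let π : (ℝ × ℝ) × (ℝ × ℝ) →L[ℝ] ℝ := (ContinuousLinearMap.fst ℝ ℝ ℝ).comp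
    (ContinuousLinearMap.snd ℝ (ℝ × ℝ) (ℝ × ℝ))
  have h4 : HasFDerivAt (fun z => (κ (ρ (-c) (D z))).2.1) (π.comp (lκ.comp (lρ.comp lD))) 0 :=
    HasFDerivAt.comp (g := π) (f := fun z => κ (ρ (-c) (D z))) (0 : ℂ) π.hasFDerivAt h3
  -- The slice time has derivative `1` on `X_H` and `0` on `X_J`, so along the disc its derivative
  -- is `A` plus a multiple of `dS`. That multiple does not affect the determinant with `dS`.
  have h5 : ∀ ζ : ℂ, π.comp (lκ.comp (lρ.comp lD)) ζ =
      fderiv ℝ S 0 ζ * π (lκ (lρ w)) + A ζ := by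
    intro ζ
    have e1 : lD ζ = fderiv ℝ S 0 ζ • (w : E4) + A ζ • (XH (D 0) : E4) + B ζ • (XJ (D 0) : E4) :=
      hd ζ
    have e2 : lρ (XH (D 0)) = XH (ρ (-c) (D 0)) := h.mfderiv_XH hDU (-c)
    have e3 : lρ (XJ (D 0)) = XJ (ρ (-c) (D 0)) := h.mfderiv_XJ hDU (-c)
    have e4 : lκ (XH (ρ (-c) (D 0))) = (0, (1, 0)) := hκH
    have e5 : lκ (XJ (ρ (-c) (D 0))) = (0, (0, 1)) := hκJ
    have e6 : lκ (lρ (lD ζ)) = fderiv ℝ S 0 ζ • lκ (lρ w) + A ζ • ((0, (1, 0)) : (ℝ × ℝ) × (ℝ × ℝ))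
        + B ζ • ((0, (0, 1)) : (ℝ × ℝ) × (ℝ × ℝ)) := by
      have e7 : ∀ (a b r : ℝ) (x y z : E4), lκ (lρ (a • x + b • y + r • z)) =
          a • lκ (lρ x) + b • lκ (lρ y) + r • lκ (lρ z) := fun a b r x y z => by
        simp only [map_add, map_smul]
      rw [← e4, ← e5, ← e2, ← e3]
      exact (congrArg (fun v => lκ (lρ v)) e1).trans (e7 _ _ _ _ _ _)
    change (lκ (lρ (lD ζ))).2.1 = _
    rw [e6]
    simp [π]
  refine ⟨_, h4, ?_⟩
  rw [h5, h5]
  nlinarith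

/-- The integral of the rotation form over the boundary of a disc crossing a polar orbit
positively is the residue of the pole. -/
lemma lineIntegral_boundaryLoop (h : IsTorusFibration Ω H J XH XJ F Γ U ρ)
    (hφ : IsPathFlow XH F Γ ρ φ) (hϑ : IsRotationForm XJ U ρ M' ϑ) {p : PathSpace F Γ} {s₀ : ℝ}
    (hp : F p = Γ s₀) {N : (ℝ × ℝ) × ℝ → M} {κ : M → (ℝ × ℝ) × (ℝ × ℝ)} {V : Set (PathSpace F Γ)}
    {ε : ℝ} (hN : IsSlice XH XJ F ρ (p : M) N κ)
    (hT : IsTube (h.torusSystem hφ).F (h.torusSystem hφ).act (h.torusSystem hφ).Γ s₀ p V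
        (fun x => (κ x).2.1) (fun x => (κ x).2.2) (sliceMap N p) ε)
    (hiso : ∀ s ∈ Ioo (s₀ - ε) (s₀ + ε), ∀ r ∈ Ioo (-ε) ε,
        sliceMap N p s r ∈ {x : PathSpace F Γ | (x : M) ∈ polarSet U M'} → s = s₀ ∧ r = 0)
    {f : ℝ × ℝ → ℝ} {R : ℝ}
    (hR : TorusSystem.IsResidue (pathPrimitive ϑ M') s₀ (sliceMap N p) ε f R) {D : ℂ → M}
    {S : ℂ → ℝ} (hD : IsPolarDisc F XH XJ ρ Γ (polarSet U M') s₀ (p : M) D S) :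
    lineIntegral ϑ (boundaryLoop D) 0 (2 * Real.pi) = R := by
  classical
  have hP := h.isRotationPrimitive hφ hϑ
  -- The disc as a map to the bundle. The default `p` can occur only outside the closed unit disc.
  let Dx : ℂ → PathSpace F Γ := fun z => if hz : F (D z) ∈ range Γ then ⟨D z, hz⟩ else p
  have hDx : ∀ z ∈ Metric.closedBall (0 : ℂ) 1, (Dx z : M) = D z := by
    intro z hz
    have hm : F (D z) ∈ range Γ := by
      rw [hD.fibre_eq z hz]
      exact mem_range_self _
    simp only [Dx, dif_pos hm]
  have h0 : (0 : ℂ) ∈ Metric.closedBall (0 : ℂ) 1 := Metric.mem_closedBall_self zero_le_one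
  have hDc : ContinuousOn Dx (Metric.closedBall 0 1) := by
    refine Topology.IsInducing.subtypeVal.continuousOn_iff.2 ?_
    refine ContinuousOn.congr (f := D) (fun z hz => ?_) hDx
    exact (hD.smooth z hz).continuousAt.continuousWithinAt
  have hSc : ContinuousOn S (Metric.closedBall 0 1) := fun z hz =>
    (hD.smooth_param z hz).continuousAt.continuousWithinAt
  have hexp : ∀ τ : ℝ, Complex.exp (τ * Complex.I) ∈ Metric.closedBall (0 : ℂ) 1 := fun τ => by
    rw [mem_closedBall_zero_iff, Complex.norm_exp_ofReal_mul_I]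
  have hDP : ∀ z ∈ Metric.closedBall (0 : ℂ) 1, z ≠ 0 →
      Dx z ∉ {x : PathSpace F Γ | (x : M) ∈ polarSet U M'} := by
    intro z hz hz0
    rw [mem_ofPred_eq, hDx z hz]
    exact hD.not_pole z hz hz0
  let c : ℝ → PathSpace F Γ := fun τ => Dx (Complex.exp (τ * Complex.I))
  have hcD : (fun τ => (c τ : M)) = boundaryLoop D := funext fun τ => hDx _ (hexp τ)
  have hcc : Continuous c := hDc.comp_continuous (by fun_prop) hexp
  have hcs : ∀ τ, ContMDiffAt 𝓘(ℝ, ℝ) (𝓡 4) 1 (fun τ => (c τ : M)) τ := by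
    intro τ
    rw [hcD]
    have e1 : ContDiff ℝ 1 fun τ : ℝ => Complex.exp (τ * Complex.I) :=
      (Complex.ofRealCLM.contDiff.mul contDiff_const).cexp
    exact ContMDiffAt.comp (g := D) (f := fun τ : ℝ => Complex.exp (τ * Complex.I)) τ
      (hD.smooth _ (hexp τ)) e1.contDiffAt.contMDiffAt
  obtain ⟨χ, hχ⟩ := hP.local_prim.exists_primOn_interval (g := c) ordConnected_univ isOpen_univ
    hcc.continuousOn fun τ _ => hDP _ (hexp τ) (Complex.exp_ne_zero _)
  rw [← hcD, lineIntegral_eq_sub hcs hχ]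
  obtain ⟨u, hu⟩ := hD.centre
  obtain ⟨m, hm, hdet⟩ := h.hasFDerivAt_time_disc hp hN hD hu
  have hSd := ((hD.smooth_param 0 h0).differentiableAt one_ne_zero).hasFDerivAt
  have hA : HasFDerivAt (fun z => ((S z - s₀ : ℝ) : ℂ) +
      ((κ ((h.torusSystem hφ).act 0 (-u) (Dx z) : PathSpace F Γ)).2.1 : ℝ) * Complex.I)
      (Complex.ofRealCLM.comp (fderiv ℝ S 0) + Complex.I • Complex.ofRealCLM.comp m) 0 := by
    have e1 : HasFDerivAt (fun z => ((S z - s₀ : ℝ) : ℂ))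
        (Complex.ofRealCLM.comp (fderiv ℝ S 0)) 0 :=
      HasFDerivAt.comp (g := Complex.ofRealCLM) (f := fun z => S z - s₀) (0 : ℂ)
        Complex.ofRealCLM.hasFDerivAt (hSd.sub_const s₀)
    have e2 : HasFDerivAt (fun z => (((κ (ρ (-u) (D z))).2.1 : ℝ) : ℂ))
        (Complex.ofRealCLM.comp m) 0 :=
      HasFDerivAt.comp (g := Complex.ofRealCLM) (f := fun z => (κ (ρ (-u) (D z))).2.1) (0 : ℂ)
        Complex.ofRealCLM.hasFDerivAt hm
    refine (e1.add (e2.mul_const Complex.I)).congr_of_eventuallyEq ?_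
    filter_upwards [Metric.closedBall_mem_nhds (0 : ℂ) one_pos] with z hz
    have e3 : ((h.torusSystem hφ).act 0 (-u) (Dx z) : M) = ρ (-u) (D z) :=
      (h.coe_act_zero_left hφ _ _).trans (congrArg (ρ (-u)) (hDx z hz))
    rw [e3]
    rfl
  refine TorusSystem.disc_residue hP hT hiso hR hDc hSc (fun z hz => ?_) hD.centre_param
    (c := u) (Subtype.ext ?_) hDP hA ?_ hχ
  · exact (congrArg F (hDx z hz)).trans (hD.fibre_eq z hz)
  · exact (hDx 0 h0).trans (hu.symm.trans (h.coe_act_zero_left hφ u p).symm)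
  · simpa using hdet

end IsTorusFibration


/-! ### First returns and the monodromy number. -/

namespace IsTorusFibration

variable {M : Type*} [TopologicalSpace M] [ChartedSpace E4 M] [IsManifold (𝓡 4) ∞ M] [T2Space M]
  {Ω : DForm 2 M} {H J : M → ℝ} {XH XJ : (x : M) → TangentSpace (𝓡 4) x} {F : M → ℝ × ℝ}
  {Γ : ℝ → ℝ × ℝ} {U : Set M} {ρ : ℝ → M → M} {φ : ℝ → M → M} {M' : Set M} {ϑ : DForm 1 M}

lemma hasPoleTubes (h : IsTorusFibration Ω H J XH XJ F Γ U ρ) (hφ : IsPathFlow XH F Γ ρ φ)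
    (hϑ : IsRotationForm XJ U ρ M' ϑ) (hsurf : IsSurfaceOffFixed ρ (polarSet U M'))
    (htrans : IsTransversalTo ρ (polarSet U M') F)
    (hΓtrans : PathTransversal Γ F (polarSet U M')) :
    (h.torusSystem hφ).HasPoleTubes {x | (x : M) ∈ polarSet U M'} := fun s₀ p hpP hp => by
  obtain ⟨N, κ, V, ε, -, -, hT, hiso⟩ := h.exists_pole_slice hφ hϑ hsurf htrans hΓtrans
    (p := p) (s₀ := s₀) hp hpP
  exact ⟨V, _, _, _, ε, hT, hiso⟩

variable [CompactSpace (PathSpace F Γ)]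

lemma isFirstReturn (h : IsTorusFibration Ω H J XH XJ F Γ U ρ) (hφ : IsPathFlow XH F Γ ρ φ)
    (x : PathSpace F Γ) {θ : ℝ} (hθ : θ ∈ Ico 0 (2 * Real.pi))
    (hx : (h.torusSystem hφ).act ((h.torusSystem hφ).T x) (-θ) x = x) :
    IsFirstReturn XH ρ (x : M) (fun t => φ t x) ((h.torusSystem hφ).T x) θ where
  curve := hφ.curve x x.2
  start := hφ.zero x x.2
  pos := (h.torusSystem hφ).T_pos x
  first := by
    rintro t ht ⟨u, hu⟩
    beta_reduce at hu
    have h1 : t ∈ (h.torusSystem hφ).returns x := by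
      refine (h.torusSystem hφ).mem_returns.2 ⟨-u, Subtype.ext ?_⟩
      refine (h.coe_act hφ t (-u) x).trans ?_
      rw [← hu, ← h.action.add _ _ _ (h.coe_mem_U x), neg_add_cancel,
        h.action.zero _ (h.coe_mem_U x)]
    exact absurd ((h.torusSystem hφ).T_le h1 ht.1) (not_le.2 ht.2)
  return_eq := by
    have h1 : ρ (-θ) (φ ((h.torusSystem hφ).T x) x) = x := congrArg Subtype.val hx
    have h2 : φ ((h.torusSystem hφ).T x) x ∈ U := h.subset (by
      rw [mem_preimage, hφ.F_eq x x.2]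
      exact x.2)
    have h3 := congrArg (ρ θ) h1
    rwa [← h.action.add _ _ _ h2, add_neg_cancel, h.action.zero _ h2] at h3
  mem := hθ

lemma isMonodromyNumber (h : IsTorusFibration Ω H J XH XJ F Γ U ρ) (hφ : IsPathFlow XH F Γ ρ φ)
    {Θt : ℝ → ℝ} {k : ℤ} (hc : Continuous Θt) (hΘ : ∀ s, (h.torusSystem hφ).IsAngle s (Θt s))
    (hΘ0 : Θt 0 ∈ Ico 0 (2 * Real.pi)) (hk : ∀ s, Θt (s + 1) = Θt s - 2 * Real.pi * k) :
    IsMonodromyNumber F XH ρ Γ k := by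
  obtain ⟨c, hcc, hcF, ⟨p, hp, hcp⟩, g, hgc, hgF, hg0, hg1⟩ :=
    (h.torusSystem hφ).exists_transport hc hΘ hk
  refine ⟨fun s τ => c s τ, continuous_subtype_val.comp_continuousOn hcc,
    fun s hs τ => ⟨(hcF s hs τ).1, congrArg Subtype.val (hcF s hs τ).2⟩,
    ⟨p, fun t => φ t p, _, Θt 0, h.isFirstReturn hφ p hΘ0 (hΘ 0 p hp), fun τ => ?_⟩,
    fun s τ => g s τ, continuous_subtype_val.comp_continuousOn hgc,
    fun s hs τ => ⟨(hgF s hs τ).1, congrArg Subtype.val (hgF s hs τ).2⟩,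
    fun τ => congrArg Subtype.val (hg0 τ), fun τ => ?_⟩
  · exact congrArg Subtype.val (hcp τ)
  · exact (congrArg Subtype.val (hg1 τ)).trans (h.coe_act_zero_left hφ _ _)

end IsTorusFibration

end RotationForms

/-! ### The theorem. -/

theorem theorem1 {M : Type*} [TopologicalSpace M] [ChartedSpace E4 M] [IsManifold (𝓡 4) ∞ M]
    [T2Space M] [SecondCountableTopology M]
    -- the integrable system
    (Ω : DForm 2 M) (hΩ : IsSymplectic Ω)
    (H J : M → ℝ) (hH : ContMDiff (𝓡 4) 𝓘(ℝ, ℝ) ∞ H) (hJ : ContMDiff (𝓡 4) 𝓘(ℝ, ℝ) ∞ J)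
    (XH XJ : (x : M) → TangentSpace (𝓡 4) x)
    (hXH : IsHamiltonianField Ω H XH) (hXJ : IsHamiltonianField Ω J XJ)
    (hcomm : ∀ x, Ω x ![XH x, XJ x] = 0)
    (F : M → ℝ × ℝ) (hF : F = energyMomentum H J)
    (hfib : ∀ v, IsCompact (F ⁻¹' {v}) ∧ IsPreconnected (F ⁻¹' {v}))
    -- the closed path of regular values
    (Γ : ℝ → ℝ × ℝ) (hΓ : ContDiff ℝ 1 Γ) (hclosed : ∀ s, Γ (s + 1) = Γ s)
    (hreg : ∀ s, IsRegularValue F (Γ s))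
    -- the circle action near the preimage of the path
    (U : Set M) (hU : F ⁻¹' Set.range Γ ⊆ U)
    (ρ : ℝ → M → M) (hρ : IsCircleAction XJ U ρ)
    (hinv : ∀ t, ∀ p ∈ U, F (ρ t p) = F p)
    (hfree : ∀ p ∈ F ⁻¹' Set.range Γ, ∀ t, ρ t p = p → ∃ n : ℤ, t = n * (2 * Real.pi))
    -- the rotation form and its polar set
    (M' : Set M) (ϑ : DForm 1 M) (hϑ : IsRotationForm XJ U ρ M' ϑ)
    (P : Set M) (hP : P = polarSet U M') (hsurf : IsSurfaceOffFixed ρ P)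
    (htrans : IsTransversalTo ρ P F)
    (hΓtrans : PathTransversal Γ F P) (hΓfin : (Set.range Γ ∩ F '' P).Finite) :
    ∃ (n : ℕ) (s : Fin n → ℝ) (p : Fin n → M) (k : ℤ) (Θ : ℝ → ℝ),
      -- the poles over the path are the disjoint union of finitely many circle orbits
      (∀ i, s i ∈ Set.Ico (0 : ℝ) 1 ∧ p i ∈ P ∧ F (p i) = Γ (s i)) ∧
      (∀ i j, i ≠ j → s i = s j → Disjoint (circleOrbit ρ (p i)) (circleOrbit ρ (p j))) ∧
      (∀ t ∈ Set.Ico (0 : ℝ) 1,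
        {x | x ∈ P ∧ F x = Γ t} = ⋃ i ∈ {i | s i = t}, circleOrbit ρ (p i)) ∧
      -- `k` is the monodromy number, and it is given by the variation of the rotation number
      IsMonodromyNumber F XH ρ Γ k ∧
      (∀ t x, F x = Γ t → IsRotationNumber XH ρ x (Θ t)) ∧
      ((discontinuities Θ).Finite → HasVariation Θ (-2 * k * Real.pi)) ∧
      -- the formula, for all choices of loops around the polar orbits, and such loops exist
      (∀ i, ∃ D S, IsPolarDisc F XH XJ ρ Γ P (s i) (p i) D S) ∧
      ∀ (D : Fin n → ℂ → M) (S : Fin n → ℂ → ℝ),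
        (∀ i, IsPolarDisc F XH XJ ρ Γ P (s i) (p i) (D i) (S i)) →
        (k : ℝ) = 1 / (2 * Real.pi) *
          ∑ i, lineIntegral ϑ (boundaryLoop (D i)) 0 (2 * Real.pi) := by
  subst hP
  have h : IsTorusFibration Ω H J XH XJ F Γ U ρ :=
    ⟨hΩ, hH, hJ, hXH, hXJ, hcomm, hF, hfib, hΓ, hclosed, hreg, hU, hρ, hinv, hfree⟩
  obtain ⟨φ, hφ⟩ := h.exists_pathFlow
  have : CompactSpace (PathSpace F Γ) := h.compactSpace
  have hrot := h.isRotationPrimitive hφ hϑ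
  have hpole := h.hasPoleTubes hφ hϑ hsurf htrans hΓtrans
  obtain ⟨n, s, p, hmem, hinj, hexh⟩ := TorusSystem.exists_poles hrot hpole
  obtain ⟨Θt, k, hΘc, hΘ, hΘ0, hk⟩ := (h.torusSystem hφ).exists_lift
  have hslice := fun i => h.exists_pole_slice hφ hϑ hsurf htrans hΓtrans
    (p := p i) (s₀ := s i) (hmem i).2.2 (hmem i).2.1
  choose N κ V ε hN hNiso hT hiso using hslice
  -- The residues are computed in slices, before any discs are given; every admissible family of
  -- discs is then shown to have these integrals.
  choose f R hR using fun i => TorusSystem.exists_residue hrot (hT i) (hiso i)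
  have hdata : (h.torusSystem hφ).PolarData (pathPrimitive ϑ M')
      {x : PathSpace F Γ | (x : M) ∈ polarSet U M'} s p R :=
    ⟨hmem, hinj, hexh, fun i => ⟨V i, _, _, _, ε i, f i, hT i, hiso i, hR i⟩⟩
  have hsum := hdata.sum_residues hrot hpole hΘc hΘ hk
  have hmod : ∀ t, ∃ m : ℤ, toIcoMod Real.two_pi_pos 0 (Θt t) - Θt t = m * (2 * Real.pi) :=
    fun t => ⟨-toIcoDiv Real.two_pi_pos 0 (Θt t), by
      rw [toIcoMod_sub_self, zsmul_eq_mul, Int.cast_neg]⟩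
  have hrange : ∀ t, toIcoMod Real.two_pi_pos 0 (Θt t) ∈ Set.Ico 0 (2 * Real.pi) := fun t => by
    have := toIcoMod_mem_Ico Real.two_pi_pos 0 (Θt t)
    rwa [zero_add] at this
  -- The reduction of the lift to `[0, 2π)` is still a return angle for all points of the fibre, so
  -- the rotation number does not depend on the point.
  have hangle : ∀ t, (h.torusSystem hφ).IsAngle t (toIcoMod Real.two_pi_pos 0 (Θt t)) := by
    intro t
    obtain ⟨m, hm⟩ := hmod t
    rw [sub_eq_iff_eq_add'.1 hm]
    exact (hΘ t).add m
  refine ⟨n, s, fun i => p i, k, fun t => toIcoMod Real.two_pi_pos 0 (Θt t), fun i => hmem i,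
    fun i j hij hs => ?_, fun t ht => ?_, h.isMonodromyNumber hφ hΘc hΘ hΘ0 hk,
    fun t x hx => ?_, fun hfin => ?_, fun i => ?_, fun D S hD => ?_⟩
  · rw [Set.disjoint_left]
    rintro _ ⟨a, rfl⟩ ⟨b, hb⟩
    refine hij (hinj i j hs ⟨-b + a, Subtype.ext ?_⟩)
    refine Eq.trans ?_ (h.coe_act_zero_left hφ (-b + a) (p i)).symm
    have hb' : ρ b (p j) = ρ a (p i) := hb
    rw [hρ.add _ _ _ (h.coe_mem_U (p i)), ← hb', ← hρ.add _ _ _ (h.coe_mem_U (p j)),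
      neg_add_cancel, hρ.zero _ (h.coe_mem_U (p j))]
  · ext x
    simp only [Set.mem_iUnion, exists_prop]
    constructor
    · rintro ⟨hxP, hx⟩
      have hxr : F x ∈ Set.range Γ := ⟨t, hx.symm⟩
      obtain ⟨i, hi, c, hc⟩ := hexh t ht (⟨x, hxr⟩ : PathSpace F Γ) hxP hx
      exact ⟨i, hi, c, ((congrArg Subtype.val hc).trans (h.coe_act_zero_left hφ c (p i))).symm⟩
    · rintro ⟨i, hi, c, rfl⟩
      have h1 := hrot.invariant c (p i) (hmem i).2.1
      have h2 := h.coe_act_zero_left hφ c (p i)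
      refine ⟨?_, ?_⟩
      · have h3 : ((h.act hφ 0 c (p i) : PathSpace F Γ) : M) ∈ polarSet U M' := h1
        rwa [h2] at h3
      · change s i = t at hi
        rw [← hi]
        exact (hinv c _ (h.coe_mem_U (p i))).trans (hmem i).2.2
  · have hxr : F x ∈ Set.range Γ := ⟨t, hx.symm⟩
    exact ⟨_, _, h.isFirstReturn hφ (⟨x, hxr⟩ : PathSpace F Γ) (hrange t)
      (hangle t (⟨x, hxr⟩ : PathSpace F Γ) hx)⟩
  · refine hasVariation_of_lift hΘc hk (fun t => ?_) hmod hfin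
    rw [hk, show Θt t - 2 * Real.pi * k = Θt t - k • (2 * Real.pi) by rw [zsmul_eq_mul]; ring]
    exact toIcoMod_sub_zsmul _ _ _ _
  · exact h.exists_isPolarDisc (hmem i).2.2 (hN i) (hNiso i)
  · have hI : ∀ i, lineIntegral ϑ (boundaryLoop (D i)) 0 (2 * Real.pi) = R i := fun i =>
      h.lineIntegral_boundaryLoop hφ hϑ (hmem i).2.2 (hN i) (hT i) (hiso i) (hR i) (hD i)
    rw [Finset.sum_congr rfl fun i _ => hI i, ← hsum]
    field_simp
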